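/- Let $m\ge 2$ be an integer. **Notation.** For $u_3<u_2<u_1$ and $n\ge 0$ let $P_n(\xi,u_1,u_2,u_3)=\xi^{n+1}+a_{n,1}\xi^n+\dots+a_{n,n+1}$ be the polynomial determined by $$\frac{P_n(\xi,u_1,u_2,u_3)}{\sqrt{(\xi-u_1)(\xi-u_2)(\xi-u_3)}}=\xi^{n-1/2}+O(\xi^{-3/2})\ (\xi\to+\infty),\qquad \int_{u_3}^{u_2}\frac{P_n(\xi,u_1,u_2,u_3)}{\sqrt{(\xi-u_1)(\xi-u_2)(\xi-u_3)}}\,d\xi=0 ;$$ for $u_2=u_3<u_1$ the second condition is replaced by its limiting form $P_n(u_3,u_1,u_3,u_3)=0$. For $i=2,3$ put $$\mu_i(u_1,u_2,u_3)=4^m(2m+1)\,\frac{P_m(u_i,u_1,u_2,u_3)}{P_0(u_i,u_1,u_2,u_3)},$$ where for $u_2=u_3$ the quotient means $\lim_{\xi\to u_i}P_m(\xi)/P_0(\xi)=P_m'(u_i)/P_0'(u_i)$. With $C_m=2^{2m+1}\big/\int_0^1\frac{s^m}{\sqrt{1-s}}\,ds$ let $$q(u_1,u_2,u_3)=\frac{C_m}{2\sqrt2\,\pi}\int_{-1}^1\!\int_{-1}^1\frac{\left(\frac{1+\mu}2\frac{1+\nu}2u_1+\frac{1+\mu}2\frac{1-\nu}2u_2+\frac{1-\mu}2u_3\right)^m}{\sqrt{(1-\mu)(1-\nu^2)}}\,d\mu\,d\nu,$$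 $\operatorname{div}q=\frac{\partial q}{\partial u_1}+\frac{\partial q}{\partial u_2}+\frac{\partial q}{\partial u_3}$ and $p_1(u_1,u_2,u_3)=2(u_1-u_2)\frac{\partial}{\partial u_2}\operatorname{div}q-\operatorname{div}q$. For real $x$ and $t\ge 0$ consider the problem of minimizing $$-\frac1{2\pi}\int_0^1\!\int_0^1\log\left|\frac{\eta-\mu}{\eta+\mu}\right|\psi(\eta)\psi(\mu)\,d\eta\,d\mu+\int_0^1\left[\eta x-4^m\eta^{2m+1}t\right]\psi(\eta)\,d\eta\ \in(-\infty,+\infty]$$ over all $\psi\in L^1(0,1)$ with $\psi\ge 0$ almost everywhere. **Theorem.** There is exactly one $u^*\in(0,1)$ with $p_1(1,u^*,u^*)=0$, and exactly one $u^{**}\in(0,1)$ with $\mu_2(1,u^{**},0)-\mu_3(1,u^{**},0)=0$. Put $\alpha=\mu_2(1,u^*,u^*)$ and $\beta=\mu_2(1,u^{**},0)$; then $\alpha<\beta<4^m$. For all real $x$ and all $t\ge0$ the minimization problem has a minimizer, unique up to equality almost everywhere, and it is given as follows. 1. If $x\le\alpha t$, then $$\psi(\eta)=\frac{-x\eta+4^m(2m+1)\,t\,\eta\,\dfrac{P_m(\eta^2,1,u^*,u^*)}{\eta^2-u^*}}{\sqrt{1-\eta^2}}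 .$$ 2. If $\alpha t<x<\beta t$, then there is exactly one pair $(u_2,u_3)$ with $0<u_3<u_2<1$, $x=\mu_2(1,u_2,u_3)\,t$ and $x=\mu_3(1,u_2,u_3)\,t$, and for this pair $$\psi(\eta)=\begin{cases}-\dfrac{-x\eta P_0(\eta^2,1,u_2,u_3)+4^m(2m+1)\,t\,\eta P_m(\eta^2,1,u_2,u_3)}{\sqrt{(1-\eta^2)(u_2-\eta^2)(u_3-\eta^2)}}&0<\eta<\sqrt{u_3}\\[2mm]0&\sqrt{u_3}<\eta<\sqrt{u_2}\\[1mm]\dfrac{-x\eta P_0(\eta^2,1,u_2,u_3)+4^m(2m+1)\,t\,\eta P_m(\eta^2,1,u_2,u_3)}{\sqrt{(1-\eta^2)(\eta^2-u_2)(\eta^2-u_3)}}&\sqrt{u_2}<\eta<1.\end{cases}$$ 3. If $\beta t<x<4^mt$, then there is exactly one $u_2$ with $u^{**}<u_2<1$ and $x=\mu_2(1,u_2,0)\,t$, and for this $u_2$ $$\psi(\eta)=\begin{cases}0&0<\eta<\sqrt{u_2}\\[1mm]\dfrac{-xP_0(\eta^2,1,u_2,0)+4^m(2m+1)\,t\,P_m(\eta^2,1,u_2,0)}{\sqrt{(1-\eta^2)(\eta^2-u_2)}}&\sqrt{u_2}<\eta<1.\end{cases}$$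 4. If $x\ge4^mt$, then $\psi\equiv0$. -/

import Mathlib

namespace KdVHierarchy

open MeasureTheory Filter Asymptotics Topology

noncomputable section

/-! ### The polynomials `P_n` and the Whitham speeds -/

/-- The conditions that determine the monic polynomial `P_n(ξ, u₁, u₂, u₃)` of degree `n + 1`, for
`u₃ ≤ u₂ < u₁`: the expansion at infinity and the vanishing of the loop integral over `(u₃, u₂)`
(where the radicand is positive).
At `u₂ = u₃` the loop condition is the continuous extension of the one for `u₃ < u₂`: since
`∫_{u₃}^{u₂} f(ξ) / √((u₂ - ξ)(ξ - u₃)) dξ → π f(u₃)` as `u₂ → u₃`, it becomes `P_n(u₃) = 0`. -/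
def IsWhithamPoly (n : ℕ) (u₁ u₂ u₃ : ℝ) (P : Polynomial ℝ) : Prop :=
  P.Monic ∧ P.natDegree = n + 1 ∧
  ((fun ξ : ℝ => P.eval ξ / √((ξ - u₁) * (ξ - u₂) * (ξ - u₃)) - ξ ^ ((n : ℝ) - 1 / 2))
      =O[atTop] fun ξ : ℝ => ξ ^ (-(3 / 2) : ℝ)) ∧
  (u₃ < u₂ → ∫ ξ in u₃..u₂, P.eval ξ / √((ξ - u₁) * (ξ - u₂) * (ξ - u₃)) = 0) ∧
  (u₂ = u₃ → P.eval u₃ = 0)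

/-- `P_n(·, u₁, u₂, u₃)`: the polynomial determined by `IsWhithamPoly`. -/
def whithamPoly (n : ℕ) (u₁ u₂ u₃ : ℝ) : Polynomial ℝ :=
  Classical.epsilon (IsWhithamPoly n u₁ u₂ u₃)

/-- `4^m (2m+1) P_m(v) / P_0(v)`. At a zero `v` of `P_0` (this happens for `u₂ = u₃ = v`, where
`P_m` vanishes too) the quotient is understood as the limit of `P_m(ξ) / P_0(ξ)` as `ξ → v`, that is
`P_m'(v) / P_0'(v)`. -/
def speedAt (m : ℕ) (u₁ u₂ u₃ v : ℝ) : ℝ :=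
  open Classical in
  4 ^ m * (2 * m + 1) *
    if (whithamPoly 0 u₁ u₂ u₃).eval v = 0 then
      (whithamPoly m u₁ u₂ u₃).derivative.eval v / (whithamPoly 0 u₁ u₂ u₃).derivative.eval v
    else
      (whithamPoly m u₁ u₂ u₃).eval v / (whithamPoly 0 u₁ u₂ u₃).eval v

/-- The second Whitham speed `μ₂^{(m)}(u₁, u₂, u₃)`. -/
def mu₂ (m : ℕ) (u₁ u₂ u₃ : ℝ) : ℝ := speedAt m u₁ u₂ u₃ u₂

/-- The third Whitham speed `μ₃^{(m)}(u₁, u₂, u₃)`. -/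
def mu₃ (m : ℕ) (u₁ u₂ u₃ : ℝ) : ℝ := speedAt m u₁ u₂ u₃ u₃

/-! ### The function `q` and the polynomial `p₁` -/

/-- `C_m = 2^{2m+1} / ∫_0^1 s^m / √(1-s) ds`. -/
def C (m : ℕ) : ℝ := 2 ^ (2 * m + 1) / ∫ s in (0 : ℝ)..1, s ^ m / √(1 - s)

/-- The solution `q` of the Euler-Poisson-Darboux problem with `q(u,u,u) = C_m u^m`. -/
def q (m : ℕ) (u₁ u₂ u₃ : ℝ) : ℝ :=
  C m / (2 * √2 * Real.pi) *
    ∫ ν in (-1 : ℝ)..1, ∫ μ in (-1 : ℝ)..1,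
      ((1 + μ) / 2 * ((1 + ν) / 2) * u₁ + (1 + μ) / 2 * ((1 - ν) / 2) * u₂ + (1 - μ) / 2 * u₃) ^ m
        / √((1 - μ) * (1 - ν ^ 2))

/-- `div q = ∂q/∂u₁ + ∂q/∂u₂ + ∂q/∂u₃`. -/
def divq (m : ℕ) (u₁ u₂ u₃ : ℝ) : ℝ :=
  deriv (fun v => q m v u₂ u₃) u₁ + deriv (fun v => q m u₁ v u₃) u₂
    + deriv (fun v => q m u₁ u₂ v) u₃

/-- `p₁ = 2 (u₁ - u₂) ∂(div q)/∂u₂ - div q`. -/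
def p₁ (m : ℕ) (u₁ u₂ u₃ : ℝ) : ℝ :=
  2 * (u₁ - u₂) * deriv (fun v => divq m u₁ v u₃) u₂ - divq m u₁ u₂ u₃

/-! ### The self-similar Whitham solution for the step `1 → 0` -/

/-- The point `u^*`. -/
def IsTrailingPoint (m : ℕ) (u : ℝ) : Prop := 0 < u ∧ u < 1 ∧ p₁ m 1 u u = 0

/-- The point `u^{**}`. -/
def IsTransitionPoint (m : ℕ) (u : ℝ) : Prop :=
  0 < u ∧ u < 1 ∧ mu₂ m 1 u 0 - mu₃ m 1 u 0 = 0

/-- `u₁ = 1`, `x = μ₂(1, u₂, u₃) t`, `x = μ₃(1, u₂, u₃) t` with `0 < u₃ < u₂ < 1`. -/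
def SolvesInner (m : ℕ) (x t u₂ u₃ : ℝ) : Prop :=
  0 < u₃ ∧ u₃ < u₂ ∧ u₂ < 1 ∧ x = mu₂ m 1 u₂ u₃ * t ∧ x = mu₃ m 1 u₂ u₃ * t

/-- `u₁ = 1`, `x = μ₂(1, u₂, 0) t`, `u₃ = 0` on the branch `w < u₂ < 1`, where `w = u^{**}`. -/
def SolvesOuter (m : ℕ) (w x t u₂ : ℝ) : Prop :=
  w < u₂ ∧ u₂ < 1 ∧ x = mu₂ m 1 u₂ 0 * t

/-! ### The minimization problem -/

/-- The admissible functions: `ψ ∈ L¹(0, 1)`, `ψ ≥ 0` (almost everywhere). -/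
def Admissible (ψ : ℝ → ℝ) : Prop :=
  IntegrableOn ψ (Set.Icc 0 1) ∧ ∀ᵐ η ∂(volume.restrict (Set.Icc (0 : ℝ) 1)), 0 ≤ ψ η

/-- The functional
`-(1/2π) ∫∫ log |(η-μ)/(η+μ)| ψ(η) ψ(μ) dη dμ + ∫ (η x - 4^m η^{2m+1} t) ψ(η) dη`
over `[0,1]`. For admissible `ψ` the integrand `-log |(η-μ)/(η+μ)| ψ(η) ψ(μ)` is nonnegative, so
that the double integral is an element of `[0, ∞]`, and the linear part is finite. -/
def energy (m : ℕ) (x t : ℝ) (ψ : ℝ → ℝ) : EReal :=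
  ((ENNReal.ofReal (1 / (2 * Real.pi)) *
      ∫⁻ η in Set.Icc (0 : ℝ) 1, ∫⁻ μ in Set.Icc (0 : ℝ) 1,
        ENNReal.ofReal (-Real.log |(η - μ) / (η + μ)| * ψ η * ψ μ) : ENNReal) : EReal)
  + ((∫ η in Set.Icc (0 : ℝ) 1, (η * x - 4 ^ m * η ^ (2 * m + 1) * t) * ψ η : ℝ) : EReal)

/-- `ψ` is the minimizer: it is admissible, it minimizes the functional among all admissible
functions, and every other minimizer agrees with it almost everywhere on `[0,1]`. -/
def IsTheMinimizer (m : ℕ) (x t : ℝ) (ψ : ℝ → ℝ) : Prop :=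
  Admissible ψ ∧
  (∀ φ, Admissible φ → energy m x t ψ ≤ energy m x t φ) ∧
  ∀ φ, Admissible φ → energy m x t φ = energy m x t ψ →
    φ =ᵐ[volume.restrict (Set.Icc (0 : ℝ) 1)] ψ

/-- The density for `x ≤ α t`, with `u = u^*`. -/
def psi₁ (m : ℕ) (x t u η : ℝ) : ℝ :=
  (-x * η + 4 ^ m * (2 * m + 1) * t * η * ((whithamPoly m 1 u u).eval (η ^ 2) / (η ^ 2 - u)))
    / √(1 - η ^ 2)

/-- The density for `α t < x < β t`. -/
def psi₂ (m : ℕ) (x t u₂ u₃ η : ℝ) : ℝ :=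
  open Classical in
  if η < √u₃ then
    -((-x * η * (whithamPoly 0 1 u₂ u₃).eval (η ^ 2)
        + 4 ^ m * (2 * m + 1) * t * η * (whithamPoly m 1 u₂ u₃).eval (η ^ 2))
      / √((1 - η ^ 2) * (u₂ - η ^ 2) * (u₃ - η ^ 2)))
  else if η ≤ √u₂ then 0
  else
    (-x * η * (whithamPoly 0 1 u₂ u₃).eval (η ^ 2)
        + 4 ^ m * (2 * m + 1) * t * η * (whithamPoly m 1 u₂ u₃).eval (η ^ 2))
      / √((1 - η ^ 2) * (η ^ 2 - u₂) * (η ^ 2 - u₃))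

/-- The density for `β t < x < 4^m t`. -/
def psi₃ (m : ℕ) (x t u₂ η : ℝ) : ℝ :=
  open Classical in
  if η ≤ √u₂ then 0
  else
    (-x * (whithamPoly 0 1 u₂ 0).eval (η ^ 2)
        + 4 ^ m * (2 * m + 1) * t * (whithamPoly m 1 u₂ 0).eval (η ^ 2))
      / √((1 - η ^ 2) * (η ^ 2 - u₂))

end

end KdVHierarchy

/-! Put m = j + 1 and u₁ = 1, a = u₂, b = u₃. All algebraic data are coefficients of products of
powers of 1 - cz. The central one is `hFun j a b ξ`, the coefficient of z^j in √(1 - z) (1 -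
az)^{-1/2} (1 - bz)^{-1/2} (1 - ξz)^{-1}. For b < a < 1, P_m equals (ξ - a)(ξ - b) `hFun` plus a
linear polynomial (`eval_whithamPoly_succ`). The speeds μ₂ and μ₃ agree exactly when the loop
integral of `hFun` over (b, a) vanishes (`mu₂_eq_mu₃_iff`), and p₁(1, u, u) is a multiple of
`trailFun` (`p₁_diag`). All signs come from one fact: for 0 ≤ a < 1 the series √((1 - z)/(1 - az))
has constant term 1 and otherwise negative coefficients. Hence the relevant coefficients, divided by
r^j, increase in r and change sign at most once (`ratioMono_coeff`), and averages against positive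
kernels inherit this. This yields the uniqueness of u^* and u^{**}, of b for given a, and the signs
of the densities. The kernel -log|(η - μ)/(η + μ)| is the integral over R > 0 of the product of (η²
- R)_+^{-1/2} and (μ² - R)_+^{-1/2}. The quadratic form is therefore the squared norm of an Abel
transform, which is injective. So a nonnegative density whose first variation N is nonnegative and
vanishes wherever the density is positive is the only minimizer (`isTheMinimizer_of_potential`). The
explicit densities are polynomials times boundary values of √(w(w - a)/((w - b)(w - 1))) with w =
η². Their Cauchy transforms are known up to a polynomial, which the growth at infinity determines
(`integral_polynomial_cauchy`). Integration along a line close to the real axis gives the potentials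
and a criterion for minimality (`isTheMinimizer_density`). The solutions in the second region exist
because the zero set of the loop integral is a connected curve, along which the speed takes all
intermediate values (`exists_loop_solution`); in the third region the intermediate value theorem
applies directly. Uniqueness of the parameters and α < β < 4^m need no monotonicity of the speeds:
otherwise one and the same problem would have two minimizers with different supports
(`inner_unique`, `outerSpeed_injective`, `bandFun_lt_outerSpeed`, `outerSpeed_lt_one`). -/

namespace StepData

/-! ### Formal power series of half-integer powers and their signs. -/

open MeasureTheory Filter Asymptotics Topology

noncomputable section

/-! ### Binomial series -/

/-- The coefficients of `(1 - z)^{-1/2}`. -/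
def eps (k : ℕ) : ℝ := (Nat.centralBinom k : ℝ) / 4 ^ k

lemma eps_zero : eps 0 = 1 := by simp [eps]

lemma eps_pos (k : ℕ) : 0 < eps k := by
  unfold eps
  have := Nat.centralBinom_pos k
  positivity

lemma eps_succ (k : ℕ) : ((k : ℝ) + 1) * eps (k + 1) = (k + 1 / 2) * eps k := by
  unfold eps
  have h := Nat.succ_mul_centralBinom_succ k
  have h' : ((k : ℝ) + 1) * (Nat.centralBinom (k + 1) : ℝ)
      = 2 * (2 * k + 1) * (Nat.centralBinom k : ℝ) := by exact_mod_cast h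
  rw [pow_succ]
  field_simp
  linarith

lemma eps_succ_lt (k : ℕ) : eps (k + 1) < eps k := by
  have h := eps_succ k
  have h0 := eps_pos k
  have hk : (0 : ℝ) ≤ k := Nat.cast_nonneg k
  nlinarith [eps_pos (k + 1)]

open PowerSeries

/-- The series `(1 - a z)^{-1/2}`. -/
def bin (a : ℝ) : PowerSeries ℝ := PowerSeries.mk fun k => eps k * a ^ k

/-- The series `(1 - a z)^{-1}`. -/
def geom (a : ℝ) : PowerSeries ℝ := PowerSeries.mk fun k => a ^ k

lemma coeff_bin (k : ℕ) (a : ℝ) : coeff k (bin a) = eps k * a ^ k := by simp [bin]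

lemma constantCoeff_bin (a : ℝ) : constantCoeff (bin a) = 1 := by
  rw [← coeff_zero_eq_constantCoeff_apply, coeff_bin, eps_zero, pow_zero, mul_one]

lemma coeff_geom (k : ℕ) (a : ℝ) : coeff k (geom a) = a ^ k := by simp [geom]

lemma coeff_one_sub_mul (k : ℕ) (a : ℝ) (g : PowerSeries ℝ) :
    coeff (k + 1) ((1 - C a * X) * g) = coeff (k + 1) g - a * coeff k g := by
  rw [sub_mul, one_mul, map_sub, mul_assoc, coeff_C_mul, coeff_succ_X_mul]

lemma coeff_zero_one_sub_mul (a : ℝ) (g : PowerSeries ℝ) :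
    coeff 0 ((1 - C a * X) * g) = coeff 0 g := by
  simp

lemma constantCoeff_geom (a : ℝ) : constantCoeff (geom a) = 1 := by
  rw [← coeff_zero_eq_constantCoeff_apply, coeff_geom, pow_zero]

lemma one_sub_mul_geom (a : ℝ) : (1 - C a * X) * geom a = 1 := by
  ext k
  rcases k with _ | k
  · simp [coeff_zero_one_sub_mul, geom]
  · rw [coeff_one_sub_mul, coeff_geom, coeff_geom, coeff_one]
    simp [pow_succ]; ring

lemma bin_zero : bin 0 = 1 := by
  ext k
  rcases k with _ | k <;> simp [coeff_bin, eps_zero, coeff_one]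

/-- The differential equation of (1 - az)^{-1/2}; coefficientwise it is `eps_succ`. Through it all
identities for `bin` are proved formally, without convergence. -/
lemma derivative_bin (a : ℝ) :
    2 * ((1 - C a * X) * derivative ℝ (bin a)) = C a * bin a := by
  ext k
  rw [show (2 : PowerSeries ℝ) = C 2 from (map_ofNat (C (R := ℝ)) 2).symm, coeff_C_mul, coeff_C_mul]
  rcases k with _ | k
  · rw [coeff_zero_one_sub_mul, coeff_derivative, coeff_bin, coeff_bin]
    have := eps_succ 0
    simp at this ⊢
    rw [this]; ring
  · rw [coeff_one_sub_mul, coeff_derivative, coeff_derivative, coeff_bin, coeff_bin]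
    have := eps_succ (k + 1)
    push_cast at this ⊢
    linear_combination 2 * a ^ (k + 2) * this

/-- By `derivative_bin` the series (1 - az) `bin`² has derivative zero, and its constant term is 1.
-/
lemma bin_mul_bin (a : ℝ) : bin a * bin a = geom a := by
  have key : (1 - C a * X) * (bin a * bin a) = 1 := by
    apply PowerSeries.derivative.ext
    · have h := derivative_bin a
      simp only [Derivation.leibniz, smul_eq_mul, map_sub, derivative_C, derivative_X,
        derivative_one]
      linear_combination (bin a) * h
    · simp [constantCoeff_bin]
  calc bin a * bin a = ((1 - C a * X) * geom a) * (bin a * bin a) := by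
        rw [one_sub_mul_geom, one_mul]
    _ = geom a * ((1 - C a * X) * (bin a * bin a)) := by ring
    _ = geom a := by rw [key, mul_one]

lemma one_sub_mul_bin_mul_bin (a : ℝ) : (1 - C a * X) * bin a * bin a = 1 := by
  rw [mul_assoc, bin_mul_bin, one_sub_mul_geom]

/-- (1 - az)^{-3/2} is (2z d/dz + 1) applied to (1 - az)^{-1/2}, and the operator multiplies the
k-th coefficient by 2k + 1. -/
lemma coeff_geom_mul_bin (k : ℕ) (a : ℝ) :
    coeff k (geom a * bin a) = (2 * k + 1) * eps k * a ^ k := by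
  have h : geom a * bin a = 2 * (X * derivative ℝ (bin a)) + bin a := by
    have h := derivative_bin a
    have h2 := one_sub_mul_geom a
    linear_combination (2 * (X * derivative ℝ (bin a)) + bin a) * h2
      - X * geom a * h
  rw [h, map_add, show (2 : PowerSeries ℝ) = C 2 from (map_ofNat (C (R := ℝ)) 2).symm, coeff_C_mul, coeff_bin]
  rcases k with _ | k
  · simp
  · rw [coeff_succ_X_mul, coeff_derivative, coeff_bin]
    push_cast; ring

/-- Horner's rule: as functions of v, the coefficients of g/(1 - vz) are the polynomial truncations
of g with reversed powers. -/
lemma coeff_mul_geom_succ (n : ℕ) (g : PowerSeries ℝ) (v : ℝ) :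
    coeff (n + 1) (g * geom v) = v * coeff n (g * geom v) + coeff (n + 1) g := by
  have : coeff (n + 1) ((1 - C v * X) * (g * geom v)) = coeff (n + 1) g := by
    rw [show (1 - C v * X) * (g * geom v) = ((1 - C v * X) * geom v) * g by ring,
      one_sub_mul_geom, one_mul]
  rw [coeff_one_sub_mul] at this
  linarith

lemma coeff_mul_geom (n : ℕ) (g : PowerSeries ℝ) (v : ℝ) :
    coeff n (g * geom v) = ∑ k ∈ Finset.range (n + 1), coeff k g * v ^ (n - k) := by
  rw [coeff_mul, Finset.Nat.sum_antidiagonal_eq_sum_range_succ_mk]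
  simp [coeff_geom]

lemma X_mul_geom_mul_geom (r v : ℝ) :
    C (v - r) * X * geom r * geom v = geom v - geom r := by
  have h1 := one_sub_mul_geom r
  have h2 := one_sub_mul_geom v
  rw [map_sub]
  linear_combination geom v * h1 - geom r * h2

/-- The derivative of the coefficients of `(1 - r z)^{-1/2} g(z)` with respect to `r`. -/
lemma hasDerivAt_coeff_bin_mul (n : ℕ) (g : PowerSeries ℝ) (r : ℝ) :
    HasDerivAt (fun r => coeff n (bin r * g)) (1 / 2 * coeff n (X * (geom r * bin r) * g)) r := by
  have hk : ∀ k, HasDerivAt (fun r => coeff k (bin r)) (1 / 2 * coeff k (X * (geom r * bin r))) r := by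
    intro k
    rw [show (fun r => coeff k (bin r)) = fun r => eps k * r ^ k from
      funext fun r => coeff_bin k r]
    rcases k with _ | k
    · simpa using hasDerivAt_const r (eps 0)
    · rw [coeff_succ_X_mul, coeff_geom_mul_bin]
      refine ((hasDerivAt_pow (k + 1) r).const_mul (eps (k + 1))).congr_deriv ?_
      have := eps_succ k
      push_cast
      linear_combination r ^ k * this
  rw [show (fun r => coeff n (bin r * g)) = fun r => ∑ x ∈ Finset.HasAntidiagonal.antidiagonal n,
    coeff x.1 (bin r) * coeff x.2 g from funext fun r => coeff_mul _ _ _, coeff_mul, Finset.mul_sum]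
  refine (HasDerivAt.fun_sum (A' := fun x : ℕ × ℕ =>
    1 / 2 * (coeff x.1 (X * (geom r * bin r)) * coeff x.2 g)) fun x _ => ?_)
  exact ((hk x.1).mul_const _).congr_deriv (by ring)

lemma continuous_coeff_bin_mul (n : ℕ) (g : PowerSeries ℝ) :
    Continuous fun r => coeff n (bin r * g) :=
  continuous_iff_continuousAt.2 fun r => (hasDerivAt_coeff_bin_mul n g r).continuousAt

/-- The derivative of the coefficients of `(1 - r z)^{-1} g(z)` with respect to `r`. -/
lemma hasDerivAt_coeff_geom_mul (n : ℕ) (g : PowerSeries ℝ) (r : ℝ) :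
    HasDerivAt (fun r => coeff n (geom r * g)) (coeff n (X * (geom r * geom r) * g)) r := by
  induction n with
  | zero => simpa [constantCoeff_geom] using hasDerivAt_const r (coeff 0 g)
  | succ n ih =>
    have h := (((hasDerivAt_id r).mul ih).add (hasDerivAt_const r (coeff (n + 1) g)))
    have e : (fun r => coeff (n + 1) (geom r * g))
        = fun r => r * coeff n (geom r * g) + coeff (n + 1) g := by
      funext r
      rw [mul_comm, coeff_mul_geom_succ]
    rw [e]
    refine h.congr_deriv ?_
    have h3 := coeff_mul_geom_succ n (X * geom r * g) r
    rw [show X * (geom r * geom r) * g = (X * geom r * g) * geom r by ring, h3, mul_assoc X,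
      coeff_succ_X_mul]
    simp; ring

/-- The series `(1 - z)^{1/2}`. -/
def sqrtSeries : PowerSeries ℝ := (1 - C 1 * X) * bin 1

lemma sqrtSeries_mul_bin_one : sqrtSeries * bin 1 = 1 := one_sub_mul_bin_mul_bin 1

lemma sqrtSeries_mul_self : sqrtSeries * sqrtSeries = 1 - C 1 * X := by
  have := sqrtSeries_mul_bin_one
  unfold sqrtSeries at *
  linear_combination (1 - C 1 * X) * this

lemma coeff_zero_sqrtSeries : coeff 0 sqrtSeries = 1 := by
  unfold sqrtSeries
  rw [coeff_zero_one_sub_mul, coeff_bin]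
  simp [eps_zero]

/-- The coefficients of √(1 - z) are the differences of the decreasing sequence `eps`. All later
sign statements go back to this. -/
lemma coeff_sqrtSeries_neg (k : ℕ) : coeff (k + 1) sqrtSeries < 0 := by
  unfold sqrtSeries
  rw [coeff_one_sub_mul, coeff_bin, coeff_bin]
  have := eps_succ_lt k
  simp only [one_pow, mul_one, one_mul]
  linarith

/-- The series `((1 - z) / (1 - a z))^{1/2}`. -/
def ratioSeries (a : ℝ) : PowerSeries ℝ := sqrtSeries * bin a

lemma coeff_zero_ratioSeries (a : ℝ) : coeff 0 (ratioSeries a) = 1 := by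
  unfold ratioSeries
  rw [coeff_mul]
  simp [coeff_zero_sqrtSeries, coeff_bin, eps_zero]

lemma ratioSeries_zero : ratioSeries 0 = sqrtSeries := by
  simp [ratioSeries, bin_zero]

lemma coeff_ratioSeries_mul_pow_le (k : ℕ) {a b : ℝ} (ha : 0 ≤ a) (hab : a ≤ b) :
    coeff k (ratioSeries a) * b ^ k ≤ coeff k (ratioSeries b) * a ^ k := by
  unfold ratioSeries
  rw [coeff_mul, coeff_mul, Finset.sum_mul, Finset.sum_mul]
  refine Finset.sum_le_sum fun x hx => ?_
  obtain ⟨i, j⟩ := x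
  rw [Finset.HasAntidiagonal.mem_antidiagonal] at hx
  simp only at hx
  simp only [coeff_bin]
  subst hx
  rcases i with _ | i
  · simp only [zero_add]; apply le_of_eq; ring
  · have h1 := coeff_sqrtSeries_neg i
    have h2 := eps_pos j
    have h3 : a ^ (i + 1) ≤ b ^ (i + 1) := pow_le_pow_left₀ ha hab _
    have h4 : 0 ≤ a ^ j * b ^ j := mul_nonneg (pow_nonneg ha _) (pow_nonneg (ha.trans hab) _)
    have h5 : 0 ≤ (-coeff (i + 1) sqrtSeries) * eps j * ((a ^ j * b ^ j) * (b ^ (i + 1) - a ^ (i + 1))) :=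
      mul_nonneg (mul_nonneg (by linarith) h2.le) (mul_nonneg h4 (by linarith))
    rw [pow_add a, pow_add b]
    linarith

/-- For a = 1 the convolution sum vanishes because √(1 - z) (1 - z)^{-1/2} = 1. After multiplication
by a^{k+1} it dominates the sum for a term by term: the only positive term is the same in both, and
in the negative terms a^j ≥ a^{k+1}, strictly for j = 0. -/
lemma coeff_ratioSeries_neg (k : ℕ) {a : ℝ} (ha : 0 ≤ a) (ha1 : a < 1) :
    coeff (k + 1) (ratioSeries a) < 0 := by
  have hone : ∑ x ∈ Finset.HasAntidiagonal.antidiagonal (k + 1),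
      coeff x.1 sqrtSeries * (eps x.2 * (1:ℝ) ^ x.2) = 0 := by
    have := congrArg (coeff (k + 1)) sqrtSeries_mul_bin_one
    rw [coeff_mul] at this
    simpa [coeff_bin, coeff_one] using this
  have hlt : ∑ x ∈ Finset.HasAntidiagonal.antidiagonal (k + 1), coeff x.1 sqrtSeries * (eps x.2 * a ^ x.2)
      < ∑ x ∈ Finset.HasAntidiagonal.antidiagonal (k + 1),
        coeff x.1 sqrtSeries * (eps x.2 * (1:ℝ) ^ x.2) * a ^ (k + 1) := by
    refine Finset.sum_lt_sum (fun x hx => ?_) ⟨(k + 1, 0), by simp, ?_⟩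
    · obtain ⟨i, j⟩ := x
      rw [Finset.HasAntidiagonal.mem_antidiagonal] at hx
      simp only at hx ⊢
      rcases i with _ | i
      · rw [zero_add] at hx; subst hx; apply le_of_eq; ring
      · have h1 := coeff_sqrtSeries_neg i
        have h2 := eps_pos j
        have h3 : a ^ (k + 1) ≤ a ^ j := pow_le_pow_of_le_one ha ha1.le (by omega)
        have := mul_nonneg (mul_nonneg (neg_nonneg.2 h1.le) h2.le) (sub_nonneg.2 h3)
        rw [one_pow]
        linarith
    · have h1 := coeff_sqrtSeries_neg k
      have h3 : a ^ (k + 1) < 1 := pow_lt_one₀ ha ha1 (by omega)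
      simp only [pow_zero, mul_one, eps_zero]
      nlinarith
  rw [← Finset.sum_mul, hone, zero_mul] at hlt
  unfold ratioSeries
  rw [coeff_mul]
  simpa [coeff_bin] using hlt

/-! ### Averages against `(1 - s)^{-1/2}` -/

lemma intervalIntegrable_inv_sqrt_one_sub :
    IntervalIntegrable (fun s : ℝ => 1 / √(1 - s)) volume 0 1 := by
  have h : IntervalIntegrable (fun s : ℝ => s ^ (-(1 / 2) : ℝ)) volume 0 1 :=
    intervalIntegral.intervalIntegrable_rpow' (by norm_num)
  have h2 := (h.comp_sub_left 1).symm
  simp only [sub_zero, sub_self] at h2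
  refine h2.congr fun s hs => ?_
  rw [Set.uIoc_of_le zero_le_one] at hs
  rw [Real.sqrt_eq_rpow, Real.rpow_neg (by linarith [hs.2])]
  exact (one_div _).symm

lemma intervalIntegrable_mul_inv_sqrt_one_sub {g : ℝ → ℝ} (hg : ContinuousOn g (Set.Icc 0 1)) :
    IntervalIntegrable (fun s : ℝ => g s / √(1 - s)) volume 0 1 := by
  have := intervalIntegrable_inv_sqrt_one_sub.continuousOn_mul
    (g := g) (by rwa [Set.uIcc_of_le zero_le_one])
  refine this.congr fun s _ => ?_
  ring

/-- With r = b + (v - b)s, an antiderivative is -2√(1 - s) times the coefficient of (1 -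
rz)^{-1/2}(1 - vz)^{-1}; the check uses v - r = (v - b)(1 - s) and partial fractions. In effect,
averaging (1 - rz)^{-3/2} from b to v with weight (1 - s)^{-1/2} produces 2(1 - bz)^{-1/2}(1 -
vz)^{-1}. -/
lemma integral_pow_div_sqrt (j : ℕ) (b v : ℝ) :
    (2 * j + 1) * eps j * ∫ s in (0 : ℝ)..1, (b + (v - b) * s) ^ j / √(1 - s)
      = 2 * coeff j (bin b * geom v) := by
  rw [← intervalIntegral.integral_const_mul]
  have hcont : Continuous fun s : ℝ => -2 * √(1 - s) * coeff j (bin (b + (v - b) * s) * geom v) := by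
    have := (continuous_coeff_bin_mul j (geom v)).comp
      (g := fun r => coeff j (bin r * geom v)) (f := fun s : ℝ => b + (v - b) * s) (by fun_prop)
    exact (by fun_prop : Continuous fun s : ℝ => -2 * √(1 - s)).mul this
  rw [intervalIntegral.integral_eq_sub_of_hasDerivAt_of_le zero_le_one
    (f := fun s : ℝ => -2 * √(1 - s) * coeff j (bin (b + (v - b) * s) * geom v))
    hcont.continuousOn ?_ ?_]
  · simp
  · intro s hs
    have h1 : HasDerivAt (fun s : ℝ => 1 - s) (-1) s := by
      simpa using (hasDerivAt_id s).const_sub 1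
    have hpos : 0 < 1 - s := by linarith [hs.2]
    have h2 := (h1.sqrt hpos.ne').const_mul (-2)
    have h3 : HasDerivAt (fun s : ℝ => b + (v - b) * s) (v - b) s := by
      simpa using ((hasDerivAt_id s).const_mul (v - b)).const_add b
    have h4 := (hasDerivAt_coeff_bin_mul j (geom v) (b + (v - b) * s)).comp s h3
    refine (h2.mul h4).congr_deriv ?_
    set r := b + (v - b) * s with hr
    have hs0 : √(1 - s) ≠ 0 := (Real.sqrt_pos.2 hpos).ne'
    have hsq : √(1 - s) * √(1 - s) = 1 - s := Real.mul_self_sqrt hpos.le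
    have hid : coeff j (C (v - r) * (X * (geom r * bin r) * geom v))
        = coeff j (bin r * geom v) - coeff j (geom r * bin r) := by
      rw [← map_sub]
      congr 1
      have := X_mul_geom_mul_geom r v
      linear_combination bin r * this
    rw [coeff_C_mul, coeff_geom_mul_bin] at hid
    simp only [Function.comp]
    rw [← hr]
    field_simp
    have hvr : (v - b) * (1 - s) = v - r := by rw [hr]; ring
    rw [show √(1 - s) ^ 2 = 1 - s by rw [sq, hsq]]
    linear_combination (-2 * coeff j (X * (geom r * bin r) * geom v)/2) * hvr - hid
  · have := intervalIntegrable_mul_inv_sqrt_one_sub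
      (g := fun s => (2 * j + 1) * eps j * (b + (v - b) * s) ^ j) (by fun_prop)
    refine this.congr fun s _ => ?_
    ring

end

end StepData

/-! ### The function q and the trailing condition as power series coefficients. -/

namespace StepData

open MeasureTheory Filter Asymptotics Topology

noncomputable section

open PowerSeries

/-! ### Arcsine moments -/

lemma hasDerivAt_sqrt_one_sub_sq {x : ℝ} (hx : x ∈ Set.Ioo (-1 : ℝ) 1) :
    HasDerivAt (fun x : ℝ => √(1 - x ^ 2)) (-x / √(1 - x ^ 2)) x := by
  have hpos : 0 < 1 - x ^ 2 := by nlinarith [hx.1, hx.2]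
  have h1 : HasDerivAt (fun x : ℝ => 1 - x ^ 2) (-(2 * x)) x := by
    simpa using (hasDerivAt_pow 2 x).const_sub 1
  refine (h1.sqrt hpos.ne').congr_deriv ?_
  field_simp

lemma intervalIntegrable_inv_sqrt_one_sub_sq :
    IntervalIntegrable (fun x : ℝ => 1 / √(1 - x ^ 2)) volume (-1) 1 := by
  refine intervalIntegral.intervalIntegrable_deriv_of_nonneg (g := Real.arcsin)
    Real.continuous_arcsin.continuousOn (fun x hx => ?_) fun x _ => by positivity
  have h : (-1 : ℝ) ≤ 1 := by norm_num
  rw [min_eq_left h, max_eq_right h] at hx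
  exact Real.hasDerivAt_arcsin hx.1.ne' hx.2.ne

lemma integral_inv_sqrt_one_sub_sq : ∫ x in (-1 : ℝ)..1, 1 / √(1 - x ^ 2) = Real.pi := by
  rw [intervalIntegral.integral_eq_sub_of_hasDerivAt_of_le (by norm_num) (f := Real.arcsin)
    Real.continuous_arcsin.continuousOn
    (fun x hx => Real.hasDerivAt_arcsin hx.1.ne' hx.2.ne) intervalIntegrable_inv_sqrt_one_sub_sq]
  simp

lemma intervalIntegrable_mul_inv_sqrt_one_sub_sq {g : ℝ → ℝ} (hg : Continuous g) :
    IntervalIntegrable (fun s : ℝ => g s / √(1 - s ^ 2)) volume (-1) 1 := by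
  have := intervalIntegrable_inv_sqrt_one_sub_sq.continuousOn_mul (g := g) hg.continuousOn
  refine this.congr fun s _ => ?_
  ring

/-- Coefficient comparison in 2(1 - uz)(1 - vz)y' = (u + v - 2uvz)y. At j = 0 the truncated index j
- 1 is harmless because of the factor j. -/
lemma coeff_bin_mul_bin_succ (j : ℕ) (u v : ℝ) :
    ((j : ℝ) + 1) * coeff (j + 1) (bin u * bin v)
      = (2 * j + 1) * ((u + v) / 2) * coeff j (bin u * bin v)
        - j * (u * v) * coeff (j - 1) (bin u * bin v) := by
  set y := bin u * bin v with hy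
  have h : 2 * derivative ℝ y - C (2 * (u + v)) * (X * derivative ℝ y)
      + C (2 * (u * v)) * (X * (X * derivative ℝ y)) = C (u + v) * y - C (2 * (u * v)) * (X * y) := by
    have h1 := derivative_bin u
    have h2 := derivative_bin v
    have hd : derivative ℝ y = bin u * derivative ℝ (bin v) + bin v * derivative ℝ (bin u) := by
      rw [hy]; simp [Derivation.leibniz]
    rw [hd, hy]
    simp only [map_add, map_mul, show C (2 : ℝ) = 2 from map_ofNat (C (R := ℝ)) 2]
    linear_combination (1 - C v * X) * bin v * h1 + (1 - C u * X) * bin u * h2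
  have hj := congrArg (coeff j) h
  simp only [map_add, map_sub, show (2 : PowerSeries ℝ) = C 2 from (map_ofNat (C (R := ℝ)) 2).symm,
    coeff_C_mul] at hj
  rcases j with _ | _ | j
  · simp only [coeff_zero_X_mul, coeff_derivative] at hj
    push_cast at hj ⊢
    rw [show (C u + C v) * y = C (u + v) * y by simp, coeff_C_mul] at hj
    linarith
  · simp only [coeff_zero_X_mul, coeff_derivative, coeff_succ_X_mul] at hj
    rw [show (C u + C v) * y = C (u + v) * y by simp, coeff_C_mul] at hj
    push_cast at hj ⊢
    simp only [zero_add] at hj ⊢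
    linarith
  · simp only [coeff_derivative, coeff_succ_X_mul] at hj
    rw [show (C u + C v) * y = C (u + v) * y by simp, coeff_C_mul] at hj
    push_cast at hj ⊢
    linarith

/-- The recurrence of `coeff_bin_mul_bin_succ` for arcsine moments: the defect is the integral of
the derivative of (u - v)/2 · Y^j √(1 - ν²), Y being the affine function in the integrand, and this
primitive vanishes at ν = ±1. -/
lemma integral_pow_div_sqrt_succ (j : ℕ) (u v : ℝ) :
    ((j : ℝ) + 1) * ∫ ν in (-1 : ℝ)..1, ((1 + ν) / 2 * u + (1 - ν) / 2 * v) ^ (j + 1) / √(1 - ν ^ 2)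
      = (2 * j + 1) * ((u + v) / 2) *
          (∫ ν in (-1 : ℝ)..1, ((1 + ν) / 2 * u + (1 - ν) / 2 * v) ^ j / √(1 - ν ^ 2))
        - j * (u * v) *
          ∫ ν in (-1 : ℝ)..1, ((1 + ν) / 2 * u + (1 - ν) / 2 * v) ^ (j - 1) / √(1 - ν ^ 2) := by
  set Y : ℝ → ℝ := fun ν => (1 + ν) / 2 * u + (1 - ν) / 2 * v with hY
  have hYc : Continuous Y := by fun_prop
  have hint : ∀ k : ℕ, IntervalIntegrable (fun ν => Y ν ^ k / √(1 - ν ^ 2)) volume (-1) 1 :=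
    fun k => intervalIntegrable_mul_inv_sqrt_one_sub_sq (hYc.pow k)
  have hint3 : IntervalIntegrable (fun ν => (2 * j + 1) * ((u + v) / 2) * (Y ν ^ j / √(1 - ν ^ 2))
        - j * (u * v) * (Y ν ^ (j - 1) / √(1 - ν ^ 2)) - (j + 1) * (Y ν ^ (j + 1) / √(1 - ν ^ 2)))
        volume (-1) 1 :=
    (((hint j).const_mul _).sub ((hint (j - 1)).const_mul _)).sub ((hint (j + 1)).const_mul _)
  have key : ∫ ν in (-1 : ℝ)..1,
      ((2 * j + 1) * ((u + v) / 2) * (Y ν ^ j / √(1 - ν ^ 2))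
        - j * (u * v) * (Y ν ^ (j - 1) / √(1 - ν ^ 2)) - (j + 1) * (Y ν ^ (j + 1) / √(1 - ν ^ 2)))
      = 0 := by
    have hFc : Continuous fun ν : ℝ => (u - v) / 2 * (Y ν ^ j * √(1 - ν ^ 2)) := by fun_prop
    rw [intervalIntegral.integral_eq_sub_of_hasDerivAt_of_le (by norm_num)
      (f := fun ν : ℝ => (u - v) / 2 * (Y ν ^ j * √(1 - ν ^ 2))) hFc.continuousOn ?_ hint3]
    · simp
    · intro ν hν
      have hpos : 0 < 1 - ν ^ 2 := by nlinarith [hν.1, hν.2]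
      have hs : √(1 - ν ^ 2) ≠ 0 := (Real.sqrt_pos.2 hpos).ne'
      have hsq : √(1 - ν ^ 2) ^ 2 = 1 - ν ^ 2 := Real.sq_sqrt hpos.le
      have h1 : HasDerivAt Y ((u - v) / 2) ν := by
        have := ((((hasDerivAt_id ν).const_add 1).div_const 2).mul_const u).add
          ((((hasDerivAt_id ν).const_sub 1).div_const 2).mul_const v)
        exact this.congr_deriv (by ring)
      have h2 := ((h1.pow j).mul (hasDerivAt_sqrt_one_sub_sq hν)).const_mul ((u - v) / 2)
      refine h2.congr_deriv ?_
      have hYe : (u - v) / 2 * ν = Y ν - (u + v) / 2 := by simp only [hY]; ring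
      have hY2 : ((u - v) / 2) ^ 2 * (1 - ν ^ 2) = -(u * v) + (u + v) * Y ν - Y ν ^ 2 := by
        have : ((u - v) / 2) ^ 2 * (1 - ν ^ 2) = ((u - v) / 2) ^ 2 - ((u - v) / 2 * ν) ^ 2 := by ring
        rw [this, hYe]; ring
      rcases j with _ | j
      · simp only [Pi.pow_apply]
        field_simp
        push_cast
        linear_combination -2 * hYe
      · simp only [Pi.pow_apply, Nat.add_sub_cancel]
        field_simp
        rw [hsq]
        push_cast
        linear_combination (-2 * Y ν ^ (j + 1)) * hYe + 2 * (j + 1) * Y ν ^ j * hY2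
  rw [intervalIntegral.integral_sub, intervalIntegral.integral_sub,
    intervalIntegral.integral_const_mul, intervalIntegral.integral_const_mul,
    intervalIntegral.integral_const_mul] at key
  · linarith
  · exact (hint j).const_mul _
  · exact (hint (j - 1)).const_mul _
  · exact ((hint j).const_mul _).sub ((hint (j - 1)).const_mul _)
  · exact (hint (j + 1)).const_mul _

lemma integral_pow_arcsine (j : ℕ) (u v : ℝ) :
    ∫ ν in (-1 : ℝ)..1, ((1 + ν) / 2 * u + (1 - ν) / 2 * v) ^ j / √(1 - ν ^ 2)
      = Real.pi * coeff j (bin u * bin v) := by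
  have h0 : ∫ ν in (-1 : ℝ)..1, ((1 + ν) / 2 * u + (1 - ν) / 2 * v) ^ 0 / √(1 - ν ^ 2)
      = Real.pi * coeff 0 (bin u * bin v) := by
    simp only [pow_zero, integral_inv_sqrt_one_sub_sq]
    simp [constantCoeff_bin]
  have hstep : ∀ j : ℕ, (∀ i ≤ j, ∫ ν in (-1 : ℝ)..1,
        ((1 + ν) / 2 * u + (1 - ν) / 2 * v) ^ i / √(1 - ν ^ 2) = Real.pi * coeff i (bin u * bin v)) →
      ∫ ν in (-1 : ℝ)..1, ((1 + ν) / 2 * u + (1 - ν) / 2 * v) ^ (j + 1) / √(1 - ν ^ 2)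
        = Real.pi * coeff (j + 1) (bin u * bin v) := by
    intro j ih
    have h1 := integral_pow_div_sqrt_succ j u v
    have h2 := coeff_bin_mul_bin_succ j u v
    rw [ih j le_rfl, ih (j - 1) (by omega)] at h1
    have hj : (0 : ℝ) < (j : ℝ) + 1 := by positivity
    apply mul_left_cancel₀ hj.ne'
    rw [h1]
    linear_combination -Real.pi * h2
  induction j using Nat.strong_induction_on with
  | _ j ih =>
    rcases j with _ | j
    · exact h0
    · exact hstep j fun i hi => ih i (by omega)

/-! ### The function `q` -/

lemma C_eq (m : ℕ) : KdVHierarchy.C m = 4 ^ m * (2 * m + 1) * eps m := by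
  have h := integral_pow_div_sqrt m 0 1
  have h1 : coeff m (bin 0 * geom 1) = 1 := by simp [bin_zero, coeff_geom]
  simp only [sub_zero, one_mul, zero_add] at h
  rw [h1] at h
  have he := eps_pos m
  have hI : ∫ s in (0 : ℝ)..1, s ^ m / √(1 - s) = 2 / ((2 * m + 1) * eps m) := by
    field_simp; linarith
  unfold KdVHierarchy.C
  rw [hI, pow_succ, pow_mul]
  field_simp
  norm_num

lemma q_inner (m : ℕ) (u₁ u₂ u₃ : ℝ) {ν : ℝ} (hν : ν ∈ Set.Icc (-1 : ℝ) 1) :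
    ∫ μ in (-1 : ℝ)..1,
      ((1 + μ) / 2 * ((1 + ν) / 2) * u₁ + (1 + μ) / 2 * ((1 - ν) / 2) * u₂ + (1 - μ) / 2 * u₃) ^ m
        / √((1 - μ) * (1 - ν ^ 2))
      = 2 * √2 / ((2 * m + 1) * eps m) *
        (coeff m (bin u₃ * geom ((1 + ν) / 2 * u₁ + (1 - ν) / 2 * u₂)) / √(1 - ν ^ 2)) := by
  set A := (1 + ν) / 2 * u₁ + (1 - ν) / 2 * u₂ with hA
  have h := integral_pow_div_sqrt m u₃ A
  have hν2 : 0 ≤ 1 - ν ^ 2 := by nlinarith [hν.1, hν.2]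
  have h2 : (0 : ℝ) < √2 := by positivity
  have he := eps_pos m
  have hcv := intervalIntegral.integral_comp_mul_add (a := -1) (b := 1)
    (fun s => (u₃ + (A - u₃) * s) ^ m / √(1 - s)) (c := 1 / 2) (by norm_num) (1 / 2)
  norm_num at hcv
  have hsq : ∀ μ ∈ Set.uIcc (-1 : ℝ) 1,
      ((1 + μ) / 2 * ((1 + ν) / 2) * u₁ + (1 + μ) / 2 * ((1 - ν) / 2) * u₂ + (1 - μ) / 2 * u₃) ^ m
        / √((1 - μ) * (1 - ν ^ 2)) = 1 / (√2 * √(1 - ν ^ 2)) *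
        ((u₃ + (A - u₃) * (1 / 2 * μ + 1 / 2)) ^ m / √(1 - (1 / 2 * μ + 1 / 2))) := by
    intro μ hμ
    rw [Real.sqrt_mul' _ hν2, show (1 - μ) = 2 * (1 - (1 / 2 * μ + 1 / 2)) by ring,
      Real.sqrt_mul (by norm_num : (0 : ℝ) ≤ 2)]
    rw [show (1 + μ) / 2 * ((1 + ν) / 2) * u₁ + (1 + μ) / 2 * ((1 - ν) / 2) * u₂
      + 2 * (1 - (1 / 2 * μ + 1 / 2)) / 2 * u₃ = u₃ + (A - u₃) * (1 / 2 * μ + 1 / 2) by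
        rw [hA]; ring]
    simp only [div_eq_mul_inv, mul_inv]
    ring
  rw [intervalIntegral.integral_congr hsq, intervalIntegral.integral_const_mul, hcv]
  have hI : ∫ s in (0 : ℝ)..1, (u₃ + (A - u₃) * s) ^ m / √(1 - s)
      = 2 * coeff m (bin u₃ * geom A) / ((2 * m + 1) * eps m) := by
    field_simp; linarith
  rw [hI]
  have h22 : √2 * √2 = 2 := by norm_num
  -- At ν = ±1 both sides are zero, since division by zero gives zero.
  by_cases hz : √(1 - ν ^ 2) = 0
  · simp [hz]
  · field_simp
    rw [Real.sq_sqrt (by norm_num)]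

/-- The μ-integral produces (1 - u₃z)^{-1/2}(1 - Az)^{-1} with A between u₁ and u₂; the arcsine
average over ν of (1 - Az)^{-1} is (1 - u₁z)^{-1/2}(1 - u₂z)^{-1/2}. -/
lemma q_eq (m : ℕ) (u₁ u₂ u₃ : ℝ) :
    KdVHierarchy.q m u₁ u₂ u₃ = 4 ^ m * coeff m (bin u₁ * bin u₂ * bin u₃) := by
  unfold KdVHierarchy.q
  rw [intervalIntegral.integral_congr (g := fun ν => 2 * √2 / ((2 * m + 1) * eps m) *
        (coeff m (bin u₃ * geom ((1 + ν) / 2 * u₁ + (1 - ν) / 2 * u₂)) / √(1 - ν ^ 2))) fun ν hν =>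
      q_inner m u₁ u₂ u₃ (by rwa [Set.uIcc_of_le (by norm_num)] at hν)]
  rw [intervalIntegral.integral_const_mul, C_eq]
  have hs : ∫ ν in (-1 : ℝ)..1,
      coeff m (bin u₃ * geom ((1 + ν) / 2 * u₁ + (1 - ν) / 2 * u₂)) / √(1 - ν ^ 2)
      = Real.pi * coeff m (bin u₁ * bin u₂ * bin u₃) := by
    simp only [coeff_mul_geom, Finset.sum_div]
    rw [intervalIntegral.integral_finsetSum]
    · have : ∀ k, ∫ ν in (-1 : ℝ)..1, coeff k (bin u₃) *
          ((1 + ν) / 2 * u₁ + (1 - ν) / 2 * u₂) ^ (m - k) / √(1 - ν ^ 2)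
          = Real.pi * (coeff k (bin u₃) * coeff (m - k) (bin u₁ * bin u₂)) := by
        intro k
        simp only [mul_div_assoc]
        rw [intervalIntegral.integral_const_mul, integral_pow_arcsine]
        ring
      simp only [this]
      rw [← Finset.mul_sum, mul_comm (bin u₁ * bin u₂), coeff_mul,
        Finset.Nat.sum_antidiagonal_eq_sum_range_succ_mk]
    · intro k _
      exact intervalIntegrable_mul_inv_sqrt_one_sub_sq
        (g := fun ν => coeff k (bin u₃) * ((1 + ν) / 2 * u₁ + (1 - ν) / 2 * u₂) ^ (m - k))
        (by fun_prop)
  rw [hs]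
  have he := eps_pos m
  have := Real.pi_pos
  have h2 : (0 : ℝ) < √2 := by positivity
  field_simp

lemma hasDerivAt_coeff_mul {F G : ℝ → PowerSeries ℝ} {F' G' : PowerSeries ℝ} {r : ℝ}
    (hF : ∀ n, HasDerivAt (fun r => coeff n (F r)) (coeff n F') r)
    (hG : ∀ n, HasDerivAt (fun r => coeff n (G r)) (coeff n G') r) (n : ℕ) :
    HasDerivAt (fun r => coeff n (F r * G r)) (coeff n (F' * G r + F r * G')) r := by
  rw [show (fun r => coeff n (F r * G r)) = fun r => ∑ x ∈ Finset.HasAntidiagonal.antidiagonal n,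
    coeff x.1 (F r) * coeff x.2 (G r) from funext fun r => coeff_mul _ _ _, map_add, coeff_mul,
    coeff_mul, ← Finset.sum_add_distrib]
  exact HasDerivAt.fun_sum fun x _ => (hF x.1).mul (hG x.2)

lemma divq_eq (m : ℕ) (u₁ u₂ u₃ : ℝ) :
    KdVHierarchy.divq m u₁ u₂ u₃ = 4 ^ m * (1 / 2 * coeff m (X * (geom u₁ + geom u₂ + geom u₃)
      * (bin u₁ * bin u₂ * bin u₃))) := by
  unfold KdVHierarchy.divq
  simp only [q_eq]
  have h1 := ((hasDerivAt_coeff_bin_mul m (bin u₂ * bin u₃) u₁).const_mul ((4 : ℝ) ^ m)).deriv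
  have h2 := ((hasDerivAt_coeff_bin_mul m (bin u₁ * bin u₃) u₂).const_mul ((4 : ℝ) ^ m)).deriv
  have h3 := ((hasDerivAt_coeff_bin_mul m (bin u₁ * bin u₂) u₃).const_mul ((4 : ℝ) ^ m)).deriv
  rw [show (fun v => 4 ^ m * coeff m (bin v * bin u₂ * bin u₃))
      = fun v => 4 ^ m * coeff m (bin v * (bin u₂ * bin u₃)) by simp only [mul_assoc],
    show (fun v => 4 ^ m * coeff m (bin u₁ * bin v * bin u₃))
      = fun v => 4 ^ m * coeff m (bin v * (bin u₁ * bin u₃)) by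
        funext v; rw [show bin u₁ * bin v * bin u₃ = bin v * (bin u₁ * bin u₃) by ring],
    show (fun v => 4 ^ m * coeff m (bin u₁ * bin u₂ * bin v))
      = fun v => 4 ^ m * coeff m (bin v * (bin u₁ * bin u₂)) by
        funext v; rw [show bin u₁ * bin u₂ * bin v = bin v * (bin u₁ * bin u₂) by ring],
    h1, h2, h3]
  rw [← mul_add, ← mul_add, ← mul_add, ← mul_add, ← map_add, ← map_add]
  congr 4
  ring

lemma derivative_geom (a : ℝ) : derivative ℝ (geom a) = C a * (geom a * geom a) := by
  have h := one_sub_mul_geom a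
  have hd := congrArg (derivative ℝ) h
  simp only [Derivation.leibniz, smul_eq_mul, map_sub, derivative_C, derivative_X,
    derivative_one] at hd
  linear_combination (geom a) * hd - derivative ℝ (geom a) * h

lemma derivative_sqrtSeries : 2 * derivative ℝ sqrtSeries = -bin 1 := by
  unfold sqrtSeries
  have h := derivative_bin 1
  simp only [Derivation.leibniz, smul_eq_mul, map_sub, derivative_C, derivative_X,
    derivative_one]
  rw [map_one] at h ⊢
  linear_combination h

/-- On the diagonal, `p₁` is a multiple of the derivative of `[z^m] √(1 - z) / (1 - u z)`. -/
lemma p₁_diag (m : ℕ) (u : ℝ) :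
    KdVHierarchy.p₁ (m + 1) 1 u u
      = -(4 ^ (m + 1) * (m + 1 + 1 / 2)) * coeff m (sqrtSeries * (geom u * geom u)) := by
  unfold KdVHierarchy.p₁
  simp only [divq_eq]
  set V : PowerSeries ℝ := C (1 / 2) * (X * (geom u * bin u)) * (X * (geom 1 + geom u) * (bin 1 * bin u))
    + (X * (geom u * geom u) * (bin u * (X * (bin 1 * bin u)))
      + geom u * (C (1 / 2) * (X * (geom u * bin u)) * (X * (bin 1 * bin u)))) with hV
  have hbin : ∀ (g : PowerSeries ℝ) (n : ℕ), HasDerivAt (fun r => coeff n (bin r * g))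
      (coeff n (C (1 / 2) * (X * (geom u * bin u)) * g)) u := fun g n =>
    (hasDerivAt_coeff_bin_mul n g u).congr_deriv (by rw [mul_assoc (C _), coeff_C_mul])
  have hgeom : ∀ n : ℕ, HasDerivAt (fun r => coeff n (geom r))
      (coeff n (X * (geom u * geom u))) u := fun n => by
    simpa using hasDerivAt_coeff_geom_mul n 1 u
  have hd : ∀ n, HasDerivAt (fun v => coeff n (X * (geom 1 + geom v + geom u)
      * (bin 1 * bin v * bin u))) (coeff n V) u := by
    intro n
    have h := (hbin (X * (geom 1 + geom u) * (bin 1 * bin u)) n).add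
      (hasDerivAt_coeff_mul hgeom (hbin (X * (bin 1 * bin u))) n)
    rw [← map_add] at h
    refine h.congr_of_eventuallyEq (Eventually.of_forall fun v => ?_)
    simp only [Pi.add_apply]
    rw [← map_add]
    congr 1
    ring
  have hd2 := (((hd (m + 1)).const_mul (1 / 2)).const_mul ((4 : ℝ) ^ (m + 1))).deriv
  rw [hd2]
  set R := sqrtSeries * (geom u * geom u) with hR
  -- The differential combination in p₁ is, for whole generating series, -z(3 + 2z d/dz) applied to
  -- R = √(1 - z)(1 - uz)^{-2}. The operator 3 + 2z d/dz only multiplies the coefficient of z^m by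
  -- 2m + 3.
  have hformal : C (2 * (1 - u)) * V - X * (geom 1 + geom u + geom u) * (bin 1 * bin u * bin u)
      = -(X * (3 * R + 2 * (X * derivative ℝ R))) := by
    have hdR : 2 * derivative ℝ R = -bin 1 * (geom u * geom u)
        + 4 * (sqrtSeries * C u * (geom u * geom u * geom u)) := by
      rw [hR]
      simp only [Derivation.leibniz, smul_eq_mul, derivative_geom]
      linear_combination (geom u * geom u) * derivative_sqrtSeries
    have h1 := one_sub_mul_geom 1
    have h2 := one_sub_mul_geom u
    have h3 := bin_mul_bin u
    have h4 : sqrtSeries = (1 - X) * bin 1 := by unfold sqrtSeries; simp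
    have hX := X_mul_geom_mul_geom u 1
    rw [show -(X * (3 * R + 2 * (X * derivative ℝ R))) = -(X * (3 * R + X * (2 * derivative ℝ R))) by
      ring, hdR, hV, hR, h4]
    simp only [map_sub, map_mul, map_one] at hX h1 ⊢
    rw [show C (2 : ℝ) = 2 from map_ofNat (C (R := ℝ)) 2]
    have h5 : 2 * C (1 / 2 : ℝ) = 1 := by
      rw [show (2 : PowerSeries ℝ) = C 2 from (map_ofNat (C (R := ℝ)) 2).symm, ← map_mul]
      norm_num
    have e1 : 2 * (1 - C u) * (C (1 / 2) * (X * (geom u * bin u)) * (X * (geom 1 + geom u) * (bin 1 * bin u))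
      + (X * (geom u * geom u) * (bin u * (X * (bin 1 * bin u)))
      + geom u * (C (1 / 2) * (X * (geom u * bin u)) * (X * (bin 1 * bin u)))))
      = (1 - C u) * X * X * bin 1 * geom u * (bin u * bin u)
        * ((2 * C (1 / 2)) * (geom 1 + 2 * geom u) + 2 * geom u) := by ring
    rw [e1, h5, h3, show bin 1 * bin u * bin u = bin 1 * (bin u * bin u) by ring, h3]
    linear_combination (X * bin 1 * geom u) * hX + 4 * X * X * bin 1 * geom u * geom u * h2
  have hc := congrArg (coeff (m + 1)) hformal
  have hlast : coeff m (3 * R + 2 * (X * derivative ℝ R)) = (2 * m + 3) * coeff m R := by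
    rw [map_add, show (2 : PowerSeries ℝ) = C 2 from (map_ofNat (C (R := ℝ)) 2).symm,
      show (3 : PowerSeries ℝ) = C 3 from (map_ofNat (C (R := ℝ)) 3).symm, coeff_C_mul, coeff_C_mul]
    rcases m with _ | m
    · simp
    · rw [coeff_succ_X_mul, coeff_derivative]; push_cast; ring
  rw [map_sub, coeff_C_mul, map_neg, coeff_succ_X_mul, hlast] at hc
  linear_combination (4 ^ (m + 1) / 2) * hc

end

end StepData

/-! ### Functions of the branch points that change sign once. -/

namespace StepData

open MeasureTheory Filter Asymptotics Topology

noncomputable section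

open PowerSeries

/-! ### Functions with a single change of sign -/

/-- `F r / r ^ j` is strictly increasing on `(0, ∞)`. -/
def RatioMono (j : ℕ) (F : ℝ → ℝ) : Prop :=
  ∀ r s : ℝ, 0 < r → r < s → F r * s ^ j < F s * r ^ j

lemma RatioMono.pos_of_nonneg {j : ℕ} {F : ℝ → ℝ} (h : RatioMono j F) {r s : ℝ} (hr : 0 < r)
    (hrs : r < s) (hF : 0 ≤ F r) : 0 < F s := by
  have h1 := h r s hr hrs
  have h2 : 0 ≤ F r * s ^ j := mul_nonneg hF (pow_nonneg (hr.trans hrs).le _)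
  exact pos_of_mul_pos_left (h2.trans_lt h1) (pow_nonneg hr.le _)

lemma RatioMono.neg_of_nonpos {j : ℕ} {F : ℝ → ℝ} (h : RatioMono j F) {r s : ℝ} (hr : 0 < r)
    (hrs : r < s) (hF : F s ≤ 0) : F r < 0 := by
  by_contra hc
  exact absurd (h.pos_of_nonneg hr hrs (not_lt.1 hc)) (not_lt.2 hF)

/-- Divided by r^j, the coefficient is a sum of terms G_i w_{j-i} r^{-i}, each increasing for i ≥ 1
since G_i < 0. The term i = j makes the increase strict, which needs j ≥ 1. -/
lemma ratioMono_coeff {j : ℕ} (hj : 1 ≤ j) {G : PowerSeries ℝ} (hG : ∀ k, coeff (k + 1) G < 0)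
    {w : ℕ → ℝ} (hw : ∀ k, 0 < w k) {W : ℝ → PowerSeries ℝ}
    (hW : ∀ r k, coeff k (W r) = w k * r ^ k) : RatioMono j fun r => coeff j (G * W r) := by
  intro r s hr hrs
  simp only [coeff_mul, Finset.sum_mul]
  have hs : 0 < s := hr.trans hrs
  refine Finset.sum_lt_sum (fun x hx => ?_) ⟨(j, 0), by simp, ?_⟩
  · obtain ⟨i, l⟩ := x
    rw [Finset.HasAntidiagonal.mem_antidiagonal] at hx
    simp only at hx ⊢
    subst hx
    rw [hW, hW]
    rcases i with _ | i
    · rw [zero_add]; apply le_of_eq; ring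
    · have h3 : r ^ (i + 1) ≤ s ^ (i + 1) := pow_le_pow_left₀ hr.le hrs.le _
      have h5 : 0 ≤ (-coeff (i + 1) G) * w l * ((r ^ l * s ^ l) * (s ^ (i + 1) - r ^ (i + 1))) :=
        mul_nonneg (mul_nonneg (by linarith [hG i]) (hw l).le)
          (mul_nonneg (by positivity) (by linarith))
      rw [pow_add r, pow_add s]
      linarith
  · simp only [hW, pow_zero, mul_one]
    obtain ⟨i, rfl⟩ : ∃ i, j = i + 1 := ⟨j - 1, by omega⟩
    have h3 : r ^ (i + 1) < s ^ (i + 1) := pow_lt_pow_left₀ hrs hr.le (by omega)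
    nlinarith [mul_pos (neg_pos.2 (hG i)) (hw 0)]

lemma coeff_geom_mul_geom (k : ℕ) (u : ℝ) : coeff k (geom u * geom u) = (k + 1 : ℝ) * u ^ k := by
  rw [coeff_mul_geom]
  have : ∀ i ∈ Finset.range (k + 1), coeff i (geom u) * u ^ (k - i) = u ^ k := by
    intro i hi
    rw [coeff_geom, ← pow_add]
    congr 1
    have := Finset.mem_range.1 hi
    omega
  rw [Finset.sum_congr rfl this]
  simp

lemma continuous_coeff_mul {Y : Type*} [TopologicalSpace Y] {F G : Y → PowerSeries ℝ}
    (hF : ∀ n, Continuous fun y => coeff n (F y)) (hG : ∀ n, Continuous fun y => coeff n (G y))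
    (n : ℕ) : Continuous fun y => coeff n (F y * G y) := by
  simp only [coeff_mul]
  exact continuous_finsetSum _ fun x _ => (hF x.1).mul (hG x.2)

lemma continuous_coeff_bin (n : ℕ) : Continuous fun a => coeff n (bin a) := by
  simp only [coeff_bin]; fun_prop

lemma continuous_coeff_geom (n : ℕ) : Continuous fun a => coeff n (geom a) := by
  simp only [coeff_geom]; fun_prop

lemma continuous_coeff_ratioSeries (n : ℕ) : Continuous fun a => coeff n (ratioSeries a) := by
  unfold ratioSeries
  exact continuous_coeff_mul (fun _ => continuous_const) continuous_coeff_bin n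

/-- The polynomial part, `[z^j] √(1 - z) (1 - a z)^{-1/2} (1 - b z)^{-1/2} (1 - ξ z)^{-1}`. -/
def hFun (j : ℕ) (a b ξ : ℝ) : ℝ := coeff j (ratioSeries a * (bin b * geom ξ))

/-- The kernel function `[z^j] √(1 - z) (1 - a z)^{-1/2} (1 - r z)^{-3/2}`. -/
def hKer (j : ℕ) (a r : ℝ) : ℝ := coeff j (ratioSeries a * (geom r * bin r))

/-- The coefficient `[z^j] √(1 - z) (1 - a z)^{-1/2} (1 - b z)^{-1/2}`. -/
def betaCoeff (j : ℕ) (a b : ℝ) : ℝ := coeff j (ratioSeries a * bin b)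

lemma continuous_hFun (j : ℕ) : Continuous fun p : ℝ × ℝ × ℝ => hFun j p.1 p.2.1 p.2.2 := by
  have h1 : ∀ n, Continuous fun p : ℝ × ℝ × ℝ => coeff n (ratioSeries p.1) := fun n =>
    (continuous_coeff_ratioSeries n).comp continuous_fst
  have h2 : ∀ n, Continuous fun p : ℝ × ℝ × ℝ => coeff n (bin p.2.1) := fun n =>
    (continuous_coeff_bin n).comp (continuous_fst.comp continuous_snd)
  have h3 : ∀ n, Continuous fun p : ℝ × ℝ × ℝ => coeff n (geom p.2.2) := fun n =>
    (continuous_coeff_geom n).comp (continuous_snd.comp continuous_snd)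
  have h4 : ∀ n, Continuous fun p : ℝ × ℝ × ℝ => coeff n (bin p.2.1 * geom p.2.2) :=
    continuous_coeff_mul h2 h3
  exact continuous_coeff_mul h1 h4 j

lemma continuous_hFun_right (j : ℕ) (a b : ℝ) : Continuous (hFun j a b) := by
  have h : Continuous fun ξ : ℝ => (a, b, ξ) := by fun_prop
  change Continuous ((fun p : ℝ × ℝ × ℝ => hFun j p.1 p.2.1 p.2.2) ∘ fun ξ : ℝ => (a, b, ξ))
  exact (continuous_hFun j).comp h

lemma continuous_hKer (j : ℕ) (a : ℝ) : Continuous (hKer j a) := by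
  unfold hKer
  exact continuous_coeff_mul (fun _ => continuous_const)
    (fun n => continuous_coeff_mul continuous_coeff_geom continuous_coeff_bin n) j

lemma continuous_betaCoeff (j : ℕ) : Continuous fun p : ℝ × ℝ => betaCoeff j p.1 p.2 := by
  have h1 : ∀ n, Continuous fun p : ℝ × ℝ => coeff n (ratioSeries p.1) := fun n =>
    (continuous_coeff_ratioSeries n).comp continuous_fst
  have h2 : ∀ n, Continuous fun p : ℝ × ℝ => coeff n (bin p.2) := fun n =>
    (continuous_coeff_bin n).comp continuous_snd
  exact continuous_coeff_mul h1 h2 j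

lemma ratioMono_hKer {j : ℕ} (hj : 1 ≤ j) {a : ℝ} (ha : 0 ≤ a) (ha1 : a < 1) :
    RatioMono j (hKer j a) :=
  ratioMono_coeff hj (fun k => coeff_ratioSeries_neg k ha ha1) (w := fun k => (2 * k + 1) * eps k)
    (fun k => mul_pos (by positivity) (eps_pos k)) fun r k => coeff_geom_mul_bin k r

lemma hKer_zero_neg {j : ℕ} (hj : 1 ≤ j) {a : ℝ} (ha : 0 ≤ a) (ha1 : a < 1) : hKer j a 0 < 0 := by
  obtain ⟨i, rfl⟩ : ∃ i, j = i + 1 := ⟨j - 1, by omega⟩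
  have h : geom 0 = 1 := by
    ext k; rcases k with _ | k <;> simp [coeff_geom, coeff_one]
  unfold hKer
  rw [h, bin_zero, mul_one, mul_one]
  exact coeff_ratioSeries_neg i ha ha1

lemma hKer_neg_of_lt {j : ℕ} (hj : 1 ≤ j) {a : ℝ} (ha : 0 ≤ a) (ha1 : a < 1) {r s : ℝ} (hr : 0 ≤ r)
    (hrs : r < s) (hs : hKer j a s ≤ 0) : hKer j a r < 0 := by
  rcases hr.eq_or_lt with rfl | hr
  · exact hKer_zero_neg hj ha ha1
  · exact (ratioMono_hKer hj ha ha1).neg_of_nonpos hr hrs hs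

lemma hKer_pos_of_lt {j : ℕ} (hj : 1 ≤ j) {a : ℝ} (ha : 0 ≤ a) (ha1 : a < 1) {r s : ℝ} (hr : 0 ≤ r)
    (hrs : r < s) (h : 0 ≤ hKer j a r) : 0 < hKer j a s := by
  by_contra hc
  exact absurd (hKer_neg_of_lt hj ha ha1 hr hrs (not_lt.1 hc)) (not_lt.2 h)

/-- `integral_pow_div_sqrt` applied to each coefficient. As the weight is positive, signs of `hKer`
between b and v pass to `hFun`. -/
lemma hFun_eq_average (j : ℕ) (a b v : ℝ) :
    hFun j a b v = 1 / 2 * ∫ s in (0 : ℝ)..1, hKer j a (b + (v - b) * s) / √(1 - s) := by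
  unfold hFun hKer
  simp only [coeff_mul _ (ratioSeries a), Finset.sum_div]
  rw [intervalIntegral.integral_finsetSum]
  · rw [Finset.mul_sum]
    refine Finset.sum_congr rfl fun x _ => ?_
    have h := integral_pow_div_sqrt x.2 b v
    simp only [coeff_geom_mul_bin, mul_div_assoc]
    rw [intervalIntegral.integral_const_mul, intervalIntegral.integral_const_mul, h]
    ring
  · intro x _
    simp only [coeff_geom_mul_bin]
    exact intervalIntegrable_mul_inv_sqrt_one_sub (by fun_prop)

lemma intervalIntegrable_hKer (j : ℕ) (a b v : ℝ) :
    IntervalIntegrable (fun s => hKer j a (b + (v - b) * s) / √(1 - s)) volume 0 1 :=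
  intervalIntegrable_mul_inv_sqrt_one_sub
    ((continuous_hKer j a).comp (by fun_prop)).continuousOn

lemma intervalIntegral_lt_of_lt {f g : ℝ → ℝ} {a b : ℝ} (hab : a < b)
    (hf : IntervalIntegrable f volume a b) (hg : IntervalIntegrable g volume a b)
    (h : ∀ x ∈ Set.Ioo a b, f x < g x) : ∫ x in a..b, f x < ∫ x in a..b, g x := by
  have := intervalIntegral.intervalIntegral_pos_of_pos_on (hg.sub hf)
    (fun x hx => sub_pos.2 (h x hx)) hab
  rw [intervalIntegral.integral_sub hg hf] at this
  linarith

lemma hFun_neg {j : ℕ} {a b v : ℝ}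
    (h : ∀ s ∈ Set.Ioo (0 : ℝ) 1, hKer j a (b + (v - b) * s) < 0) : hFun j a b v < 0 := by
  rw [hFun_eq_average]
  have := intervalIntegral_lt_of_lt zero_lt_one (intervalIntegrable_hKer j a b v)
    (intervalIntegrable_const (c := (0 : ℝ))) fun s hs =>
      div_neg_of_neg_of_pos (h s hs) (Real.sqrt_pos.2 (by linarith [hs.2]))
  rw [intervalIntegral.integral_zero] at this
  linarith

lemma hFun_pos {j : ℕ} {a b v : ℝ}
    (h : ∀ s ∈ Set.Ioo (0 : ℝ) 1, 0 < hKer j a (b + (v - b) * s)) : 0 < hFun j a b v := by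
  rw [hFun_eq_average]
  have := intervalIntegral.intervalIntegral_pos_of_pos_on (intervalIntegrable_hKer j a b v)
    (fun s hs => div_pos (h s hs) (Real.sqrt_pos.2 (by linarith [hs.2]))) zero_lt_one
  linarith

/-- `hFun` changes sign at most once on `(b, ∞)`, from negative to positive. -/
lemma hFun_pos_of_nonneg {j : ℕ} (hj : 1 ≤ j) {a b v₁ v₂ : ℝ} (ha : 0 ≤ a) (ha1 : a < 1)
    (hb : 0 ≤ b) (h1 : b < v₁) (h2 : v₁ < v₂) (hH : 0 ≤ hFun j a b v₁) : 0 < hFun j a b v₂ := by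
  have hmono := ratioMono_hKer hj ha ha1
  have hr1 : ∀ s ∈ Set.Ioo (0 : ℝ) 1, 0 < b + (v₁ - b) * s := fun s hs => by
    nlinarith [mul_pos (sub_pos.2 h1) hs.1]
  have hr2 : ∀ s ∈ Set.Ioo (0 : ℝ) 1, b + (v₁ - b) * s < b + (v₂ - b) * s := fun s hs => by
    nlinarith [mul_pos (sub_pos.2 h2) hs.1]
  by_cases hb0 : 0 ≤ hKer j a b
  · refine hFun_pos fun s hs => hKer_pos_of_lt hj ha ha1 hb ?_ hb0
    nlinarith [mul_pos (sub_pos.2 (h1.trans h2)) hs.1]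
  -- Otherwise `hKer` is negative on the open segment from b to v₁ and its average is negative. So
  -- `hKer` has a zero r0 in between.
  have hv0 : 0 < hKer j a v₁ := by
    by_contra hc
    refine absurd (hFun_neg (j := j) (a := a) (b := b) (v := v₁) fun s hs => ?_) (not_lt.2 hH)
    refine hKer_neg_of_lt hj ha ha1 (hr1 s hs).le ?_ (not_lt.1 hc)
    nlinarith [mul_pos (sub_pos.2 h1) (sub_pos.2 hs.2)]
  obtain ⟨r0, hr0, hz⟩ := intermediate_value_Ioo h1.le (continuous_hKer j a).continuousOn
    (Set.mem_Ioo.2 ⟨not_le.1 hb0, hv0⟩)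
  set s0 := (r0 - b) / (v₁ - b) with hs0
  have hd : 0 < v₁ - b := sub_pos.2 h1
  have hs0r : b + (v₁ - b) * s0 = r0 := by rw [hs0]; field_simp; ring
  have hs0m : s0 ∈ Set.Ioo (0 : ℝ) 1 :=
    ⟨div_pos (by linarith [hr0.1]) hd, (div_lt_one hd).2 (by linarith [hr0.2])⟩
  -- `RatioMono` compares the two integrands at the same s with the factor ρ(s)^j. As b ≥ 0, ρ is
  -- nondecreasing, so replacing ρ(s) by its value at the sign change s0 lowers the bound on both
  -- sides of s0. The constant ρ(s0)^j can then leave the integral.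
  set ρ : ℝ → ℝ := fun s => (b + (v₂ - b) * s) / (b + (v₁ - b) * s) with hρ
  have hρmono : ∀ s ∈ Set.Ioo (0 : ℝ) 1, ∀ t ∈ Set.Ioo (0 : ℝ) 1, s ≤ t → ρ s ≤ ρ t := by
    intro s hs t ht hst
    simp only [hρ]
    rw [div_le_div_iff₀ (hr1 s hs) (hr1 t ht)]
    nlinarith [mul_nonneg (mul_nonneg hb (sub_nonneg.2 hst)) (sub_nonneg.2 h2.le)]
  have hρpos : ∀ s ∈ Set.Ioo (0 : ℝ) 1, 0 < ρ s := fun s hs =>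
    div_pos ((hr1 s hs).trans (hr2 s hs)) (hr1 s hs)
  have hlt : ∀ s ∈ Set.Ioo (0 : ℝ) 1,
      ρ s0 ^ j * hKer j a (b + (v₁ - b) * s) < hKer j a (b + (v₂ - b) * s) := by
    intro s hs
    have hm := hmono _ _ (hr1 s hs) (hr2 s hs)
    have hp : 0 < (b + (v₁ - b) * s) ^ j := pow_pos (hr1 s hs) _
    have hm2 : ρ s ^ j * hKer j a (b + (v₁ - b) * s) < hKer j a (b + (v₂ - b) * s) := by
      simp only [hρ, div_pow]
      rw [div_mul_eq_mul_div, div_lt_iff₀ hp]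
      linarith
    refine lt_of_le_of_lt ?_ hm2
    rcases le_total s s0 with hle | hle
    · have hneg : hKer j a (b + (v₁ - b) * s) ≤ 0 := by
        rcases hle.eq_or_lt with rfl | hlt
        · rw [hs0r, hz]
        · refine (hKer_neg_of_lt hj ha ha1 (hr1 s hs).le (s := r0) ?_ hz.le).le
          rw [← hs0r]; nlinarith
      exact mul_le_mul_of_nonpos_right
        (pow_le_pow_left₀ (hρpos s hs).le (hρmono s hs s0 hs0m hle) _) hneg
    · have hpos : 0 ≤ hKer j a (b + (v₁ - b) * s) := by
        rcases hle.eq_or_lt with h | hlt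
        · rw [← h, hs0r, hz]
        · refine (hKer_pos_of_lt hj ha ha1 (r := r0) (hb.trans hr0.1.le) ?_ hz.ge).le
          rw [← hs0r]; nlinarith
      exact mul_le_mul_of_nonneg_right
        (pow_le_pow_left₀ (hρpos s0 hs0m).le (hρmono s0 hs0m s hs hle) _) hpos
  rw [hFun_eq_average] at hH ⊢
  have := intervalIntegral_lt_of_lt zero_lt_one
    ((intervalIntegrable_hKer j a b v₁).const_mul (ρ s0 ^ j)) (intervalIntegrable_hKer j a b v₂)
    fun s hs => by
      rw [← mul_div_assoc]
      exact div_lt_div_of_pos_right (hlt s hs) (Real.sqrt_pos.2 (by linarith [hs.2]))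
  rw [intervalIntegral.integral_const_mul] at this
  have h0 : 0 ≤ ρ s0 ^ j * ∫ s in (0 : ℝ)..1, hKer j a (b + (v₁ - b) * s) / √(1 - s) :=
    mul_nonneg (pow_nonneg (hρpos s0 hs0m).le _) (by linarith)
  linarith

lemma hFun_diag (j : ℕ) (u : ℝ) : hFun j u u u = coeff j (sqrtSeries * (geom u * geom u)) := by
  unfold hFun ratioSeries
  rw [← bin_mul_bin]
  congr 1; ring

lemma hKer_diag (j : ℕ) (u : ℝ) : hKer j u u = coeff j (sqrtSeries * (geom u * geom u)) := by
  unfold hKer ratioSeries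
  rw [← bin_mul_bin]
  congr 1; ring

/-- The trailing function `[z^j] √(1 - z) (1 - u z)^{-2}`. -/
def trailFun (j : ℕ) (u : ℝ) : ℝ := coeff j (sqrtSeries * (geom u * geom u))

lemma ratioMono_trailFun {j : ℕ} (hj : 1 ≤ j) : RatioMono j (trailFun j) :=
  ratioMono_coeff hj coeff_sqrtSeries_neg (w := fun k => (k : ℝ) + 1)
    (fun k => by positivity) fun r k => coeff_geom_mul_geom k r

lemma continuous_trailFun (j : ℕ) : Continuous (trailFun j) := by
  unfold trailFun
  exact continuous_coeff_mul (fun _ => continuous_const)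
    (fun n => continuous_coeff_mul continuous_coeff_geom continuous_coeff_geom n) j

/-- At u = 0 the value is a negative coefficient of √(1 - z); at u = 1 it is a coefficient of (1 -
z)^{-3/2}, which is positive. -/
lemma exists_trailFun_eq_zero {j : ℕ} (hj : 1 ≤ j) :
    ∃ u ∈ Set.Ioo (0 : ℝ) 1, trailFun j u = 0 := by
  have h0 : trailFun j 0 < 0 := by
    obtain ⟨i, rfl⟩ : ∃ i, j = i + 1 := ⟨j - 1, by omega⟩
    have h : geom 0 = 1 := by
      ext k; rcases k with _ | k <;> simp [coeff_geom, coeff_one]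
    unfold trailFun
    rw [h, mul_one, mul_one]
    exact coeff_sqrtSeries_neg i
  have h1 : 0 < trailFun j 1 := by
    have : sqrtSeries * (geom 1 * geom 1) = bin 1 * geom 1 := by
      rw [← bin_mul_bin]
      linear_combination (bin 1 * bin 1 * bin 1) * sqrtSeries_mul_bin_one
    unfold trailFun
    rw [this, coeff_mul_geom]
    refine Finset.sum_pos (fun i _ => ?_) ⟨0, by simp⟩
    rw [coeff_bin]
    have := eps_pos i
    simp [this]
  obtain ⟨u, hu, hz⟩ := intermediate_value_Ioo zero_le_one (continuous_trailFun j).continuousOn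
    (Set.mem_Ioo.2 ⟨h0, h1⟩)
  exact ⟨u, hu, hz⟩

lemma trailFun_eq_zero_unique {j : ℕ} (hj : 1 ≤ j) {u v : ℝ} (hu : 0 < u) (hv : 0 < v)
    (h1 : trailFun j u = 0) (h2 : trailFun j v = 0) : u = v := by
  rcases lt_trichotomy u v with h | h | h
  · exact absurd h2 ((ratioMono_trailFun hj).pos_of_nonneg hu h h1.ge).ne'
  · exact h
  · exact absurd h1 ((ratioMono_trailFun hj).pos_of_nonneg hv h h2.ge).ne'

lemma hKer_diag_eq_trailFun (j : ℕ) (u : ℝ) : hKer j u u = trailFun j u := hKer_diag j u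

lemma isTrailingPoint_iff (j : ℕ) (u : ℝ) :
    KdVHierarchy.IsTrailingPoint (j + 1) u ↔ 0 < u ∧ u < 1 ∧ trailFun j u = 0 := by
  unfold KdVHierarchy.IsTrailingPoint trailFun
  rw [p₁_diag]
  have : -((4 : ℝ) ^ (j + 1) * (j + 1 + 1 / 2)) ≠ 0 := by
    have : (0 : ℝ) < 4 ^ (j + 1) * (j + 1 + 1 / 2) := by positivity
    exact neg_ne_zero.2 this.ne'
  rw [mul_eq_zero, or_iff_right this]

attribute [irreducible] hFun hKer betaCoeff trailFun

end

end StepData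

/-! ### The loop integral, its zero curve and the transition point. -/

namespace StepData

open MeasureTheory Filter Asymptotics Topology

noncomputable section

open PowerSeries

/-! ### The loop integral -/

/-- The loop integral over the gap `(b, a)`. -/
def loopInt (j : ℕ) (a b : ℝ) : ℝ :=
  ∫ v in b..a, hFun j a b v * (√((a - v) * (v - b)) / √(1 - v))

/-- The loop integral rescaled to `(0, 1)`. -/
def loopHat (j : ℕ) (a b : ℝ) : ℝ :=
  ∫ s in (0 : ℝ)..1, hFun j a b (b + (a - b) * s) * (√(s * (1 - s)) / √(1 - (b + (a - b) * s)))

/-- Splitting off (a - b)² gives the condition a meaning at a = b, where it becomes `trailFun` = 0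
by `loopHat_diag`. -/
lemma loopInt_eq (j : ℕ) {a b : ℝ} (hab : b ≤ a) : loopInt j a b = (a - b) ^ 2 * loopHat j a b := by
  unfold loopInt loopHat
  rcases hab.eq_or_lt with rfl | hab
  · simp
  have hd : 0 < a - b := sub_pos.2 hab
  have h := intervalIntegral.integral_comp_add_mul (a := 0) (b := 1)
    (fun v => hFun j a b v * (√((a - v) * (v - b)) / √(1 - v))) hd.ne' b
  simp only [mul_zero, add_zero, mul_one, add_sub_cancel, smul_eq_mul] at h
  have h2 : ∀ s ∈ Set.uIcc (0 : ℝ) 1, hFun j a b (b + (a - b) * s)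
      * (√((a - (b + (a - b) * s)) * (b + (a - b) * s - b)) / √(1 - (b + (a - b) * s)))
      = (a - b) * (hFun j a b (b + (a - b) * s)
        * (√(s * (1 - s)) / √(1 - (b + (a - b) * s)))) := by
    intro s _
    rw [show (a - (b + (a - b) * s)) * (b + (a - b) * s - b) = (a - b) ^ 2 * (s * (1 - s)) by ring,
      Real.sqrt_mul (by positivity), Real.sqrt_sq hd.le]
    ring
  rw [intervalIntegral.integral_congr h2, intervalIntegral.integral_const_mul] at h
  have h3 : ∫ v in b..a, hFun j a b v * (√((a - v) * (v - b)) / √(1 - v))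
      = (a - b) * ((a - b)⁻¹ * ∫ v in b..a, hFun j a b v * (√((a - v) * (v - b)) / √(1 - v))) := by
    field_simp
  rw [h3, ← h]
  ring

lemma loopInt_eq_zero_iff (j : ℕ) {a b : ℝ} (hab : b < a) : loopInt j a b = 0 ↔ loopHat j a b = 0 := by
  rw [loopInt_eq j hab.le, mul_eq_zero, or_iff_right (pow_ne_zero 2 (sub_pos.2 hab).ne')]

lemma continuousOn_loopWeight {a b c d : ℝ} (hd : d < 1) :
    ContinuousOn (fun v : ℝ => √((a - v) * (v - b)) / √(1 - v)) (Set.Icc c d) := by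
  refine ContinuousOn.div (by fun_prop) (by fun_prop) fun v hv => ?_
  exact (Real.sqrt_pos.2 (by linarith [hv.2])).ne'

lemma intervalIntegrable_loop (j : ℕ) {a b c d : ℝ} (hcd : c ≤ d) (hd : d < 1) :
    IntervalIntegrable (fun v => hFun j a b v * (√((a - v) * (v - b)) / √(1 - v))) volume c d := by
  apply ContinuousOn.intervalIntegrable
  rw [Set.uIcc_of_le hcd]
  exact (continuous_hFun_right j a b).continuousOn.mul (continuousOn_loopWeight hd)

lemma loopWeight_pos {a b v : ℝ} (hv : v ∈ Set.Ioo b a) (ha : a < 1) :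
    0 < √((a - v) * (v - b)) / √(1 - v) :=
  div_pos (Real.sqrt_pos.2 (mul_pos (by linarith [hv.2]) (by linarith [hv.1])))
    (Real.sqrt_pos.2 (by linarith [hv.2]))

lemma loopInt_pos {j : ℕ} {a b : ℝ} (hab : b < a) (ha1 : a < 1)
    (h : ∀ v ∈ Set.Ioo b a, 0 < hFun j a b v) : 0 < loopInt j a b :=
  intervalIntegral.intervalIntegral_pos_of_pos_on (intervalIntegrable_loop j hab.le ha1)
    (fun v hv => mul_pos (h v hv) (loopWeight_pos hv ha1)) hab

lemma loopInt_neg {j : ℕ} {a b : ℝ} (hab : b < a) (ha1 : a < 1)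
    (h : ∀ v ∈ Set.Ioo b a, hFun j a b v < 0) : loopInt j a b < 0 := by
  have := intervalIntegral_lt_of_lt hab (intervalIntegrable_loop j hab.le ha1)
    (intervalIntegrable_const (c := (0 : ℝ)))
    (fun v hv => mul_neg_of_neg_of_pos (h v hv) (loopWeight_pos hv ha1))
  rwa [intervalIntegral.integral_zero] at this

/-- `hKer` goes from negative to positive, so its sign at the left end, or in the next lemma at the
right end, decides the sign in the whole gap and thus that of the averages `hFun`. -/
lemma loopInt_pos_of_hKer_nonneg {j : ℕ} (hj : 1 ≤ j) {a b : ℝ} (hb : 0 ≤ b) (hab : b < a)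
    (ha1 : a < 1) (h : 0 ≤ hKer j a b) : 0 < loopInt j a b :=
  loopInt_pos hab ha1 fun v hv => hFun_pos fun s hs =>
    hKer_pos_of_lt hj (hb.trans hab.le) ha1 hb
      (by nlinarith [mul_pos (sub_pos.2 hv.1) hs.1]) h

lemma loopInt_neg_of_hKer_nonpos {j : ℕ} (hj : 1 ≤ j) {a b : ℝ} (hb : 0 ≤ b) (hab : b < a)
    (ha1 : a < 1) (h : hKer j a a ≤ 0) : loopInt j a b < 0 :=
  loopInt_neg hab ha1 fun v hv => hFun_neg fun s hs =>
    hKer_neg_of_lt hj (hb.trans hab.le) ha1 (by nlinarith [mul_pos (sub_pos.2 hv.1) hs.1])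
      (by nlinarith [mul_pos (sub_pos.2 hv.1) hs.1, mul_pos (sub_pos.2 hv.1) (sub_pos.2 hs.2), hv.2]) h

lemma intervalIntegrable_hKer_abel (j : ℕ) (a : ℝ) {b v : ℝ} (hbv : b < v) :
    IntervalIntegrable (fun r => hKer j a r / √(v - r)) volume b v := by
  have h : IntervalIntegrable (fun s : ℝ => s ^ (-(1 / 2) : ℝ)) volume 0 (v - b) :=
    intervalIntegral.intervalIntegrable_rpow' (by norm_num)
  have h2 := (h.comp_sub_left v).symm
  simp only [sub_zero, sub_sub_cancel] at h2
  refine (h2.continuousOn_mul (continuous_hKer j a).continuousOn).congr fun r hr => ?_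
  rw [Set.uIoc_of_le hbv.le] at hr
  rw [Real.sqrt_eq_rpow, Real.rpow_neg (by linarith [hr.2])]
  exact (div_eq_mul_inv _ _).symm

/-- In the variable r = b + (v - b)s the average is an Abel integral in which b occurs only as the
lower limit. This makes the dependence on b transparent. -/
lemma hFun_mul_sqrt (j : ℕ) (a : ℝ) {b v : ℝ} (hbv : b < v) :
    hFun j a b v * √(v - b) = 1 / 2 * ∫ r in b..v, hKer j a r / √(v - r) := by
  have hd : 0 < v - b := sub_pos.2 hbv
  have h := intervalIntegral.integral_comp_add_mul (a := 0) (b := 1)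
    (fun r => hKer j a r / √(v - r)) hd.ne' b
  simp only [mul_zero, add_zero, mul_one, add_sub_cancel, smul_eq_mul] at h
  have hs : 0 < √(v - b) := Real.sqrt_pos.2 hd
  have h2 : ∀ s ∈ Set.uIcc (0 : ℝ) 1, hKer j a (b + (v - b) * s) / √(v - (b + (v - b) * s))
      = 1 / √(v - b) * (hKer j a (b + (v - b) * s) / √(1 - s)) := by
    intro s _
    rw [show v - (b + (v - b) * s) = (v - b) * (1 - s) by ring, Real.sqrt_mul hd.le]
    simp only [div_eq_mul_inv, mul_inv]; ring
  rw [intervalIntegral.integral_congr h2, intervalIntegral.integral_const_mul] at h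
  have hsq : √(v - b) * √(v - b) = v - b := Real.mul_self_sqrt hd.le
  have h3 : ∫ r in b..v, hKer j a r / √(v - r)
      = √(v - b) * ∫ s in (0 : ℝ)..1, hKer j a (b + (v - b) * s) / √(1 - s) := by
    have h4 : ∫ r in b..v, hKer j a r / √(v - r)
        = (v - b) * ((v - b)⁻¹ * ∫ r in b..v, hKer j a r / √(v - r)) := by
      rw [mul_inv_cancel_left₀ hd.ne']
    rw [h4, ← h, ← mul_assoc]
    congr 1
    field_simp
    rw [sq, hsq]
  rw [h3, hFun_eq_average]
  ring

/-- The loop integral is strictly increasing in the left end point as long as `hKer ≤ 0`. -/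
lemma loopInt_lt_of_hKer_nonpos {j : ℕ} (hj : 1 ≤ j) {a b c : ℝ} (hb : 0 ≤ b) (hbc : b < c)
    (hca : c < a) (ha1 : a < 1) (h : hKer j a c ≤ 0) : loopInt j a b < loopInt j a c := by
  have ha0 : 0 ≤ a := by linarith
  have hneg : ∀ r ∈ Set.Ioo b c, hKer j a r < 0 := fun r hr =>
    hKer_neg_of_lt hj ha0 ha1 (hb.trans hr.1.le) hr.2 h
  -- On (b, c) the integrand is negative. On (c, a), raising the lower limit of the Abel integral
  -- from b to c removes a negative contribution.
  have hsplit : loopInt j a b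
      = (∫ v in b..c, hFun j a b v * (√((a - v) * (v - b)) / √(1 - v)))
        + ∫ v in c..a, hFun j a b v * (√((a - v) * (v - b)) / √(1 - v)) :=
    (intervalIntegral.integral_add_adjacent_intervals
      (intervalIntegrable_loop j hbc.le (hca.trans ha1))
      (intervalIntegrable_loop j hca.le ha1)).symm
  have h1 : ∫ v in b..c, hFun j a b v * (√((a - v) * (v - b)) / √(1 - v)) < 0 := by
    have := intervalIntegral_lt_of_lt hbc (intervalIntegrable_loop j (a := a) (b := b) hbc.le (hca.trans ha1))
      (intervalIntegrable_const (c := (0 : ℝ))) fun v hv =>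
        mul_neg_of_neg_of_pos (hFun_neg fun s hs => hneg _
          ⟨by nlinarith [mul_pos (sub_pos.2 hv.1) hs.1],
           by nlinarith [mul_pos (sub_pos.2 hv.1) (sub_pos.2 hs.2), hv.2]⟩)
          (loopWeight_pos (a := a) (b := b) ⟨hv.1, hv.2.trans hca⟩ ha1)
    rwa [intervalIntegral.integral_zero] at this
  have h2 : ∫ v in c..a, hFun j a b v * (√((a - v) * (v - b)) / √(1 - v)) < loopInt j a c := by
    refine intervalIntegral_lt_of_lt hca (intervalIntegrable_loop j hca.le ha1)
      (intervalIntegrable_loop j hca.le ha1) fun v hv => ?_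
    have e1 : √((a - v) * (v - b)) = √(a - v) * √(v - b) := Real.sqrt_mul (by linarith [hv.2]) _
    have e2 : √((a - v) * (v - c)) = √(a - v) * √(v - c) := Real.sqrt_mul (by linarith [hv.2]) _
    have hb1 : 0 < √(a - v) / √(1 - v) := div_pos (Real.sqrt_pos.2 (by linarith [hv.2]))
      (Real.sqrt_pos.2 (by linarith [hv.2]))
    rw [e1, e2, show hFun j a b v * (√(a - v) * √(v - b) / √(1 - v))
        = (hFun j a b v * √(v - b)) * (√(a - v) / √(1 - v)) by ring,
      show hFun j a c v * (√(a - v) * √(v - c) / √(1 - v))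
        = (hFun j a c v * √(v - c)) * (√(a - v) / √(1 - v)) by ring,
      hFun_mul_sqrt j a (hbc.trans hv.1), hFun_mul_sqrt j a hv.1]
    refine mul_lt_mul_of_pos_right ?_ hb1
    have hi := intervalIntegrable_hKer_abel j a (hbc.trans hv.1)
    have hi1 : IntervalIntegrable (fun r => hKer j a r / √(v - r)) volume b c :=
      hi.mono_set (by
        rw [Set.uIcc_of_le hbc.le, Set.uIcc_of_le (hbc.trans hv.1).le]
        exact Set.Icc_subset_Icc_right hv.1.le)
    rw [← intervalIntegral.integral_add_adjacent_intervals hi1 (intervalIntegrable_hKer_abel j a hv.1)]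
    have := intervalIntegral_lt_of_lt hbc hi1 (intervalIntegrable_const (c := (0 : ℝ))) fun r hr =>
      div_neg_of_neg_of_pos (hneg r hr) (Real.sqrt_pos.2 (by linarith [hr.2, hv.1]))
    rw [intervalIntegral.integral_zero] at this
    linarith
  linarith

/-- Let b < c be two zeros. If c < a, then `hKer` at c cannot be positive, so the loop integral
increases strictly from b to c. If c = a, then `hKer` vanishes at a and the loop integral for b is
negative. -/
lemma loopInt_zero_unique {j : ℕ} (hj : 1 ≤ j) {a b c : ℝ} (hb : 0 ≤ b) (hc : 0 ≤ c) (hba : b ≤ a)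
    (hca : c ≤ a) (ha1 : a < 1) (h1 : loopHat j a b = 0) (h2 : loopHat j a c = 0) : b = c := by
  have key : ∀ b c : ℝ, 0 ≤ b → b < c → c ≤ a → loopHat j a b = 0 → loopHat j a c = 0 → False := by
    intro b c hb hbc hca h1 h2
    have hba := hbc.trans_le hca
    have hL := (loopInt_eq_zero_iff j hba).2 h1
    rcases hca.eq_or_lt with rfl | hca
    · have hK : hKer j c c = 0 := by
        have e : loopHat j c c = hFun j c c c
            * ∫ s in (0 : ℝ)..1, √(s * (1 - s)) / √(1 - c) := by
          unfold loopHat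
          rw [← intervalIntegral.integral_const_mul]
          simp
        have hpos : 0 < ∫ s in (0 : ℝ)..1, √(s * (1 - s)) / √(1 - c) := by
          refine intervalIntegral.intervalIntegral_pos_of_pos_on
            (Continuous.intervalIntegrable (by fun_prop) _ _) (fun s hs => ?_) zero_lt_one
          exact div_pos (Real.sqrt_pos.2 (mul_pos hs.1 (by linarith [hs.2])))
            (Real.sqrt_pos.2 (by linarith))
        rw [h2, hFun_diag] at e
        rw [hKer_diag]
        exact (mul_eq_zero.1 e.symm).resolve_right hpos.ne'
      exact absurd hL (loopInt_neg_of_hKer_nonpos hj hb hbc ha1 hK.le).ne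
    · have hL2 := (loopInt_eq_zero_iff j hca).2 h2
      have hK : hKer j a c ≤ 0 := by
        by_contra hcon
        exact absurd hL2
          (loopInt_pos_of_hKer_nonneg hj (hb.trans hbc.le) hca ha1 (not_le.1 hcon).le).ne'
      have := loopInt_lt_of_hKer_nonpos hj hb hbc hca ha1 hK
      rw [hL, hL2] at this
      exact lt_irrefl _ this
  rcases lt_trichotomy b c with h | h | h
  · exact (key b c hb h hca h1 h2).elim
  · exact h
  · exact (key c b hc h hba h2 h1).elim

lemma loopHat_diag (j : ℕ) (u : ℝ) :
    loopHat j u u = trailFun j u * ∫ s in (0 : ℝ)..1, √(s * (1 - s)) / √(1 - u) := by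
  unfold loopHat trailFun
  rw [← hFun_diag, ← intervalIntegral.integral_const_mul]
  simp

lemma diagWeight_pos {u : ℝ} (hu : u < 1) :
    0 < ∫ s in (0 : ℝ)..1, √(s * (1 - s)) / √(1 - u) := by
  refine intervalIntegral.intervalIntegral_pos_of_pos_on
    (Continuous.intervalIntegrable (by fun_prop) _ _) (fun s hs => ?_) zero_lt_one
  exact div_pos (Real.sqrt_pos.2 (mul_pos hs.1 (by linarith [hs.2])))
    (Real.sqrt_pos.2 (by linarith))

/-- The denominator satisfies 1 - (b + (a - b)s) ≥ (1 - B)(1 - s), and the numerator supplies the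
factor √(1 - s). The bound therefore remains valid up to a = 1. -/
lemma loopHat_weight_le {a b s B : ℝ} (ha : a ≤ 1) (hbB : b ≤ B)
    (hB : B < 1) (hs : s ∈ Set.Ioo (0 : ℝ) 1) :
    √(s * (1 - s)) / √(1 - (b + (a - b) * s)) ≤ 1 / √(1 - B) := by
  have h1 : 0 < 1 - s := by linarith [hs.2]
  have h2 : (1 - B) * (1 - s) ≤ 1 - (b + (a - b) * s) := by nlinarith [hs.1]
  have h3 : 0 < (1 - B) * (1 - s) := mul_pos (by linarith) h1
  have h4 : √(s * (1 - s)) ≤ √(1 - s) := Real.sqrt_le_sqrt (by nlinarith [hs.2])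
  calc √(s * (1 - s)) / √(1 - (b + (a - b) * s)) ≤ √(1 - s) / √((1 - B) * (1 - s)) :=
        div_le_div₀ (by positivity) h4 (Real.sqrt_pos.2 h3) (Real.sqrt_le_sqrt h2)
    _ = 1 / √(1 - B) := by
        rw [Real.sqrt_mul (by linarith)]
        have := (Real.sqrt_pos.2 h1).ne'
        field_simp

attribute [irreducible] loopInt

/-- Dominated convergence. The value a = 1 is included because the existence of u^{**} and the upper
end of the third region are read off there. -/
lemma continuousOn_loopHat (j : ℕ) {B : ℝ} (hB : B < 1) :
    ContinuousOn (fun p : ℝ × ℝ => loopHat j p.1 p.2)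
      {p | 0 ≤ p.2 ∧ p.2 ≤ p.1 ∧ p.1 ≤ 1 ∧ p.2 ≤ B} := by
  obtain ⟨M, hM⟩ := (isCompact_Icc (a := ((0 : ℝ), (0 : ℝ), (0 : ℝ))) (b := (1, 1, 1))).exists_bound_of_continuousOn
    (continuous_hFun j).continuousOn
  have hmem : ∀ p : ℝ × ℝ, 0 ≤ p.2 → p.2 ≤ p.1 → p.1 ≤ 1 → ∀ s ∈ Set.Ioo (0 : ℝ) 1,
      (p.1, p.2, p.2 + (p.1 - p.2) * s) ∈ Set.Icc ((0 : ℝ), (0 : ℝ), (0 : ℝ)) (1, 1, 1) := by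
    intro p h1 h2 h3 s hs
    have h4 : 0 ≤ (p.1 - p.2) * s := mul_nonneg (by linarith) hs.1.le
    have h5 : (p.1 - p.2) * s ≤ p.1 - p.2 := by nlinarith [hs.2]
    refine ⟨⟨?_, ?_, ?_⟩, ⟨?_, ?_, ?_⟩⟩ <;> simp only <;> linarith
  have hHc : ∀ s : ℝ, Continuous fun p : ℝ × ℝ => hFun j p.1 p.2 (p.2 + (p.1 - p.2) * s) := by
    intro s
    have hc : Continuous fun p : ℝ × ℝ => (p.1, p.2, p.2 + (p.1 - p.2) * s) := by fun_prop
    exact (continuous_hFun j).comp hc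
  intro p hp
  unfold loopHat
  refine intervalIntegral.continuousWithinAt_of_dominated_interval
    (bound := fun _ => M * (1 / √(1 - B))) ?_ ?_ ?_ ?_
  · refine Eventually.of_forall fun p => Measurable.aestronglyMeasurable ?_
    have := (continuous_hFun_right j p.1 p.2).measurable
    fun_prop
  · refine eventually_nhdsWithin_of_forall fun p hp => ?_
    have hone : ∀ᵐ s : ℝ, s ≠ 1 := by simp [ae_iff, measure_singleton]
    filter_upwards [hone] with s hs1 hs
    rw [Set.uIoc_of_le zero_le_one] at hs
    have hs' : s ∈ Set.Ioo (0 : ℝ) 1 := ⟨hs.1, lt_of_le_of_ne hs.2 hs1⟩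
    rw [norm_mul]
    have h1 := hM _ (hmem p hp.1 hp.2.1 hp.2.2.1 s hs')
    have h2 := loopHat_weight_le hp.2.2.1 hp.2.2.2 hB hs'
    refine mul_le_mul h1 ?_ (norm_nonneg _) ((norm_nonneg _).trans h1)
    rw [Real.norm_of_nonneg (by positivity)]
    exact h2
  · exact intervalIntegrable_const
  · have hone : ∀ᵐ s : ℝ, s ≠ 1 := by simp [ae_iff, measure_singleton]
    filter_upwards [hone] with s hs1 hs
    rw [Set.uIoc_of_le zero_le_one] at hs
    have hs' : s ∈ Set.Ioo (0 : ℝ) 1 := ⟨hs.1, lt_of_le_of_ne hs.2 hs1⟩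
    refine ContinuousAt.continuousWithinAt ?_
    refine (hHc s).continuousAt.mul (ContinuousAt.div (by fun_prop) (by fun_prop) ?_)
    refine (Real.sqrt_pos.2 ?_).ne'
    obtain ⟨h1, h2, h3, h4⟩ := hp
    nlinarith [mul_nonneg (sub_nonneg.2 h2) (sub_nonneg.2 hs.2), hs'.1, hs'.2,
      mul_pos (sub_pos.2 hB) (sub_pos.2 hs'.2)]

/-! ### The transition point -/

lemma coeff_ratioSeries_mul_pow_lt (k : ℕ) {a b : ℝ} (ha : 0 ≤ a) (hab : a < b) :
    coeff (k + 1) (ratioSeries a) * b ^ (k + 1) < coeff (k + 1) (ratioSeries b) * a ^ (k + 1) := by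
  unfold ratioSeries
  rw [coeff_mul, coeff_mul, Finset.sum_mul, Finset.sum_mul]
  refine Finset.sum_lt_sum (fun x hx => ?_) ⟨(k + 1, 0), by simp, ?_⟩
  · obtain ⟨i, j⟩ := x
    rw [Finset.HasAntidiagonal.mem_antidiagonal] at hx
    simp only at hx
    simp only [coeff_bin]
    rw [← hx]
    rcases i with _ | i
    · simp only [zero_add]; apply le_of_eq; ring
    · have h3 : a ^ (i + 1) ≤ b ^ (i + 1) := pow_le_pow_left₀ ha hab.le _
      have h4 : 0 ≤ a ^ j * b ^ j :=
        mul_nonneg (pow_nonneg ha _) (pow_nonneg (ha.trans hab.le) _)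
      have h5 : 0 ≤ (-coeff (i + 1) sqrtSeries) * eps j
          * ((a ^ j * b ^ j) * (b ^ (i + 1) - a ^ (i + 1))) :=
        mul_nonneg (mul_nonneg (by linarith [coeff_sqrtSeries_neg i]) (eps_pos j).le)
          (mul_nonneg h4 (by linarith))
      rw [pow_add a, pow_add b]
      linarith
  · simp only [coeff_bin, pow_zero, mul_one, eps_zero]
    have h3 : a ^ (k + 1) < b ^ (k + 1) := pow_lt_pow_left₀ hab ha (by omega)
    nlinarith [coeff_sqrtSeries_neg k]

lemma hFun_zero_right (j : ℕ) (a ξ : ℝ) : hFun j a 0 ξ = coeff j (ratioSeries a * geom ξ) := by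
  unfold hFun; rw [bin_zero, one_mul]

/-- With ξ proportional to a, division by a^j leaves the quotients of
`coeff_ratioSeries_mul_pow_le`, which increase with a. -/
lemma hFun_scale_lt {j : ℕ} (hj : 1 ≤ j) {u v s : ℝ} (hu : 0 < u) (huv : u < v) (hs : 0 < s) :
    hFun j u 0 (u * s) * v ^ j < hFun j v 0 (v * s) * u ^ j := by
  simp only [hFun_zero_right, coeff_mul, Finset.sum_mul]
  have hv : 0 < v := hu.trans huv
  refine Finset.sum_lt_sum (fun x hx => ?_) ⟨(j, 0), by simp, ?_⟩
  · obtain ⟨i, l⟩ := x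
    rw [Finset.HasAntidiagonal.mem_antidiagonal] at hx
    simp only at hx
    simp only [coeff_geom]
    rw [← hx]
    have h := coeff_ratioSeries_mul_pow_le i hu.le huv.le
    have h5 : 0 ≤ (u ^ l * v ^ l * s ^ l) := by positivity
    have := mul_le_mul_of_nonneg_left h h5
    rw [pow_add u, pow_add v, mul_pow, mul_pow]
    linarith
  · obtain ⟨i, rfl⟩ : ∃ i, j = i + 1 := ⟨j - 1, by omega⟩
    have h := coeff_ratioSeries_mul_pow_lt i hu.le huv
    simp only [coeff_geom, pow_zero, mul_one]
    exact h

lemma ratioMono_hFun_zero {j : ℕ} (hj : 1 ≤ j) {a : ℝ} (ha : 0 ≤ a) (ha1 : a < 1) :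
    RatioMono j (hFun j a 0) := by
  have := ratioMono_coeff hj (fun k => coeff_ratioSeries_neg k ha ha1) (w := fun _ => 1)
    (fun _ => one_pos) (W := geom) fun r k => by rw [coeff_geom, one_mul]
  intro r s hr hrs
  rw [hFun_zero_right, hFun_zero_right]
  exact this r s hr hrs

lemma intervalIntegrable_loopHat_zero (j : ℕ) {u : ℝ} (hu1 : u < 1) (u' : ℝ) :
    IntervalIntegrable (fun s => hFun j u' 0 (u' * s) * (√(s * (1 - s)) / √(1 - u * s)))
      volume 0 1 := by
  apply ContinuousOn.intervalIntegrable
  rw [Set.uIcc_of_le zero_le_one]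
  refine ((continuous_hFun_right j u' 0).comp (by fun_prop)).continuousOn.mul
    (ContinuousOn.div (by fun_prop) (by fun_prop) fun s hs => ?_)
  refine (Real.sqrt_pos.2 ?_).ne'
  rcases le_total u 0 with h | h
  · nlinarith [hs.1, hs.2]
  · nlinarith [hs.1, hs.2]

/-- The method of `hFun_pos_of_nonneg`, now in the direction of a: the integrand changes sign once,
at s0. `hFun_scale_lt` compares the polynomial factors, and the increasing ratio √(1 - us)/√(1 - vs)
of the weights is replaced by its value κ at s0. -/
lemma loopHat_zero_pos_of_nonneg {j : ℕ} (hj : 1 ≤ j) {u v : ℝ} (hu : 0 < u) (huv : u < v)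
    (hv1 : v < 1) (h : 0 ≤ loopHat j u 0) : 0 < loopHat j v 0 := by
  have hu1 := huv.trans hv1
  have hv := hu.trans huv
  unfold loopHat at h ⊢
  simp only [sub_zero, zero_add] at h ⊢
  have hmono := ratioMono_hFun_zero hj hu.le hu1
  have hden : ∀ w : ℝ, 0 < w → w < 1 → ∀ s ∈ Set.Icc (0 : ℝ) 1, 0 < 1 - w * s := by
    intro w h0 h1 s hs
    nlinarith [hs.1, hs.2]
  have hwpos : ∀ w : ℝ, 0 < w → w < 1 → ∀ s ∈ Set.Ioo (0 : ℝ) 1, 0 < √(s * (1 - s)) / √(1 - w * s) :=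
    fun w h0 h1 s hs => div_pos (Real.sqrt_pos.2 (mul_pos hs.1 (by linarith [hs.2])))
      (Real.sqrt_pos.2 (hden w h0 h1 s ⟨hs.1.le, hs.2.le⟩))
  have hu_pos : 0 < hFun j u 0 u := by
    by_contra hc
    have := intervalIntegral_lt_of_lt zero_lt_one (intervalIntegrable_loopHat_zero j hu1 u)
      (intervalIntegrable_const (c := (0 : ℝ))) fun s hs =>
        mul_neg_of_neg_of_pos (hmono.neg_of_nonpos (r := u * s) (s := u) (mul_pos hu hs.1)
          (by nlinarith [hs.2]) (not_lt.1 hc)) (hwpos u hu hu1 s hs)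
    rw [intervalIntegral.integral_zero] at this
    linarith
  have hu_neg : hFun j u 0 0 < 0 := by
    obtain ⟨i, rfl⟩ : ∃ i, j = i + 1 := ⟨j - 1, by omega⟩
    have hg : geom 0 = 1 := by
      ext k; rcases k with _ | k <;> simp [coeff_geom, coeff_one]
    rw [hFun_zero_right, hg, mul_one]
    exact coeff_ratioSeries_neg i hu.le hu1
  obtain ⟨r0, hr0, hz⟩ := intermediate_value_Ioo hu.le (continuous_hFun_right j u 0).continuousOn
    (Set.mem_Ioo.2 ⟨hu_neg, hu_pos⟩)
  set s0 := r0 / u with hs0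
  have hs0r : u * s0 = r0 := by rw [hs0]; field_simp
  have hs0m : s0 ∈ Set.Ioo (0 : ℝ) 1 := ⟨div_pos hr0.1 hu, (div_lt_one hu).2 hr0.2⟩
  set κ : ℝ := √(1 - u * s0) / √(1 - v * s0) with hκ
  have hκ0 : 0 ≤ κ := by positivity
  have hratio : ∀ s ∈ Set.Ioo (0 : ℝ) 1, ∀ t ∈ Set.Ioo (0 : ℝ) 1, s ≤ t →
      √(1 - u * s) / √(1 - v * s) ≤ √(1 - u * t) / √(1 - v * t) := by
    intro s hs t ht hst
    have h1 := hden u hu hu1 s ⟨hs.1.le, hs.2.le⟩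
    have h2 := hden v hv hv1 s ⟨hs.1.le, hs.2.le⟩
    have h3 := hden u hu hu1 t ⟨ht.1.le, ht.2.le⟩
    have h4 := hden v hv hv1 t ⟨ht.1.le, ht.2.le⟩
    rw [← Real.sqrt_div h1.le, ← Real.sqrt_div h3.le]
    apply Real.sqrt_le_sqrt
    rw [div_le_div_iff₀ h2 h4]
    nlinarith [mul_nonneg (sub_nonneg.2 hst) (sub_nonneg.2 huv.le)]
  have hlt : ∀ s ∈ Set.Ioo (0 : ℝ) 1,
      v ^ j * κ * (hFun j u 0 (u * s) * (√(s * (1 - s)) / √(1 - u * s)))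
        < u ^ j * (hFun j v 0 (v * s) * (√(s * (1 - s)) / √(1 - v * s))) := by
    intro s hs
    have h1 := hden u hu hu1 s ⟨hs.1.le, hs.2.le⟩
    have h2 := hden v hv hv1 s ⟨hs.1.le, hs.2.le⟩
    have hw := hwpos v hv hv1 s hs
    have hstep := mul_lt_mul_of_pos_right (hFun_scale_lt hj hu huv hs.1) hw
    have hle : κ * hFun j u 0 (u * s) ≤ √(1 - u * s) / √(1 - v * s) * hFun j u 0 (u * s) := by
      rcases le_total s s0 with hle | hle
      · have hneg : hFun j u 0 (u * s) ≤ 0 := by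
          rcases hle.eq_or_lt with rfl | hlt
          · rw [hs0r, hz]
          · exact (hmono.neg_of_nonpos (mul_pos hu hs.1) (s := r0)
              (by rw [← hs0r]; nlinarith) hz.le).le
        exact mul_le_mul_of_nonpos_right (hratio s hs s0 hs0m hle) hneg
      · have hpos : 0 ≤ hFun j u 0 (u * s) := by
          rcases hle.eq_or_lt with h | hlt
          · rw [← h, hs0r, hz]
          · exact (hmono.pos_of_nonneg hr0.1 (s := u * s)
              (by rw [← hs0r]; nlinarith) hz.ge).le
        exact mul_le_mul_of_nonneg_right (hratio s0 hs0m s hs hle) hpos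
    have hsu := Real.sqrt_pos.2 h1
    have hsv := Real.sqrt_pos.2 h2
    have hwu := hwpos u hu hu1 s hs
    have hle2 := mul_le_mul_of_nonneg_left (mul_le_mul_of_nonneg_right hle hwu.le)
      (pow_nonneg hv.le j)
    have e : √(1 - u * s) / √(1 - v * s) * hFun j u 0 (u * s) * (√(s * (1 - s)) / √(1 - u * s))
        = hFun j u 0 (u * s) * (√(s * (1 - s)) / √(1 - v * s)) := by
      field_simp
    rw [e] at hle2
    linarith
  have := intervalIntegral_lt_of_lt zero_lt_one
    ((intervalIntegrable_loopHat_zero j hu1 u).const_mul (v ^ j * κ))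
    ((intervalIntegrable_loopHat_zero j hv1 v).const_mul (u ^ j)) hlt
  rw [intervalIntegral.integral_const_mul, intervalIntegral.integral_const_mul] at this
  have h0 := mul_nonneg (mul_nonneg (pow_nonneg hv.le j) hκ0) h
  exact pos_of_mul_pos_right (h0.trans_lt this) (pow_nonneg hu.le j)

lemma continuousOn_loopHat_zero (j : ℕ) :
    ContinuousOn (fun u => loopHat j u 0) (Set.Icc 0 1) := by
  have h := continuousOn_loopHat j (B := 0) (by norm_num)
  have hc : Continuous fun u : ℝ => (u, (0 : ℝ)) := by fun_prop
  exact h.comp (f := fun u : ℝ => (u, (0 : ℝ))) hc.continuousOn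
    fun u hu => ⟨le_rfl, hu.1, hu.2, le_rfl⟩

/-- At a = 0 the value is a positive multiple of a coefficient of √(1 - z), hence negative. At a = 1
the ratio series is 1 and the integral becomes that of s^j √s. -/
lemma exists_loopHat_zero {j : ℕ} (hj : 1 ≤ j) :
    ∃ u ∈ Set.Ioo (0 : ℝ) 1, loopHat j u 0 = 0 := by
  have hg : geom 0 = 1 := by
    ext k; rcases k with _ | k <;> simp [coeff_geom, coeff_one]
  have h0 : loopHat j 0 0 < 0 := by
    rw [loopHat_diag]
    refine mul_neg_of_neg_of_pos ?_ (diagWeight_pos zero_lt_one)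
    obtain ⟨i, rfl⟩ : ∃ i, j = i + 1 := ⟨j - 1, by omega⟩
    unfold trailFun
    rw [hg, mul_one, mul_one]
    exact coeff_sqrtSeries_neg i
  have h1 : 0 < loopHat j 1 0 := by
    have e : loopHat j 1 0 = ∫ s in (0 : ℝ)..1, s ^ j * √s := by
      unfold loopHat
      refine intervalIntegral.integral_congr_ae ?_
      have hone : ∀ᵐ s : ℝ, s ≠ 1 := by simp [ae_iff, measure_singleton]
      filter_upwards [hone] with s hs1 hs
      rw [Set.uIoc_of_le zero_le_one] at hs
      have hpos : 0 < √(1 - s) := Real.sqrt_pos.2 (by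
        have := lt_of_le_of_ne hs.2 hs1; linarith)
      have hr : ratioSeries 1 = 1 := sqrtSeries_mul_bin_one
      rw [hFun_zero_right, hr, one_mul, coeff_geom, Real.sqrt_mul hs.1.le]
      simp only [sub_zero, one_mul, zero_add]
      field_simp
    rw [e]
    refine intervalIntegral.intervalIntegral_pos_of_pos_on
      (Continuous.intervalIntegrable (by fun_prop) _ _) (fun s hs => ?_) zero_lt_one
    exact mul_pos (pow_pos hs.1 _) (Real.sqrt_pos.2 hs.1)
  obtain ⟨u, hu, hz⟩ := intermediate_value_Ioo zero_le_one (continuousOn_loopHat_zero j)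
    (Set.mem_Ioo.2 ⟨h0, h1⟩)
  exact ⟨u, hu, hz⟩

lemma loopHat_zero_unique {j : ℕ} (hj : 1 ≤ j) {u v : ℝ} (hu : u ∈ Set.Ioo (0 : ℝ) 1)
    (hv : v ∈ Set.Ioo (0 : ℝ) 1) (h1 : loopHat j u 0 = 0) (h2 : loopHat j v 0 = 0) : u = v := by
  rcases lt_trichotomy u v with h | h | h
  · exact absurd h2 (loopHat_zero_pos_of_nonneg hj hu.1 h hv.2 h1.ge).ne'
  · exact h
  · exact absurd h1 (loopHat_zero_pos_of_nonneg hj hv.1 h hu.2 h2.ge).ne'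

/-! ### Solving the two equations in the two-gap region -/

/-- Every value strictly between the two end values of `betaCoeff` is attained on the curve
`loopHat = 0`, at an interior point. -/
lemma exists_loop_solution {j : ℕ} (hj : 1 ≤ j) {us uss x : ℝ} (hus : us ∈ Set.Ioo (0 : ℝ) 1)
    (huss : uss ∈ Set.Ioo (0 : ℝ) 1) (h1 : trailFun j us = 0) (h2 : loopHat j uss 0 = 0)
    (hx1 : betaCoeff (j + 1) us us < x) (hx2 : x < betaCoeff (j + 1) uss 0) :
    ∃ a b : ℝ, 0 < b ∧ b < a ∧ a < 1 ∧ loopInt j a b = 0 ∧ betaCoeff (j + 1) a b = x := by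
  -- At a = u^* the function `hKer` vanishes at a, so the loop integral with b = 0 is negative. As
  -- `loopHat` with b = 0 stays positive beyond its zero, u^* ≤ u^{**}.
  have hneg : loopHat j us 0 < 0 := by
    have hK : hKer j us us ≤ 0 := by rw [hKer_diag_eq_trailFun]; exact h1.le
    have := loopInt_neg_of_hKer_nonpos hj le_rfl hus.1 hus.2 hK
    rw [loopInt_eq j hus.1.le] at this
    exact neg_of_mul_neg_right this (by positivity)
  have hle : us ≤ uss := by
    by_contra hc
    exact absurd (loopHat_zero_pos_of_nonneg hj huss.1 (not_le.1 hc) hus.2 h2.ge) (not_lt.2 hneg.le)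
  set Dset : Set (ℝ × ℝ) := {p | us ≤ p.1 ∧ p.1 ≤ uss ∧ 0 ≤ p.2 ∧ p.2 ≤ p.1} with hD
  have hDsub : Dset ⊆ {p | 0 ≤ p.2 ∧ p.2 ≤ p.1 ∧ p.1 ≤ 1 ∧ p.2 ≤ uss} := fun p hp =>
    ⟨hp.2.2.1, hp.2.2.2, hp.2.1.trans huss.2.le, hp.2.2.2.trans hp.2.1⟩
  have hcont : ContinuousOn (fun p : ℝ × ℝ => loopHat j p.1 p.2) Dset :=
    (continuousOn_loopHat j huss.2).mono hDsub
  have hDclosed : IsClosed Dset :=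
    (isClosed_le continuous_const continuous_fst).inter
      ((isClosed_le continuous_fst continuous_const).inter
        ((isClosed_le continuous_const continuous_snd).inter
          (isClosed_le continuous_snd continuous_fst)))
  have hDcompact : IsCompact Dset := by
    refine (isCompact_Icc (a := ((us : ℝ), (0 : ℝ))) (b := (uss, uss))).of_isClosed_subset
      hDclosed fun p hp => ⟨⟨hp.1, hp.2.2.1⟩, ⟨hp.2.1, hp.2.2.2.trans hp.2.1⟩⟩
  set K : Set (ℝ × ℝ) := Dset ∩ (fun p : ℝ × ℝ => loopHat j p.1 p.2) ⁻¹' {0} with hK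
  have hKcompact : IsCompact K := hDcompact.of_isClosed_subset
    (hcont.preimage_isClosed_of_isClosed hDclosed isClosed_singleton) Set.inter_subset_left
  have : CompactSpace K := isCompact_iff_compactSpace.1 hKcompact
  set f : K → ℝ := fun p => p.1.1 with hf
  have hfc : Continuous f := continuous_fst.comp continuous_subtype_val
  -- For every a there is at most one b on the curve; `hsurj` below gives at least one, since
  -- `loopHat` is nonpositive at b = 0 and nonnegative at b = a.
  have hinj : Function.Injective f := by
    rintro ⟨⟨a, b⟩, ⟨ha1, ha2, hb1, hb2⟩, hp⟩ ⟨⟨a', b'⟩, ⟨ha1', ha2', hb1', hb2'⟩, hp'⟩ heq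
    simp only [hf] at heq
    subst heq
    have hbb : b = b' := loopInt_zero_unique hj hb1 hb1' hb2 hb2'
      (lt_of_le_of_lt ha2 huss.2) hp hp'
    subst hbb
    rfl
  have hsurj : Set.Icc us uss ⊆ Set.range f := by
    intro a ha
    have hcol : ContinuousOn (fun b => loopHat j a b) (Set.Icc 0 a) := by
      have hc : Continuous fun b : ℝ => (a, b) := by fun_prop
      exact hcont.comp (f := fun b : ℝ => (a, b)) hc.continuousOn
        fun b hb => ⟨ha.1, ha.2, hb.1, hb.2⟩
    have ha0 : 0 < a := hus.1.trans_le ha.1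
    have ha1 : a < 1 := ha.2.trans_lt huss.2
    have hl : loopHat j a 0 ≤ 0 := by
      by_contra hc
      rcases ha.2.eq_or_lt with rfl | hlt
      · exact hc h2.le
      · exact absurd h2 (loopHat_zero_pos_of_nonneg hj ha0 hlt huss.2 (not_le.1 hc).le).ne'
    have hr : 0 ≤ loopHat j a a := by
      rw [loopHat_diag]
      refine mul_nonneg ?_ (diagWeight_pos ha1).le
      rcases ha.1.eq_or_lt with rfl | hlt
      · exact h1.ge
      · exact ((ratioMono_trailFun hj).pos_of_nonneg hus.1 hlt h1.ge).le
    obtain ⟨b, hb, hz⟩ := intermediate_value_Icc ha0.le hcol (Set.mem_Icc.2 ⟨hl, hr⟩)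
    exact ⟨⟨(a, b), ⟨ha.1, ha.2, hb.1, hb.2⟩, hz⟩, rfl⟩
  -- A continuous map from a compact space to the line is closed, and an injective closed map pulls
  -- connectedness back. Thus the curve is connected without b being shown to depend continuously on
  -- a.
  have hpre : IsPreconnected (Set.univ : Set K) := by
    have h := (isPreconnected_Icc (a := us) (b := uss)).preimage_of_isClosedMap hinj
      hfc.isClosedMap hsurj
    rwa [show f ⁻¹' Set.Icc us uss = Set.univ from
      Set.eq_univ_of_forall fun p => ⟨p.2.1.1, p.2.1.2.1⟩] at h
  have hmem1 : (us, us) ∈ K := ⟨⟨le_rfl, hle, hus.1.le, le_rfl⟩, by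
    simp only [Set.mem_preimage, Set.mem_singleton_iff]
    rw [loopHat_diag, h1, zero_mul]⟩
  have hmem2 : (uss, 0) ∈ K := ⟨⟨hle, le_rfl, le_rfl, huss.1.le⟩, h2⟩
  have hβ : Continuous fun p : K => betaCoeff (j + 1) p.1.1 p.1.2 := by
    have := (continuous_betaCoeff (j + 1)).comp (continuous_subtype_val (p := fun p => p ∈ K))
    exact this
  obtain ⟨⟨⟨a, b⟩, hab⟩, -, hval⟩ := hpre.intermediate_value (Set.mem_univ ⟨_, hmem1⟩)
    (Set.mem_univ ⟨_, hmem2⟩) hβ.continuousOn ⟨hx1.le, hx2.le⟩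
  simp only at hval
  obtain ⟨⟨ha1, ha2, hb1, hb2⟩, hz⟩ := hab
  simp only [Set.mem_preimage, Set.mem_singleton_iff] at hz
  simp only at ha1 ha2 hb1 hb2
  have ha0 : 0 < a := hus.1.trans_le ha1
  have ha1' : a < 1 := ha2.trans_lt huss.2
  -- A point of the curve with b = 0 is (u^{**}, 0), and one with b = a is (u^*, u^*). Both are
  -- excluded because x lies strictly between the end values.
  have hb0 : b ≠ 0 := by
    rintro rfl
    have := loopHat_zero_unique hj ⟨ha0, ha1'⟩ huss hz h2
    subst this
    exact hx2.ne hval.symm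
  have hba : b ≠ a := by
    rintro rfl
    rw [loopHat_diag] at hz
    have := trailFun_eq_zero_unique hj ha0 hus.1
      ((mul_eq_zero.1 hz).resolve_right (diagWeight_pos ha1').ne') h1
    subst this
    exact hx1.ne hval
  have hlt := lt_of_le_of_ne hb2 hba
  exact ⟨a, b, lt_of_le_of_ne hb1 hb0.symm, hlt, ha1', (loopInt_eq_zero_iff j hlt).2 hz, hval⟩

/-! ### Signs on the curve `loopInt = 0` -/

/-- A zero loop integral forces `hKer` < 0 at b, hence on [0, b], and so `hFun` < 0 there. It also
forces `hFun` ≥ 0 somewhere in the gap, hence `hFun` > 0 from a on. In the gap the sign goes from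
minus to plus, so the primitive falls, then rises back to zero. -/
lemma hFun_signs {j : ℕ} (hj : 1 ≤ j) {a b : ℝ} (hb : 0 ≤ b) (hab : b < a) (ha1 : a < 1)
    (hL : loopInt j a b = 0) :
    (∀ v ∈ Set.Icc 0 b, hFun j a b v < 0) ∧ (∀ v, a ≤ v → 0 < hFun j a b v) ∧
    ∀ ξ ∈ Set.Icc b a, ∫ v in b..ξ, hFun j a b v * (√((a - v) * (v - b)) / √(1 - v)) ≤ 0 := by
  have ha0 : 0 ≤ a := hb.trans hab.le
  have hK : hKer j a b < 0 := by
    by_contra hc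
    exact absurd hL (loopInt_pos_of_hKer_nonneg hj hb hab ha1 (not_lt.1 hc)).ne'
  have hK' : ∀ r ∈ Set.Icc 0 b, hKer j a r < 0 := fun r hr => by
    rcases hr.2.eq_or_lt with rfl | hlt
    · exact hK
    · exact hKer_neg_of_lt hj ha0 ha1 hr.1 hlt hK.le
  have hex : ∃ v ∈ Set.Ioo b a, 0 ≤ hFun j a b v := by
    by_contra hc
    push Not at hc
    exact absurd hL (loopInt_neg hab ha1 hc).ne
  refine ⟨fun v hv => hFun_neg fun s hs => hK' _ ⟨?_, ?_⟩, fun v hv => ?_, fun ξ hξ => ?_⟩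
  · nlinarith [mul_nonneg hv.1 hs.1.le, mul_nonneg hb (sub_nonneg.2 hs.2.le)]
  · nlinarith [mul_nonneg (sub_nonneg.2 hv.2) hs.1.le]
  · obtain ⟨w, hw, hw0⟩ := hex
    exact hFun_pos_of_nonneg hj ha0 ha1 hb hw.1 (hw.2.trans_le hv) hw0
  · have hsplit := intervalIntegral.integral_add_adjacent_intervals
      (intervalIntegrable_loop j (a := a) (b := b) hξ.1 (hξ.2.trans_lt ha1))
      (intervalIntegrable_loop j (a := a) (b := b) hξ.2 ha1)
    have hL' : ∫ v in b..a, hFun j a b v * (√((a - v) * (v - b)) / √(1 - v)) = 0 := by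
      rw [← hL, loopInt]
    rw [hL'] at hsplit
    rcases hξ.1.eq_or_lt with rfl | hbξ
    · simp
    by_cases hH : 0 ≤ hFun j a b ξ
    · have : 0 ≤ ∫ v in ξ..a, hFun j a b v * (√((a - v) * (v - b)) / √(1 - v)) := by
        refine intervalIntegral.integral_nonneg hξ.2 fun v hv => mul_nonneg ?_ (by positivity)
        rcases hv.1.eq_or_lt with rfl | hlt
        · exact hH
        · exact (hFun_pos_of_nonneg hj ha0 ha1 hb hbξ hlt hH).le
      linarith
    · have hmono := intervalIntegral.integral_mono_on hξ.1
        (intervalIntegrable_loop j (a := a) (b := b) hξ.1 (hξ.2.trans_lt ha1))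
        (intervalIntegrable_const (c := (0 : ℝ))) fun v hv => by
          refine mul_nonpos_of_nonpos_of_nonneg ?_ (by positivity)
          rcases hv.1.eq_or_lt with rfl | hlt
          · exact (hFun_neg fun s hs => hK' _ (by simpa using hb)).le
          · by_contra hc
            refine hH ?_
            rcases hv.2.eq_or_lt with rfl | hlt2
            · exact (not_le.1 hc).le
            · exact (hFun_pos_of_nonneg hj ha0 ha1 hb hlt hlt2 (not_le.1 hc).le).le
      simpa using hmono

end

end StepData

/-! ### Identification of the polynomials P_n by their expansion at infinity. -/

namespace StepData

open MeasureTheory Filter Asymptotics Topology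

noncomputable section

/-! ### The arcsine density on an interval -/

lemma hasDerivAt_arcsin_affine {a b v : ℝ} (hv : v ∈ Set.Ioo b a) :
    HasDerivAt (fun v => Real.arcsin ((2 * v - a - b) / (a - b))) (1 / √((a - v) * (v - b))) v := by
  have hab : 0 < a - b := by linarith [hv.1, hv.2]
  have h1 : HasDerivAt (fun v : ℝ => (2 * v - a - b) / (a - b)) (2 / (a - b)) v := by
    have := ((((hasDerivAt_id v).const_mul 2).sub_const a).sub_const b).div_const (a - b)
    simpa using this
  have hlt : (2 * v - a - b) / (a - b) < 1 := by rw [div_lt_one hab]; linarith [hv.2]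
  have hgt : -1 < (2 * v - a - b) / (a - b) := by rw [lt_div_iff₀ hab]; linarith [hv.1]
  refine ((Real.hasDerivAt_arcsin hgt.ne' hlt.ne).comp v h1).congr_deriv ?_
  have hp : 0 < (a - v) * (v - b) := mul_pos (by linarith [hv.2]) (by linarith [hv.1])
  have e : 1 - ((2 * v - a - b) / (a - b)) ^ 2 = (2 / (a - b)) ^ 2 * ((a - v) * (v - b)) := by
    field_simp; ring
  rw [e, Real.sqrt_mul (by positivity), Real.sqrt_sq (by positivity)]
  have := (Real.sqrt_pos.2 hp).ne'
  field_simp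

lemma intervalIntegrable_arcsine {a b : ℝ} (hab : b < a) :
    IntervalIntegrable (fun v => 1 / √((a - v) * (v - b))) volume b a := by
  refine intervalIntegral.intervalIntegrable_deriv_of_nonneg
    (g := fun v => Real.arcsin ((2 * v - a - b) / (a - b)))
    (Continuous.continuousOn (Real.continuous_arcsin.comp (by fun_prop)))
    (fun v hv => ?_) fun v _ => by positivity
  rw [min_eq_left hab.le, max_eq_right hab.le] at hv
  exact hasDerivAt_arcsin_affine hv

lemma integral_arcsine {a b : ℝ} (hab : b < a) :
    ∫ v in b..a, 1 / √((a - v) * (v - b)) = Real.pi := by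
  rw [intervalIntegral.integral_eq_sub_of_hasDerivAt_of_le hab.le
    (f := fun v => Real.arcsin ((2 * v - a - b) / (a - b)))
    (Continuous.continuousOn (Real.continuous_arcsin.comp (by fun_prop)))
    (fun v hv => hasDerivAt_arcsin_affine hv) (intervalIntegrable_arcsine hab)]
  have h : a - b ≠ 0 := (sub_pos.2 hab).ne'
  rw [show 2 * a - a - b = a - b by ring, show 2 * b - a - b = -(a - b) by ring, neg_div,
    div_self h, Real.arcsin_one, Real.arcsin_neg, Real.arcsin_one]
  ring

/-! ### Expansions at infinity -/

open PowerSeries in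
/-- The truncations of a formal square root of `B / A` approximate `√(B / A)`. -/
lemma isBigO_trunc_sub_sqrt (n : ℕ) {g : PowerSeries ℝ} {A B : Polynomial ℝ}
    (hg : g * g * (A : PowerSeries ℝ) = (B : PowerSeries ℝ)) (hg0 : coeff 0 g = 1)
    (hA : A.eval 0 = 1) (hB : B.eval 0 = 1) :
    (fun z : ℝ => (trunc (n + 1) g).eval z - √(B.eval z / A.eval z)) =O[𝓝 0] fun z => z ^ (n + 1) := by
  set p := trunc (n + 1) g with hp
  have hdvd : (X : PowerSeries ℝ) ^ (n + 1) ∣ ((p * p * A - B : Polynomial ℝ) : PowerSeries ℝ) := by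
    have h1 : (X : PowerSeries ℝ) ^ (n + 1) ∣ (p : PowerSeries ℝ) - g := by
      rw [X_pow_dvd_iff]
      intro k hk
      rw [map_sub, Polynomial.coeff_coe, hp, coeff_trunc, if_pos hk, sub_self]
    have e : ((p * p * A - B : Polynomial ℝ) : PowerSeries ℝ)
        = ((p : PowerSeries ℝ) - g) * ((p + g) * A) := by
      push_cast
      linear_combination hg
    rw [e]
    exact h1.mul_right _
  have hdvd' : (Polynomial.X : Polynomial ℝ) ^ (n + 1) ∣ p * p * A - B := by
    rw [Polynomial.X_pow_dvd_iff]
    intro k hk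
    rw [← Polynomial.coeff_coe]
    exact X_pow_dvd_iff.1 hdvd k hk
  obtain ⟨r, hr⟩ := hdvd'
  have hp0 : p.eval 0 = 1 := by
    rw [← Polynomial.coeff_zero_eq_eval_zero, hp, coeff_trunc, if_pos (Nat.succ_pos n), hg0]
  have hAc : ContinuousAt (fun z => A.eval z) 0 := A.continuous.continuousAt
  have hBc : ContinuousAt (fun z => B.eval z) 0 := B.continuous.continuousAt
  have hFc : ContinuousAt (fun z => √(B.eval z / A.eval z)) 0 :=
    (hBc.div hAc (by simp only [hA]; norm_num)).sqrt
  have hF0 : √(B.eval 0 / A.eval 0) = 1 := by rw [hA, hB]; simp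
  have hden : ContinuousAt (fun z => p.eval z + √(B.eval z / A.eval z)) 0 :=
    p.continuous.continuousAt.add hFc
  have hG : ContinuousAt (fun z => r.eval z / (A.eval z * (p.eval z + √(B.eval z / A.eval z)))) 0 := by
    refine r.continuous.continuousAt.div (hAc.mul hden) ?_
    rw [hF0, hA, hp0]; norm_num
  have hAne : ∀ᶠ z in 𝓝 (0 : ℝ), 0 < A.eval z :=
    hAc.eventually (lt_mem_nhds (by simp only [hA]; norm_num))
  have hBne : ∀ᶠ z in 𝓝 (0 : ℝ), 0 < B.eval z :=
    hBc.eventually (lt_mem_nhds (by simp only [hB]; norm_num))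
  have hdne : ∀ᶠ z in 𝓝 (0 : ℝ), 0 < p.eval z + √(B.eval z / A.eval z) :=
    hden.eventually (lt_mem_nhds (by simp only [hF0, hp0]; norm_num))
  -- p - √(B/A) = (p²A - B)/(A(p + √(B/A))). The numerator is divisible by z^{n+1}, and the
  -- denominator tends to 2.
  have hEq : (fun z : ℝ => p.eval z - √(B.eval z / A.eval z)) =ᶠ[𝓝 0]
      fun z => z ^ (n + 1) * (r.eval z / (A.eval z * (p.eval z + √(B.eval z / A.eval z)))) := by
    filter_upwards [hAne, hBne, hdne] with z h1 h2 h3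
    have h4 := congrArg (Polynomial.eval z) hr
    simp only [Polynomial.eval_sub, Polynomial.eval_mul, Polynomial.eval_pow, Polynomial.eval_X] at h4
    have h5 : √(B.eval z / A.eval z) * √(B.eval z / A.eval z) = B.eval z / A.eval z :=
      Real.mul_self_sqrt (div_nonneg h2.le h1.le)
    rw [← mul_div_assoc, ← h4, eq_div_iff (mul_pos h1 h3).ne']
    have h6 : A.eval z * (B.eval z / A.eval z) = B.eval z := by field_simp
    linear_combination (-A.eval z) * h5 - h6
  have h := (isBigO_refl (fun z : ℝ => z ^ (n + 1)) (𝓝 0)).mul (hG.tendsto.isBigO_one ℝ)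
  simp only [mul_one] at h
  exact hEq.trans_isBigO h

/-- `√((1 - z) / ((1 - a z)(1 - b z)))` at `z = 1 / ξ`. -/
def sRoot (a b ξ : ℝ) : ℝ := √((1 - ξ⁻¹) / ((1 - a * ξ⁻¹) * (1 - b * ξ⁻¹)))

-- The coefficient of z^n in g/(1 - ξz) is ξ^n times the truncation of g at 1/ξ, whose error is
-- O(ξ^{-n-1}).
open PowerSeries in
lemma isBigO_coeff_sub_sRoot (n : ℕ) (a b : ℝ) :
    (fun ξ : ℝ => coeff n (ratioSeries a * (bin b * geom ξ)) - ξ ^ n * sRoot a b ξ)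
      =O[atTop] fun ξ : ℝ => ξ⁻¹ := by
  set g := ratioSeries a * bin b with hg
  have h := isBigO_trunc_sub_sqrt n (g := g)
    (A := (1 - Polynomial.C a * Polynomial.X) * (1 - Polynomial.C b * Polynomial.X))
    (B := 1 - Polynomial.C 1 * Polynomial.X) (by
      rw [hg]
      push_cast
      unfold ratioSeries
      have h1 := one_sub_mul_bin_mul_bin a
      have h2 := one_sub_mul_bin_mul_bin b
      have h3 := sqrtSeries_mul_self
      linear_combination (sqrtSeries * sqrtSeries * ((1 - C b * X) * bin b * bin b)) * h1
        + sqrtSeries * sqrtSeries * h2 + h3) (by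
      rw [hg, coeff_mul]
      simp [coeff_zero_ratioSeries, coeff_bin, eps_zero])
      (by simp) (by simp)
  have h2 := h.comp_tendsto tendsto_inv_atTop_zero
  have h3 := (isBigO_refl (fun ξ : ℝ => ξ ^ n) atTop).mul h2
  refine (h3.congr' ?_ ?_)
  · filter_upwards [eventually_gt_atTop 0] with ξ hξ
    simp only [Function.comp]
    rw [mul_sub, ← mul_assoc, ← hg, coeff_mul_geom, Polynomial.eval, eval₂_trunc_eq_sum_range,
      Finset.mul_sum]
    congr 1
    · refine Finset.sum_congr rfl fun k hk => ?_
      have hk' := Finset.mem_range.1 hk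
      obtain ⟨l, rfl⟩ : ∃ l, n = k + l := ⟨n - k, by omega⟩
      simp only [RingHom.id_apply, Nat.add_sub_cancel_left]
      rw [pow_add, inv_pow]
      field_simp
    · simp [sRoot]
  · filter_upwards [eventually_gt_atTop 0] with ξ hξ
    simp only [Function.comp]
    rw [inv_pow, pow_succ]
    field_simp

lemma tendsto_sRoot (a b : ℝ) : Tendsto (sRoot a b) atTop (𝓝 1) := by
  have hc : ContinuousAt (fun z : ℝ => √((1 - z) / ((1 - a * z) * (1 - b * z)))) 0 := by
    refine (ContinuousAt.div (by fun_prop) (by fun_prop) ?_).sqrt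
    simp
  have := hc.tendsto.comp tendsto_inv_atTop_zero
  unfold sRoot
  simpa [Function.comp_def] using this

/-! ### Identification of the Whitham polynomials -/

open PowerSeries in
/-- The polynomial with values `hFun j a b`. -/
def hPoly (n : ℕ) (a b : ℝ) : Polynomial ℝ :=
  ∑ k ∈ Finset.range n, Polynomial.C (betaCoeff k a b) * Polynomial.X ^ (n - 1 - k)

lemma eval_hPoly (j : ℕ) (a b ξ : ℝ) : (hPoly (j + 1) a b).eval ξ = hFun j a b ξ := by
  unfold hPoly hFun betaCoeff
  rw [← mul_assoc, coeff_mul_geom, Polynomial.eval_finsetSum]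
  simp

open PowerSeries in
lemma coeff_eq_mul_hPoly (n : ℕ) (a b ξ : ℝ) :
    coeff n (ratioSeries a * (bin b * geom ξ)) = ξ * (hPoly n a b).eval ξ + betaCoeff n a b := by
  rcases n with _ | j
  · simp [hPoly, betaCoeff, constantCoeff_geom]
  · rw [eval_hPoly, ← mul_assoc, coeff_mul_geom_succ]
    unfold hFun betaCoeff
    rw [mul_assoc]

lemma betaCoeff_zero (a b : ℝ) : betaCoeff 0 a b = 1 := by
  unfold betaCoeff
  rw [PowerSeries.coeff_mul]
  simp [coeff_zero_ratioSeries, coeff_bin, eps_zero]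

lemma hPoly_succ (j : ℕ) (a b : ℝ) : ∃ p : Polynomial ℝ, p.degree < j ∧
    hPoly (j + 1) a b = Polynomial.X ^ j + p := by
  refine ⟨∑ k ∈ Finset.range j, Polynomial.C (betaCoeff (k + 1) a b) * Polynomial.X ^ (j - (k + 1)),
    ?_, ?_⟩
  · refine (Polynomial.degree_sum_le _ _).trans_lt ?_
    rw [Finset.sup_lt_iff (by exact WithBot.bot_lt_coe j)]
    intro k hk
    refine (Polynomial.degree_C_mul_X_pow_le _ _).trans_lt ?_
    have := Finset.mem_range.1 hk
    exact_mod_cast (by omega : j - (k + 1) < j)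
  · unfold hPoly
    rw [Finset.sum_range_succ']
    simp [betaCoeff_zero, add_comm]

/-- The general form of the polynomials `P_n(ξ, 1, a, b)`. -/
def whithamForm (n : ℕ) (a b κ l : ℝ) : Polynomial ℝ :=
  (Polynomial.X - Polynomial.C a) * (Polynomial.X - Polynomial.C b) * hPoly n a b
    + (Polynomial.C (betaCoeff n a b) * (Polynomial.X - Polynomial.C κ) + Polynomial.C l)

lemma eval_whithamForm (n : ℕ) (a b κ l ξ : ℝ) : (whithamForm n a b κ l).eval ξ
    = (ξ - a) * (ξ - b) * (hPoly n a b).eval ξ + (betaCoeff n a b * (ξ - κ) + l) := by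
  simp [whithamForm]

lemma whithamForm_monic_natDegree (n : ℕ) (a b κ l : ℝ) :
    (whithamForm n a b κ l).Monic ∧ (whithamForm n a b κ l).natDegree = n + 1 := by
  rcases n with _ | j
  · have : whithamForm 0 a b κ l = Polynomial.X + Polynomial.C (l - κ) := by
      unfold whithamForm hPoly
      rw [betaCoeff_zero]
      simp; ring
    rw [this]
    exact ⟨Polynomial.monic_X_add_C _, Polynomial.natDegree_X_add_C _⟩
  · obtain ⟨p, hp, he⟩ := hPoly_succ j a b
    have hm : (hPoly (j + 1) a b).Monic := by rw [he]; exact Polynomial.monic_X_pow_add hp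
    have hd : (hPoly (j + 1) a b).natDegree = j := by
      rw [he]
      rw [Polynomial.natDegree_add_eq_left_of_degree_lt, Polynomial.natDegree_X_pow]
      rwa [Polynomial.degree_X_pow]
    have hab : ((Polynomial.X - Polynomial.C a) * (Polynomial.X - Polynomial.C b)).Monic :=
      (Polynomial.monic_X_sub_C a).mul (Polynomial.monic_X_sub_C b)
    have hM : ((Polynomial.X - Polynomial.C a) * (Polynomial.X - Polynomial.C b)
        * hPoly (j + 1) a b).Monic := hab.mul hm
    have hD : ((Polynomial.X - Polynomial.C a) * (Polynomial.X - Polynomial.C b)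
        * hPoly (j + 1) a b).natDegree = j + 2 := by
      rw [hab.natDegree_mul hm, (Polynomial.monic_X_sub_C a).natDegree_mul
        (Polynomial.monic_X_sub_C b), Polynomial.natDegree_X_sub_C, Polynomial.natDegree_X_sub_C, hd]
      ring
    have hlow : (Polynomial.C (betaCoeff (j + 1) a b) * (Polynomial.X - Polynomial.C κ)
        + Polynomial.C l).degree < ((Polynomial.X - Polynomial.C a) * (Polynomial.X - Polynomial.C b)
        * hPoly (j + 1) a b).degree := by
      rw [Polynomial.degree_eq_natDegree hM.ne_zero, hD]
      have h1 : (Polynomial.C (betaCoeff (j + 1) a b) * (Polynomial.X - Polynomial.C κ)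
        + Polynomial.C l).natDegree ≤ 1 := by compute_degree
      refine (Polynomial.degree_le_of_natDegree_le h1).trans_lt ?_
      exact_mod_cast (by omega : 1 < j + 2)
    exact ⟨hM.add_of_left hlow, by
      unfold whithamForm; rw [Polynomial.natDegree_add_eq_left_of_degree_lt hlow, hD]⟩

/-- The root of the radicand is ξ^{3/2}(1 - a/ξ)(1 - b/ξ)S with S = `sRoot a b ξ`, and ξ `hPoly` + β
equals ξ^n S up to O(1/ξ), where β = `betaCoeff n a b`. What is left of the numerator is O(1), so κ
and l only enter the error O(ξ^{-3/2}). -/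
lemma isBigO_whithamForm (n : ℕ) {a b : ℝ} (ha : a < 1) (hb : b < 1) (κ l : ℝ) :
    (fun ξ : ℝ => (whithamForm n a b κ l).eval ξ / √((ξ - 1) * (ξ - a) * (ξ - b))
      - ξ ^ ((n : ℝ) - 1 / 2)) =O[atTop] fun ξ : ℝ => ξ ^ (-(3 / 2) : ℝ) := by
  set E : ℝ → ℝ := fun ξ => PowerSeries.coeff n (ratioSeries a * (bin b * geom ξ))
    - ξ ^ n * sRoot a b ξ with hE
  have hEO : (fun ξ : ℝ => ξ * E ξ) =O[atTop] fun _ => (1 : ℝ) := by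
    have h := (isBigO_refl (fun ξ : ℝ => ξ) atTop).mul (isBigO_coeff_sub_sRoot n a b)
    refine h.congr' (by rfl) ?_
    filter_upwards [eventually_gt_atTop 0] with ξ hξ
    exact mul_inv_cancel₀ hξ.ne'
  have hSinv : (fun ξ => 1 / sRoot a b ξ) =O[atTop] fun _ => (1 : ℝ) :=
    ((tendsto_const_nhds.div (tendsto_sRoot a b) one_ne_zero).isBigO_one ℝ)
  have hz : ∀ {G : ℝ → ℝ}, ContinuousAt G 0 → (fun ξ : ℝ => G ξ⁻¹) =O[atTop] fun _ => (1 : ℝ) :=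
    fun {G} hG => (hG.tendsto.comp tendsto_inv_atTop_zero).isBigO_one ℝ
  have h1 : (fun ξ : ℝ => ((a + b) - a * b * ξ⁻¹) / ((1 - a * ξ⁻¹) * (1 - b * ξ⁻¹)))
      =O[atTop] fun _ => (1 : ℝ) :=
    hz (G := fun z => ((a + b) - a * b * z) / ((1 - a * z) * (1 - b * z)))
      (ContinuousAt.div (by fun_prop) (by fun_prop) (by simp))
  have h2 : (fun ξ : ℝ => 1 / ((1 - a * ξ⁻¹) * (1 - b * ξ⁻¹))) =O[atTop] fun _ => (1 : ℝ) :=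
    hz (G := fun z => 1 / ((1 - a * z) * (1 - b * z)))
      (ContinuousAt.div (by fun_prop) (by fun_prop) (by simp))
  have hsum := ((hEO.mul hSinv).add ((h1.const_mul_left (betaCoeff n a b)).mul hSinv)).add
    ((h2.const_mul_left (l - betaCoeff n a b * κ)).mul hSinv)
  have htot := (isBigO_refl (fun ξ : ℝ => ξ ^ (-(3 / 2) : ℝ)) atTop).mul
    (hsum.trans (isBigO_of_le _ (g := fun _ => (1 : ℝ)) (by simp)))
  refine htot.congr' ?_ (by simp)
  filter_upwards [eventually_gt_atTop 1] with ξ hξ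
  have hξ0 : 0 < ξ := by linarith
  have hA : 0 < 1 - a * ξ⁻¹ := by
    rw [sub_pos, ← div_eq_mul_inv, div_lt_one hξ0]; linarith
  have hB : 0 < 1 - b * ξ⁻¹ := by
    rw [sub_pos, ← div_eq_mul_inv, div_lt_one hξ0]; linarith
  have h1' : 0 < 1 - ξ⁻¹ := by
    rw [sub_pos, inv_lt_one₀ hξ0]; exact hξ
  set S := sRoot a b ξ with hS
  have hSpos : 0 < S := Real.sqrt_pos.2 (div_pos h1' (mul_pos hA hB))
  have hsq : √ξ * √ξ = ξ := Real.mul_self_sqrt hξ0.le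
  have hsqpos : 0 < √ξ := Real.sqrt_pos.2 hξ0
  have hR : √((ξ - 1) * (ξ - a) * (ξ - b)) = ξ * √ξ * ((1 - a * ξ⁻¹) * (1 - b * ξ⁻¹)) * S := by
    have hS2 : S ^ 2 = (1 - ξ⁻¹) / ((1 - a * ξ⁻¹) * (1 - b * ξ⁻¹)) :=
      Real.sq_sqrt (div_pos h1' (mul_pos hA hB)).le
    rw [Real.sqrt_eq_iff_mul_self_eq (by
      have := sub_pos.2 hξ
      exact mul_nonneg (mul_nonneg this.le (by linarith)) (by linarith)) (by positivity)]
    have e : ξ * √ξ * ((1 - a * ξ⁻¹) * (1 - b * ξ⁻¹)) * S * (ξ * √ξ * ((1 - a * ξ⁻¹) * (1 - b * ξ⁻¹)) * S)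
      = ξ ^ 2 * (√ξ * √ξ) * ((1 - a * ξ⁻¹) * (1 - b * ξ⁻¹)) ^ 2 * S ^ 2 := by ring
    rw [e, hS2, hsq]
    field_simp
  have hT : PowerSeries.coeff n (ratioSeries a * (bin b * geom ξ))
      = ξ * (hPoly n a b).eval ξ + betaCoeff n a b := coeff_eq_mul_hPoly n a b ξ
  have hp1 : ξ ^ ((n : ℝ) - 1 / 2) = ξ ^ n / √ξ := by
    rw [Real.rpow_sub hξ0, Real.rpow_natCast, Real.sqrt_eq_rpow]
  have hp2 : ξ ^ (-(3 / 2) : ℝ) = 1 / (ξ * √ξ) := by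
    rw [Real.rpow_neg hξ0.le, show (3 / 2 : ℝ) = 1 + 1 / 2 by norm_num, Real.rpow_add hξ0,
      Real.rpow_one, Real.sqrt_eq_rpow]
    exact (one_div _).symm
  have hEe : E ξ = ξ * (hPoly n a b).eval ξ + betaCoeff n a b - ξ ^ n * S := by
    rw [hE, ← hT]
  rw [hEe, hp1, hp2, hR, eval_whithamForm]
  have hAB1 : ξ - a ≠ 0 := by linarith
  have hAB2 : ξ - b ≠ 0 := by linarith
  have e1 : 1 - a * ξ⁻¹ = (ξ - a) / ξ := by field_simp
  have e2 : 1 - b * ξ⁻¹ = (ξ - b) / ξ := by field_simp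
  have e3 : a + b - a * b * ξ⁻¹ = ((a + b) * ξ - a * b) / ξ := by field_simp
  rw [e1, e2, e3]
  field_simp
  ring

lemma isWhithamPoly_whithamForm (n : ℕ) {a b κ l : ℝ} (ha : a < 1) (hb : b < 1)
    (h1 : b < a → ∫ ξ in b..a, (whithamForm n a b κ l).eval ξ / √((ξ - 1) * (ξ - a) * (ξ - b)) = 0)
    (h2 : a = b → (whithamForm n a b κ l).eval b = 0) :
    KdVHierarchy.IsWhithamPoly n 1 a b (whithamForm n a b κ l) :=
  ⟨(whithamForm_monic_natDegree n a b κ l).1, (whithamForm_monic_natDegree n a b κ l).2,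
    isBigO_whithamForm n ha hb κ l, h1, h2⟩

lemma sqrt_radicand {a b v : ℝ} (ha : a < 1) (hv : v ∈ Set.Ioo b a) :
    √((v - 1) * (v - a) * (v - b)) = √(1 - v) * √((a - v) * (v - b)) := by
  rw [← Real.sqrt_mul (by linarith [hv.2])]
  congr 1; ring

lemma intervalIntegral_congr_Ioo {f g : ℝ → ℝ} {a b : ℝ} (hab : b ≤ a)
    (h : ∀ v ∈ Set.Ioo b a, f v = g v) : ∫ v in b..a, f v = ∫ v in b..a, g v := by
  rw [intervalIntegral.integral_of_le hab, intervalIntegral.integral_of_le hab,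
    integral_Ioc_eq_integral_Ioo, integral_Ioc_eq_integral_Ioo]
  exact setIntegral_congr_fun measurableSet_Ioo h

lemma intervalIntegrable_congr_Ioo {f g : ℝ → ℝ} {a b : ℝ} (hab : b ≤ a)
    (h : ∀ v ∈ Set.Ioo b a, f v = g v) (hf : IntervalIntegrable f volume b a) :
    IntervalIntegrable g volume b a := by
  rw [intervalIntegrable_iff_integrableOn_Ioo_of_le hab] at hf ⊢
  exact hf.congr_fun h measurableSet_Ioo

lemma intervalIntegrable_div_radicand {a b : ℝ} (hab : b < a) (ha : a < 1) {g : ℝ → ℝ}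
    (hg : Continuous g) :
    IntervalIntegrable (fun v => g v / √((v - 1) * (v - a) * (v - b))) volume b a := by
  have hc : ContinuousOn (fun v => g v / √(1 - v)) (Set.uIcc b a) := by
    rw [Set.uIcc_of_le hab.le]
    exact hg.continuousOn.div (by fun_prop) fun v hv => (Real.sqrt_pos.2 (by linarith [hv.2])).ne'
  refine intervalIntegrable_congr_Ioo hab.le (fun v hv => ?_)
    ((intervalIntegrable_arcsine hab).continuousOn_mul hc)
  rw [sqrt_radicand ha hv]
  field_simp

lemma integral_div_radicand_pos {a b : ℝ} (hab : b < a) (ha : a < 1) {g : ℝ → ℝ}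
    (hg : Continuous g) (h : ∀ v ∈ Set.Ioo b a, 0 < g v) :
    0 < ∫ v in b..a, g v / √((v - 1) * (v - a) * (v - b)) := by
  refine intervalIntegral.intervalIntegral_pos_of_pos_on
    (intervalIntegrable_div_radicand hab ha hg) (fun v hv => div_pos (h v hv) ?_) hab
  rw [sqrt_radicand ha hv]
  exact mul_pos (Real.sqrt_pos.2 (by linarith [hv.2]))
    (Real.sqrt_pos.2 (mul_pos (by linarith [hv.2]) (by linarith [hv.1])))

/-- The expansion determines P up to O(ξ^{-3/2} ξ^{3/2}) = O(1), that is up to a constant. The loop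
condition, whose weight has positive mass, or the value condition at b = a removes the constant. -/
lemma isWhithamPoly_unique {n : ℕ} {a b : ℝ} (hab : b ≤ a) (ha : a < 1) {P Q : Polynomial ℝ}
    (hP : KdVHierarchy.IsWhithamPoly n 1 a b P) (hQ : KdVHierarchy.IsWhithamPoly n 1 a b Q) :
    P = Q := by
  obtain ⟨-, -, hP3, hP4, hP5⟩ := hP
  obtain ⟨-, -, hQ3, hQ4, hQ5⟩ := hQ
  have hdiff := hP3.sub hQ3
  have hsq : (fun ξ : ℝ => √((ξ - 1) * (ξ - a) * (ξ - b))) =O[atTop] fun ξ => ξ ^ (3 / 2 : ℝ) := by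
    have hc : ContinuousAt (fun z : ℝ => √((1 - z) * (1 - a * z) * (1 - b * z))) 0 := by fun_prop
    have h := (isBigO_refl (fun ξ : ℝ => ξ ^ (3 / 2 : ℝ)) atTop).mul
      ((hc.tendsto.comp tendsto_inv_atTop_zero).isBigO_one ℝ)
    refine h.congr' ?_ (by simp)
    filter_upwards [eventually_gt_atTop 0] with ξ hξ
    simp only [Function.comp]
    rw [show (ξ - 1) * (ξ - a) * (ξ - b)
      = (ξ ^ (3 / 2 : ℝ)) ^ 2 * ((1 - ξ⁻¹) * (1 - a * ξ⁻¹) * (1 - b * ξ⁻¹)) by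
        rw [← Real.rpow_natCast, ← Real.rpow_mul hξ.le]
        norm_num
        field_simp]
    rw [Real.sqrt_mul (sq_nonneg _), Real.sqrt_sq (Real.rpow_nonneg hξ.le _)]
  have hO : (fun ξ : ℝ => (P - Q).eval ξ) =O[atTop] fun _ => (1 : ℝ) := by
    refine (hdiff.mul hsq).congr' ?_ ?_
    · filter_upwards [eventually_gt_atTop 1] with ξ hξ
      have : 0 < √((ξ - 1) * (ξ - a) * (ξ - b)) := Real.sqrt_pos.2
        (mul_pos (mul_pos (by linarith) (by linarith)) (by linarith))
      rw [Polynomial.eval_sub]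
      field_simp
      ring
    · filter_upwards [eventually_gt_atTop 1] with ξ hξ
      rw [← Real.rpow_add (by linarith)]; norm_num
  have hdeg : (P - Q).degree ≤ 0 := by
    rw [← Polynomial.isBoundedUnder_abs_atTop_iff]
    have := (isBigO_one_iff ℝ).1 hO
    simpa using this
  have hconst := Polynomial.eq_C_of_degree_le_zero hdeg
  set d := (P - Q).coeff 0 with hd
  have hPe : ∀ ξ, P.eval ξ = Q.eval ξ + d := fun ξ => by
    have := congrArg (Polynomial.eval ξ) hconst
    simp at this; linarith
  have hd0 : d = 0 := by
    rcases hab.eq_or_lt with h | h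
    · have h1 := hP5 h.symm
      have h2 := hQ5 h.symm
      rw [hPe, h2] at h1
      linarith
    · have h1 := hP4 h
      have h2 := hQ4 h
      have e : ∀ ξ, P.eval ξ / √((ξ - 1) * (ξ - a) * (ξ - b))
          = Q.eval ξ / √((ξ - 1) * (ξ - a) * (ξ - b)) + d * (1 / √((ξ - 1) * (ξ - a) * (ξ - b))) := by
        intro ξ; rw [hPe]; ring
      simp only [e] at h1
      rw [intervalIntegral.integral_add (intervalIntegrable_div_radicand h ha Q.continuous)
        ((intervalIntegrable_div_radicand h ha continuous_const).const_mul d), h2,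
        intervalIntegral.integral_const_mul, zero_add] at h1
      exact (mul_eq_zero.1 h1).resolve_right
        (integral_div_radicand_pos h ha continuous_const fun _ _ => one_pos).ne'
  rw [hd0, map_zero] at hconst
  exact sub_eq_zero.1 hconst

lemma whithamPoly_eq {n : ℕ} {a b : ℝ} (hab : b ≤ a) (ha : a < 1) {P : Polynomial ℝ}
    (hP : KdVHierarchy.IsWhithamPoly n 1 a b P) : KdVHierarchy.whithamPoly n 1 a b = P :=
  isWhithamPoly_unique hab ha (Classical.epsilon_spec (p := KdVHierarchy.IsWhithamPoly n 1 a b) ⟨P, hP⟩) hP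

end

end StepData

/-! ### The Whitham speeds in terms of loop integrals. -/

namespace StepData

open MeasureTheory Filter Asymptotics Topology

noncomputable section

/-! ### The Whitham speeds -/

/-- The total mass of `1 / √R` on `(b, a)`. -/
def loopMass (a b : ℝ) : ℝ := ∫ v in b..a, 1 / √((v - 1) * (v - a) * (v - b))

/-- The centre of mass of `1 / √R` on `(b, a)`. -/
def loopCenter (a b : ℝ) : ℝ :=
  (∫ v in b..a, v / √((v - 1) * (v - a) * (v - b))) / loopMass a b

/-- The normalized loop integral. -/
def loopMult (j : ℕ) (a b : ℝ) : ℝ := loopInt j a b / loopMass a b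

lemma loopMass_pos {a b : ℝ} (hab : b < a) (ha : a < 1) : 0 < loopMass a b :=
  integral_div_radicand_pos hab ha continuous_const fun _ _ => one_pos

lemma integral_sub_center {a b : ℝ} (hab : b < a) (ha : a < 1) (y : ℝ) :
    ∫ v in b..a, (v - y) / √((v - 1) * (v - a) * (v - b)) = loopMass a b * (loopCenter a b - y) := by
  have h1 := intervalIntegrable_div_radicand hab ha continuous_id
  have h2 := intervalIntegrable_div_radicand hab ha (g := fun _ => (1 : ℝ)) continuous_const
  have e : ∀ v, (v - y) / √((v - 1) * (v - a) * (v - b))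
      = id v / √((v - 1) * (v - a) * (v - b)) - y * (1 / √((v - 1) * (v - a) * (v - b))) := by
    intro v; simp only [id]; ring
  simp only [e]
  rw [intervalIntegral.integral_sub h1 (h2.const_mul y), intervalIntegral.integral_const_mul]
  unfold loopCenter
  have := (loopMass_pos hab ha).ne'
  rw [mul_sub, mul_div_cancel₀ _ this]
  simp only [id, loopMass]
  ring

lemma loopCenter_mem {a b : ℝ} (hab : b < a) (ha : a < 1) : loopCenter a b ∈ Set.Ioo b a := by
  have hI := loopMass_pos hab ha
  have h1 := integral_div_radicand_pos hab ha (g := fun v => v - b) (by fun_prop)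
    fun v hv => by linarith [hv.1]
  have h2 := integral_div_radicand_pos hab ha (g := fun v => a - v) (by fun_prop)
    fun v hv => by linarith [hv.2]
  have e : ∀ v, (a - v) / √((v - 1) * (v - a) * (v - b))
      = -((v - a) / √((v - 1) * (v - a) * (v - b))) := fun v => by ring
  simp only [e] at h2
  rw [intervalIntegral.integral_neg, integral_sub_center hab ha] at h2
  rw [integral_sub_center hab ha] at h1
  constructor
  · have := pos_of_mul_pos_right h1 hI.le
    linarith
  · have : 0 < loopMass a b * (a - loopCenter a b) := by linarith
    have := pos_of_mul_pos_right this hI.le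
    linarith

/-- In the gap (v - a)(v - b) is minus the square of √((a - v)(v - b)). -/
lemma integral_quadratic_hPoly (j : ℕ) {a b : ℝ} (hab : b < a) (ha : a < 1) :
    ∫ v in b..a, ((v - a) * (v - b) * hFun j a b v) / √((v - 1) * (v - a) * (v - b))
      = -loopInt j a b := by
  unfold loopInt
  rw [← intervalIntegral.integral_neg]
  refine intervalIntegral_congr_Ioo hab.le fun v hv => ?_
  rw [sqrt_radicand ha hv]
  have h1 : 0 < √(1 - v) := Real.sqrt_pos.2 (by linarith [hv.2])
  have h0 : 0 < (a - v) * (v - b) := mul_pos (by linarith [hv.2]) (by linarith [hv.1])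
  have h2 : 0 < √((a - v) * (v - b)) := Real.sqrt_pos.2 h0
  have h3 : √((a - v) * (v - b)) ^ 2 = (a - v) * (v - b) := Real.sq_sqrt h0.le
  generalize √((a - v) * (v - b)) = S at h2 h3 ⊢
  rw [div_eq_iff (by positivity)]
  field_simp
  linear_combination hFun j a b v * h3

lemma whithamPoly_zero_eq {a b : ℝ} (hab : b < a) (ha : a < 1) :
    KdVHierarchy.whithamPoly 0 1 a b = whithamForm 0 a b (loopCenter a b) 0 := by
  refine whithamPoly_eq hab.le ha (isWhithamPoly_whithamForm 0 ha (hab.trans ha) (fun _ => ?_)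
    fun h => absurd h hab.ne')
  have e : ∀ v, (whithamForm 0 a b (loopCenter a b) 0).eval v = v - loopCenter a b := fun v => by
    rw [eval_whithamForm, betaCoeff_zero]; simp [hPoly]
  simp only [e]
  rw [integral_sub_center hab ha, sub_self, mul_zero]

lemma eval_whithamPoly_zero {a b : ℝ} (hab : b < a) (ha : a < 1) (ξ : ℝ) :
    (KdVHierarchy.whithamPoly 0 1 a b).eval ξ = ξ - loopCenter a b := by
  rw [whithamPoly_zero_eq hab ha, eval_whithamForm, betaCoeff_zero]; simp [hPoly]

/-- The loop condition fixes the free constants of `whithamForm`: with κ the centre of mass the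
linear term integrates to zero, and l = `loopMult` compensates the loop integral of the quadratic
term. -/
lemma eval_whithamPoly_succ (j : ℕ) {a b : ℝ} (hab : b < a) (ha : a < 1) (ξ : ℝ) :
    (KdVHierarchy.whithamPoly (j + 1) 1 a b).eval ξ = (ξ - a) * (ξ - b) * hFun j a b ξ
      + (betaCoeff (j + 1) a b * (ξ - loopCenter a b) + loopMult j a b) := by
  have key : KdVHierarchy.whithamPoly (j + 1) 1 a b
      = whithamForm (j + 1) a b (loopCenter a b) (loopMult j a b) := by
    refine whithamPoly_eq hab.le ha (isWhithamPoly_whithamForm _ ha (hab.trans ha) (fun _ => ?_)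
      fun h => absurd h hab.ne')
    simp only [eval_whithamForm, eval_hPoly]
    have hc := continuous_hFun_right j a b
    have i1 := intervalIntegrable_div_radicand hab ha
      (g := fun v => (v - a) * (v - b) * hFun j a b v) (by fun_prop)
    have i2 := intervalIntegrable_div_radicand hab ha
      (g := fun v => v - loopCenter a b) (by fun_prop)
    have i3 := intervalIntegrable_div_radicand hab ha (g := fun _ => (1 : ℝ)) continuous_const
    have e : ∀ v, ((v - a) * (v - b) * hFun j a b v + (betaCoeff (j + 1) a b * (v - loopCenter a b)
        + loopMult j a b)) / √((v - 1) * (v - a) * (v - b))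
        = ((v - a) * (v - b) * hFun j a b v) / √((v - 1) * (v - a) * (v - b))
        + (betaCoeff (j + 1) a b * ((v - loopCenter a b) / √((v - 1) * (v - a) * (v - b)))
        + loopMult j a b * (1 / √((v - 1) * (v - a) * (v - b)))) := fun v => by ring
    simp only [e]
    rw [intervalIntegral.integral_add i1 ((i2.const_mul _).add (i3.const_mul _)),
      intervalIntegral.integral_add (i2.const_mul _) (i3.const_mul _),
      intervalIntegral.integral_const_mul, intervalIntegral.integral_const_mul,
      integral_quadratic_hPoly j hab ha, integral_sub_center hab ha, sub_self]
    have := (loopMass_pos hab ha).ne'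
    unfold loopMult
    change -loopInt j a b + (_ + loopInt j a b / loopMass a b * loopMass a b) = 0
    field_simp
    ring
  rw [key, eval_whithamForm, eval_hPoly]

lemma mu₂_eq (j : ℕ) {a b : ℝ} (hab : b < a) (ha : a < 1) :
    KdVHierarchy.mu₂ (j + 1) 1 a b = 4 ^ (j + 1) * (2 * ((j + 1 : ℕ) : ℝ) + 1) *
      (betaCoeff (j + 1) a b + loopMult j a b / (a - loopCenter a b)) := by
  have h := loopCenter_mem hab ha
  have hne : a - loopCenter a b ≠ 0 := by linarith [h.2]
  unfold KdVHierarchy.mu₂ KdVHierarchy.speedAt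
  rw [eval_whithamPoly_zero hab ha, if_neg hne, eval_whithamPoly_succ j hab ha]
  congr 1
  field_simp
  ring

lemma mu₃_eq (j : ℕ) {a b : ℝ} (hab : b < a) (ha : a < 1) :
    KdVHierarchy.mu₃ (j + 1) 1 a b = 4 ^ (j + 1) * (2 * ((j + 1 : ℕ) : ℝ) + 1) *
      (betaCoeff (j + 1) a b + loopMult j a b / (b - loopCenter a b)) := by
  have h := loopCenter_mem hab ha
  have hne : b - loopCenter a b ≠ 0 := by linarith [h.1]
  unfold KdVHierarchy.mu₃ KdVHierarchy.speedAt
  rw [eval_whithamPoly_zero hab ha, if_neg hne, eval_whithamPoly_succ j hab ha]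
  congr 1
  field_simp
  ring

/-- Both speeds have the same first term and differ by `loopMult` divided by a, respectively b,
minus the centre. The centre lies strictly between b and a, so the two denominators have opposite
signs. -/
lemma mu₂_eq_mu₃_iff (j : ℕ) {a b : ℝ} (hab : b < a) (ha : a < 1) :
    KdVHierarchy.mu₂ (j + 1) 1 a b = KdVHierarchy.mu₃ (j + 1) 1 a b ↔ loopInt j a b = 0 := by
  have h := loopCenter_mem hab ha
  rw [mu₂_eq j hab ha, mu₃_eq j hab ha]
  have h1 : 0 < a - loopCenter a b := by linarith [h.2]
  have h2 : b - loopCenter a b < 0 := by linarith [h.1]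
  have hc : (4 : ℝ) ^ (j + 1) * (2 * ((j + 1 : ℕ) : ℝ) + 1) ≠ 0 := by positivity
  have hM := loopMass_pos hab ha
  constructor
  · intro e
    have e1 := add_left_cancel (mul_left_cancel₀ hc e)
    have h3 : loopMult j a b = 0 := by
      by_contra hne
      rw [div_eq_div_iff h1.ne' h2.ne] at e1
      have := mul_left_cancel₀ hne e1
      linarith
    unfold loopMult at h3
    exact (div_eq_zero_iff.1 h3).resolve_right hM.ne'
  · intro e
    simp [loopMult, e]

lemma isTransitionPoint_iff (j : ℕ) (u : ℝ) :
    KdVHierarchy.IsTransitionPoint (j + 1) u ↔ 0 < u ∧ u < 1 ∧ loopHat j u 0 = 0 := by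
  unfold KdVHierarchy.IsTransitionPoint
  refine and_congr_right fun h0 => and_congr_right fun h1 => ?_
  rw [sub_eq_zero, mu₂_eq_mu₃_iff j h0 h1, loopInt_eq_zero_iff j h0]

lemma mu₂_eq_of_loopInt_eq_zero {j : ℕ} {a b : ℝ} (hab : b < a) (ha : a < 1)
    (h : loopInt j a b = 0) : KdVHierarchy.mu₂ (j + 1) 1 a b
      = 4 ^ (j + 1) * (2 * ((j + 1 : ℕ) : ℝ) + 1) * betaCoeff (j + 1) a b := by
  rw [mu₂_eq j hab ha, loopMult, h]; simp

lemma solvesInner_iff (j : ℕ) {x t : ℝ} (ht : 0 < t) (a b : ℝ) :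
    KdVHierarchy.SolvesInner (j + 1) x t a b ↔ 0 < b ∧ b < a ∧ a < 1 ∧ loopInt j a b = 0 ∧
      x = 4 ^ (j + 1) * (2 * ((j + 1 : ℕ) : ℝ) + 1) * betaCoeff (j + 1) a b * t := by
  unfold KdVHierarchy.SolvesInner
  refine and_congr_right fun h0 => and_congr_right fun hab => and_congr_right fun h1 => ?_
  constructor
  · rintro ⟨e1, e2⟩
    have h : loopInt j a b = 0 :=
      (mu₂_eq_mu₃_iff j hab h1).1 (mul_right_cancel₀ ht.ne' (e1.symm.trans e2))
    exact ⟨h, by rw [e1, mu₂_eq_of_loopInt_eq_zero hab h1 h]⟩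
  · rintro ⟨h, e⟩
    have h2 := (mu₂_eq_mu₃_iff j hab h1).2 h
    refine ⟨?_, ?_⟩
    · rw [e, mu₂_eq_of_loopInt_eq_zero hab h1 h]
    · rw [← h2, e, mu₂_eq_of_loopInt_eq_zero hab h1 h]

/-! ### Coinciding branch points -/

/-- The polynomial part `[z^n] √(1 - z) (1 - ξ z)^{-1}` of the density on a single band. -/
def bandFun (n : ℕ) (ξ : ℝ) : ℝ := PowerSeries.coeff n (sqrtSeries * geom ξ)

/-- Division of a polynomial in ξ by ξ - u: the quotient is `hFun j u u ξ` by partial fractions, and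
the remainder is the value at u. -/
lemma bandFun_eq (j : ℕ) (u ξ : ℝ) :
    bandFun (j + 1) ξ = (ξ - u) * hFun j u u ξ + betaCoeff (j + 1) u u := by
  unfold bandFun hFun betaCoeff ratioSeries
  rw [show sqrtSeries * bin u * (bin u * geom ξ) = sqrtSeries * (geom u * geom ξ) from by
    rw [← bin_mul_bin u]; ring,
    show sqrtSeries * bin u * bin u = sqrtSeries * geom u from by rw [← bin_mul_bin]; ring]
  have h1 := one_sub_mul_geom u
  have h2 := one_sub_mul_geom ξ
  have key : sqrtSeries * geom ξ - sqrtSeries * geom u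
      = PowerSeries.C (ξ - u) * (PowerSeries.X * (sqrtSeries * (geom u * geom ξ))) := by
    rw [map_sub]
    linear_combination (-sqrtSeries * geom ξ) * h1 + (sqrtSeries * geom u) * h2
  have := congrArg (PowerSeries.coeff (j + 1)) key
  rw [map_sub, PowerSeries.coeff_C_mul, PowerSeries.coeff_succ_X_mul] at this
  linarith

lemma betaCoeff_diag (j : ℕ) (u : ℝ) : betaCoeff (j + 1) u u = bandFun (j + 1) u := by
  rw [bandFun_eq j u u]; ring

lemma eval_whithamPoly_diag (j : ℕ) {u : ℝ} (hu : u < 1) (ξ : ℝ) :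
    (KdVHierarchy.whithamPoly (j + 1) 1 u u).eval ξ = (ξ - u) * bandFun (j + 1) ξ := by
  rw [whithamPoly_eq le_rfl hu (isWhithamPoly_whithamForm (j + 1) (κ := u) (l := 0) hu hu
    (fun h => absurd h (lt_irrefl _)) fun _ => by rw [eval_whithamForm]; ring),
    eval_whithamForm, eval_hPoly, bandFun_eq j u]
  ring

lemma mu₂_diag (j : ℕ) {u : ℝ} (hu : u < 1) : KdVHierarchy.mu₂ (j + 1) 1 u u
    = 4 ^ (j + 1) * (2 * ((j + 1 : ℕ) : ℝ) + 1) * bandFun (j + 1) u := by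
  have e1 : KdVHierarchy.whithamPoly (j + 1) 1 u u = whithamForm (j + 1) u u u 0 :=
    whithamPoly_eq le_rfl hu (isWhithamPoly_whithamForm (j + 1) (κ := u) (l := 0) hu hu
      (fun h => absurd h (lt_irrefl _)) fun _ => by rw [eval_whithamForm]; ring)
  have e0 : KdVHierarchy.whithamPoly 0 1 u u = whithamForm 0 u u u 0 :=
    whithamPoly_eq le_rfl hu (isWhithamPoly_whithamForm 0 (κ := u) (l := 0) hu hu
      (fun h => absurd h (lt_irrefl _)) fun _ => by rw [eval_whithamForm]; ring)
  unfold KdVHierarchy.mu₂ KdVHierarchy.speedAt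
  rw [e1, e0, if_pos (by rw [eval_whithamForm]; ring)]
  -- Here P_0 vanishes at u, so the derivative quotient applies; the double zero of (ξ - u)² leaves
  -- only the slope of the linear part.
  have d : ∀ n, (whithamForm n u u u 0).derivative.eval u = betaCoeff n u u := fun n => by
    simp [whithamForm]
  rw [d, d, betaCoeff_zero, div_one, betaCoeff_diag]

/-! ### The outer speed -/

lemma intervalIntegrable_outerWeight {a : ℝ} (ha1 : a ≤ 1) :
    IntervalIntegrable (fun s => √(1 - s) / √(s * (1 - a * s))) volume 0 1 ∧
    (∀ s ∈ Set.Ioo (0 : ℝ) 1, ‖√(1 - s) / √(s * (1 - a * s))‖ ≤ s ^ (-(1 / 2) : ℝ)) := by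
  have hb : ∀ s ∈ Set.Ioo (0 : ℝ) 1, ‖√(1 - s) / √(s * (1 - a * s))‖ ≤ s ^ (-(1 / 2) : ℝ) := by
    intro s hs
    have hle : 1 - s ≤ 1 - a * s := by nlinarith [hs.1]
    have h1 : 0 < √(1 - a * s) := Real.sqrt_pos.2 (by linarith [hs.2])
    have h2 : 0 < √s := Real.sqrt_pos.2 hs.1
    rw [Real.norm_of_nonneg (by positivity), Real.sqrt_mul hs.1.le, Real.rpow_neg hs.1.le,
      ← Real.sqrt_eq_rpow, div_le_iff₀ (by positivity)]
    have := Real.sqrt_le_sqrt hle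
    field_simp
    rwa [mul_comm s a]
  refine ⟨?_, hb⟩
  have hi : IntervalIntegrable (fun s : ℝ => s ^ (-(1 / 2) : ℝ)) volume 0 1 :=
    intervalIntegral.intervalIntegrable_rpow' (by norm_num)
  rw [intervalIntegrable_iff_integrableOn_Ioo_of_le zero_le_one] at hi ⊢
  refine Integrable.mono' hi (Measurable.aestronglyMeasurable (by fun_prop)) ?_
  exact (ae_restrict_iff' measurableSet_Ioo).2 (ae_of_all _ hb)

/-- The rescaled normalization `∫ (a - v) / √(v (a - v) (1 - v)) dv / a`. -/
def outerMass (a : ℝ) : ℝ := ∫ s in (0 : ℝ)..1, √(1 - s) / √(s * (1 - a * s))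

lemma outerMass_pos {a : ℝ} (ha1 : a ≤ 1) : 0 < outerMass a := by
  refine intervalIntegral.intervalIntegral_pos_of_pos_on (intervalIntegrable_outerWeight ha1).1
    (fun s hs => ?_) zero_lt_one
  have : a * s < 1 := by nlinarith [hs.1, hs.2]
  exact div_pos (Real.sqrt_pos.2 (by linarith [hs.2]))
    (Real.sqrt_pos.2 (mul_pos hs.1 (by linarith)))

lemma outerMass_one : outerMass 1 = 2 := by
  have : outerMass 1 = ∫ s in (0 : ℝ)..1, s ^ (-(1 / 2) : ℝ) := by
    unfold outerMass
    refine intervalIntegral_congr_Ioo zero_le_one fun s hs => ?_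
    have h1 : 0 < √(1 - s) := Real.sqrt_pos.2 (by linarith [hs.2])
    have h2 : 0 < √s := Real.sqrt_pos.2 hs.1
    rw [one_mul, Real.sqrt_mul hs.1.le, Real.rpow_neg hs.1.le, ← Real.sqrt_eq_rpow]
    field_simp
  rw [this, integral_rpow (Or.inl (by norm_num))]
  norm_num

lemma continuousOn_outerMass : ContinuousOn outerMass (Set.Icc 0 1) := by
  intro a ha
  refine intervalIntegral.continuousWithinAt_of_dominated_interval
    (bound := fun s => s ^ (-(1 / 2) : ℝ)) ?_ ?_
    (intervalIntegral.intervalIntegrable_rpow' (by norm_num)) ?_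
  · exact Eventually.of_forall fun x => Measurable.aestronglyMeasurable (by fun_prop)
  · filter_upwards [self_mem_nhdsWithin] with x hx
    have h1 : ∀ᵐ s : ℝ, s ≠ 1 := by simp [ae_iff, measure_singleton]
    filter_upwards [h1] with s hs1 hs
    rw [Set.uIoc_of_le zero_le_one] at hs
    exact (intervalIntegrable_outerWeight hx.2).2 s ⟨hs.1, lt_of_le_of_ne hs.2 hs1⟩
  · have h1 : ∀ᵐ s : ℝ, s ≠ 1 := by simp [ae_iff, measure_singleton]
    filter_upwards [h1] with s hs1 hs
    rw [Set.uIoc_of_le zero_le_one] at hs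
    have hs2 : s < 1 := lt_of_le_of_ne hs.2 hs1
    have : a * s < 1 := by nlinarith [ha.1, ha.2, hs.1]
    refine ContinuousAt.continuousWithinAt (ContinuousAt.div (by fun_prop) (by fun_prop) ?_)
    exact (Real.sqrt_pos.2 (mul_pos hs.1 (by linarith))).ne'

/-- The normalized second speed at `b = 0`. -/
def outerSpeed (j : ℕ) (a : ℝ) : ℝ := betaCoeff (j + 1) a 0 + a * loopHat j a 0 / outerMass a

/-- The mass diverges as a → 1, but this product does not. Rewriting the speed with `outerMass`
extends it continuously to a = 1. -/
lemma loopMass_mul_sub_center {a : ℝ} (ha : 0 < a) (ha1 : a < 1) :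
    loopMass a 0 * (a - loopCenter a 0) = a * outerMass a := by
  have h := integral_sub_center ha ha1 a
  have e : loopMass a 0 * (a - loopCenter a 0)
      = -∫ v in (0 : ℝ)..a, (v - a) / √((v - 1) * (v - a) * (v - 0)) := by rw [h]; ring
  rw [e, ← intervalIntegral.integral_neg]
  have hs := intervalIntegral.integral_comp_mul_left
    (fun v => -((v - a) / √((v - 1) * (v - a) * (v - 0)))) (a := 0) (b := 1) ha.ne'
  rw [mul_zero, mul_one, smul_eq_mul] at hs
  rw [show (∫ v in (0 : ℝ)..a, -((v - a) / √((v - 1) * (v - a) * (v - 0))))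
    = a * ∫ s in (0 : ℝ)..1, -((a * s - a) / √((a * s - 1) * (a * s - a) * (a * s - 0))) from by
      rw [hs, mul_inv_cancel_left₀ ha.ne']]
  congr 1
  refine intervalIntegral_congr_Ioo zero_le_one fun s hs => ?_
  have hs1 : 0 < 1 - s := by linarith [hs.2]
  have has : 0 < 1 - a * s := by nlinarith [hs.1, hs.2]
  rw [show (a * s - 1) * (a * s - a) * (a * s - 0) = a ^ 2 * ((1 - s) * (s * (1 - a * s))) by ring,
    Real.sqrt_mul (sq_nonneg _), Real.sqrt_sq ha.le, Real.sqrt_mul hs1.le]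
  have h1 : 0 < √(1 - s) := Real.sqrt_pos.2 hs1
  have h2 : 0 < √(s * (1 - a * s)) := Real.sqrt_pos.2 (mul_pos hs.1 has)
  have h3 : √(1 - s) ^ 2 = 1 - s := Real.sq_sqrt hs1.le
  field_simp
  rw [h3]; ring

lemma loopMult_div_center (j : ℕ) {a : ℝ} (ha : 0 < a) (ha1 : a < 1) :
    loopMult j a 0 / (a - loopCenter a 0) = a * loopHat j a 0 / outerMass a := by
  unfold loopMult
  rw [div_div, loopMass_mul_sub_center ha ha1, loopInt_eq j ha.le]
  have := (outerMass_pos ha1.le).ne'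
  field_simp
  ring

lemma mu₂_zero_eq (j : ℕ) {a : ℝ} (ha : 0 < a) (ha1 : a < 1) :
    KdVHierarchy.mu₂ (j + 1) 1 a 0
      = 4 ^ (j + 1) * (2 * ((j + 1 : ℕ) : ℝ) + 1) * outerSpeed j a := by
  rw [mu₂_eq j ha ha1, loopMult_div_center j ha ha1, outerSpeed]

lemma continuousOn_outerSpeed (j : ℕ) : ContinuousOn (outerSpeed j) (Set.Icc 0 1) := by
  have h1 : Continuous fun a : ℝ => betaCoeff (j + 1) a 0 :=
    (continuous_betaCoeff (j + 1)).comp (by fun_prop : Continuous fun a : ℝ => (a, (0 : ℝ)))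
  exact h1.continuousOn.add ((continuousOn_id.mul (continuousOn_loopHat_zero j)).div
    continuousOn_outerMass fun a ha => (outerMass_pos ha.2).ne')

lemma ratioSeries_one : ratioSeries 1 = 1 := by
  unfold ratioSeries
  exact sqrtSeries_mul_bin_one

/-- For a = 1 the ratio series is 1, so `betaCoeff` vanishes, `loopHat` is the integral of
s^{j+1/2}, and `outerMass` is 2. After scaling this is the upper end 4^m of the third region. -/
lemma outerSpeed_one (j : ℕ) : outerSpeed j 1 = 1 / (2 * ((j + 1 : ℕ) : ℝ) + 1) := by
  have hb : betaCoeff (j + 1) 1 0 = 0 := by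
    unfold betaCoeff
    rw [ratioSeries_one, bin_zero, one_mul, PowerSeries.coeff_one, if_neg (by omega)]
  have hl : loopHat j 1 0 = 1 / (j + 3 / 2) := by
    have e : loopHat j 1 0 = ∫ s in (0 : ℝ)..1, s ^ ((j : ℝ) + 1 / 2) := by
      unfold loopHat
      refine intervalIntegral_congr_Ioo zero_le_one fun s hs => ?_
      have h1 : 0 < √(1 - s) := Real.sqrt_pos.2 (by linarith [hs.2])
      rw [hFun_zero_right, ratioSeries_one, one_mul, coeff_geom, sub_zero, one_mul, zero_add,
        Real.sqrt_mul hs.1.le, Real.rpow_add hs.1, Real.rpow_natCast, ← Real.sqrt_eq_rpow]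
      field_simp
    rw [e, integral_rpow (Or.inl (by linarith [(Nat.cast_nonneg j : (0 : ℝ) ≤ j)]))]
    rw [Real.one_rpow, Real.zero_rpow (by positivity)]
    rw [sub_zero]; congr 1; ring
  unfold outerSpeed
  rw [hb, hl, outerMass_one]
  push_cast
  field_simp
  ring

/-! ### The densities in terms of the polynomial parts -/

/-- With zero loop integral, this choice of x cancels the linear part of P_m. The remaining zeros at
a and b cancel against the roots in the denominator of the density. -/
lemma inner_density_numerator {j : ℕ} {a b t : ℝ} (hab : b < a) (ha : a < 1)
    (h : loopInt j a b = 0) (ξ : ℝ) (c : ℝ) :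
    -(c * betaCoeff (j + 1) a b * t) * (KdVHierarchy.whithamPoly 0 1 a b).eval ξ
      + c * t * (KdVHierarchy.whithamPoly (j + 1) 1 a b).eval ξ
      = (ξ - a) * (ξ - b) * (c * t * hFun j a b ξ) := by
  rw [eval_whithamPoly_zero hab ha, eval_whithamPoly_succ j hab ha, loopMult, h]
  ring

/-- For b = 0 only μ₂ is prescribed, which amounts to a zero of the numerator at ξ = a. -/
lemma outer_density_numerator (j : ℕ) {a t : ℝ} (ha0 : 0 < a) (ha : a < 1) (ξ : ℝ) (c : ℝ) :
    -(c * outerSpeed j a * t) * (KdVHierarchy.whithamPoly 0 1 a 0).eval ξ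
      + c * t * (KdVHierarchy.whithamPoly (j + 1) 1 a 0).eval ξ
      = (ξ - a) * (c * t * (hFun (j + 1) a 0 ξ - outerSpeed j a)) := by
  have h := loopCenter_mem ha0 ha
  have hne : a - loopCenter a 0 ≠ 0 := by linarith [h.2]
  have h1 : hFun (j + 1) a 0 ξ = ξ * hFun j a 0 ξ + betaCoeff (j + 1) a 0 := by
    have := coeff_eq_mul_hPoly (j + 1) a 0 ξ
    rw [eval_hPoly] at this
    rw [← this]; unfold hFun; rfl
  have h2 : loopMult j a 0 = (outerSpeed j a - betaCoeff (j + 1) a 0) * (a - loopCenter a 0) := by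
    rw [outerSpeed, ← loopMult_div_center j ha0 ha]
    field_simp
    ring
  rw [eval_whithamPoly_zero ha0 ha, eval_whithamPoly_succ j ha0 ha, h1, h2]
  ring

end

end StepData

/-! ### The logarithmic kernel as the square of an Abel transform. -/

namespace StepData

open MeasureTheory Filter Asymptotics Topology

noncomputable section

/-! ### The Abel factorization of the logarithmic kernel -/

/-- The kernel `-log |(η - μ) / (η + μ)|`. -/
def logKer (η μ : ℝ) : ℝ := -Real.log |(η - μ) / (η + μ)|

/-- The kernel `1 / √(η² - R)`, supported in `R < η²`. -/
def abelKer (η R : ℝ) : ENNReal := ENNReal.ofReal (1 / √(η ^ 2 - R))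

/-- The Abel transform of a density on `[0, 1]`. -/
def abelT (f : ℝ → ENNReal) (R : ℝ) : ENNReal := ∫⁻ η in Set.Icc (0 : ℝ) 1, abelKer η R * f η

lemma measurable_abelKer : Measurable fun p : ℝ × ℝ => abelKer p.1 p.2 := by
  unfold abelKer; fun_prop

lemma measurable_abelKer_left (R : ℝ) : Measurable fun η : ℝ => abelKer η R := by
  unfold abelKer; fun_prop

lemma measurable_abelKer_right (η : ℝ) : Measurable fun R : ℝ => abelKer η R := by
  unfold abelKer; fun_prop

lemma measurable_abelKer_left_mul {f : ℝ → ENNReal} (hf : Measurable f) (R : ℝ) :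
    Measurable fun η : ℝ => abelKer η R * f η :=
  (measurable_abelKer_left R).mul hf

lemma measurable_mul_abelKer_right {f : ℝ → ENNReal} (hf : Measurable f) (η : ℝ) :
    Measurable fun R : ℝ => f R * abelKer η R :=
  hf.mul (measurable_abelKer_right η)

lemma abelKer_eq_zero {η R : ℝ} (h : η ^ 2 ≤ R) : abelKer η R = 0 := by
  unfold abelKer
  rw [Real.sqrt_eq_zero_of_nonpos (by linarith)]; simp

lemma logKer_comm (η μ : ℝ) : logKer η μ = logKer μ η := by
  unfold logKer
  rw [abs_div, abs_div, abs_sub_comm, add_comm]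

lemma logKer_nonneg {η μ : ℝ} (hη : 0 ≤ η) (hμ : 0 ≤ μ) : 0 ≤ logKer η μ := by
  unfold logKer
  rw [neg_nonneg]
  refine Real.log_nonpos (abs_nonneg _) ?_
  rw [abs_div, abs_of_nonneg (add_nonneg hη hμ)]
  refine div_le_one_of_le₀ ?_ (add_nonneg hη hμ)
  rw [abs_le]; constructor <;> linarith

lemma hasDerivAt_log_sqrt_add {A B R : ℝ} (hBA : B < A) (hR : R < B) :
    HasDerivAt (fun R => -(2 * Real.log (√(A - R) + √(B - R)))) (1 / √(A - R) * (1 / √(B - R))) R := by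
  have hA : 0 < A - R := by linarith
  have hB : 0 < B - R := by linarith
  have h1 : HasDerivAt (fun R => √(A - R)) (-1 / (2 * √(A - R))) R :=
    ((hasDerivAt_id R).const_sub A).sqrt hA.ne'
  have h2 : HasDerivAt (fun R => √(B - R)) (-1 / (2 * √(B - R))) R :=
    ((hasDerivAt_id R).const_sub B).sqrt hB.ne'
  have pA := Real.sqrt_pos.2 hA
  have pB := Real.sqrt_pos.2 hB
  refine ((((h1.add h2).log (add_pos pA pB).ne').const_mul 2).neg).congr_deriv ?_
  have : √(A - R) + √(B - R) ≠ 0 := (add_pos pA pB).ne'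
  simp only [Pi.add_apply]
  field_simp
  ring

/-- The product lives on R < μ² and has the primitive -2 log(√(η² - R) + √(μ² - R)); its increment
over (0, μ²) is log((η + μ)²/(η² - μ²)). -/
lemma lintegral_abelKer_mul_of_lt {η μ : ℝ} (hμ : 0 < μ) (h : μ < η) :
    ∫⁻ R in Set.Ioi 0, abelKer η R * abelKer μ R = ENNReal.ofReal (logKer η μ) := by
  have hη : 0 < η := hμ.trans h
  have hBA : μ ^ 2 < η ^ 2 := by nlinarith
  have hB0 : 0 < μ ^ 2 := by positivity
  set F : ℝ → ℝ := fun R => -(2 * Real.log (√(η ^ 2 - R) + √(μ ^ 2 - R))) with hF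
  have hcont : ContinuousOn F (Set.Icc 0 (μ ^ 2)) := by
    refine ((ContinuousOn.log (by fun_prop) fun R hR => ?_).const_smul (2 : ℝ)).neg
    have := Real.sqrt_pos.2 (show 0 < η ^ 2 - R by linarith [hR.2])
    have := Real.sqrt_nonneg (μ ^ 2 - R)
    positivity
  have hder : ∀ R ∈ Set.Ioo 0 (μ ^ 2), HasDerivAt F (1 / √(η ^ 2 - R) * (1 / √(μ ^ 2 - R))) R :=
    fun R hR => hasDerivAt_log_sqrt_add hBA hR.2
  have hint : IntervalIntegrable (fun R => 1 / √(η ^ 2 - R) * (1 / √(μ ^ 2 - R))) volume 0 (μ ^ 2) := by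
    refine intervalIntegral.intervalIntegrable_deriv_of_nonneg (g := F) ?_ ?_ fun R _ => by positivity
    · rwa [Set.uIcc_of_le hB0.le]
    · rwa [min_eq_left hB0.le, max_eq_right hB0.le]
  have hval := intervalIntegral.integral_eq_sub_of_hasDerivAt_of_le hB0.le hcont hder hint
  have hlog : F (μ ^ 2) - F 0 = logKer η μ := by
    simp only [hF, logKer, sub_self, Real.sqrt_zero, add_zero, sub_zero, Real.sqrt_sq hη.le,
      Real.sqrt_sq hμ.le]
    have hd : 0 < η - μ := by linarith
    rw [Real.log_sqrt (by linarith), show η ^ 2 - μ ^ 2 = (η - μ) * (η + μ) by ring,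
      Real.log_mul hd.ne' (by positivity), abs_of_pos (by positivity),
      Real.log_div hd.ne' (by positivity)]
    ring
  rw [← hlog, ← hval, intervalIntegral.integral_of_le hB0.le,
    ofReal_integral_eq_lintegral_ofReal ((intervalIntegrable_iff_integrableOn_Ioc_of_le hB0.le).1 hint)
      (ae_of_all _ fun R => by positivity)]
  have hsplit : ∫⁻ R in Set.Ioi 0, abelKer η R * abelKer μ R
      = ∫⁻ R in Set.Ioc 0 (μ ^ 2), abelKer η R * abelKer μ R := by
    rw [← Set.Ioc_union_Ioi_eq_Ioi hB0.le, lintegral_union measurableSet_Ioi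
      (Set.disjoint_left.2 fun x hx hx' => absurd hx.2 (not_le.2 hx'))]
    rw [setLIntegral_congr_fun (g := fun _ => 0) measurableSet_Ioi fun R (hR : μ ^ 2 < R) => by
      simp only [abelKer_eq_zero hR.le, mul_zero]]
    simp
  rw [hsplit]
  refine lintegral_congr fun R => ?_
  unfold abelKer
  rw [← ENNReal.ofReal_mul (by positivity)]

lemma lintegral_abelKer_mul {η μ : ℝ} (hη : 0 < η) (hμ : 0 < μ) (h : η ≠ μ) :
    ∫⁻ R in Set.Ioi 0, abelKer η R * abelKer μ R = ENNReal.ofReal (logKer η μ) := by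
  rcases lt_or_gt_of_ne h with h | h
  · rw [logKer_comm, ← lintegral_abelKer_mul_of_lt hη h]
    exact lintegral_congr fun R => mul_comm _ _
  · exact lintegral_abelKer_mul_of_lt hμ h

lemma measurable_abelT {f : ℝ → ENNReal} (hf : Measurable f) : Measurable (abelT f) := by
  unfold abelT
  refine Measurable.lintegral_prod_right' (f := fun p : ℝ × ℝ => abelKer p.2 p.1 * f p.2) ?_
  exact (measurable_abelKer.comp measurable_swap).mul (hf.comp measurable_snd)

lemma ae_pos_Icc : ∀ᵐ η ∂(volume.restrict (Set.Icc (0 : ℝ) 1)), η ∈ Set.Ioo (0 : ℝ) 1 := by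
  rw [← Measure.restrict_congr_set Ioo_ae_eq_Icc]
  exact ae_restrict_mem measurableSet_Ioo

lemma ae_ne_Icc (c : ℝ) : ∀ᵐ η ∂(volume.restrict (Set.Icc (0 : ℝ) 1)), η ≠ c := by
  refine ae_restrict_of_ae ?_
  simp [ae_iff, measure_singleton]

/-- Tonelli for the factorized kernel. With g = f the interaction becomes the squared L² norm of
`abelT f`, which gives its positivity. -/
lemma lintegral_logKer_bilinear {f g : ℝ → ENNReal} (hf : Measurable f) (hg : Measurable g) :
    ∫⁻ η in Set.Icc (0 : ℝ) 1, f η * ∫⁻ μ in Set.Icc (0 : ℝ) 1, ENNReal.ofReal (logKer η μ) * g μ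
      = ∫⁻ R in Set.Ioi 0, abelT f R * abelT g R := by
  have h1 : ∀ η ∈ Set.Ioo (0 : ℝ) 1,
      ∫⁻ μ in Set.Icc (0 : ℝ) 1, ENNReal.ofReal (logKer η μ) * g μ
        = ∫⁻ R in Set.Ioi 0, abelKer η R * abelT g R := by
    intro η hη
    have : ∫⁻ μ in Set.Icc (0 : ℝ) 1, ENNReal.ofReal (logKer η μ) * g μ
        = ∫⁻ μ in Set.Icc (0 : ℝ) 1, ∫⁻ R in Set.Ioi 0, abelKer η R * (abelKer μ R * g μ) := by
      refine lintegral_congr_ae ?_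
      filter_upwards [ae_pos_Icc, ae_ne_Icc η] with μ hμ hne
      rw [← lintegral_abelKer_mul hη.1 hμ.1 hne.symm, ← lintegral_mul_const _
        (measurable_mul_abelKer_right (measurable_abelKer_right η) μ)]
      exact lintegral_congr fun R => mul_assoc _ _ _
    rw [this, lintegral_lintegral_swap]
    · refine lintegral_congr fun R => ?_
      rw [lintegral_const_mul _ (measurable_abelKer_left_mul hg R)]
      rfl
    · refine Measurable.aemeasurable ?_
      exact ((measurable_abelKer_right η).comp measurable_snd).mul
        (measurable_abelKer.mul (hg.comp measurable_fst))
  have h2 : ∫⁻ η in Set.Icc (0 : ℝ) 1, f η * ∫⁻ μ in Set.Icc (0 : ℝ) 1,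
      ENNReal.ofReal (logKer η μ) * g μ
      = ∫⁻ η in Set.Icc (0 : ℝ) 1, ∫⁻ R in Set.Ioi 0, f η * (abelKer η R * abelT g R) := by
    refine lintegral_congr_ae ?_
    filter_upwards [ae_pos_Icc] with η hη
    rw [h1 η hη, lintegral_const_mul]
    simpa only [mul_comm] using measurable_mul_abelKer_right (measurable_abelT hg) η
  rw [h2, lintegral_lintegral_swap]
  · refine lintegral_congr fun R => ?_
    unfold abelT
    rw [← lintegral_mul_const _ (measurable_abelKer_left_mul hf R)]
    exact lintegral_congr fun η => by ring
  · refine Measurable.aemeasurable ?_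
    exact (hf.comp measurable_fst).mul
      (measurable_abelKer.mul ((measurable_abelT hg).comp measurable_snd))

/-! ### Inversion of the Abel transform -/

/-- The arcsine density on (s², η²) has mass π whatever its end points: two half integrations
compose to a full one. -/
lemma lintegral_abelKer_inverse {s η : ℝ} (hs : 0 ≤ s) (hη : 0 < η) :
    ∫⁻ R in Set.Ioi 0, ENNReal.ofReal (1 / √(R - s ^ 2)) * abelKer η R
      = if s < η then ENNReal.ofReal Real.pi else 0 := by
  split_ifs with h
  · have hBA : s ^ 2 < η ^ 2 := by nlinarith
    have hint := intervalIntegrable_arcsine hBA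
    rw [← integral_arcsine hBA, intervalIntegral.integral_of_le hBA.le,
      integral_Ioc_eq_integral_Ioo, ofReal_integral_eq_lintegral_ofReal
        ((intervalIntegrable_iff_integrableOn_Ioo_of_le hBA.le).1 hint)
        (ae_of_all _ fun R => by positivity),
      ← lintegral_indicator measurableSet_Ioi, ← lintegral_indicator measurableSet_Ioo]
    refine lintegral_congr fun R => ?_
    by_cases hR : R ∈ Set.Ioo (s ^ 2) (η ^ 2)
    · rw [Set.indicator_of_mem hR, Set.indicator_of_mem (show R ∈ Set.Ioi 0 from
        lt_of_le_of_lt (sq_nonneg s) hR.1), abelKer, ← ENNReal.ofReal_mul (by positivity),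
        Real.sqrt_mul (by linarith [hR.2])]
      congr 1
      field_simp
    · rw [Set.indicator_of_notMem hR]
      refine Set.indicator_apply_eq_zero.2 fun _ => ?_
      by_cases h1 : s ^ 2 < R
      · rw [abelKer_eq_zero (not_lt.1 fun h2 => hR ⟨h1, h2⟩), mul_zero]
      · rw [Real.sqrt_eq_zero_of_nonpos (by linarith)]; simp
  · have h' : η ^ 2 ≤ s ^ 2 := by nlinarith
    rw [lintegral_congr (g := fun _ => 0) fun R => ?_]
    · simp
    · by_cases h1 : s ^ 2 < R
      · rw [abelKer_eq_zero (by linarith), mul_zero]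
      · rw [Real.sqrt_eq_zero_of_nonpos (by linarith)]; simp

lemma lintegral_abelT_inverse {f : ℝ → ENNReal} (hf : Measurable f) {s : ℝ} (hs : 0 ≤ s) :
    ∫⁻ R in Set.Ioi 0, ENNReal.ofReal (1 / √(R - s ^ 2)) * abelT f R
      = ENNReal.ofReal Real.pi * ∫⁻ η in Set.Ioi s, f η ∂(volume.restrict (Set.Icc (0 : ℝ) 1)) := by
  have hm : Measurable fun R : ℝ => ENNReal.ofReal (1 / √(R - s ^ 2)) := by fun_prop
  have h1 : ∫⁻ R in Set.Ioi 0, ENNReal.ofReal (1 / √(R - s ^ 2)) * abelT f R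
      = ∫⁻ R in Set.Ioi 0, ∫⁻ η in Set.Icc (0 : ℝ) 1,
        ENNReal.ofReal (1 / √(R - s ^ 2)) * (abelKer η R * f η) := by
    refine lintegral_congr fun R => ?_
    unfold abelT
    rw [lintegral_const_mul _ (measurable_abelKer_left_mul hf R)]
  rw [h1, lintegral_lintegral_swap, ← lintegral_indicator measurableSet_Ioi,
    ← lintegral_const_mul _ (hf.indicator measurableSet_Ioi)]
  · refine lintegral_congr_ae ?_
    filter_upwards [ae_pos_Icc] with η hη
    rw [lintegral_congr (g := fun R => (ENNReal.ofReal (1 / √(R - s ^ 2)) * abelKer η R) * f η)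
      fun R => (mul_assoc _ _ _).symm, lintegral_mul_const _ (measurable_mul_abelKer_right hm η),
      lintegral_abelKer_inverse hs hη.1]
    split_ifs with h
    · rw [Set.indicator_of_mem (show η ∈ Set.Ioi s from h)]
    · rw [Set.indicator_of_notMem (show η ∉ Set.Ioi s from h)]; simp
  · refine Measurable.aemeasurable ?_
    exact (hm.comp measurable_fst).mul
      ((measurable_abelKer.comp measurable_swap).mul (hf.comp measurable_snd))

/-- By `lintegral_abelT_inverse` the transform determines the mass beyond every s ≥ 0, and a finite
measure is determined by its values on half lines. -/
lemma ae_eq_of_abelT_ae_eq {f g : ℝ → ENNReal} (hf : Measurable f) (hg : Measurable g)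
    (hfi : ∫⁻ η in Set.Icc (0 : ℝ) 1, f η ≠ ⊤)
    (h : abelT f =ᵐ[volume.restrict (Set.Ioi 0)] abelT g) :
    f =ᵐ[volume.restrict (Set.Icc (0 : ℝ) 1)] g := by
  set ν := volume.restrict (Set.Icc (0 : ℝ) 1) with hν
  have key : ∀ s : ℝ, 0 ≤ s → ∫⁻ η in Set.Ioi s, f η ∂ν = ∫⁻ η in Set.Ioi s, g η ∂ν := by
    intro s hs
    have h1 := lintegral_abelT_inverse hf hs
    rw [lintegral_congr_ae (g := fun R => ENNReal.ofReal (1 / √(R - s ^ 2)) * abelT g R)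
      (by filter_upwards [h] with R hR; rw [hR]), lintegral_abelT_inverse hg hs] at h1
    exact ((ENNReal.mul_right_inj (ENNReal.ofReal_pos.2 Real.pi_pos).ne' ENNReal.ofReal_ne_top).1
      h1).symm
  have hset : ∀ s : ℝ, Set.Ici s =ᵐ[ν] Set.Ioi (max s 0) := by
    intro s
    filter_upwards [ae_pos_Icc, ae_ne_Icc s] with η hη hne
    refine propext ⟨fun h => ?_, fun h => ?_⟩
    · exact max_lt (lt_of_le_of_ne h hne.symm) hη.1
    · exact ((le_max_left s 0).trans_lt h).le
  rw [← withDensity_eq_iff hf.aemeasurable hg.aemeasurable hfi]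
  have : IsFiniteMeasure (ν.withDensity f) := isFiniteMeasure_withDensity hfi
  refine Measure.ext_of_Ici _ _ fun s => ?_
  rw [withDensity_apply _ measurableSet_Ici, withDensity_apply _ measurableSet_Ici,
    setLIntegral_congr (hset s), setLIntegral_congr (hset s)]
  exact key _ (le_max_right _ _)

end

end StepData

/-! ### The variational conditions imply minimality and uniqueness. -/

namespace StepData

open MeasureTheory Filter Asymptotics Topology

noncomputable section

/-! ### Sufficiency of the variational conditions -/

/-- The linear part of the functional. -/
def external (m : ℕ) (x t η : ℝ) : ℝ := η * x - 4 ^ m * η ^ (2 * m + 1) * t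

lemma continuous_external (m : ℕ) (x t : ℝ) : Continuous (external m x t) := by
  unfold external; fun_prop

lemma exists_measurable_density {φ : ℝ → ℝ} (hφ : KdVHierarchy.Admissible φ) :
    ∃ f : ℝ → ENNReal, Measurable f ∧
      f =ᵐ[volume.restrict (Set.Icc (0 : ℝ) 1)] fun η => ENNReal.ofReal (φ η) := by
  have h := hφ.1.1.aemeasurable
  refine ⟨fun η => ENNReal.ofReal (h.mk φ η), h.measurable_mk.ennreal_ofReal, ?_⟩
  filter_upwards [h.ae_eq_mk] with η hη
  rw [hη]

lemma lintegral_ofReal_mul_density {φ w : ℝ → ℝ} (hφ : KdVHierarchy.Admissible φ)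
    {f : ℝ → ENNReal} (hf : f =ᵐ[volume.restrict (Set.Icc (0 : ℝ) 1)] fun η => ENNReal.ofReal (φ η))
    (hw : ContinuousOn w (Set.Icc 0 1)) (hw0 : ∀ η ∈ Set.Ioo (0 : ℝ) 1, 0 ≤ w η) :
    ∫⁻ η in Set.Icc (0 : ℝ) 1, f η * ENNReal.ofReal (w η)
      = ENNReal.ofReal (∫ η in Set.Icc (0 : ℝ) 1, w η * φ η) := by
  rw [ofReal_integral_eq_lintegral_ofReal (hφ.1.continuousOn_mul hw isCompact_Icc)]
  · refine lintegral_congr_ae ?_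
    filter_upwards [hf, hφ.2] with η h1 h2
    rw [h1, ← ENNReal.ofReal_mul h2, mul_comm]
  · filter_upwards [ae_pos_Icc, hφ.2] with η h1 h2
    exact mul_nonneg (hw0 η h1) h2

lemma energy_eq (m : ℕ) (x t : ℝ) {φ : ℝ → ℝ} (hφ : KdVHierarchy.Admissible φ)
    {f : ℝ → ENNReal} (hfm : Measurable f)
    (hf : f =ᵐ[volume.restrict (Set.Icc (0 : ℝ) 1)] fun η => ENNReal.ofReal (φ η)) :
    KdVHierarchy.energy m x t φ =
      ((ENNReal.ofReal (1 / (2 * Real.pi)) * ∫⁻ R in Set.Ioi 0, abelT f R * abelT f R : ENNReal) : EReal)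
        + ((∫ η in Set.Icc (0 : ℝ) 1, external m x t η * φ η : ℝ) : EReal) := by
  unfold KdVHierarchy.energy
  congr 3
  rw [← lintegral_logKer_bilinear hfm hfm]
  refine lintegral_congr_ae ?_
  filter_upwards [ae_pos_Icc, hf, hφ.2] with η hη h1 h2
  have hlm : Measurable fun μ => ENNReal.ofReal (logKer η μ) * f μ := by
    refine Measurable.mul (Measurable.ennreal_ofReal ?_) hfm
    unfold logKer
    exact ((measurable_const.sub measurable_id).div (measurable_const.add measurable_id)).abs.log.neg
  rw [← lintegral_const_mul _ hlm]
  refine lintegral_congr_ae ?_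
  filter_upwards [ae_pos_Icc, hf, hφ.2] with μ hμ h3 h4
  have h5 := logKer_nonneg hη.1.le hμ.1.le
  rw [h1, h3]
  change ENNReal.ofReal (logKer η μ * φ η * φ μ) = _
  rw [ENNReal.ofReal_mul (mul_nonneg h5 h2), ENNReal.ofReal_mul h5]
  ring

lemma energy_eq_coe (m : ℕ) (x t : ℝ) {φ : ℝ → ℝ} (hφ : KdVHierarchy.Admissible φ)
    {f : ℝ → ENNReal} (hfm : Measurable f)
    (hf : f =ᵐ[volume.restrict (Set.Icc (0 : ℝ) 1)] fun η => ENNReal.ofReal (φ η)) {d : ℝ} (hd0 : 0 ≤ d)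
    (hd : ∫⁻ R in Set.Ioi 0, abelT f R * abelT f R = ENNReal.ofReal d) :
    KdVHierarchy.energy m x t φ =
      ((1 / (2 * Real.pi) * d + ∫ η in Set.Icc (0 : ℝ) 1, external m x t η * φ η : ℝ) : EReal) := by
  have hpi := Real.pi_pos
  rw [energy_eq m x t hφ hfm hf, hd, ← ENNReal.ofReal_mul (by positivity), EReal.coe_ennreal_ofReal,
    max_eq_left (by positivity), EReal.coe_add]

lemma energy_eq_top (m : ℕ) (x t : ℝ) {φ : ℝ → ℝ} (hφ : KdVHierarchy.Admissible φ)
    {f : ℝ → ENNReal} (hfm : Measurable f)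
    (hf : f =ᵐ[volume.restrict (Set.Icc (0 : ℝ) 1)] fun η => ENNReal.ofReal (φ η))
    (hd : ∫⁻ R in Set.Ioi 0, abelT f R * abelT f R = ⊤) :
    KdVHierarchy.energy m x t φ = ⊤ := by
  have hpi := Real.pi_pos
  rw [energy_eq m x t hφ hfm hf, hd, ENNReal.mul_top (ENNReal.ofReal_pos.2 (by positivity)).ne',
    EReal.coe_ennreal_top, EReal.top_add_coe]

lemma measurable_abelT_mul {f g : ℝ → ENNReal} (hf : Measurable f) (hg : Measurable g) :
    Measurable fun R => abelT f R * abelT g R :=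
  (measurable_abelT hf).mul (measurable_abelT hg)

lemma two_mul_mul_le_add (a b : ENNReal) : 2 * (a * b) ≤ a * a + b * b := by
  rcases eq_or_ne a ⊤ with rfl | ha
  · simp
  rcases eq_or_ne b ⊤ with rfl | hb
  · simp
  lift a to NNReal using ha
  lift b to NNReal using hb
  norm_cast
  rw [← NNReal.coe_le_coe]
  push_cast
  nlinarith [sq_nonneg ((a : ℝ) - b)]

lemma eq_of_two_mul_mul_eq {a b : ENNReal} (ha : a ≠ ⊤) (hb : b ≠ ⊤)
    (h : 2 * (a * b) = a * a + b * b) : a = b := by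
  lift a to NNReal using ha
  lift b to NNReal using hb
  norm_cast at h ⊢
  rw [← NNReal.coe_inj] at h ⊢
  push_cast at h
  have : ((a : ℝ) - b) ^ 2 = 0 := by linarith
  linarith [pow_eq_zero_iff (two_ne_zero) |>.1 this]

/-- A density is the minimizer if its potential satisfies the variational conditions with the
multiplier `N`. -/
theorem isTheMinimizer_of_potential {m : ℕ} {x t : ℝ} {ψ N : ℝ → ℝ}
    (hψ : KdVHierarchy.Admissible ψ) (hN : ContinuousOn N (Set.Icc 0 1))
    (hN0 : ∀ η ∈ Set.Ioo (0 : ℝ) 1, 0 ≤ N η)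
    (hNψ : ∀ᵐ η ∂(volume.restrict (Set.Icc (0 : ℝ) 1)), N η * ψ η = 0)
    (hNa : ∀ η ∈ Set.Ioo (0 : ℝ) 1, external m x t η ≤ N η)
    (hpot : ∀ η ∈ Set.Ioo (0 : ℝ) 1,
      ∫⁻ μ in Set.Icc (0 : ℝ) 1, ENNReal.ofReal (logKer η μ) * ENNReal.ofReal (ψ μ)
        = ENNReal.ofReal (Real.pi * (N η - external m x t η))) :
    KdVHierarchy.IsTheMinimizer m x t ψ := by
  have hpi := Real.pi_pos
  obtain ⟨g, hgm, hg⟩ := exists_measurable_density hψ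
  have hac := (continuous_external m x t).continuousOn (s := Set.Icc 0 1)
  have hw : ContinuousOn (fun η => Real.pi * (N η - external m x t η)) (Set.Icc 0 1) :=
    continuousOn_const.mul (hN.sub hac)
  have hw0 : ∀ η ∈ Set.Ioo (0 : ℝ) 1, 0 ≤ Real.pi * (N η - external m x t η) := fun η hη =>
    mul_nonneg hpi.le (sub_nonneg.2 (hNa η hη))
  -- the linear functional `∫ (N - a) φ`
  set J : (ℝ → ℝ) → ℝ := fun φ => ∫ η in Set.Icc (0 : ℝ) 1, external m x t η * φ η with hJ
  set M : (ℝ → ℝ) → ℝ := fun φ => ∫ η in Set.Icc (0 : ℝ) 1, N η * φ η with hM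
  -- The known potential of ψ turns the mixed interaction of φ and ψ into a linear functional of φ,
  -- even if the interaction of φ with itself is infinite.
  have hcross : ∀ {φ : ℝ → ℝ} {f : ℝ → ENNReal}, KdVHierarchy.Admissible φ → Measurable f →
      f =ᵐ[volume.restrict (Set.Icc (0 : ℝ) 1)] (fun η => ENNReal.ofReal (φ η)) →
      ∫⁻ R in Set.Ioi 0, abelT f R * abelT g R = ENNReal.ofReal (Real.pi * (M φ - J φ)) ∧
      0 ≤ M φ - J φ ∧ 0 ≤ M φ := by
    intro φ f hφ hfm hf
    have i1 : Integrable (fun η => N η * φ η) (volume.restrict (Set.Icc (0 : ℝ) 1)) :=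
      hφ.1.continuousOn_mul hN isCompact_Icc
    have i2 : Integrable (fun η => external m x t η * φ η) (volume.restrict (Set.Icc (0 : ℝ) 1)) :=
      hφ.1.continuousOn_mul hac isCompact_Icc
    have e : ∫ η in Set.Icc (0 : ℝ) 1, Real.pi * (N η - external m x t η) * φ η
        = Real.pi * (M φ - J φ) := by
      rw [hM, hJ]
      simp only
      rw [← integral_sub i1 i2, ← integral_const_mul]
      congr 1; ext η; ring
    refine ⟨?_, ?_, ?_⟩
    · rw [← lintegral_logKer_bilinear hfm hgm, ← e, ← lintegral_ofReal_mul_density hφ hf hw hw0]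
      refine lintegral_congr_ae ?_
      filter_upwards [ae_pos_Icc] with η hη
      rw [← hpot η hη]
      congr 1
      refine lintegral_congr_ae ?_
      filter_upwards [hg] with μ hμ
      rw [hμ]
    · have : 0 ≤ Real.pi * (M φ - J φ) := by
        rw [← e]
        refine integral_nonneg_of_ae ?_
        filter_upwards [ae_pos_Icc, hφ.2] with η h1 h2
        exact mul_nonneg (hw0 η h1) h2
      exact nonneg_of_mul_nonneg_right this hpi
    · refine integral_nonneg_of_ae ?_
      filter_upwards [ae_pos_Icc, hφ.2] with η h1 h2
      exact mul_nonneg (hN0 η h1) h2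
  have hMψ : M ψ = 0 := by
    rw [hM]
    exact (integral_congr_ae hNψ).trans (by simp)
  obtain ⟨hDψ, hJψ, -⟩ := hcross hψ hgm hg
  rw [hMψ] at hDψ hJψ
  have hEψ := energy_eq_coe m x t hψ hgm hg (mul_nonneg hpi.le hJψ) hDψ
  have hEψ' : KdVHierarchy.energy m x t ψ = ((J ψ / 2 : ℝ) : EReal) := by
    rw [hEψ, EReal.coe_eq_coe_iff]
    change _ + J ψ = _
    field_simp; ring
  -- Integrated form of 2FG ≤ F² + G² for the transforms F and G of φ and ψ. Since ∫ Nφ ≥ 0 = ∫ Nψ,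
  -- it gives the energy inequality.
  have main : ∀ {φ : ℝ → ℝ} {f : ℝ → ENNReal} {d : ℝ}, KdVHierarchy.Admissible φ → Measurable f →
      f =ᵐ[volume.restrict (Set.Icc (0 : ℝ) 1)] (fun η => ENNReal.ofReal (φ η)) → 0 ≤ d →
      ∫⁻ R in Set.Ioi 0, abelT f R * abelT f R = ENNReal.ofReal d →
      2 * (Real.pi * (M φ - J φ)) ≤ d + Real.pi * (0 - J ψ) := by
    intro φ f d hφ hfm hf hd0 hd
    obtain ⟨h1, h2, -⟩ := hcross hφ hfm hf
    have h3 : ∫⁻ R in Set.Ioi 0, 2 * (abelT f R * abelT g R)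
        ≤ ∫⁻ R in Set.Ioi 0, (abelT f R * abelT f R + abelT g R * abelT g R) :=
      lintegral_mono fun R => two_mul_mul_le_add _ _
    rw [lintegral_add_left (measurable_abelT_mul hfm hfm), lintegral_const_mul _ (measurable_abelT_mul hfm hgm), hd, hDψ, h1,
      ← ENNReal.ofReal_add hd0 (mul_nonneg hpi.le hJψ),
      show (2 : ENNReal) = ENNReal.ofReal 2 by simp, ← ENNReal.ofReal_mul (by norm_num)] at h3
    exact (ENNReal.ofReal_le_ofReal_iff (add_nonneg hd0 (mul_nonneg hpi.le hJψ))).1 h3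
  refine ⟨hψ, fun φ hφ => ?_, fun φ hφ hE => ?_⟩
  · obtain ⟨f, hfm, hf⟩ := exists_measurable_density hφ
    by_cases hfin : ∫⁻ R in Set.Ioi 0, abelT f R * abelT f R = ⊤
    · rw [energy_eq_top m x t hφ hfm hf hfin]; exact le_top
    have hd := (ENNReal.ofReal_toReal hfin).symm
    have h1 := main hφ hfm hf ENNReal.toReal_nonneg hd
    obtain ⟨-, -, hMφ⟩ := hcross hφ hfm hf
    rw [hEψ', energy_eq_coe m x t hφ hfm hf ENNReal.toReal_nonneg hd, EReal.coe_le_coe_iff]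
    change _ ≤ _ + J φ
    generalize (∫⁻ R in Set.Ioi 0, abelT f R * abelT f R).toReal = d at h1 ⊢
    have h2 : J ψ / 2 - J φ ≤ d / (2 * Real.pi) := by
      rw [le_div_iff₀ (by positivity)]
      nlinarith [mul_nonneg hpi.le hMφ]
    rw [one_div_mul_eq_div]
    linarith
  · obtain ⟨f, hfm, hf⟩ := exists_measurable_density hφ
    have hfin : ∫⁻ R in Set.Ioi 0, abelT f R * abelT f R ≠ ⊤ := by
      intro h
      rw [energy_eq_top m x t hφ hfm hf h, hEψ'] at hE
      exact EReal.coe_ne_top _ hE.symm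
    have hd := (ENNReal.ofReal_toReal hfin).symm
    have hE2 := hE
    rw [hEψ', energy_eq_coe m x t hφ hfm hf ENNReal.toReal_nonneg hd, EReal.coe_eq_coe_iff] at hE2
    change _ + J φ = _ at hE2
    obtain ⟨hX, hX0, hMφ⟩ := hcross hφ hfm hf
    have hd0 : (0 : ℝ) ≤ (∫⁻ R in Set.Ioi 0, abelT f R * abelT f R).toReal := ENNReal.toReal_nonneg
    -- Equal energies reverse the integrated inequality, so 2FG = F² + G² and hence F = G almost
    -- everywhere; injectivity of the Abel transform concludes.
    have hle : ∫⁻ R in Set.Ioi 0, (abelT f R * abelT f R + abelT g R * abelT g R)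
        ≤ ∫⁻ R in Set.Ioi 0, 2 * (abelT f R * abelT g R) := by
      rw [lintegral_add_left (measurable_abelT_mul hfm hfm), lintegral_const_mul _ (measurable_abelT_mul hfm hgm), hDψ, hX, hd,
        ← ENNReal.ofReal_add hd0 (mul_nonneg hpi.le hJψ),
        show (2 : ENNReal) = ENNReal.ofReal 2 by simp, ← ENNReal.ofReal_mul (by norm_num)]
      refine ENNReal.ofReal_le_ofReal ?_
      generalize (∫⁻ R in Set.Ioi 0, abelT f R * abelT f R).toReal = d at hE2
      have h2 : d = 2 * Real.pi * (J ψ / 2 - J φ) := by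
        rw [← hE2]; field_simp; ring
      rw [h2]
      nlinarith [mul_nonneg hpi.le hMφ]
    have hne : ∫⁻ R in Set.Ioi 0, 2 * (abelT f R * abelT g R) ≠ ⊤ := by
      rw [lintegral_const_mul _ (measurable_abelT_mul hfm hgm), hX]
      exact ENNReal.mul_ne_top (by simp) ENNReal.ofReal_ne_top
    have hae := ae_eq_of_ae_le_of_lintegral_le
      (ae_of_all _ fun R => two_mul_mul_le_add (abelT f R) (abelT g R)) hne
      ((measurable_abelT_mul hfm hfm).add
        (measurable_abelT_mul hgm hgm)).aemeasurable hle
    have hF := ae_lt_top (measurable_abelT_mul hfm hfm) hfin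
    have hG := ae_lt_top (measurable_abelT_mul hgm hgm) (by
      change ∫⁻ R in Set.Ioi 0, abelT g R * abelT g R ≠ ⊤
      rw [hDψ]; exact ENNReal.ofReal_ne_top)
    have hfg : abelT f =ᵐ[volume.restrict (Set.Ioi 0)] abelT g := by
      filter_upwards [hae, hF, hG] with R h1 h2 h3
      refine eq_of_two_mul_mul_eq ?_ ?_ h1
      · intro h; simp [h] at h2
      · intro h; simp [h] at h3
    have hfi : ∫⁻ η in Set.Icc (0 : ℝ) 1, f η ≠ ⊤ := by
      rw [lintegral_congr_ae hf, ← ofReal_integral_eq_lintegral_ofReal hφ.1 hφ.2]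
      exact ENNReal.ofReal_ne_top
    have := ae_eq_of_abelT_ae_eq hfm hgm hfi hfg
    filter_upwards [this, hf, hg, hφ.2, hψ.2] with η h1 h2 h3 h4 h5
    rw [h2, h3] at h1
    exact (ENNReal.ofReal_eq_ofReal_iff h4 h5).1 h1

end

end StepData

/-! ### The Cauchy transform of a single band. -/

namespace StepData

open MeasureTheory Filter Asymptotics Topology

noncomputable section

/-! ### The square root of `(w - A) / (w - B)` and its Cauchy representation -/

/-- The branch of `√((w - A) / (w - B))` with positive real part. -/
def bandRoot (A B : ℝ) (w : ℂ) : ℂ := Complex.exp (Complex.log ((w - A) / (w - B)) / 2)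

/-- The points off the cut `[A, B]`. -/
def OffBand (A B : ℝ) (w : ℂ) : Prop := (w - A) / (w - B) ∈ Complex.slitPlane

lemma OffBand.ne {A B : ℝ} {w : ℂ} (h : OffBand A B w) : w ≠ A ∧ w ≠ B := by
  have h0 := Complex.slitPlane_ne_zero h
  rw [div_ne_zero_iff] at h0
  exact ⟨sub_ne_zero.1 h0.1, sub_ne_zero.1 h0.2⟩

lemma OffBand.ne_of_mem {A B : ℝ} {w : ℂ} (h : OffBand A B w) {v : ℝ} (hv : v ∈ Set.Icc A B) :
    (v : ℂ) - w ≠ 0 := by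
  rw [sub_ne_zero]
  rintro rfl
  unfold OffBand at h
  rw [← Complex.ofReal_sub, ← Complex.ofReal_sub, ← Complex.ofReal_div,
    Complex.ofReal_mem_slitPlane] at h
  exact absurd h (not_lt.2 (div_nonpos_of_nonneg_of_nonpos (by linarith [hv.1]) (by linarith [hv.2])))

lemma offBand_of_im_pos {A B : ℝ} (hAB : A < B) {w : ℂ} (hw : 0 < w.im) : OffBand A B w := by
  have hB : w - B ≠ 0 := by
    intro h
    have := congrArg Complex.im h
    simp at this; linarith
  have e : (w - A) / (w - B) = 1 + ((B - A : ℝ) : ℂ) * (w - B)⁻¹ := by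
    push_cast
    field_simp
    ring
  refine Complex.mem_slitPlane_iff.2 (Or.inr ?_)
  rw [e]
  have hn : 0 < Complex.normSq (w - B) := Complex.normSq_pos.2 hB
  simp only [Complex.add_im, Complex.one_im, Complex.im_ofReal_mul, Complex.inv_im, Complex.sub_im,
    Complex.ofReal_im, sub_zero, zero_add]
  exact (mul_neg_of_pos_of_neg (sub_pos.2 hAB) (div_neg_of_neg_of_pos (neg_neg_of_pos hw) hn)).ne

lemma offBand_ofReal {A B v : ℝ} (h : 0 < (v - A) / (v - B)) : OffBand A B v := by
  unfold OffBand
  rw [← Complex.ofReal_sub, ← Complex.ofReal_sub, ← Complex.ofReal_div,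
    Complex.ofReal_mem_slitPlane]
  exact h

lemma bandRoot_ne_zero (A B : ℝ) (w : ℂ) : bandRoot A B w ≠ 0 := Complex.exp_ne_zero _

lemma bandRoot_sq {A B : ℝ} {w : ℂ} (h : OffBand A B w) :
    bandRoot A B w ^ 2 = (w - A) / (w - B) := by
  unfold bandRoot
  rw [← Complex.exp_nat_mul, Nat.cast_ofNat, mul_div_cancel₀ _ two_ne_zero,
    Complex.exp_log (Complex.slitPlane_ne_zero h)]

lemma bandRoot_re_pos {A B : ℝ} {w : ℂ} (h : OffBand A B w) : 0 < (bandRoot A B w).re := by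
  unfold bandRoot
  rw [Complex.exp_re]
  refine mul_pos (Real.exp_pos _) (Real.cos_pos_of_mem_Ioo ?_)
  have h1 := Complex.mem_slitPlane_iff_arg.1 h
  have h2 := Complex.neg_pi_lt_arg ((w - A) / (w - B))
  have h3 := lt_of_le_of_ne (Complex.arg_le_pi ((w - A) / (w - B))) h1.1
  have e : (Complex.log ((w - A) / (w - B)) / 2).im = Complex.arg ((w - A) / (w - B)) / 2 := by
    rw [Complex.div_ofNat_im, Complex.log_im]
  rw [e]
  constructor <;> linarith

lemma norm_bandRoot_sq {A B : ℝ} {w : ℂ} (h : OffBand A B w) :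
    ‖bandRoot A B w‖ ^ 2 = ‖w - A‖ / ‖w - B‖ := by
  rw [← norm_pow, bandRoot_sq h, norm_div]

lemma bandRoot_ofReal {A B v : ℝ} (h : 0 < (v - A) / (v - B)) :
    bandRoot A B v = ((√((v - A) / (v - B)) : ℝ) : ℂ) := by
  unfold bandRoot
  rw [← Complex.ofReal_sub, ← Complex.ofReal_sub, ← Complex.ofReal_div, ← Complex.ofReal_log h.le]
  rw [show ((Real.log ((v - A) / (v - B)) : ℝ) : ℂ) / 2
    = ((Real.log ((v - A) / (v - B)) / 2 : ℝ) : ℂ) by push_cast; ring, ← Complex.ofReal_exp]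
  congr 1
  rw [← Real.log_sqrt h.le, Real.exp_log (Real.sqrt_pos.2 h)]

lemma bandRoot_self (A : ℝ) {w : ℂ} (h : w ≠ A) : bandRoot A A w = 1 := by
  unfold bandRoot
  rw [div_self (sub_ne_zero.2 h)]; simp

lemma intervalIntegrable_ofReal' {f : ℝ → ℝ} {a b : ℝ} (h : IntervalIntegrable f volume a b) :
    IntervalIntegrable (fun v => (f v : ℂ)) volume a b :=
  ⟨h.1.ofReal, h.2.ofReal⟩

section Cauchy

variable {A B : ℝ} {w : ℂ}

lemma band_factor_mem_slitPlane {s : ℂ} (hs : 0 < s.re) {x y : ℝ} (hy : 0 ≤ y)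
    (h : 0 < x ∨ 0 < y) :
    (x : ℂ) - Complex.I * s * y ∈ Complex.slitPlane ∧ (x : ℂ) + Complex.I * s * y ∈ Complex.slitPlane := by
  rcases hy.eq_or_lt with rfl | hy
  · have : 0 < x := h.resolve_right (lt_irrefl _)
    simp [Complex.ofReal_mem_slitPlane, this]
  · refine ⟨Complex.mem_slitPlane_iff.2 (Or.inr ?_), Complex.mem_slitPlane_iff.2 (Or.inr ?_)⟩
    · simp [hs.ne', hy.ne']
    · simp [hs.ne', hy.ne']

/-- Let X = √(v - A), Y = √(B - v) and s = `bandRoot A B w`. The arguments X ± isY of the logarithms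
multiply to X² + s²Y² = (B - A)(w - v)/(w - B), which creates the Cauchy kernel. As Re s > 0, both
stay off the cut of the logarithm. -/
lemma hasDerivAt_band_log (h : OffBand A B w) {v : ℝ} (hv : v ∈ Set.Ioo A B) :
    HasDerivAt (fun v : ℝ => Complex.log ((√(v - A) : ℝ) - Complex.I * bandRoot A B w * (√(B - v) : ℝ))
      - Complex.log ((√(v - A) : ℝ) + Complex.I * bandRoot A B w * (√(B - v) : ℝ)))
      (((1 / √((B - v) * (v - A)) : ℝ) : ℂ) * (Complex.I * bandRoot A B w * (w - B) / (w - v))) v := by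
  set s := bandRoot A B w with hs
  have hx0 : 0 < v - A := by linarith [hv.1]
  have hy0 : 0 < B - v := by linarith [hv.2]
  have px := Real.sqrt_pos.2 hx0
  have py := Real.sqrt_pos.2 hy0
  have dx : HasDerivAt (fun v : ℝ => ((√(v - A) : ℝ) : ℂ)) ((1 / (2 * √(v - A)) : ℝ) : ℂ) v :=
    (((hasDerivAt_id v).sub_const A).sqrt hx0.ne').ofReal_comp
  have dy : HasDerivAt (fun v : ℝ => ((√(B - v) : ℝ) : ℂ)) ((-1 / (2 * √(B - v)) : ℝ) : ℂ) v :=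
    (((hasDerivAt_id v).const_sub B).sqrt hy0.ne').ofReal_comp
  obtain ⟨m1, m2⟩ := band_factor_mem_slitPlane (bandRoot_re_pos h) py.le (Or.inl px)
  rw [← hs] at m1 m2
  refine (((dx.sub (dy.const_mul (Complex.I * s))).clog_real m1).sub
    ((dx.add (dy.const_mul (Complex.I * s))).clog_real m2)).congr_deriv ?_
  have n1 := Complex.slitPlane_ne_zero m1
  have n2 := Complex.slitPlane_ne_zero m2
  have hw : w - v ≠ 0 := by
    have := h.ne_of_mem (Set.Ioo_subset_Icc_self hv)
    rw [← neg_ne_zero, neg_sub]; exact this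
  have hwB : w - B ≠ 0 := sub_ne_zero.2 h.ne.2
  have hs2 : s ^ 2 * (w - B) = w - A := by
    rw [hs, bandRoot_sq h, div_mul_cancel₀ _ hwB]
  have sx : ((√(v - A) : ℝ) : ℂ) ^ 2 = v - A := by
    rw [← Complex.ofReal_pow, Real.sq_sqrt hx0.le]; push_cast; ring
  have sy : ((√(B - v) : ℝ) : ℂ) ^ 2 = B - v := by
    rw [← Complex.ofReal_pow, Real.sq_sqrt hy0.le]; push_cast; ring
  rw [Real.sqrt_mul hy0.le]
  have cx : ((√(v - A) : ℝ) : ℂ) ≠ 0 := Complex.ofReal_ne_zero.2 px.ne'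
  have cy : ((√(B - v) : ℝ) : ℂ) ≠ 0 := Complex.ofReal_ne_zero.2 py.ne'
  simp only [Pi.sub_apply, Pi.add_apply]
  push_cast
  generalize ((√(v - A) : ℝ) : ℂ) = X at *
  generalize ((√(B - v) : ℝ) : ℂ) = Y at *
  have hI := Complex.I_sq
  have hXY : X ^ 2 + s ^ 2 * Y ^ 2 = (B - A) * (w - v) / (w - B) := by
    rw [eq_div_iff hwB, sx, sy]
    linear_combination ((B : ℂ) - v) * hs2
  have hprod : (X - Complex.I * s * Y) * (X + Complex.I * s * Y) = (B - A) * (w - v) / (w - B) := by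
    rw [← hXY]; linear_combination (-s ^ 2 * Y ^ 2) * hI
  have hBA : (B : ℂ) - A ≠ 0 := by
    rw [← Complex.ofReal_sub]; exact Complex.ofReal_ne_zero.2 (by linarith)
  have hnum : (1 / (2 * X) - Complex.I * s * (-1 / (2 * Y))) / (X - Complex.I * s * Y)
      - (1 / (2 * X) + Complex.I * s * (-1 / (2 * Y))) / (X + Complex.I * s * Y)
      = (Complex.I * s * (X ^ 2 + Y ^ 2) / (X * Y))
        / ((X - Complex.I * s * Y) * (X + Complex.I * s * Y)) := by
    field_simp
    ring
  rw [hnum, hprod, sx, sy]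
  field_simp
  ring

lemma continuousOn_band_log (hAB : A < B) (h : OffBand A B w) :
    ContinuousOn (fun v : ℝ =>
      Complex.log ((√(v - A) : ℝ) - Complex.I * bandRoot A B w * (√(B - v) : ℝ))
      - Complex.log ((√(v - A) : ℝ) + Complex.I * bandRoot A B w * (√(B - v) : ℝ))) (Set.Icc A B) := by
  have hc1 : Continuous fun v : ℝ => ((√(v - A) : ℝ) : ℂ) := by fun_prop
  have hc2 : Continuous fun v : ℝ => ((√(B - v) : ℝ) : ℂ) := by fun_prop
  have hm : ∀ v ∈ Set.Icc A B, 0 < √(v - A) ∨ 0 < √(B - v) := fun v hv => by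
    rcases hv.1.eq_or_lt with h1 | h1
    · exact Or.inr (Real.sqrt_pos.2 (by linarith))
    · exact Or.inl (Real.sqrt_pos.2 (by linarith))
  refine ContinuousOn.sub (ContinuousOn.clog (by fun_prop) fun v hv => ?_)
    (ContinuousOn.clog (by fun_prop) fun v hv => ?_)
  · exact (band_factor_mem_slitPlane (bandRoot_re_pos h) (Real.sqrt_nonneg _)
      (hm v hv)).1
  · exact (band_factor_mem_slitPlane (bandRoot_re_pos h) (Real.sqrt_nonneg _)
      (hm v hv)).2

lemma intervalIntegrable_arcsine_div (hAB : A < B) (h : OffBand A B w) :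
    IntervalIntegrable (fun v : ℝ => ((1 / √((B - v) * (v - A)) : ℝ) : ℂ) * (1 / (v - w)))
      volume A B := by
  refine IntervalIntegrable.mul_continuousOn (intervalIntegrable_ofReal' (intervalIntegrable_arcsine hAB)) ?_
  rw [Set.uIcc_of_le hAB.le]
  exact continuousOn_const.div (by fun_prop) fun v hv => h.ne_of_mem hv

lemma integral_arcsine_div (hAB : A < B) (h : OffBand A B w) :
    ∫ v in A..B, ((1 / √((B - v) * (v - A)) : ℝ) : ℂ) * (1 / (v - w))
      = -Real.pi / (bandRoot A B w * (w - B)) := by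
  set s := bandRoot A B w with hs
  have hs0 : s ≠ 0 := bandRoot_ne_zero A B w
  have hwB : w - B ≠ 0 := sub_ne_zero.2 h.ne.2
  have hint := (intervalIntegrable_arcsine_div hAB h).const_mul (-(Complex.I * s * (w - B)))
  have e : ∀ v : ℝ, -(Complex.I * s * (w - B)) * (((1 / √((B - v) * (v - A)) : ℝ) : ℂ) * (1 / (v - w)))
      = ((1 / √((B - v) * (v - A)) : ℝ) : ℂ) * (Complex.I * s * (w - B) / (w - v)) := by
    intro v
    rw [← neg_sub w, div_neg]; ring
  simp only [e] at hint
  have hval := intervalIntegral.integral_eq_sub_of_hasDerivAt_of_le hAB.le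
    (continuousOn_band_log hAB h) (fun v hv => hasDerivAt_band_log h hv) hint
  have hre : 0 < s.re := bandRoot_re_pos h
  have hR : 0 < √(B - A) := Real.sqrt_pos.2 (by linarith)
  have him : 0 < (Complex.I * s * ((√(B - A) : ℝ) : ℂ)).im := by simp [hre, hR]
  -- The primitive vanishes at v = B. At v = A it is the difference of the logarithms of two
  -- opposite numbers, which is -πi because is√(B - A) lies in the upper half plane.
  have hneg : Complex.log (-(Complex.I * s * ((√(B - A) : ℝ) : ℂ)))
      = Complex.log (Complex.I * s * ((√(B - A) : ℝ) : ℂ)) - Real.pi * Complex.I := by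
    unfold Complex.log
    rw [norm_neg, Complex.arg_neg_eq_arg_sub_pi_of_im_pos him]
    push_cast; ring
  simp only [← hs, ← e, sub_self, Real.sqrt_zero, Complex.ofReal_zero, mul_zero, sub_zero, add_zero,
    zero_sub, zero_add] at hval
  rw [intervalIntegral.integral_const_mul, hneg] at hval
  have hI := Complex.I_ne_zero
  rw [eq_div_iff (mul_ne_zero hs0 hwB)]
  have h2 : Complex.I * ((∫ v in A..B, ((1 / √((B - v) * (v - A)) : ℝ) : ℂ) * (1 / (v - w)))
      * (s * (w - B))) = Complex.I * -Real.pi := by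
    linear_combination -hval
  exact mul_left_cancel₀ hI h2

lemma band_density_eq {v : ℝ} (hv : v ∈ Set.Ioo A B) :
    √((v - A) / (B - v)) = (v - A) * (1 / √((B - v) * (v - A))) := by
  have hx0 : 0 < v - A := by linarith [hv.1]
  have hy0 : 0 < B - v := by linarith [hv.2]
  rw [Real.sqrt_div hx0.le, Real.sqrt_mul hy0.le]
  have h1 := Real.sqrt_pos.2 hx0
  have h2 := Real.sqrt_pos.2 hy0
  have h3 := Real.mul_self_sqrt hx0.le
  field_simp
  rw [pow_two, h3]

lemma intervalIntegrable_band_density (hAB : A < B) :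
    IntervalIntegrable (fun v : ℝ => √((v - A) / (B - v))) volume A B :=
  intervalIntegrable_congr_Ioo hAB.le (fun _ hv => (band_density_eq hv).symm)
    ((intervalIntegrable_arcsine hAB).continuousOn_mul (by fun_prop))

lemma intervalIntegrable_band_cauchy (hAB : A < B) (h : OffBand A B w) :
    IntervalIntegrable (fun v : ℝ => ((√((v - A) / (B - v)) : ℝ) : ℂ) * (1 / (v - w)))
      volume A B := by
  refine IntervalIntegrable.mul_continuousOn (intervalIntegrable_ofReal' (intervalIntegrable_band_density hAB)) ?_
  rw [Set.uIcc_of_le hAB.le]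
  exact continuousOn_const.div (by fun_prop) fun v hv => h.ne_of_mem hv

/-- Writing v - A = (v - w) + (w - A) reduces to the arcsine density. With s = `bandRoot A B w` the
two parts give π and -π(w - A)/(s(w - B)), and the latter is -πs since s² = (w - A)/(w - B). -/
lemma integral_band_cauchy (hAB : A < B) (h : OffBand A B w) :
    ∫ v in A..B, ((√((v - A) / (B - v)) : ℝ) : ℂ) * (1 / (v - w))
      = Real.pi * (1 - bandRoot A B w) := by
  have hwB : w - B ≠ 0 := sub_ne_zero.2 h.ne.2
  have e : ∫ v in A..B, ((√((v - A) / (B - v)) : ℝ) : ℂ) * (1 / (v - w))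
      = ∫ v in A..B, (((1 / √((B - v) * (v - A)) : ℝ) : ℂ)
        + (w - A) * (((1 / √((B - v) * (v - A)) : ℝ) : ℂ) * (1 / (v - w)))) := by
    rw [intervalIntegral.integral_of_le hAB.le, intervalIntegral.integral_of_le hAB.le,
      integral_Ioc_eq_integral_Ioo, integral_Ioc_eq_integral_Ioo]
    refine setIntegral_congr_fun measurableSet_Ioo fun v hv => ?_
    have hne := h.ne_of_mem (Set.Ioo_subset_Icc_self hv)
    rw [band_density_eq hv, Complex.ofReal_mul]
    generalize ((1 / √((B - v) * (v - A)) : ℝ) : ℂ) = R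
    push_cast
    field_simp
    ring
  rw [e, intervalIntegral.integral_add (intervalIntegrable_ofReal' (intervalIntegrable_arcsine hAB))
    ((intervalIntegrable_arcsine_div hAB h).const_mul _), intervalIntegral.integral_const_mul,
    integral_arcsine_div hAB h, intervalIntegral.integral_ofReal, integral_arcsine hAB]
  have hs := bandRoot_sq h
  have hs0 := bandRoot_ne_zero A B w
  rw [eq_div_iff hwB] at hs
  rw [← hs]
  field_simp
  ring

end Cauchy

end

end StepData

/-! ### The Cauchy transform of two bands. -/

namespace StepData

open MeasureTheory Filter Asymptotics Topology

noncomputable section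

/-! ### Two bands -/

/-- The admissible positions of the branch points `b ≤ a < 1`; `b = 0` is the case of one band. -/
def BandEnds (a b : ℝ) : Prop := 0 ≤ a ∧ a < 1 ∧ (b = 0 ∨ 0 < b ∧ b < a)

/-- The function `√(w (w - a) / ((w - b) (w - 1)))`, cut along the bands `[0, b]` and `[a, 1]`. -/
def twoBand (a b : ℝ) (w : ℂ) : ℂ := bandRoot 0 b w * bandRoot a 1 w

/-- The boundary values on the bands; one of the two terms vanishes. -/
def bandDensity (a b v : ℝ) : ℝ :=
  √(v / (b - v)) * √((a - v) / (1 - v)) + √(v / (v - b)) * √((v - a) / (1 - v))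

/-- The boundary values in the gap `(b, a)`. -/
def gapFun (a b v : ℝ) : ℝ := √(v / (v - b)) * √((a - v) / (1 - v))

variable {a b : ℝ}

lemma BandEnds.b_nonneg (h : BandEnds a b) : 0 ≤ b := by
  rcases h.2.2 with h | h
  · exact h.ge
  · exact h.1.le

lemma BandEnds.b_le (h : BandEnds a b) : b ≤ a := by
  rcases h.2.2 with h' | h'
  · rw [h']; exact h.1
  · exact h'.2.le

lemma BandEnds.lt_of_pos (h : BandEnds a b) (hb : 0 < b) : b < a := by
  rcases h.2.2 with h | h
  · exact absurd h hb.ne'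
  · exact h.2

lemma bandDensity_lower {v : ℝ} (hv : v ∈ Set.Ioo 0 b) :
    bandDensity a b v = √(v / (b - v)) * √((a - v) / (1 - v)) := by
  unfold bandDensity
  rw [Real.sqrt_eq_zero_of_nonpos (x := v / (v - b))
    (div_nonpos_of_nonneg_of_nonpos hv.1.le (by linarith [hv.2]))]
  ring

lemma bandDensity_gap (h : BandEnds a b) {v : ℝ} (hv : v ∈ Set.Ioo b a) : bandDensity a b v = 0 := by
  unfold bandDensity
  rw [Real.sqrt_eq_zero_of_nonpos (x := v / (b - v))
    (div_nonpos_of_nonneg_of_nonpos (h.b_nonneg.trans hv.1.le) (by linarith [hv.1])),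
    Real.sqrt_eq_zero_of_nonpos (x := (v - a) / (1 - v))
    (div_nonpos_of_nonpos_of_nonneg (by linarith [hv.2]) (by linarith [hv.2, h.2.1]))]
  ring

lemma bandDensity_upper (h : BandEnds a b) {v : ℝ} (hv : v ∈ Set.Ioo a 1) :
    bandDensity a b v = √(v / (v - b)) * √((v - a) / (1 - v)) := by
  unfold bandDensity
  rw [Real.sqrt_eq_zero_of_nonpos (x := v / (b - v))
    (div_nonpos_of_nonneg_of_nonpos (h.1.trans hv.1.le) (by linarith [hv.1, h.b_le]))]
  ring

lemma gapFun_lower {v : ℝ} (hv : v ∈ Set.Icc 0 b) : gapFun a b v = 0 := by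
  unfold gapFun
  rw [Real.sqrt_eq_zero_of_nonpos (x := v / (v - b))
    (div_nonpos_of_nonneg_of_nonpos hv.1 (by linarith [hv.2]))]
  ring

lemma gapFun_upper {v : ℝ} (hv : v ∈ Set.Icc a 1) : gapFun a b v = 0 := by
  unfold gapFun
  rw [Real.sqrt_eq_zero_of_nonpos (x := (a - v) / (1 - v))
    (div_nonpos_of_nonpos_of_nonneg (by linarith [hv.1]) (by linarith [hv.2]))]
  ring

lemma bandDensity_nonneg (a b v : ℝ) : 0 ≤ bandDensity a b v := by
  unfold bandDensity; positivity

lemma gapFun_nonneg (a b v : ℝ) : 0 ≤ gapFun a b v := by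
  unfold gapFun; positivity

lemma measurable_bandDensity (a b : ℝ) : Measurable (bandDensity a b) := by
  unfold bandDensity; fun_prop

lemma measurable_gapFun (a b : ℝ) : Measurable (gapFun a b) := by
  unfold gapFun; fun_prop

/-- The points at which the Cauchy transforms are evaluated. -/
def Exterior (w : ℂ) : Prop := 0 < w.im ∨ ∃ ξ : ℝ, 1 < ξ ∧ w = ξ

lemma Exterior.offBand {w : ℂ} (hw : Exterior w) {A B : ℝ} (hAB : A < B) (hB : B ≤ 1) :
    OffBand A B w := by
  rcases hw with hw | ⟨ξ, hξ, rfl⟩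
  · exact offBand_of_im_pos hAB hw
  · exact offBand_ofReal (div_pos (by linarith) (by linarith))

lemma Exterior.sub_ne {w : ℂ} (hw : Exterior w) {v : ℝ} (hv : v ∈ Set.Icc (0 : ℝ) 1) :
    (v : ℂ) - w ≠ 0 :=
  (hw.offBand zero_lt_one le_rfl).ne_of_mem hv

lemma Exterior.continuousOn_inv {w : ℂ} (hw : Exterior w) :
    ContinuousOn (fun v : ℝ => 1 / ((v : ℂ) - w)) (Set.Icc 0 1) :=
  continuousOn_const.div (by fun_prop) fun _ hv => hw.sub_ne hv

lemma intervalIntegrable_lower (h : BandEnds a b) :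
    IntervalIntegrable (bandDensity a b) volume 0 b := by
  rcases h.b_nonneg.eq_or_lt with h0 | h0
  · rw [← h0]
  refine intervalIntegrable_congr_Ioo h0.le (fun v hv => (bandDensity_lower hv).symm) ?_
  have h1 := intervalIntegrable_band_density h0
  simp only [sub_zero] at h1
  refine h1.mul_continuousOn ?_
  rw [Set.uIcc_of_le h0.le]
  refine (ContinuousOn.div (by fun_prop) (by fun_prop) fun v hv => ?_).sqrt
  linarith [hv.2, h.lt_of_pos h0, h.2.1]

lemma intervalIntegrable_upper (h : BandEnds a b) :
    IntervalIntegrable (bandDensity a b) volume a 1 := by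
  refine intervalIntegrable_congr_Ioo h.2.1.le (fun v hv => (bandDensity_upper h hv).symm) ?_
  have h1 := intervalIntegrable_band_density h.2.1
  rcases h.b_nonneg.eq_or_lt with h0 | h0
  · refine intervalIntegrable_congr_Ioo h.2.1.le (fun v hv => ?_) h1
    rw [← h0, sub_zero, div_self (h.1.trans_lt hv.1).ne', Real.sqrt_one, one_mul]
  · refine h1.continuousOn_mul ?_
    rw [Set.uIcc_of_le h.2.1.le]
    refine (ContinuousOn.div (by fun_prop) (by fun_prop) fun v hv => ?_).sqrt
    linarith [hv.1, h.lt_of_pos h0]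

lemma intervalIntegrable_gap (h : BandEnds a b) :
    IntervalIntegrable (bandDensity a b) volume b a :=
  intervalIntegrable_congr_Ioo h.b_le (f := fun _ => 0) (fun _ hv => (bandDensity_gap h hv).symm)
    (intervalIntegrable_const)

lemma intervalIntegrable_bandDensity (h : BandEnds a b) :
    IntervalIntegrable (bandDensity a b) volume 0 1 :=
  ((intervalIntegrable_lower h).trans (intervalIntegrable_gap h)).trans (intervalIntegrable_upper h)

lemma intervalIntegrable_bandDensity_cauchy (h : BandEnds a b) {w : ℂ} (hw : Exterior w) :
    IntervalIntegrable (fun v => (bandDensity a b v : ℂ) * (1 / (v - w))) volume 0 1 := by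
  refine (intervalIntegrable_ofReal' (intervalIntegrable_bandDensity h)).mul_continuousOn ?_
  rw [Set.uIcc_of_le zero_le_one]
  exact hw.continuousOn_inv

/-- The product of two Cauchy transforms on separated bands. -/
lemma integral_two_band_cauchy (hb : 0 < b) (hba : b < a) (ha : a < 1) {w : ℂ} (hw : Exterior w) :
    (∫ v in 0..b, ((√(v / (b - v)) : ℝ) : ℂ) * (1 / (v - w)) * bandRoot a 1 v)
      + (∫ u in a..1, ((√((u - a) / (1 - u)) : ℝ) : ℂ) * (1 / (u - w)) * bandRoot 0 b u)
      = Real.pi * (1 - bandRoot 0 b w * bandRoot a 1 w) := by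
  set f : ℝ → ℂ := fun v => ((√(v / (b - v)) : ℝ) : ℂ) * (1 / (v - w)) with hf
  set g : ℝ → ℂ := fun u => ((√((u - a) / (1 - u)) : ℝ) : ℂ) * (1 / (u - w)) with hg
  set r₁ : ℝ → ℂ := fun v => ((√(v / (b - v)) : ℝ) : ℂ) with hr₁
  set r₂ : ℝ → ℂ := fun u => ((√((u - a) / (1 - u)) : ℝ) : ℂ) with hr₂
  set μ₁ := (volume : Measure ℝ).restrict (Set.Ioc 0 b) with hμ₁
  set μ₂ := (volume : Measure ℝ).restrict (Set.Ioc a 1) with hμ₂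
  have o1 := hw.offBand hb (by linarith)
  have o2 := hw.offBand ha le_rfl
  have ir₁ : Integrable r₁ μ₁ := by
    have := (intervalIntegrable_ofReal' (intervalIntegrable_band_density hb)).1
    simp only [sub_zero] at this; exact this
  have ir₂ : Integrable r₂ μ₂ := (intervalIntegrable_ofReal' (intervalIntegrable_band_density ha)).1
  have if_ : Integrable f μ₁ := by
    have := (intervalIntegrable_band_cauchy hb o1).1
    simp only [sub_zero] at this; exact this
  have ig : Integrable g μ₂ := (intervalIntegrable_band_cauchy ha o2).1
  have vf : ∫ v, f v ∂μ₁ = Real.pi * (1 - bandRoot 0 b w) := by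
    have := integral_band_cauchy hb o1
    rw [intervalIntegral.integral_of_le hb.le] at this
    simpa only [sub_zero] using this
  have vg : ∫ u, g u ∂μ₂ = Real.pi * (1 - bandRoot a 1 w) := by
    have := integral_band_cauchy ha o2
    rwa [intervalIntegral.integral_of_le ha.le] at this
  have hmem : ∀ᵐ p ∂(μ₁.prod μ₂), p.1 ∈ Set.Ioc 0 b ∧ p.2 ∈ Set.Ioc a 1 := by
    rw [hμ₁, hμ₂, Measure.prod_restrict]
    exact ae_restrict_mem (measurableSet_Ioc.prod measurableSet_Ioc)
  have mker : Measurable fun p : ℝ × ℝ => (1 : ℂ) / ((p.2 : ℂ) - p.1) := by fun_prop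
  have bker : ∀ v ∈ Set.Ioc 0 b, ∀ u ∈ Set.Ioc a 1, ‖(1 : ℂ) / ((u : ℂ) - v)‖ ≤ 1 / (a - b) := by
    intro v hv u hu
    rw [← Complex.ofReal_sub, norm_div, norm_one, Complex.norm_real,
      Real.norm_of_nonneg (by linarith [hv.2, hu.1])]
    exact one_div_le_one_div_of_le (by linarith) (by linarith [hv.2, hu.1])
  have iker : ∀ {F : ℝ × ℝ → ℂ}, Integrable F (μ₁.prod μ₂) →
      Integrable (fun p => F p * (1 / ((p.2 : ℂ) - p.1))) (μ₁.prod μ₂) := by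
    intro F hF
    refine (hF.norm.mul_const (1 / (a - b))).mono' (hF.1.mul mker.aestronglyMeasurable) ?_
    filter_upwards [hmem] with p hp
    rw [norm_mul]
    exact mul_le_mul_of_nonneg_left (bker _ hp.1 _ hp.2) (norm_nonneg _)
  have i1 : Integrable (fun p : ℝ × ℝ => f p.1 * r₂ p.2 * (1 / ((p.2 : ℂ) - p.1))) (μ₁.prod μ₂) :=
    iker (if_.mul_prod ir₂)
  have i2 : Integrable (fun p : ℝ × ℝ => r₁ p.1 * g p.2 * (1 / ((p.2 : ℂ) - p.1))) (μ₁.prod μ₂) :=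
    iker (ir₁.mul_prod ig)
  -- Resolvent identity: 1/((v - w)(u - w)) = (1/(v - w) - 1/(u - w))/(u - v). In either term one
  -- variable now occurs only in 1/(u - v), so that integral is a one-band transform at a point of
  -- the other band.
  have hprod : (∫ v, f v ∂μ₁) * (∫ u, g u ∂μ₂)
      = (∫ p, f p.1 * r₂ p.2 * (1 / ((p.2 : ℂ) - p.1)) ∂(μ₁.prod μ₂))
        - ∫ p, r₁ p.1 * g p.2 * (1 / ((p.2 : ℂ) - p.1)) ∂(μ₁.prod μ₂) := by
    rw [← integral_prod_mul, ← integral_sub i1 i2]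
    refine integral_congr_ae ?_
    filter_upwards [hmem] with p hp
    have n1 := hw.sub_ne (v := p.1) ⟨hp.1.1.le, by linarith [hp.1.2]⟩
    have n2 := hw.sub_ne (v := p.2) ⟨by linarith [hp.2.1], hp.2.2⟩
    have n3 : (p.2 : ℂ) - p.1 ≠ 0 := by
      rw [← Complex.ofReal_sub]
      exact Complex.ofReal_ne_zero.2 (by linarith [hp.1.2, hp.2.1])
    simp only [hf, hg, hr₁, hr₂]
    field_simp
    ring
  have e1 : ∫ p, f p.1 * r₂ p.2 * (1 / ((p.2 : ℂ) - p.1)) ∂(μ₁.prod μ₂)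
      = Real.pi * (∫ v, f v ∂μ₁) - Real.pi * ∫ v, f v * bandRoot a 1 v ∂μ₁ := by
    have hin : ∀ v ∈ Set.Ioc 0 b, ∫ u, f v * r₂ u * (1 / ((u : ℂ) - v)) ∂μ₂
        = Real.pi * f v - Real.pi * (f v * bandRoot a 1 v) := by
      intro v hv
      have hv2 := hv.2
      have o : OffBand a 1 v := offBand_ofReal (div_pos_of_neg_of_neg (by linarith) (by linarith))
      have := integral_band_cauchy ha o
      rw [intervalIntegral.integral_of_le ha.le] at this
      simp only [mul_assoc]
      rw [integral_const_mul, this]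
      ring
    have hae : (fun v => ∫ u, f v * r₂ u * (1 / ((u : ℂ) - v)) ∂μ₂)
        =ᵐ[μ₁] fun v => Real.pi * f v - Real.pi * (f v * bandRoot a 1 v) := by
      filter_upwards [ae_restrict_mem measurableSet_Ioc] with v hv using hin v hv
    have hi3 : Integrable (fun v => Real.pi * f v - Real.pi * (f v * bandRoot a 1 v)) μ₁ :=
      (i1.integral_prod_left).congr hae
    have hi4 : Integrable (fun v => Real.pi * (f v * bandRoot a 1 v)) μ₁ := by
      have := (if_.const_mul (Real.pi : ℂ)).sub hi3
      refine this.congr (ae_of_all _ fun v => ?_)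
      simp
    rw [integral_prod _ i1, integral_congr_ae hae, integral_sub (if_.const_mul _) hi4,
      integral_const_mul, integral_const_mul]
  have e2 : ∫ p, r₁ p.1 * g p.2 * (1 / ((p.2 : ℂ) - p.1)) ∂(μ₁.prod μ₂)
      = Real.pi * (∫ u, g u * bandRoot 0 b u ∂μ₂) - Real.pi * ∫ u, g u ∂μ₂ := by
    have hin : ∀ u ∈ Set.Ioc a 1, ∫ v, r₁ v * g u * (1 / ((u : ℂ) - v)) ∂μ₁
        = Real.pi * (g u * bandRoot 0 b u) - Real.pi * g u := by
      intro u hu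
      have hu1 := hu.1
      have o : OffBand 0 b u := offBand_ofReal (div_pos (by linarith) (by linarith))
      have := integral_band_cauchy hb o
      rw [intervalIntegral.integral_of_le hb.le] at this
      simp only [sub_zero] at this
      have e : ∀ v : ℝ, r₁ v * g u * (1 / ((u : ℂ) - v))
          = -g u * (((√(v / (b - v)) : ℝ) : ℂ) * (1 / ((v : ℂ) - u))) := by
        intro v
        rw [← neg_sub (v : ℂ), div_neg]
        simp only [hr₁]; ring
      simp only [e]
      rw [integral_const_mul, this]
      ring
    have hae : (fun u => ∫ v, r₁ v * g u * (1 / ((u : ℂ) - v)) ∂μ₁)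
        =ᵐ[μ₂] fun u => Real.pi * (g u * bandRoot 0 b u) - Real.pi * g u := by
      filter_upwards [ae_restrict_mem measurableSet_Ioc] with u hu using hin u hu
    have hi3 : Integrable (fun u => Real.pi * (g u * bandRoot 0 b u) - Real.pi * g u) μ₂ :=
      (i2.integral_prod_right).congr hae
    have hi4 : Integrable (fun u => Real.pi * (g u * bandRoot 0 b u)) μ₂ := by
      have := (ig.const_mul (Real.pi : ℂ)).add hi3
      refine this.congr (ae_of_all _ fun v => ?_)
      simp
    rw [integral_prod_symm _ i2, integral_congr_ae hae, integral_sub hi4 (ig.const_mul _),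
      integral_const_mul, integral_const_mul]
  rw [e1, e2, vf, vg] at hprod
  rw [intervalIntegral.integral_of_le hb.le, intervalIntegral.integral_of_le ha.le]
  have hpi : (Real.pi : ℂ) ≠ 0 := Complex.ofReal_ne_zero.2 Real.pi_ne_zero
  refine mul_left_cancel₀ hpi ?_
  change (Real.pi : ℂ) * ((∫ v, f v * bandRoot a 1 v ∂μ₁) + ∫ u, g u * bandRoot 0 b u ∂μ₂) = _
  linear_combination hprod

/-- On each band the density is the one-band density times the real value of the other root, and in
the gap it vanishes. For b = 0 the lower band disappears and its root is 1. -/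
lemma integral_bandDensity_cauchy (h : BandEnds a b) {w : ℂ} (hw : Exterior w) :
    ∫ v in (0 : ℝ)..1, (bandDensity a b v : ℂ) * (1 / (v - w)) = Real.pi * (1 - twoBand a b w) := by
  have hi := intervalIntegrable_bandDensity_cauchy h hw
  have hsub : ∀ {c d : ℝ}, 0 ≤ c → c ≤ d → d ≤ 1 →
      IntervalIntegrable (fun v => (bandDensity a b v : ℂ) * (1 / (v - w))) volume c d :=
    fun h1 h2 h3 => hi.mono_set (by
      rw [Set.uIcc_of_le h2, Set.uIcc_of_le zero_le_one]; exact Set.Icc_subset_Icc h1 h3)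
  have hb0 := h.b_nonneg
  have hba := h.b_le
  have ha1 := h.2.1
  rw [← intervalIntegral.integral_add_adjacent_intervals (hsub le_rfl h.1 ha1.le)
    (hsub h.1 ha1.le le_rfl), ← intervalIntegral.integral_add_adjacent_intervals
    (hsub le_rfl hb0 (hba.trans ha1.le)) (hsub hb0 hba ha1.le)]
  have eg : ∫ v in b..a, (bandDensity a b v : ℂ) * (1 / (v - w)) = 0 := by
    rw [intervalIntegral.integral_of_le hba, integral_Ioc_eq_integral_Ioo,
      setIntegral_congr_fun (g := fun _ => 0) measurableSet_Ioo fun v hv => by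
        simp [bandDensity_gap h hv]]
    simp
  have eu : ∫ v in a..1, (bandDensity a b v : ℂ) * (1 / (v - w))
      = ∫ u in a..1, ((√((u - a) / (1 - u)) : ℝ) : ℂ) * (1 / (u - w)) * bandRoot 0 b u := by
    rw [intervalIntegral.integral_of_le ha1.le, intervalIntegral.integral_of_le ha1.le,
      integral_Ioc_eq_integral_Ioo, integral_Ioc_eq_integral_Ioo]
    refine setIntegral_congr_fun measurableSet_Ioo fun v hv => ?_
    have hv0 : 0 < v := h.1.trans_lt hv.1
    rw [bandDensity_upper h hv, bandRoot_ofReal (div_pos (by linarith) (by linarith [hv.1]))]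
    push_cast
    rw [sub_zero]; ring
  rw [eg, eu]
  rcases hb0.eq_or_lt with h0 | h0
  · have hw0 : w ≠ (0 : ℝ) := (hw.offBand zero_lt_one le_rfl).ne.1
    subst h0
    rw [intervalIntegral.integral_same, twoBand, bandRoot_self 0 hw0, one_mul, zero_add, zero_add,
      ← integral_band_cauchy ha1 (hw.offBand ha1 le_rfl)]
    rw [intervalIntegral.integral_of_le ha1.le, intervalIntegral.integral_of_le ha1.le,
      integral_Ioc_eq_integral_Ioo, integral_Ioc_eq_integral_Ioo]
    refine setIntegral_congr_fun measurableSet_Ioo fun v hv => ?_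
    have hv0 : 0 < v := h.1.trans_lt hv.1
    rw [bandRoot_self 0 (Complex.ofReal_injective.ne hv0.ne'), mul_one]
  · have hlt := h.lt_of_pos h0
    have el : ∫ v in 0..b, (bandDensity a b v : ℂ) * (1 / (v - w))
        = ∫ v in 0..b, ((√(v / (b - v)) : ℝ) : ℂ) * (1 / (v - w)) * bandRoot a 1 v := by
      rw [intervalIntegral.integral_of_le h0.le, intervalIntegral.integral_of_le h0.le,
        integral_Ioc_eq_integral_Ioo, integral_Ioc_eq_integral_Ioo]
      refine setIntegral_congr_fun measurableSet_Ioo fun v hv => ?_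
      have hv2 := hv.2
      rw [bandDensity_lower hv,
        bandRoot_ofReal (div_pos_of_neg_of_neg (by linarith) (by linarith)),
        ← neg_div_neg_eq (v - a), neg_sub, neg_sub]
      push_cast
      ring
    rw [el, add_zero, integral_two_band_cauchy h0 hlt ha1 hw, twoBand]

end

end StepData

/-! ### Boundary values, majorants and polynomial Cauchy transforms. -/

namespace StepData

open MeasureTheory Filter Asymptotics Topology

noncomputable section

/-! ### Boundary values of the band functions -/

variable {a b : ℝ}

lemma exterior_sq {s ε : ℝ} (hs : 0 < s) (hε : 0 < ε) :
    Exterior (((s : ℂ) + ε * Complex.I) ^ 2) := by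
  left
  simp [pow_two]
  nlinarith [mul_pos hs hε]

lemma tendsto_sq_boundary (s : ℝ) :
    Tendsto (fun ε : ℝ => ((s : ℂ) + ε * Complex.I) ^ 2) (𝓝[>] 0) (𝓝 ((s ^ 2 : ℝ) : ℂ)) := by
  have hc : Continuous fun ε : ℝ => ((s : ℂ) + ε * Complex.I) ^ 2 := by fun_prop
  have := hc.tendsto 0
  simp only [Complex.ofReal_zero, zero_mul, add_zero] at this
  rw [Complex.ofReal_pow]
  exact this.mono_left nhdsWithin_le_nhds

lemma continuousAt_bandRatio {A B v : ℝ} (h : v ≠ B) :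
    ContinuousAt (fun w : ℂ => (w - A) / (w - B)) v :=
  ContinuousAt.div (by fun_prop) (by fun_prop) (sub_ne_zero.2 (Complex.ofReal_injective.ne h))

lemma tendsto_bandRoot_off {A B s : ℝ} (h : 0 < (s ^ 2 - A) / (s ^ 2 - B)) :
    Tendsto (fun ε : ℝ => bandRoot A B (((s : ℂ) + ε * Complex.I) ^ 2)) (𝓝[>] 0)
      (𝓝 ((√((s ^ 2 - A) / (s ^ 2 - B)) : ℝ) : ℂ)) := by
  rw [← bandRoot_ofReal h]
  have hne : s ^ 2 ≠ B := by
    intro e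
    rw [e, sub_self, div_zero] at h
    exact lt_irrefl _ h
  have hc : ContinuousAt (bandRoot A B) ((s ^ 2 : ℝ) : ℂ) := by
    have h1 := (continuousAt_bandRatio hne (A := A)).clog (offBand_ofReal h)
    exact (h1.div_const 2).cexp
  exact hc.tendsto.comp (tendsto_sq_boundary s)

/-- The positive real part is expressed through the square of the root alone. The right-hand side
stays continuous on the interior of the cut, where the logarithm defining the root jumps. -/
lemma re_sq_bandRoot {A B : ℝ} {w : ℂ} (h : OffBand A B w) :
    (bandRoot A B w).re = √((‖(w - A) / (w - B)‖ + ((w - A) / (w - B)).re) / 2) := by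
  have h1 := bandRoot_sq h
  have h2 : ‖(w - A) / (w - B)‖ = (bandRoot A B w).re ^ 2 + (bandRoot A B w).im ^ 2 := by
    rw [← h1, norm_pow, ← Complex.normSq_eq_norm_sq, Complex.normSq_apply]; ring
  have h3 : ((w - A) / (w - B)).re = (bandRoot A B w).re ^ 2 - (bandRoot A B w).im ^ 2 := by
    rw [← h1]; simp [pow_two]
  rw [h2, h3]
  ring_nf
  rw [Real.sqrt_sq (bandRoot_re_pos h).le]

lemma tendsto_re_bandRoot {A B s : ℝ} (hs : 0 < s) (h1 : A < s ^ 2) (h2 : s ^ 2 < B) (hB : B ≤ 1) :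
    Tendsto (fun ε : ℝ => (bandRoot A B (((s : ℂ) + ε * Complex.I) ^ 2)).re) (𝓝[>] 0) (𝓝 0) := by
  have hc : ContinuousAt (fun w : ℂ => √((‖(w - A) / (w - B)‖ + ((w - A) / (w - B)).re) / 2))
      ((s ^ 2 : ℝ) : ℂ) := by
    have h := continuousAt_bandRatio h2.ne (A := A)
    exact ((h.norm.add (Complex.continuous_re.continuousAt.comp h)).div_const 2).sqrt
  have h := hc.tendsto.comp (tendsto_sq_boundary s)
  have hval : √((‖(((s ^ 2 : ℝ) : ℂ) - A) / (((s ^ 2 : ℝ) : ℂ) - B)‖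
      + ((((s ^ 2 : ℝ) : ℂ) - A) / (((s ^ 2 : ℝ) : ℂ) - B)).re) / 2) = 0 := by
    have hneg : (s ^ 2 - A) / (s ^ 2 - B) < 0 :=
      div_neg_of_pos_of_neg (by linarith) (by linarith)
    rw [← Complex.ofReal_sub, ← Complex.ofReal_sub, ← Complex.ofReal_div, Complex.norm_real,
      Complex.ofReal_re, Real.norm_of_nonpos hneg.le]
    simp
  rw [hval] at h
  refine h.congr' ?_
  filter_upwards [self_mem_nhdsWithin] with ε hε
  rw [re_sq_bandRoot ((exterior_sq hs hε).offBand (h1.trans h2) hB)]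
  rfl

lemma tendsto_norm_bandRoot {A B s : ℝ} (hs : 0 < s) (hAB : A < B) (h2 : s ^ 2 ≠ B) (hB : B ≤ 1) :
    ∃ L, Tendsto (fun ε : ℝ => ‖bandRoot A B (((s : ℂ) + ε * Complex.I) ^ 2)‖) (𝓝[>] 0) (𝓝 L) := by
  have hc : ContinuousAt (fun w : ℂ => √(‖(w - A) / (w - B)‖)) ((s ^ 2 : ℝ) : ℂ) :=
    (continuousAt_bandRatio h2).norm.sqrt
  refine ⟨_, (hc.tendsto.comp (tendsto_sq_boundary s)).congr' ?_⟩
  filter_upwards [self_mem_nhdsWithin] with ε hε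
  have h := norm_bandRoot_sq ((exterior_sq hs hε).offBand hAB hB)
  simp only [Function.comp]
  rw [norm_div, ← h, Real.sqrt_sq (norm_nonneg _)]

/-- On a band one factor of `twoBand` has a real limit, while of the other only the vanishing real
part and the limit of the modulus are known. This suffices for the real part of the product. -/
lemma tendsto_re_mul_zero {l : Filter ℝ} {f g : ℝ → ℂ} {r L : ℝ} (hf : Tendsto f l (𝓝 (r : ℂ)))
    (hg : Tendsto (fun ε => (g ε).re) l (𝓝 0)) (hL : Tendsto (fun ε => ‖g ε‖) l (𝓝 L)) :
    Tendsto (fun ε => (f ε * g ε).re) l (𝓝 0) := by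
  have h1 : Tendsto (fun ε => (f ε - r) * g ε) l (𝓝 0) := by
    rw [tendsto_zero_iff_norm_tendsto_zero]
    have h2 : Tendsto (fun ε => ‖f ε - r‖) l (𝓝 0) := by
      rw [← tendsto_zero_iff_norm_tendsto_zero]
      simpa using hf.sub_const (r : ℂ)
    simpa [norm_mul] using h2.mul hL
  have h3 := (Complex.continuous_re.tendsto _).comp h1
  have h4 := h3.add (hg.const_mul r)
  simp only [Function.comp_def, Complex.zero_re, mul_zero, add_zero] at h4
  refine h4.congr fun ε => ?_
  simp only [sub_mul, Complex.sub_re, Complex.re_ofReal_mul]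
  ring

lemma tendsto_re_twoBand (h : BandEnds a b) {s : ℝ} (hs : s ∈ Set.Ioo (0 : ℝ) 1) (hb : s ^ 2 ≠ b)
    (ha : s ^ 2 ≠ a) :
    Tendsto (fun ε : ℝ => (twoBand a b (((s : ℂ) + ε * Complex.I) ^ 2)).re) (𝓝[>] 0)
      (𝓝 (gapFun a b (s ^ 2))) := by
  have hs2 : 0 < s ^ 2 := by have := hs.1; positivity
  have hs1 : s ^ 2 < 1 := by nlinarith [hs.1, hs.2]
  have hb0 := h.b_nonneg
  have ha1 := h.2.1
  rcases lt_or_gt_of_ne hb with hlt | hgt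
  · have h0 : 0 < b := hs2.trans hlt
    have hba := h.lt_of_pos h0
    rw [gapFun_lower ⟨hs2.le, hlt.le⟩]
    unfold twoBand
    obtain ⟨L, hL⟩ := tendsto_norm_bandRoot hs.1 h0 hb (by linarith)
    have h2 := tendsto_bandRoot_off (A := a) (B := 1) (s := s)
      (div_pos_of_neg_of_neg (by linarith) (by linarith))
    simp only [mul_comm (bandRoot 0 b _)]
    exact tendsto_re_mul_zero h2 (tendsto_re_bandRoot hs.1 (by simpa using hs2) hlt (by linarith)) hL
  · have h1 := tendsto_bandRoot_off (A := 0) (B := b) (s := s)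
      (div_pos (by linarith) (by linarith))
    rcases lt_or_gt_of_ne ha with hla | hga
    · have h2 := tendsto_bandRoot_off (A := a) (B := 1) (s := s)
        (div_pos_of_neg_of_neg (by linarith) (by linarith))
      have h3 := (Complex.continuous_re.tendsto _).comp (h1.mul h2)
      unfold twoBand gapFun
      rw [← Complex.ofReal_mul, Complex.ofReal_re, ← neg_div_neg_eq (s ^ 2 - a), neg_sub, neg_sub,
        sub_zero] at h3
      exact h3
    · rw [gapFun_upper ⟨hga.le, hs1.le⟩]
      obtain ⟨L, hL⟩ := tendsto_norm_bandRoot hs.1 ha1 hs1.ne le_rfl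
      exact tendsto_re_mul_zero h1 (tendsto_re_bandRoot hs.1 hga hs1 le_rfl) hL

/-! ### Integrable majorants -/

/-- A real power of a negative base carries the cosine of π times the exponent, which is zero for
-1/2; so only one summand survives. -/
lemma rpow_neg_half_add (x : ℝ) : x ^ (-(1 / 2) : ℝ) + (-x) ^ (-(1 / 2) : ℝ) = 1 / √|x| := by
  have h0 : ∀ y : ℝ, 0 < y → (-y) ^ (-(1 / 2) : ℝ) = 0 := fun y hy => by
    rw [Real.rpow_def_of_neg (by linarith), show -(1 / 2) * Real.pi = -(Real.pi / 2) by ring,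
      Real.cos_neg, Real.cos_pi_div_two, mul_zero]
  have h1 : ∀ y : ℝ, 0 < y → y ^ (-(1 / 2) : ℝ) = 1 / √y := fun y hy => by
    rw [Real.rpow_neg hy.le, Real.sqrt_eq_rpow]; exact (one_div _).symm
  rcases lt_trichotomy x 0 with hx | rfl | hx
  · have e : x ^ (-(1 / 2) : ℝ) = 0 := by
      have := h0 (-x) (by linarith)
      rwa [neg_neg] at this
    rw [e, h1 _ (by linarith), abs_of_neg hx, zero_add]
  · rw [neg_zero, Real.zero_rpow (by norm_num)]; simp
  · rw [h0 x hx, h1 x hx, abs_of_pos hx, add_zero]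

lemma intervalIntegrable_inv_sqrt_abs (c d e : ℝ) :
    IntervalIntegrable (fun s => 1 / √|s - c|) volume d e := by
  have h1 : ∀ d e : ℝ, IntervalIntegrable (fun x : ℝ => x ^ (-(1 / 2) : ℝ)) volume d e := fun d e =>
    intervalIntegral.intervalIntegrable_rpow' (by norm_num)
  have h2 : IntervalIntegrable (fun x : ℝ => (-x) ^ (-(1 / 2) : ℝ)) volume (d - c) (e - c) := by
    have := (h1 (-(d - c)) (-(e - c))).comp_mul_left (c := -1)
    simpa [div_neg] using this
  have h3 := ((h1 (d - c) (e - c)).add h2).comp_sub_right c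
  simp only [sub_add_cancel] at h3
  refine h3.congr fun s _ => ?_
  exact rpow_neg_half_add (s - c)

/-- |s² - b| = |s - √b|(s + √b), and s² ≤ s + √b for s < 1. -/
lemma sq_div_le (hb : 0 ≤ b) {s : ℝ} (hs : s ∈ Set.Ioo (0 : ℝ) 1) :
    s ^ 2 / (s ^ 2 - b) ≤ 1 / |s - √b| ∧ s ^ 2 / (b - s ^ 2) ≤ 1 / |s - √b| := by
  have hr := Real.sqrt_nonneg b
  have e : √b ^ 2 = b := Real.sq_sqrt hb
  have hnn : 0 ≤ 1 / |s - √b| := by positivity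
  have hs0 := hs.1
  generalize √b = r at hr e hnn ⊢
  subst e
  rcases lt_trichotomy s r with h | rfl | h
  · refine ⟨le_trans (div_nonpos_of_nonneg_of_nonpos (sq_nonneg s) (by nlinarith)) hnn, ?_⟩
    rw [abs_of_neg (by linarith), div_le_div_iff₀ (by nlinarith) (by linarith)]
    nlinarith [mul_pos hs0 (sub_pos.2 h), hs.2, mul_pos (mul_pos hs0 (sub_pos.2 h)) (sub_pos.2 hs.2),
      mul_pos (sub_pos.2 h) (sub_pos.2 h)]
  · simp
  · refine ⟨?_, le_trans (div_nonpos_of_nonneg_of_nonpos (sq_nonneg s) (by nlinarith)) hnn⟩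
    rw [abs_of_pos (by linarith), div_le_div_iff₀ (by nlinarith) (by linarith)]
    nlinarith [mul_pos hs0 (sub_pos.2 h), hs.2, mul_pos (mul_pos hs0 (sub_pos.2 h)) (sub_pos.2 hs.2),
      mul_nonneg hr (sub_pos.2 h).le]

lemma one_div_sqrt (x : ℝ) : 1 / √x = √(1 / x) := by
  rw [Real.sqrt_div zero_le_one, Real.sqrt_one]

lemma gapFun_sq_le (h : BandEnds a b) {s : ℝ} (hs : s ∈ Set.Ioo (0 : ℝ) 1) :
    gapFun a b (s ^ 2) ≤ 1 / √|s - √b| := by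
  have hs1 : s ^ 2 < 1 := by nlinarith [hs.1, hs.2]
  have h1 : √(s ^ 2 / (s ^ 2 - b)) ≤ 1 / √|s - √b| := by
    rw [one_div_sqrt]
    exact Real.sqrt_le_sqrt (sq_div_le h.b_nonneg hs).1
  have h2 : √((a - s ^ 2) / (1 - s ^ 2)) ≤ 1 := by
    rw [Real.sqrt_le_one]
    exact div_le_one_of_le₀ (by linarith [h.2.1]) (by linarith)
  unfold gapFun
  calc _ ≤ (1 / √|s - √b|) * 1 := mul_le_mul h1 h2 (Real.sqrt_nonneg _) (by positivity)
    _ = _ := mul_one _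

lemma intervalIntegrable_gapFun_sq (h : BandEnds a b) :
    IntervalIntegrable (fun s => gapFun a b (s ^ 2)) volume 0 1 := by
  have h1 := intervalIntegrable_inv_sqrt_abs (√b) 0 1
  rw [intervalIntegrable_iff_integrableOn_Ioo_of_le zero_le_one] at h1 ⊢
  refine h1.mono' ((measurable_gapFun a b).comp (by fun_prop)).aestronglyMeasurable ?_
  refine (ae_restrict_iff' measurableSet_Ioo).2 (ae_of_all _ fun s hs => ?_)
  rw [Real.norm_of_nonneg (gapFun_nonneg _ _ _)]
  exact gapFun_sq_le h hs

lemma exists_bandDensity_sq_le (h : BandEnds a b) : ∃ C : ℝ, ∀ s ∈ Set.Ioo (0 : ℝ) 1,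
    bandDensity a b (s ^ 2) ≤ 1 / √|s - √b| + C * (1 / √|s - 1|) := by
  obtain ⟨C, hC⟩ : ∃ C : ℝ, ∀ v, a < v → v / (v - b) ≤ C := by
    rcases h.b_nonneg.eq_or_lt with h0 | h0
    · refine ⟨1, fun v hv => ?_⟩
      rw [← h0, sub_zero, div_self (h.1.trans_lt hv).ne']
    · have hba := h.lt_of_pos h0
      refine ⟨a / (a - b), fun v hv => ?_⟩
      rw [div_le_div_iff₀ (by linarith) (by linarith)]
      nlinarith
  refine ⟨√C, fun s hs => ?_⟩
  have hs0 := hs.1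
  have hs1 : s ^ 2 < 1 := by nlinarith [hs.1, hs.2]
  have h1 : √(s ^ 2 / (b - s ^ 2)) ≤ 1 / √|s - √b| := by
    rw [one_div_sqrt]
    exact Real.sqrt_le_sqrt (sq_div_le h.b_nonneg hs).2
  have h2 : √((a - s ^ 2) / (1 - s ^ 2)) ≤ 1 := by
    rw [Real.sqrt_le_one]
    exact div_le_one_of_le₀ (by linarith [h.2.1]) (by linarith)
  have h3 : √(s ^ 2 / (b - s ^ 2)) * √((a - s ^ 2) / (1 - s ^ 2)) ≤ 1 / √|s - √b| := by
    calc _ ≤ (1 / √|s - √b|) * 1 := mul_le_mul h1 h2 (Real.sqrt_nonneg _) (by positivity)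
      _ = _ := mul_one _
  refine add_le_add h3 ?_
  rcases le_or_gt (s ^ 2) a with hle | hgt
  · rw [Real.sqrt_eq_zero_of_nonpos (x := (s ^ 2 - a) / (1 - s ^ 2))
      (div_nonpos_of_nonpos_of_nonneg (by linarith) (by linarith)), mul_zero]
    positivity
  · refine mul_le_mul (Real.sqrt_le_sqrt (hC _ hgt)) ?_ (Real.sqrt_nonneg _) (Real.sqrt_nonneg _)
    rw [one_div_sqrt]
    refine Real.sqrt_le_sqrt ?_
    rw [abs_of_neg (by linarith [hs.2]), div_le_div_iff₀ (by linarith) (by linarith [hs.2])]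
    nlinarith [hs.2, h.1]

lemma integrableOn_bandDensity_sq (h : BandEnds a b) {g : ℝ → ℝ} (hg : Continuous g) :
    IntegrableOn (fun s => g s * bandDensity a b (s ^ 2)) (Set.Icc 0 1) := by
  have key : IntegrableOn (fun s => bandDensity a b (s ^ 2)) (Set.Icc 0 1) := by
    obtain ⟨C, hC⟩ := exists_bandDensity_sq_le h
    have h1 := (intervalIntegrable_inv_sqrt_abs (√b) 0 1).add
      ((intervalIntegrable_inv_sqrt_abs 1 0 1).const_mul C)
    rw [intervalIntegrable_iff_integrableOn_Ioo_of_le zero_le_one] at h1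
    rw [integrableOn_Icc_iff_integrableOn_Ioo]
    refine h1.mono' ((measurable_bandDensity a b).comp (by fun_prop)).aestronglyMeasurable ?_
    refine (ae_restrict_iff' measurableSet_Ioo).2 (ae_of_all _ fun s hs => ?_)
    rw [Real.norm_of_nonneg (bandDensity_nonneg _ _ _)]
    exact hC s hs
  exact key.continuousOn_mul hg.continuousOn isCompact_Icc

lemma norm_sq_sub_ge {s ε c : ℝ} (hs : 0 < s) (hc : 0 ≤ c) :
    |s - c| * c ≤ ‖((s : ℂ) + ε * Complex.I) ^ 2 - ((c ^ 2 : ℝ) : ℂ)‖ := by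
  have e : ((s : ℂ) + ε * Complex.I) ^ 2 - ((c ^ 2 : ℝ) : ℂ)
      = ((s : ℂ) + ε * Complex.I - c) * ((s : ℂ) + ε * Complex.I + c) := by push_cast; ring
  rw [e, norm_mul]
  refine mul_le_mul ?_ ?_ hc (norm_nonneg _)
  · have := Complex.abs_re_le_norm ((s : ℂ) + ε * Complex.I - c)
    simpa using this
  · have := Complex.abs_re_le_norm ((s : ℂ) + ε * Complex.I + c)
    have h2 : ((s : ℂ) + ε * Complex.I + c).re = s + c := by simp
    rw [h2, abs_of_nonneg (by linarith)] at this
    linarith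

lemma norm_boundary_sq_le {s ε : ℝ} (hs : s ∈ Set.Ioo (0 : ℝ) 1) (hε : ε ∈ Set.Ioc (0 : ℝ) 1) :
    ‖((s : ℂ) + ε * Complex.I) ^ 2‖ ≤ 2 := by
  rw [norm_pow, ← Complex.normSq_eq_norm_sq]
  simp [Complex.normSq_apply]
  nlinarith [hs.1, hs.2, hε.1, hε.2]

/-- A majorant independent of ε. Stopping at η < 1 avoids the singularity at 1, and the one at √b is
of integrable order -1/2. -/
lemma exists_norm_twoBand_le (h : BandEnds a b) {η : ℝ} (hη : η ∈ Set.Ioo (0 : ℝ) 1) :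
    ∃ D : ℝ → ℝ, IntervalIntegrable D volume 0 η ∧ ∀ ε ∈ Set.Ioc (0 : ℝ) 1, ∀ s ∈ Set.Ioc 0 η,
      s ≠ √b → ‖twoBand a b (((s : ℂ) + ε * Complex.I) ^ 2)‖ ≤ D s := by
  have h2 : ∀ ε ∈ Set.Ioc (0 : ℝ) 1, ∀ s ∈ Set.Ioc 0 η,
      ‖bandRoot a 1 (((s : ℂ) + ε * Complex.I) ^ 2)‖ ≤ √(3 / (1 - η)) := by
    intro ε hε s hs
    have hs1 : s ∈ Set.Ioo (0 : ℝ) 1 := ⟨hs.1, hs.2.trans_lt hη.2⟩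
    refine Real.le_sqrt_of_sq_le ?_
    rw [norm_bandRoot_sq ((exterior_sq hs.1 hε.1).offBand h.2.1 le_rfl)]
    have n1 : ‖((s : ℂ) + ε * Complex.I) ^ 2 - a‖ ≤ 3 := by
      refine (norm_sub_le _ _).trans ?_
      rw [Complex.norm_real, Real.norm_of_nonneg h.1]
      linarith [norm_boundary_sq_le hs1 hε, h.2.1]
    have n2 := norm_sq_sub_ge (ε := ε) hs.1 (c := 1) zero_le_one
    rw [one_pow, mul_one, abs_of_neg (by linarith [hs1.2])] at n2
    exact div_le_div₀ (by norm_num) n1 (by linarith [hη.2]) (by linarith [hs.2])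
  rcases h.b_nonneg.eq_or_lt with h0 | h0
  · refine ⟨fun _ => √(3 / (1 - η)), intervalIntegrable_const, fun ε hε s hs _ => ?_⟩
    have hne : ((s : ℂ) + ε * Complex.I) ^ 2 ≠ ((0 : ℝ) : ℂ) :=
      ((exterior_sq hs.1 hε.1).offBand zero_lt_one le_rfl).ne.1
    rw [twoBand, ← h0, bandRoot_self 0 hne, one_mul]
    exact h2 ε hε s hs
  · have hr := Real.sqrt_pos.2 h0
    refine ⟨fun s => (√(2 / √b) * √(3 / (1 - η))) * (1 / √|s - √b|),
      (intervalIntegrable_inv_sqrt_abs _ _ _).const_mul _, fun ε hε s hs hne => ?_⟩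
    have hs1 : s ∈ Set.Ioo (0 : ℝ) 1 := ⟨hs.1, hs.2.trans_lt hη.2⟩
    have hba := h.lt_of_pos h0
    have habs : 0 < |s - √b| := abs_pos.2 (sub_ne_zero.2 hne)
    have h1 : ‖bandRoot 0 b (((s : ℂ) + ε * Complex.I) ^ 2)‖ ≤ √(2 / √b) * (1 / √|s - √b|) := by
      rw [mul_one_div, ← Real.sqrt_div (by positivity)]
      refine Real.le_sqrt_of_sq_le ?_
      rw [norm_bandRoot_sq ((exterior_sq hs.1 hε.1).offBand h0 (by linarith [h.2.1])), div_div]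
      have n2 := norm_sq_sub_ge (ε := ε) hs.1 (c := √b) hr.le
      rw [Real.sq_sqrt h0.le] at n2
      refine div_le_div₀ (by norm_num) ?_ (by positivity) (by linarith [mul_comm (√b) |s - √b|])
      rw [Complex.ofReal_zero, sub_zero]
      exact norm_boundary_sq_le hs1 hε
    rw [twoBand, norm_mul]
    calc _ ≤ (√(2 / √b) * (1 / √|s - √b|)) * √(3 / (1 - η)) :=
          mul_le_mul h1 (h2 ε hε s hs) (norm_nonneg _) (by positivity)
      _ = _ := by ring

/-! ### Cauchy transforms of polynomial multiples of the density -/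

lemma exterior_ofReal {ξ : ℝ} (hξ : 1 < ξ) : Exterior (ξ : ℂ) := Or.inr ⟨ξ, hξ, rfl⟩

lemma twoBand_ofReal (h : BandEnds a b) {ξ : ℝ} (hξ : 1 < ξ) :
    twoBand a b ξ = ((√(ξ / (ξ - b)) * √((ξ - a) / (ξ - 1)) : ℝ) : ℂ) := by
  have h1 := h.b_le
  have h2 := h.2.1
  rw [twoBand, bandRoot_ofReal (div_pos (by linarith) (by linarith)),
    bandRoot_ofReal (div_pos (by linarith) (by linarith)), sub_zero, Complex.ofReal_mul]

lemma intervalIntegrable_polynomial_bandDensity (h : BandEnds a b) (p : Polynomial ℝ) :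
    IntervalIntegrable (fun v => p.eval v * bandDensity a b v) volume 0 1 :=
  (intervalIntegrable_bandDensity h).continuousOn_mul p.continuous.continuousOn

lemma intervalIntegrable_polynomial_cauchy (h : BandEnds a b) (p : Polynomial ℝ) {w : ℂ}
    (hw : Exterior w) :
    IntervalIntegrable (fun v => ((p.eval v * bandDensity a b v : ℝ) : ℂ) * (1 / (v - w)))
      volume 0 1 := by
  refine (intervalIntegrable_ofReal' (intervalIntegrable_polynomial_bandDensity h p)).mul_continuousOn ?_
  rw [Set.uIcc_of_le zero_le_one]
  exact hw.continuousOn_inv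

/-- Since v/(v - w) = 1 + w/(v - w), a further factor v multiplies the transform by w and adds a
real moment, so the correction remains a real polynomial. -/
lemma exists_polynomial_cauchy (h : BandEnds a b) (p : Polynomial ℝ) : ∃ T : Polynomial ℝ,
    ∀ w : ℂ, Exterior w →
      ∫ v in (0 : ℝ)..1, ((p.eval v * bandDensity a b v : ℝ) : ℂ) * (1 / (v - w))
        = Real.pi * (Polynomial.aeval w T - Polynomial.aeval w p * twoBand a b w) := by
  have hpi : (Real.pi : ℂ) ≠ 0 := Complex.ofReal_ne_zero.2 Real.pi_ne_zero
  induction p using Polynomial.induction_on with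
  | C c =>
    refine ⟨Polynomial.C c, fun w hw => ?_⟩
    simp only [Polynomial.eval_C, Complex.ofReal_mul, mul_assoc, Polynomial.aeval_C,
      Complex.coe_algebraMap]
    rw [intervalIntegral.integral_const_mul, integral_bandDensity_cauchy h hw]
    ring
  | add p q hp hq =>
    obtain ⟨T, hT⟩ := hp
    obtain ⟨U, hU⟩ := hq
    refine ⟨T + U, fun w hw => ?_⟩
    have e : ∀ v : ℝ, (((p + q).eval v * bandDensity a b v : ℝ) : ℂ) * (1 / (v - w))
        = ((p.eval v * bandDensity a b v : ℝ) : ℂ) * (1 / (v - w))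
          + ((q.eval v * bandDensity a b v : ℝ) : ℂ) * (1 / (v - w)) := fun v => by
      rw [Polynomial.eval_add]; push_cast; ring
    simp only [e]
    rw [intervalIntegral.integral_add (intervalIntegrable_polynomial_cauchy h p hw)
      (intervalIntegrable_polynomial_cauchy h q hw), hT w hw, hU w hw, map_add, map_add]
    ring
  | monomial n c hp =>
    obtain ⟨T, hT⟩ := hp
    set p : Polynomial ℝ := Polynomial.C c * Polynomial.X ^ n with hpdef
    have e1 : Polynomial.C c * Polynomial.X ^ (n + 1) = Polynomial.X * p := by
      rw [hpdef, pow_succ]; ring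
    set M : ℝ := ∫ v in (0 : ℝ)..1, p.eval v * bandDensity a b v with hM
    refine ⟨Polynomial.C (M / Real.pi) + Polynomial.X * T, fun w hw => ?_⟩
    rw [e1]
    have e : ∫ v in (0 : ℝ)..1, (((Polynomial.X * p).eval v * bandDensity a b v : ℝ) : ℂ) * (1 / (v - w))
        = ∫ v in (0 : ℝ)..1, (((p.eval v * bandDensity a b v : ℝ) : ℂ)
          + w * (((p.eval v * bandDensity a b v : ℝ) : ℂ) * (1 / (v - w)))) := by
      refine intervalIntegral.integral_congr fun v hv => ?_
      rw [Set.uIcc_of_le zero_le_one] at hv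
      have hne := hw.sub_ne hv
      rw [Polynomial.eval_mul, Polynomial.eval_X]
      push_cast
      field_simp
      ring
    rw [e, intervalIntegral.integral_add
      (intervalIntegrable_ofReal' (intervalIntegrable_polynomial_bandDensity h p))
      ((intervalIntegrable_polynomial_cauchy h p hw).const_mul w),
      intervalIntegral.integral_const_mul, hT w hw, intervalIntegral.integral_ofReal, ← hM]
    simp only [map_add, map_mul, Polynomial.aeval_C, Polynomial.aeval_X, Complex.coe_algebraMap]
    push_cast
    field_simp
    ring

lemma aeval_ofReal (p : Polynomial ℝ) (ξ : ℝ) :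
    Polynomial.aeval (ξ : ℂ) p = ((p.eval ξ : ℝ) : ℂ) := by
  rw [← Complex.coe_algebraMap, Polynomial.aeval_algebraMap_apply]; simp

lemma tendsto_polynomial_cauchy (h : BandEnds a b) (p : Polynomial ℝ) :
    Tendsto (fun ξ : ℝ => ∫ v in (0 : ℝ)..1, ((p.eval v * bandDensity a b v : ℝ) : ℂ) * (1 / (v - (ξ : ℂ))))
      atTop (𝓝 0) := by
  have hi := intervalIntegrable_polynomial_bandDensity h p
  have hlim : Tendsto (fun ξ : ℝ => (∫ v in (0 : ℝ)..1, ‖p.eval v * bandDensity a b v‖) * (1 / (ξ - 1)))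
      atTop (𝓝 0) := by
    have h1 : Tendsto (fun ξ : ℝ => 1 / (ξ - 1)) atTop (𝓝 0) := by
      simp only [one_div]
      exact tendsto_inv_atTop_zero.comp (tendsto_atTop_add_const_right _ _ tendsto_id)
    simpa using h1.const_mul (∫ v in (0 : ℝ)..1, ‖p.eval v * bandDensity a b v‖)
  refine squeeze_zero_norm' ?_ hlim
  filter_upwards [eventually_gt_atTop 1] with ξ hξ
  rw [← intervalIntegral.integral_mul_const]
  refine intervalIntegral.norm_integral_le_of_norm_le zero_le_one ?_ (hi.norm.mul_const _)
  refine ae_of_all _ fun v hv => ?_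
  rw [norm_mul, Complex.norm_real]
  refine mul_le_mul_of_nonneg_left ?_ (norm_nonneg _)
  rw [← Complex.ofReal_sub, norm_div, norm_one, Complex.norm_real, Real.norm_eq_abs, abs_sub_comm,
    abs_of_pos (by linarith [hv.2])]
  exact one_div_le_one_div_of_le (by linarith) (by linarith [hv.2])

/-- The Cauchy transform is determined by the growth of `p Y` at infinity. -/
lemma integral_polynomial_cauchy (h : BandEnds a b) {p U : Polynomial ℝ}
    (hasym : Tendsto (fun ξ : ℝ => p.eval ξ * (√(ξ / (ξ - b)) * √((ξ - a) / (ξ - 1))) - U.eval ξ)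
      atTop (𝓝 0)) {w : ℂ} (hw : Exterior w) :
    ∫ v in (0 : ℝ)..1, ((p.eval v * bandDensity a b v : ℝ) : ℂ) * (1 / (v - w))
      = Real.pi * (Polynomial.aeval w U - Polynomial.aeval w p * twoBand a b w) := by
  obtain ⟨T, hT⟩ := exists_polynomial_cauchy h p
  -- Both Cauchy transform and asymptotic error tend to zero along the real axis, hence so does T -
  -- U; a polynomial with limit zero at infinity is zero.
  have hTU : T = U := by
    have h1 := (tendsto_polynomial_cauchy h p).const_mul ((1 / Real.pi : ℝ) : ℂ)
    have h2 := (Complex.continuous_re.tendsto _).comp h1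
    have h3 : Tendsto (fun ξ : ℝ => (T - U).eval ξ) atTop (𝓝 0) := by
      have h4 := h2.add hasym
      simp only [mul_zero, Complex.zero_re, add_zero] at h4
      refine h4.congr' ?_
      filter_upwards [eventually_gt_atTop 1] with ξ hξ
      have hpi := Real.pi_ne_zero
      simp only [Function.comp]
      rw [hT ξ (exterior_ofReal hξ), aeval_ofReal, aeval_ofReal, twoBand_ofReal h hξ,
        ← Complex.ofReal_mul, ← Complex.ofReal_sub, ← Complex.ofReal_mul, ← Complex.ofReal_mul,
        Complex.ofReal_re, Polynomial.eval_sub]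
      field_simp
      ring
    have h5 := (Polynomial.tendsto_nhds_iff (P := T - U)).1 h3
    exact sub_eq_zero.1 (Polynomial.leadingCoeff_eq_zero.1 h5.1)
  rw [hT w hw, hTU]

end

end StepData

/-! ### Logarithmic potentials of the band densities. -/

namespace StepData

open MeasureTheory Filter Asymptotics Topology

noncomputable section

/-! ### The regularized logarithmic kernel -/

variable {a b : ℝ}

/-- The regularization `½ log (((η + μ)² + ε²) / ((η - μ)² + ε²))` of the logarithmic kernel. -/
def regKer (ε η μ : ℝ) : ℝ := 1 / 2 * Real.log (((η + μ) ^ 2 + ε ^ 2) / ((η - μ) ^ 2 + ε ^ 2))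

/-- The derivative of `regKer` in `η`. -/
def regKerDeriv (ε s μ : ℝ) : ℝ :=
  (s + μ) / ((s + μ) ^ 2 + ε ^ 2) - (s - μ) / ((s - μ) ^ 2 + ε ^ 2)

lemma continuous_regKerDeriv {ε : ℝ} (hε : 0 < ε) :
    Continuous fun p : ℝ × ℝ => regKerDeriv ε p.1 p.2 := by
  unfold regKerDeriv
  refine (Continuous.div (by fun_prop) (by fun_prop) fun p => ?_).sub
    (Continuous.div (by fun_prop) (by fun_prop) fun p => ?_) <;> positivity

lemma abs_div_sq_add_le {ε : ℝ} (hε : 0 < ε) (y : ℝ) : |y / (y ^ 2 + ε ^ 2)| ≤ 1 / ε := by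
  rw [abs_div, abs_of_pos (by positivity : 0 < y ^ 2 + ε ^ 2),
    div_le_div_iff₀ (by positivity) hε, ← sq_abs y]
  nlinarith [sq_nonneg (|y| - ε), abs_nonneg y, mul_nonneg (abs_nonneg y) hε.le]

lemma abs_regKerDeriv_le {ε : ℝ} (hε : 0 < ε) (s μ : ℝ) : |regKerDeriv ε s μ| ≤ 2 / ε := by
  unfold regKerDeriv
  refine (abs_sub _ _).trans ?_
  have := add_le_add (abs_div_sq_add_le hε (s + μ)) (abs_div_sq_add_le hε (s - μ))
  rw [← add_div] at this
  norm_num at this ⊢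
  exact this

lemma regKer_eq_integral {ε : ℝ} (hε : 0 < ε) (η μ : ℝ) :
    regKer ε η μ = ∫ s in (0 : ℝ)..η, regKerDeriv ε s μ := by
  have hd : ∀ s ∈ Set.uIcc 0 η, HasDerivAt
      (fun s => 1 / 2 * (Real.log ((s + μ) ^ 2 + ε ^ 2) - Real.log ((s - μ) ^ 2 + ε ^ 2)))
      (regKerDeriv ε s μ) s := by
    intro s _
    have h1 : HasDerivAt (fun s => (s + μ) ^ 2 + ε ^ 2) (2 * (s + μ)) s := by
      simpa using (((hasDerivAt_id s).add_const μ).pow 2).add_const (ε ^ 2)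
    have h2 : HasDerivAt (fun s => (s - μ) ^ 2 + ε ^ 2) (2 * (s - μ)) s := by
      simpa using (((hasDerivAt_id s).sub_const μ).pow 2).add_const (ε ^ 2)
    have p1 : 0 < (s + μ) ^ 2 + ε ^ 2 := by positivity
    have p2 : 0 < (s - μ) ^ 2 + ε ^ 2 := by positivity
    refine (((h1.log p1.ne').sub (h2.log p2.ne')).const_mul (1 / 2)).congr_deriv ?_
    unfold regKerDeriv
    ring
  have hc : Continuous fun s => regKerDeriv ε s μ :=
    (continuous_regKerDeriv hε).comp (by fun_prop : Continuous fun s : ℝ => (s, μ))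
  rw [intervalIntegral.integral_eq_sub_of_hasDerivAt hd (hc.intervalIntegrable _ _)]
  unfold regKer
  rw [Real.log_div (by positivity) (by positivity)]
  simp

lemma regKer_antitone {ε δ η μ : ℝ} (hε : 0 < ε) (hεδ : ε ≤ δ) (hη : 0 ≤ η) (hμ : 0 ≤ μ) :
    regKer δ η μ ≤ regKer ε η μ := by
  unfold regKer
  have hδ : 0 < δ := hε.trans_le hεδ
  refine mul_le_mul_of_nonneg_left (Real.log_le_log (by positivity) ?_) (by norm_num)
  rw [div_le_div_iff₀ (by positivity) (by positivity)]
  have h1 : ε ^ 2 ≤ δ ^ 2 := by nlinarith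
  nlinarith [mul_nonneg (mul_nonneg hη hμ) (sub_nonneg.2 h1)]

lemma regKer_nonneg {ε η μ : ℝ} (hε : 0 < ε) (hη : 0 ≤ η) (hμ : 0 ≤ μ) : 0 ≤ regKer ε η μ := by
  unfold regKer
  refine mul_nonneg (by norm_num) (Real.log_nonneg ?_)
  rw [le_div_iff₀ (by positivity)]
  nlinarith [mul_nonneg hη hμ]

lemma tendsto_regKer {η μ : ℝ} (hη : 0 < η) (hμ : 0 < μ) (h : η ≠ μ) :
    Tendsto (fun ε => regKer ε η μ) (𝓝 0) (𝓝 (logKer η μ)) := by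
  have h1 : 0 < |η - μ| := abs_pos.2 (sub_ne_zero.2 h)
  have h2 : 0 < (η - μ) ^ 2 := by rw [← sq_abs]; positivity
  have hc : ContinuousAt (fun ε => regKer ε η μ) 0 := by
    unfold regKer
    refine ContinuousAt.mul continuousAt_const (ContinuousAt.log
      (ContinuousAt.div (by fun_prop) (by fun_prop) (by simpa using h2.ne')) ?_)
    simp only [ne_eq, OfNat.ofNat_ne_zero, not_false_eq_true, zero_pow, add_zero]
    positivity
  have := hc.tendsto
  have e : regKer 0 η μ = logKer η μ := by
    unfold regKer logKer
    rw [abs_div, abs_of_pos (by positivity : 0 < η + μ), Real.log_div h1.ne' (by positivity),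
      ← sq_abs (η - μ), zero_pow two_ne_zero, add_zero, add_zero,
      Real.log_div (by positivity) (by positivity), Real.log_pow, Real.log_pow]
    push_cast; ring
  rwa [e] at this

/-- With ζ = s + iε, 2μ/(μ² - ζ²) = 1/(μ - ζ) + 1/(μ + ζ). In the variable v = μ², the derivative of
the regularized kernel is thus the real part of a Cauchy kernel at ζ². -/
lemma two_mul_div_sq_sub {ε : ℝ} (hε : 0 < ε) (s μ : ℝ) :
    (((2 * μ : ℝ) : ℂ) * (1 / (((μ ^ 2 : ℝ) : ℂ) - ((s : ℂ) + ε * Complex.I) ^ 2))).re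
      = regKerDeriv ε s μ := by
  have n1 : (μ : ℂ) - (s + ε * Complex.I) ≠ 0 := by
    intro e
    have := congrArg Complex.im e
    simp at this; linarith
  have n2 : (μ : ℂ) + (s + ε * Complex.I) ≠ 0 := by
    intro e
    have := congrArg Complex.im e
    simp at this; linarith
  have e : ((2 * μ : ℝ) : ℂ) * (1 / (((μ ^ 2 : ℝ) : ℂ) - ((s : ℂ) + ε * Complex.I) ^ 2))
      = ((μ : ℂ) - (s + ε * Complex.I))⁻¹ + ((μ : ℂ) + (s + ε * Complex.I))⁻¹ := by
    have n3 : ((μ ^ 2 : ℝ) : ℂ) - ((s : ℂ) + ε * Complex.I) ^ 2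
      = ((μ : ℂ) - (s + ε * Complex.I)) * ((μ : ℂ) + (s + ε * Complex.I)) := by push_cast; ring
    rw [n3]
    push_cast
    field_simp
    ring
  rw [e, Complex.add_re, Complex.inv_re, Complex.inv_re]
  simp only [Complex.normSq_apply, Complex.sub_re, Complex.add_re, Complex.sub_im, Complex.add_im,
    Complex.ofReal_re, Complex.ofReal_im, Complex.re_ofReal_mul, Complex.im_ofReal_mul,
    Complex.I_re, Complex.I_im, mul_zero, mul_one, add_zero, zero_add, zero_sub]
  unfold regKerDeriv
  rw [show (μ - s) * (μ - s) + -ε * -ε = (s - μ) ^ 2 + ε ^ 2 by ring,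
    show (μ + s) * (μ + s) + ε * ε = (s + μ) ^ 2 + ε ^ 2 by ring]
  ring

/-! ### The potential of the density -/

lemma integral_smul_comp_sq {E : Type*} [NormedAddCommGroup E] [NormedSpace ℝ E] (F : ℝ → E) :
    ∫ μ in (0 : ℝ)..1, (2 * μ) • F (μ ^ 2) = ∫ v in (0 : ℝ)..1, F v := by
  rw [intervalIntegral.integral_of_le zero_le_one, integral_Ioc_eq_integral_Ioo,
    intervalIntegral.integral_of_le zero_le_one, integral_Ioc_eq_integral_Ioo]
  have himg : (fun μ : ℝ => μ ^ 2) '' Set.Ioo 0 1 = Set.Ioo 0 1 := by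
    ext v
    constructor
    · rintro ⟨μ, hμ, rfl⟩
      exact ⟨by have := hμ.1; positivity, by nlinarith [hμ.1, hμ.2]⟩
    · intro hv
      exact ⟨√v, ⟨Real.sqrt_pos.2 hv.1, (Real.sqrt_lt' one_pos).2 (by simpa using hv.2)⟩,
        Real.sq_sqrt hv.1.le⟩
  have h := integral_image_eq_integral_abs_deriv_smul (s := Set.Ioo (0 : ℝ) 1)
    (f := fun μ => μ ^ 2) (f' := fun μ => 2 * μ) measurableSet_Ioo
    (fun μ _ => by simpa using (hasDerivAt_pow 2 μ).hasDerivWithinAt)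
    (fun x hx y hy hxy => by
      have h1 : x ^ 2 = y ^ 2 := hxy
      nlinarith [hx.1, hy.1, sq_nonneg (x - y)] ) F
  rw [himg] at h
  rw [h]
  refine setIntegral_congr_fun measurableSet_Ioo fun μ hμ => ?_
  rw [abs_of_pos (by linarith [hμ.1])]

lemma integral_comp_sq (F : ℝ → ℂ) :
    ∫ μ in Set.Icc (0 : ℝ) 1, ((2 * μ : ℝ) : ℂ) * F (μ ^ 2) = ∫ v in (0 : ℝ)..1, F v := by
  rw [← integral_smul_comp_sq, intervalIntegral.integral_of_le zero_le_one,
    integral_Icc_eq_integral_Ioc]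
  simp only [Complex.real_smul]

variable (a b) in
/-- The density `p(η²) ρ(η²)`. -/
def density (p : Polynomial ℝ) (η : ℝ) : ℝ := p.eval (η ^ 2) * bandDensity a b (η ^ 2)

lemma integrableOn_density (h : BandEnds a b) (p : Polynomial ℝ) :
    IntegrableOn (density a b p) (Set.Icc 0 1) :=
  integrableOn_bandDensity_sq h (g := fun η => p.eval (η ^ 2)) (p.continuous.comp (by fun_prop))

lemma integral_density_regKerDeriv (h : BandEnds a b) {p U : Polynomial ℝ}
    (hasym : Tendsto (fun ξ : ℝ => p.eval ξ * (√(ξ / (ξ - b)) * √((ξ - a) / (ξ - 1))) - U.eval ξ)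
      atTop (𝓝 0)) {s ε : ℝ} (hs : 0 < s) (hε : 0 < ε) :
    ∫ μ in Set.Icc (0 : ℝ) 1, density a b p μ * regKerDeriv ε s μ
      = Real.pi * (Polynomial.aeval (((s : ℂ) + ε * Complex.I) ^ 2) U
        - Polynomial.aeval (((s : ℂ) + ε * Complex.I) ^ 2) p
          * twoBand a b (((s : ℂ) + ε * Complex.I) ^ 2)).re := by
  set w := ((s : ℂ) + ε * Complex.I) ^ 2 with hw
  have hext : Exterior w := exterior_sq hs hε
  have h1 := integral_polynomial_cauchy h hasym hext
  rw [← integral_comp_sq fun v => ((p.eval v * bandDensity a b v : ℝ) : ℂ) * (1 / (v - w))] at h1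
  have hint : Integrable (fun μ : ℝ => ((2 * μ : ℝ) : ℂ)
      * (((p.eval (μ ^ 2) * bandDensity a b (μ ^ 2) : ℝ) : ℂ) * (1 / (((μ ^ 2 : ℝ) : ℂ) - w))))
      (volume.restrict (Set.Icc (0 : ℝ) 1)) := by
    have h2 : Integrable (fun μ : ℝ => ((density a b p μ : ℝ) : ℂ)) (volume.restrict (Set.Icc (0 : ℝ) 1)) :=
      (integrableOn_density h p).ofReal
    have h3 : ContinuousOn (fun μ : ℝ => ((2 * μ : ℝ) : ℂ) * (1 / (((μ ^ 2 : ℝ) : ℂ) - w))) (Set.Icc 0 1) := by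
      refine ContinuousOn.mul (by fun_prop) (continuousOn_const.div (by fun_prop) fun μ hμ => ?_)
      exact hext.sub_ne ⟨sq_nonneg μ, by nlinarith [hμ.1, hμ.2]⟩
    have h4 : IntegrableOn _ (Set.Icc (0 : ℝ) 1) := IntegrableOn.continuousOn_mul h3 h2 isCompact_Icc
    refine h4.congr (ae_of_all _ fun μ => ?_)
    simp only [density]
    ring
  have h5 := congrArg Complex.re h1
  rw [← RCLike.re_eq_complex_re, ← integral_re hint, RCLike.re_eq_complex_re,
    Complex.re_ofReal_mul] at h5
  rw [← h5]
  refine integral_congr_ae (ae_of_all _ fun μ => ?_)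
  beta_reduce
  rw [← two_mul_div_sq_sub hε, density, ← hw,
    show ((2 * μ : ℝ) : ℂ) * (((p.eval (μ ^ 2) * bandDensity a b (μ ^ 2) : ℝ) : ℂ)
      * (1 / (((μ ^ 2 : ℝ) : ℂ) - w))) = ((p.eval (μ ^ 2) * bandDensity a b (μ ^ 2) : ℝ) : ℂ)
      * (((2 * μ : ℝ) : ℂ) * (1 / (((μ ^ 2 : ℝ) : ℂ) - w))) by ring,
    Complex.re_ofReal_mul (p.eval (μ ^ 2) * bandDensity a b (μ ^ 2))]

lemma integral_density_regKer (h : BandEnds a b) {p U : Polynomial ℝ}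
    (hasym : Tendsto (fun ξ : ℝ => p.eval ξ * (√(ξ / (ξ - b)) * √((ξ - a) / (ξ - 1))) - U.eval ξ)
      atTop (𝓝 0)) {η ε : ℝ} (hη : 0 < η) (hε : 0 < ε) :
    ∫ μ in Set.Icc (0 : ℝ) 1, density a b p μ * regKer ε η μ
      = ∫ s in (0 : ℝ)..η, Real.pi * (Polynomial.aeval (((s : ℂ) + ε * Complex.I) ^ 2) U
        - Polynomial.aeval (((s : ℂ) + ε * Complex.I) ^ 2) p
          * twoBand a b (((s : ℂ) + ε * Complex.I) ^ 2)).re := by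
  have hi := integrableOn_density h p
  have hc := continuous_regKerDeriv hε
  have hsw : Integrable (Function.uncurry fun μ s => density a b p μ * regKerDeriv ε s μ)
      ((volume.restrict (Set.Icc (0 : ℝ) 1)).prod (volume.restrict (Set.Ioc 0 η))) := by
    have h1 : Integrable (fun z : ℝ × ℝ => density a b p z.1 * (fun _ => (1 : ℝ)) z.2)
        ((volume.restrict (Set.Icc (0 : ℝ) 1)).prod (volume.restrict (Set.Ioc 0 η))) :=
      Integrable.mul_prod hi (integrable_const _)
    simp only [mul_one] at h1
    refine (h1.norm.mul_const (2 / ε)).mono'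
      (h1.1.mul (hc.comp continuous_swap).aestronglyMeasurable) (ae_of_all _ fun z => ?_)
    simp only [Function.uncurry]
    rw [norm_mul]
    exact mul_le_mul_of_nonneg_left (abs_regKerDeriv_le hε _ _) (norm_nonneg _)
  have e1 : ∀ μ, density a b p μ * regKer ε η μ
      = ∫ s in Set.Ioc 0 η, density a b p μ * regKerDeriv ε s μ := fun μ => by
    rw [regKer_eq_integral hε, intervalIntegral.integral_of_le hη.le, integral_const_mul]
  simp only [e1]
  rw [integral_integral_swap hsw, intervalIntegral.integral_of_le hη.le]
  exact setIntegral_congr_fun measurableSet_Ioc fun s hs =>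
    integral_density_regKerDeriv h hasym hs.1 hε

lemma measurable_twoBand (a b : ℝ) : Measurable (twoBand a b) := by
  unfold twoBand bandRoot
  fun_prop

/-- Dominated convergence as the path approaches the real axis. The real part of `twoBand` tends to
zero on the bands, so besides U only the gap contributes. -/
lemma tendsto_integral_density_regKer (h : BandEnds a b) {p U : Polynomial ℝ}
    (hasym : Tendsto (fun ξ : ℝ => p.eval ξ * (√(ξ / (ξ - b)) * √((ξ - a) / (ξ - 1))) - U.eval ξ)
      atTop (𝓝 0)) {η : ℝ} (hη : η ∈ Set.Ioo (0 : ℝ) 1) :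
    Tendsto (fun ε => ∫ μ in Set.Icc (0 : ℝ) 1, density a b p μ * regKer ε η μ) (𝓝[>] 0)
      (𝓝 (∫ s in (0 : ℝ)..η, Real.pi * (U.eval (s ^ 2) - p.eval (s ^ 2) * gapFun a b (s ^ 2)))) := by
  obtain ⟨D, hD, hDle⟩ := exists_norm_twoBand_le h hη
  obtain ⟨Cp, hCp⟩ := (isCompact_closedBall (0 : ℂ) 2).exists_bound_of_continuousOn
    (f := fun w => Polynomial.aeval w p) (Polynomial.continuous_aeval p).continuousOn
  obtain ⟨CU, hCU⟩ := (isCompact_closedBall (0 : ℂ) 2).exists_bound_of_continuousOn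
    (f := fun w => Polynomial.aeval w U) (Polynomial.continuous_aeval U).continuousOn
  have hsmall : ∀ᶠ ε : ℝ in 𝓝[>] 0, ε ∈ Set.Ioc (0 : ℝ) 1 := Ioc_mem_nhdsGT zero_lt_one
  have hmain : Tendsto (fun ε : ℝ => ∫ s in (0 : ℝ)..η,
      Real.pi * (Polynomial.aeval (((s : ℂ) + ε * Complex.I) ^ 2) U
        - Polynomial.aeval (((s : ℂ) + ε * Complex.I) ^ 2) p
          * twoBand a b (((s : ℂ) + ε * Complex.I) ^ 2)).re) (𝓝[>] 0)
      (𝓝 (∫ s in (0 : ℝ)..η, Real.pi * (U.eval (s ^ 2) - p.eval (s ^ 2) * gapFun a b (s ^ 2)))) := by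
    refine intervalIntegral.tendsto_integral_filter_of_dominated_convergence
      (fun s => Real.pi * (CU + Cp * D s)) ?_ ?_
      ((intervalIntegrable_const.add (hD.const_mul Cp)).const_mul Real.pi) ?_
    · refine Eventually.of_forall fun ε => Measurable.aestronglyMeasurable ?_
      have hw : Measurable fun s : ℝ => ((s : ℂ) + ε * Complex.I) ^ 2 := by fun_prop
      refine measurable_const.mul (Complex.measurable_re.comp (Measurable.sub ?_ (Measurable.mul ?_ ?_)))
      · exact (Polynomial.continuous_aeval U).measurable.comp hw
      · exact (Polynomial.continuous_aeval p).measurable.comp hw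
      · exact (measurable_twoBand a b).comp hw
    · filter_upwards [hsmall] with ε hε
      have hne : ∀ᵐ s : ℝ, s ≠ √b := by simp [ae_iff, measure_singleton]
      filter_upwards [hne] with s hsb hs
      rw [Set.uIoc_of_le hη.1.le] at hs
      have hs1 : s ∈ Set.Ioo (0 : ℝ) 1 := ⟨hs.1, hs.2.trans_lt hη.2⟩
      have hball : ((s : ℂ) + ε * Complex.I) ^ 2 ∈ Metric.closedBall (0 : ℂ) 2 := by
        rw [mem_closedBall_zero_iff]; exact norm_boundary_sq_le hs1 hε
      have b1 := hCp _ hball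
      have b2 := hCU _ hball
      have b3 := hDle ε hε s hs hsb
      rw [norm_mul, Real.norm_of_nonneg Real.pi_pos.le]
      refine mul_le_mul_of_nonneg_left ?_ Real.pi_pos.le
      refine (Complex.abs_re_le_norm _).trans ((norm_sub_le _ _).trans (add_le_add b2 ?_))
      rw [norm_mul]
      exact mul_le_mul b1 b3 (norm_nonneg _) ((norm_nonneg _).trans b1)
    · have hne : ∀ᵐ s : ℝ, s ≠ √b := by simp [ae_iff, measure_singleton]
      have hne' : ∀ᵐ s : ℝ, s ≠ √a := by simp [ae_iff, measure_singleton]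
      filter_upwards [hne, hne'] with s hsb hsa hs
      rw [Set.uIoc_of_le hη.1.le] at hs
      have hs1 : s ∈ Set.Ioo (0 : ℝ) 1 := ⟨hs.1, hs.2.trans_lt hη.2⟩
      have hb2 : s ^ 2 ≠ b := fun e => hsb (by rw [← e, Real.sqrt_sq hs.1.le])
      have ha2 : s ^ 2 ≠ a := fun e => hsa (by rw [← e, Real.sqrt_sq hs.1.le])
      have hlim := tendsto_re_twoBand h hs1 hb2 ha2
      have hw := tendsto_sq_boundary s
      have hU := (((Polynomial.continuous_aeval U).tendsto ((s ^ 2 : ℝ) : ℂ)).comp hw)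
      have hp := (((Polynomial.continuous_aeval p).tendsto ((s ^ 2 : ℝ) : ℂ)).comp hw)
      rw [aeval_ofReal] at hU hp
      have hU' := (Complex.continuous_re.tendsto _).comp hU
      have hz : Tendsto (fun ε : ℝ => ((Polynomial.aeval (((s : ℂ) + ε * Complex.I) ^ 2) p
          - ((p.eval (s ^ 2) : ℝ) : ℂ)) * twoBand a b (((s : ℂ) + ε * Complex.I) ^ 2))) (𝓝[>] 0)
          (𝓝 0) := by
        have hp0 : Tendsto (fun ε : ℝ => ‖Polynomial.aeval (((s : ℂ) + ε * Complex.I) ^ 2) p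
            - ((p.eval (s ^ 2) : ℝ) : ℂ)‖ * D s) (𝓝[>] 0) (𝓝 0) := by
          have := (hp.sub_const ((p.eval (s ^ 2) : ℝ) : ℂ)).norm.mul_const (D s)
          simpa using this
        refine squeeze_zero_norm' ?_ hp0
        filter_upwards [hsmall] with ε hε
        rw [norm_mul]
        exact mul_le_mul_of_nonneg_left (hDle ε hε s hs hsb) (norm_nonneg _)
      have hz' := (Complex.continuous_re.tendsto _).comp hz
      have hall := ((hU'.sub hz').sub (hlim.const_mul (p.eval (s ^ 2)))).const_mul Real.pi
      simp only [Complex.zero_re, sub_zero, Complex.ofReal_re] at hall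
      refine hall.congr fun ε => ?_
      simp only [Function.comp, sub_mul, Complex.sub_re, Complex.re_ofReal_mul]
      ring
  refine hmain.congr' ?_
  filter_upwards [hsmall] with ε hε
  exact (integral_density_regKer h hasym hη.1 hε.1).symm

/-- The regularized kernels increase to the logarithmic one as ε decreases. Monotone convergence and
`tendsto_integral_density_regKer` evaluate the same limit, which also shows that it is nonnegative.
-/
lemma lintegral_logKer_density (h : BandEnds a b) {p U : Polynomial ℝ}
    (hasym : Tendsto (fun ξ : ℝ => p.eval ξ * (√(ξ / (ξ - b)) * √((ξ - a) / (ξ - 1))) - U.eval ξ)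
      atTop (𝓝 0)) (hpos : ∀ η ∈ Set.Ioo (0 : ℝ) 1, 0 ≤ density a b p η) {η : ℝ}
    (hη : η ∈ Set.Ioo (0 : ℝ) 1) :
    0 ≤ (∫ s in (0 : ℝ)..η, Real.pi * (U.eval (s ^ 2) - p.eval (s ^ 2) * gapFun a b (s ^ 2))) ∧
    ∫⁻ μ in Set.Icc (0 : ℝ) 1, ENNReal.ofReal (logKer η μ) * ENNReal.ofReal (density a b p μ)
      = ENNReal.ofReal
        (∫ s in (0 : ℝ)..η, Real.pi * (U.eval (s ^ 2) - p.eval (s ^ 2) * gapFun a b (s ^ 2))) := by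
  set L := ∫ s in (0 : ℝ)..η, Real.pi * (U.eval (s ^ 2) - p.eval (s ^ 2) * gapFun a b (s ^ 2)) with hL
  have hseq : Tendsto (fun n : ℕ => 1 / ((n : ℝ) + 1)) atTop (𝓝[>] 0) := by
    refine tendsto_nhdsWithin_iff.2 ⟨tendsto_one_div_add_atTop_nhds_zero_nat, ?_⟩
    exact Eventually.of_forall fun n => by simp only [Set.mem_Ioi]; positivity
  have hseq0 : ∀ n : ℕ, (0 : ℝ) < 1 / ((n : ℝ) + 1) := fun n => by positivity
  have hlim := (tendsto_integral_density_regKer h hasym hη).comp hseq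
  have hnn : ∀ n : ℕ, 0 ≤ᵐ[volume.restrict (Set.Icc (0 : ℝ) 1)]
      fun μ => density a b p μ * regKer (1 / ((n : ℝ) + 1)) η μ := fun n => by
    filter_upwards [ae_pos_Icc] with μ hμ
    exact mul_nonneg (hpos μ hμ) (regKer_nonneg (hseq0 n) hη.1.le hμ.1.le)
  have hint : ∀ n : ℕ, Integrable (fun μ => density a b p μ * regKer (1 / ((n : ℝ) + 1)) η μ)
      (volume.restrict (Set.Icc (0 : ℝ) 1)) := fun n => by
    have hc : Continuous fun μ => regKer (1 / ((n : ℝ) + 1)) η μ := by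
      have hp := hseq0 n
      unfold regKer
      refine continuous_const.mul (Continuous.log (Continuous.div (by fun_prop) (by fun_prop)
        fun μ => ?_) fun μ => ?_) <;> positivity
    exact (integrableOn_density h p).mul_continuousOn hc.continuousOn isCompact_Icc
  have hL0 : 0 ≤ L := ge_of_tendsto' hlim fun n => integral_nonneg_of_ae (hnn n)
  refine ⟨hL0, ?_⟩
  have h1 : Tendsto (fun n : ℕ => ∫⁻ μ in Set.Icc (0 : ℝ) 1,
      ENNReal.ofReal (density a b p μ * regKer (1 / ((n : ℝ) + 1)) η μ)) atTop
      (𝓝 (ENNReal.ofReal L)) := by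
    have := (ENNReal.continuous_ofReal.tendsto L).comp hlim
    refine this.congr fun n => ?_
    simp only [Function.comp]
    exact ofReal_integral_eq_lintegral_ofReal (hint n) (hnn n)
  have h2 : Tendsto (fun n : ℕ => ∫⁻ μ in Set.Icc (0 : ℝ) 1,
      ENNReal.ofReal (density a b p μ * regKer (1 / ((n : ℝ) + 1)) η μ)) atTop
      (𝓝 (∫⁻ μ in Set.Icc (0 : ℝ) 1, ENNReal.ofReal (logKer η μ) * ENNReal.ofReal (density a b p μ))) := by
    refine lintegral_tendsto_of_tendsto_of_monotone (fun n => (hint n).1.aemeasurable.ennreal_ofReal)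
      ?_ ?_
    · filter_upwards [ae_pos_Icc] with μ hμ
      intro n k hnk
      refine ENNReal.ofReal_le_ofReal (mul_le_mul_of_nonneg_left ?_ (hpos μ hμ))
      refine regKer_antitone (hseq0 k) ?_ hη.1.le hμ.1.le
      have : (n : ℝ) ≤ k := by exact_mod_cast hnk
      exact one_div_le_one_div_of_le (by positivity) (by linarith)
    · filter_upwards [ae_pos_Icc, ae_ne_Icc η] with μ hμ hne
      rw [← ENNReal.ofReal_mul (logKer_nonneg hη.1.le hμ.1.le), mul_comm (logKer η μ)]
      have h3 := ((tendsto_regKer hη.1 hμ.1 hne.symm).mono_left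
        (nhdsWithin_le_nhds (s := Set.Ioi 0))).comp hseq
      exact (ENNReal.continuous_ofReal.tendsto _).comp (h3.const_mul (density a b p μ))
  exact tendsto_nhds_unique h2 h1

/-! ### Band densities as minimizers -/

variable (a b) in
/-- The multiplier of the variational conditions. -/
def multiplier (p : Polynomial ℝ) (η : ℝ) : ℝ :=
  -∫ s in (0 : ℝ)..η, p.eval (s ^ 2) * gapFun a b (s ^ 2)

lemma intervalIntegrable_gap_polynomial (h : BandEnds a b) (p : Polynomial ℝ) :
    IntervalIntegrable (fun s => p.eval (s ^ 2) * gapFun a b (s ^ 2)) volume 0 1 :=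
  (intervalIntegrable_gapFun_sq h).continuousOn_mul
    (p.continuous.comp (by fun_prop : Continuous fun s : ℝ => s ^ 2)).continuousOn

lemma continuousOn_multiplier (h : BandEnds a b) (p : Polynomial ℝ) :
    ContinuousOn (multiplier a b p) (Set.Icc 0 1) := by
  have := intervalIntegral.continuousOn_primitive_interval
    (μ := volume) (a := (0 : ℝ)) (b := 1) (f := fun s => p.eval (s ^ 2) * gapFun a b (s ^ 2)) (by
      rw [Set.uIcc_of_le zero_le_one, integrableOn_Icc_iff_integrableOn_Ioc]
      exact (intervalIntegrable_gap_polynomial h p).1)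
  rw [Set.uIcc_of_le zero_le_one] at this
  exact this.neg

/-- The required polynomial part U(ξ) = 4^m(2m + 1)tξ^m - x is chosen so that U(s²) is minus the
derivative of `external`. The potential is then π(N - `external`), N being the `multiplier`
contributed by the gap. -/
theorem isTheMinimizer_density (h : BandEnds a b) {m : ℕ} {x t : ℝ} {p : Polynomial ℝ}
    (hasym : Tendsto (fun ξ : ℝ => p.eval ξ * (√(ξ / (ξ - b)) * √((ξ - a) / (ξ - 1)))
      - (4 ^ m * (2 * m + 1) * t * ξ ^ m - x)) atTop (𝓝 0))
    (hpos : ∀ η ∈ Set.Ioo (0 : ℝ) 1, 0 ≤ density a b p η)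
    (hN : ∀ η ∈ Set.Ioo (0 : ℝ) 1, 0 ≤ multiplier a b p η)
    (hN0 : ∀ η ∈ Set.Ioo (0 : ℝ) 1, η ^ 2 ≠ a → η ^ 2 ≠ b →
      multiplier a b p η * density a b p η = 0)
    {ψ : ℝ → ℝ} (hψ : ψ =ᵐ[volume.restrict (Set.Icc (0 : ℝ) 1)] density a b p) :
    KdVHierarchy.IsTheMinimizer m x t ψ := by
  set U : Polynomial ℝ := Polynomial.C (4 ^ m * (2 * m + 1) * t) * Polynomial.X ^ m - Polynomial.C x
    with hU
  have hUe : ∀ ξ, U.eval ξ = 4 ^ m * (2 * m + 1) * t * ξ ^ m - x := fun ξ => by simp [hU]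
  have hasym' : Tendsto (fun ξ : ℝ => p.eval ξ * (√(ξ / (ξ - b)) * √((ξ - a) / (ξ - 1))) - U.eval ξ)
      atTop (𝓝 0) := by simpa only [hUe] using hasym
  have hval : ∀ η ∈ Set.Ioo (0 : ℝ) 1,
      (∫ s in (0 : ℝ)..η, Real.pi * (U.eval (s ^ 2) - p.eval (s ^ 2) * gapFun a b (s ^ 2)))
        = Real.pi * (multiplier a b p η - external m x t η) := by
    intro η hη
    have hg : IntervalIntegrable (fun s => p.eval (s ^ 2) * gapFun a b (s ^ 2)) volume 0 η :=
      (intervalIntegrable_gap_polynomial h p).mono_set (by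
        rw [Set.uIcc_of_le zero_le_one, Set.uIcc_of_le hη.1.le]
        exact Set.Icc_subset_Icc le_rfl hη.2.le)
    have hUint : IntervalIntegrable (fun s : ℝ => U.eval (s ^ 2)) volume 0 η :=
      (U.continuous.comp (by fun_prop : Continuous fun s : ℝ => s ^ 2)).intervalIntegrable _ _
    rw [intervalIntegral.integral_const_mul, intervalIntegral.integral_sub hUint hg]
    congr 1
    have hUi : ∫ s in (0 : ℝ)..η, U.eval (s ^ 2) = -external m x t η := by
      have e : ∀ s : ℝ, U.eval (s ^ 2) = 4 ^ m * (2 * m + 1) * t * s ^ (2 * m) - x := fun s => by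
        rw [hUe, ← pow_mul]
      simp only [e]
      rw [intervalIntegral.integral_sub ((by fun_prop : Continuous fun s : ℝ =>
          4 ^ m * (2 * m + 1) * t * s ^ (2 * m)).intervalIntegrable _ _) intervalIntegrable_const,
        intervalIntegral.integral_const_mul, integral_pow, intervalIntegral.integral_const]
      unfold external
      have : (2 * (m : ℝ) + 1) ≠ 0 := by positivity
      push_cast
      simp only [smul_eq_mul]
      field_simp
      ring
    rw [hUi, multiplier]
    ring
  have hadm : KdVHierarchy.Admissible ψ := by
    refine ⟨(integrableOn_density h p).congr hψ.symm, ?_⟩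
    filter_upwards [hψ, ae_pos_Icc] with η h1 h2
    rw [h1]; exact hpos η h2
  refine isTheMinimizer_of_potential hadm (continuousOn_multiplier h p) hN ?_ (fun η hη => ?_)
    fun η hη => ?_
  · have h1 : ∀ c : ℝ, ∀ᵐ η ∂(volume.restrict (Set.Icc (0 : ℝ) 1)), η ^ 2 ≠ c := fun c => by
      filter_upwards [ae_pos_Icc, ae_ne_Icc (√c)] with η h2 h3 e
      exact h3 (by rw [← e, Real.sqrt_sq h2.1.le])
    filter_upwards [hψ, ae_pos_Icc, h1 a, h1 b] with η h2 h3 h4 h5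
    rw [h2]; exact hN0 η h3 h4 h5
  · have h1 := (lintegral_logKer_density h hasym' hpos hη).1
    rw [hval η hη] at h1
    linarith [nonneg_of_mul_nonneg_right h1 Real.pi_pos]
  · rw [← hval η hη, ← (lintegral_logKer_density h hasym' hpos hη).2]
    refine lintegral_congr_ae ?_
    filter_upwards [hψ] with μ hμ
    rw [hμ]

end

end StepData

/-! ### Minimality of the density on two bands. -/

namespace StepData

open MeasureTheory Filter Asymptotics Topology

noncomputable section

variable {a b : ℝ}

/-! ### Asymptotics of the polynomial parts -/

lemma band_sqrt_eq_sRoot (h : BandEnds a b) {ξ : ℝ} (hξ : 1 < ξ) :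
    √(ξ / (ξ - b)) * √((ξ - a) / (ξ - 1)) = ξ / ((ξ - b) * sRoot a b ξ) ∧ 0 < sRoot a b ξ := by
  have h1 := h.b_le
  have h2 := h.2.1
  have pb : 0 < ξ - b := by linarith
  have pa : 0 < ξ - a := by linarith
  have p1 : 0 < ξ - 1 := by linarith
  have p0 : 0 < ξ := by linarith
  have e : (1 - ξ⁻¹) / ((1 - a * ξ⁻¹) * (1 - b * ξ⁻¹)) = ξ * (ξ - 1) / ((ξ - a) * (ξ - b)) := by
    have e1 : 1 - ξ⁻¹ = (ξ - 1) / ξ := by field_simp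
    have e2 : 1 - a * ξ⁻¹ = (ξ - a) / ξ := by field_simp
    have e3 : 1 - b * ξ⁻¹ = (ξ - b) / ξ := by field_simp
    rw [e1, e2, e3]
    field_simp
  have hpos : 0 < sRoot a b ξ := by
    unfold sRoot
    rw [e]
    exact Real.sqrt_pos.2 (by positivity)
  refine ⟨?_, hpos⟩
  rw [eq_div_iff (mul_pos pb hpos).ne']
  unfold sRoot
  rw [e, ← Real.sqrt_mul (by positivity), mul_left_comm, ← Real.sqrt_mul (by positivity),
    show ξ / (ξ - b) * ((ξ - a) / (ξ - 1)) * (ξ * (ξ - 1) / ((ξ - a) * (ξ - b)))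
      = (ξ / (ξ - b)) ^ 2 by field_simp, Real.sqrt_sq (by positivity)]
  field_simp

lemma tendsto_coeff_sub_sRoot (n : ℕ) (a b : ℝ) :
    Tendsto (fun ξ : ℝ => PowerSeries.coeff n (ratioSeries a * (bin b * geom ξ))
      - ξ ^ n * sRoot a b ξ) atTop (𝓝 0) :=
  (isBigO_coeff_sub_sRoot n a b).trans_tendsto tendsto_inv_atTop_zero

/-- The polynomial part of the density on one upper band. -/
def outerPoly (n : ℕ) (a k x : ℝ) : Polynomial ℝ :=
  Polynomial.C k * hPoly (n + 1) a 0 - Polynomial.C x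

/-- The polynomial part of the density on two bands. -/
def innerPoly (j : ℕ) (a b k : ℝ) : Polynomial ℝ :=
  Polynomial.C k * hPoly (j + 1) a b * (Polynomial.X - Polynomial.C b)

lemma eval_outerPoly (n : ℕ) (a k x ξ : ℝ) : (outerPoly n a k x).eval ξ = k * hFun n a 0 ξ - x := by
  simp [outerPoly, eval_hPoly]

lemma eval_innerPoly (j : ℕ) (a b k ξ : ℝ) :
    (innerPoly j a b k).eval ξ = k * hFun j a b ξ * (ξ - b) := by
  simp [innerPoly, eval_hPoly]

lemma tendsto_outerPoly (n : ℕ) (h : BandEnds a 0) (k x : ℝ) :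
    Tendsto (fun ξ : ℝ => (outerPoly n a k x).eval ξ * (√(ξ / (ξ - 0)) * √((ξ - a) / (ξ - 1)))
      - (k * ξ ^ n - x)) atTop (𝓝 0) := by
  have hS := (tendsto_sRoot a 0).inv₀ one_ne_zero
  have hE := tendsto_coeff_sub_sRoot n a 0
  have hlim := ((hE.mul hS).const_mul k).add 
    (((tendsto_const_nhds (x := (1 : ℝ))).sub hS).const_mul x)
  rw [zero_mul, mul_zero, inv_one, sub_self, mul_zero, add_zero] at hlim
  refine hlim.congr' ?_
  filter_upwards [eventually_gt_atTop 1] with ξ hξ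
  obtain ⟨e, hp⟩ := band_sqrt_eq_sRoot h hξ
  rw [e, eval_outerPoly]
  unfold hFun
  generalize PowerSeries.coeff n (ratioSeries a * (bin 0 * geom ξ)) = T
  have h0 : ξ ≠ 0 := by linarith
  have := hp.ne'
  rw [sub_zero]
  field_simp
  ring

/-- (ξ - b) times the band root is ξ/S with S = `sRoot a b ξ`, and ξ `hFun` is the next coefficient
minus β = `betaCoeff (j + 1) a b`. As that coefficient is ξ^{j+1}S + o(1) and S → 1, the constant
-kβ remains: x = kβ is forced. -/
lemma tendsto_innerPoly (j : ℕ) (h : BandEnds a b) (k : ℝ) :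
    Tendsto (fun ξ : ℝ => (innerPoly j a b k).eval ξ * (√(ξ / (ξ - b)) * √((ξ - a) / (ξ - 1)))
      - (k * ξ ^ (j + 1) - k * betaCoeff (j + 1) a b)) atTop (𝓝 0) := by
  have hS := (tendsto_sRoot a b).inv₀ one_ne_zero
  have hE := tendsto_coeff_sub_sRoot (j + 1) a b
  have hlim := ((hE.mul hS).const_mul k).add
    (((tendsto_const_nhds (x := (1 : ℝ))).sub hS).const_mul (k * betaCoeff (j + 1) a b))
  rw [zero_mul, mul_zero, inv_one, sub_self, mul_zero, add_zero] at hlim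
  refine hlim.congr' ?_
  filter_upwards [eventually_gt_atTop 1] with ξ hξ
  obtain ⟨e, hp⟩ := band_sqrt_eq_sRoot h hξ
  have h1 := h.b_le
  have h2 := h.2.1
  have pb : ξ - b ≠ 0 := by linarith
  rw [e, eval_innerPoly, coeff_eq_mul_hPoly, eval_hPoly]
  have := hp.ne'
  field_simp
  ring

/-! ### The multiplier on two bands -/

lemma gapFun_sq_mul (h : BandEnds a b) {s : ℝ} (hs : s ∈ Set.Ioo (0 : ℝ) 1) :
    (s ^ 2 - b) * gapFun a b (s ^ 2) = s * (√((a - s ^ 2) * (s ^ 2 - b)) / √(1 - s ^ 2)) := by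
  have hs0 := hs.1
  have hs1 : 0 < 1 - s ^ 2 := by nlinarith [hs.1, hs.2]
  rcases le_or_gt (s ^ 2) b with hb | hb
  · rw [gapFun_lower ⟨sq_nonneg s, hb⟩, Real.sqrt_eq_zero_of_nonpos
      (mul_nonpos_of_nonneg_of_nonpos (by linarith [h.b_le]) (by linarith))]
    ring
  rcases le_or_gt a (s ^ 2) with ha | ha
  · rw [gapFun_upper ⟨ha, by linarith⟩, Real.sqrt_eq_zero_of_nonpos
      (mul_nonpos_of_nonpos_of_nonneg (by linarith) (by linarith))]
    ring
  · have pb : 0 < s ^ 2 - b := by linarith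
    have pa : 0 < a - s ^ 2 := by linarith
    unfold gapFun
    rw [Real.sqrt_div (sq_nonneg s), Real.sqrt_sq hs0.le, Real.sqrt_div pa.le, Real.sqrt_mul pa.le]
    have h1 := Real.sqrt_pos.2 pb
    have h2 := Real.sqrt_pos.2 hs1
    have h3 := Real.sq_sqrt pb.le
    generalize √(s ^ 2 - b) = B at h1 h3 ⊢
    rw [← h3]
    field_simp

lemma integral_loop_comp_sq (j : ℕ) {η : ℝ} (hη : 0 ≤ η) (hη1 : η < 1) :
    ∫ s in (0 : ℝ)..η, s * (hFun j a b (s ^ 2) * (√((a - s ^ 2) * (s ^ 2 - b)) / √(1 - s ^ 2)))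
      = 1 / 2 * ∫ v in (0 : ℝ)..η ^ 2, hFun j a b v * (√((a - v) * (v - b)) / √(1 - v)) := by
  have h := intervalIntegral.integral_comp_mul_deriv''' (a := 0) (b := η) (f := fun s : ℝ => s ^ 2)
    (f' := fun s => 2 * s) (g := fun v => hFun j a b v * (√((a - v) * (v - b)) / √(1 - v)))
    (by fun_prop) (fun s _ => by simpa using (hasDerivAt_pow 2 s).hasDerivWithinAt) ?_ ?_ ?_
  · rw [zero_pow two_ne_zero] at h
    rw [← h, ← intervalIntegral.integral_const_mul]
    refine intervalIntegral.integral_congr fun s _ => ?_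
    simp only [Function.comp]
    ring
  all_goals
    have hcont : ContinuousOn (fun v => hFun j a b v * (√((a - v) * (v - b)) / √(1 - v)))
        (Set.Icc 0 (η ^ 2)) :=
      (continuous_hFun_right j a b).continuousOn.mul
        (continuousOn_loopWeight (by nlinarith : η ^ 2 < 1))
    have himg : (fun s : ℝ => s ^ 2) '' Set.uIcc 0 η ⊆ Set.Icc 0 (η ^ 2) := by
      rw [Set.uIcc_of_le hη]
      rintro _ ⟨s, hs, rfl⟩
      exact ⟨sq_nonneg s, by nlinarith [hs.1, hs.2]⟩
  · refine hcont.mono (Set.Subset.trans (Set.image_mono ?_) himg)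
    rw [min_eq_left hη, max_eq_right hη, Set.uIcc_of_le hη]
    exact Set.Ioo_subset_Icc_self
  · exact (hcont.integrableOn_Icc).mono_set himg
  · refine ContinuousOn.integrableOn_uIcc ?_
    refine ContinuousOn.mul (hcont.comp (by fun_prop) fun s hs => himg ⟨s, hs, rfl⟩) (by fun_prop)

lemma multiplier_innerPoly (h : BandEnds a b) (j : ℕ) (k : ℝ) {η : ℝ} (hη : η ∈ Set.Ioo (0 : ℝ) 1) :
    multiplier a b (innerPoly j a b k) η
      = -(k / 2 * ∫ v in (0 : ℝ)..η ^ 2, hFun j a b v * (√((a - v) * (v - b)) / √(1 - v))) := by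
  have e : ∫ s in (0 : ℝ)..η, (innerPoly j a b k).eval (s ^ 2) * gapFun a b (s ^ 2)
      = ∫ s in (0 : ℝ)..η,
        k * (s * (hFun j a b (s ^ 2) * (√((a - s ^ 2) * (s ^ 2 - b)) / √(1 - s ^ 2)))) := by
    refine intervalIntegral_congr_Ioo hη.1.le fun s hs => ?_
    have := gapFun_sq_mul h (s := s) ⟨hs.1, hs.2.trans hη.2⟩
    rw [eval_innerPoly, mul_assoc, this]
    ring
  rw [multiplier, e, intervalIntegral.integral_const_mul, integral_loop_comp_sq j hη.1.le hη.2]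
  ring

/-- Outside the gap the integrand is zero, as the root of a nonpositive number. Inside, `hFun_signs`
applies, and the zero loop integral brings the primitive back to zero at a. So the multiplier is
nonnegative and vanishes on both bands. -/
lemma loop_primitive_le {j : ℕ} (hj : 1 ≤ j) (hb : 0 < b) (hba : b < a) (ha : a < 1)
    (hL : loopInt j a b = 0) {y : ℝ} (hy0 : 0 ≤ y) (hy1 : y < 1) :
    (∫ v in (0 : ℝ)..y, hFun j a b v * (√((a - v) * (v - b)) / √(1 - v))) ≤ 0 ∧
    (y ≤ b ∨ a ≤ y →
      ∫ v in (0 : ℝ)..y, hFun j a b v * (√((a - v) * (v - b)) / √(1 - v)) = 0) := by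
  have hz : ∀ {c d : ℝ}, c ≤ d → (d ≤ b ∨ a ≤ c) →
      ∫ v in c..d, hFun j a b v * (√((a - v) * (v - b)) / √(1 - v)) = 0 := by
    intro c d hcd hd
    rw [intervalIntegral_congr_Ioo (g := fun _ => 0) hcd fun v hv => ?_]
    · simp
    · have : (a - v) * (v - b) ≤ 0 := by
        rcases hd with h | h
        · exact mul_nonpos_of_nonneg_of_nonpos (by linarith [hv.2]) (by linarith [hv.2])
        · exact mul_nonpos_of_nonpos_of_nonneg (by linarith [hv.1]) (by linarith [hv.1])
      rw [Real.sqrt_eq_zero_of_nonpos this]; simp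
  have hint : ∀ {c d : ℝ}, c ≤ d → d < 1 → IntervalIntegrable
      (fun v => hFun j a b v * (√((a - v) * (v - b)) / √(1 - v))) volume c d :=
    fun h1 h2 => intervalIntegrable_loop j h1 h2
  rcases le_or_gt y b with hyb | hyb
  · have := hz hy0 (Or.inl hyb)
    exact ⟨this.le, fun _ => this⟩
  have h1 := intervalIntegral.integral_add_adjacent_intervals (hint hb.le (hba.trans ha))
    (hint hyb.le hy1)
  rw [hz hb.le (Or.inl le_rfl), zero_add] at h1
  rcases le_or_gt y a with hya | hya
  · rw [← h1]
    refine ⟨(hFun_signs hj hb.le hba ha hL).2.2 y ⟨hyb.le, hya⟩, fun hy => ?_⟩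
    have : y = a := le_antisymm hya (hy.resolve_left (not_le.2 hyb))
    rw [this]; unfold loopInt at hL; exact hL
  · have h2 := intervalIntegral.integral_add_adjacent_intervals (hint hba.le ha) (hint hya.le hy1)
    rw [hz hya.le (Or.inr le_rfl), add_zero] at h2
    rw [← h1, ← h2]
    unfold loopInt at hL
    exact ⟨hL.le, fun _ => hL⟩

lemma bandDensity_pos_lower (h : BandEnds a b) {v : ℝ} (hv : v ∈ Set.Ioo 0 b) :
    0 < bandDensity a b v := by
  have h1 := h.lt_of_pos (hv.1.trans hv.2)
  rw [bandDensity_lower hv]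
  exact mul_pos (Real.sqrt_pos.2 (div_pos hv.1 (by linarith [hv.2])))
    (Real.sqrt_pos.2 (div_pos (by linarith [hv.2]) (by linarith [hv.2, h.2.1])))

lemma bandDensity_pos_upper (h : BandEnds a b) {v : ℝ} (hv : v ∈ Set.Ioo a 1) :
    0 < bandDensity a b v := by
  have h1 := h.1
  have h2 := h.b_le
  rw [bandDensity_upper h hv]
  exact mul_pos (Real.sqrt_pos.2 (div_pos (by linarith [hv.1]) (by linarith [hv.1])))
    (Real.sqrt_pos.2 (div_pos (by linarith [hv.1]) (by linarith [hv.2])))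

lemma sq_mem_Ioo {η : ℝ} (hη : η ∈ Set.Ioo (0 : ℝ) 1) : η ^ 2 ∈ Set.Ioo (0 : ℝ) 1 :=
  ⟨by have := hη.1; positivity, by nlinarith [hη.1, hη.2]⟩

/-- On the lower band `hFun` and ξ - b are both negative, on the upper band both are positive. -/
lemma density_innerPoly {j : ℕ} (hj : 1 ≤ j) (hb : 0 < b) (hba : b < a) (ha : a < 1)
    (hL : loopInt j a b = 0) {k : ℝ} (hk : 0 < k) {η : ℝ} (hη : η ∈ Set.Ioo (0 : ℝ) 1) :
    (η ^ 2 < b → 0 < density a b (innerPoly j a b k) η) ∧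
    (b < η ^ 2 → η ^ 2 < a → density a b (innerPoly j a b k) η = 0) ∧
    (a < η ^ 2 → 0 < density a b (innerPoly j a b k) η) := by
  have h : BandEnds a b := ⟨(hb.trans hba).le, ha, Or.inr ⟨hb, hba⟩⟩
  obtain ⟨s1, s2, -⟩ := hFun_signs hj hb.le hba ha hL
  have hη2 := sq_mem_Ioo hη
  unfold density
  rw [eval_innerPoly]
  refine ⟨fun h1 => ?_, fun h1 h2 => ?_, fun h1 => ?_⟩
  · have := s1 _ ⟨hη2.1.le, h1.le⟩
    exact mul_pos (mul_pos_of_neg_of_neg (mul_neg_of_pos_of_neg hk this) (by linarith))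
      (bandDensity_pos_lower h ⟨hη2.1, h1⟩)
  · rw [bandDensity_gap h ⟨h1, h2⟩, mul_zero]
  · have := s2 _ h1.le
    exact mul_pos (mul_pos (mul_pos hk this) (by linarith))
      (bandDensity_pos_upper h ⟨h1, hη2.2⟩)

lemma bandDensity_branch (h : BandEnds a b) {v : ℝ} (hv : v = a ∨ v = b) : bandDensity a b v = 0 := by
  have h1 := h.1
  have h2 := h.b_le
  have h3 := h.2.1
  unfold bandDensity
  rcases hv with rfl | rfl
  · simp
  · simp

theorem isTheMinimizer_inner {j : ℕ} (hj : 1 ≤ j) (hb : 0 < b) (hba : b < a) (ha : a < 1)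
    (hL : loopInt j a b = 0) {t : ℝ} (ht : 0 < t) {ψ : ℝ → ℝ}
    (hψ : ψ =ᵐ[volume.restrict (Set.Icc (0 : ℝ) 1)] density a b
      (innerPoly j a b (4 ^ (j + 1) * (2 * ((j + 1 : ℕ) : ℝ) + 1) * t))) :
    KdVHierarchy.IsTheMinimizer (j + 1)
      (4 ^ (j + 1) * (2 * ((j + 1 : ℕ) : ℝ) + 1) * betaCoeff (j + 1) a b * t) t ψ := by
  have h : BandEnds a b := ⟨(hb.trans hba).le, ha, Or.inr ⟨hb, hba⟩⟩
  set k := (4 : ℝ) ^ (j + 1) * (2 * ((j + 1 : ℕ) : ℝ) + 1) * t with hk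
  have hk0 : 0 < k := by positivity
  have hmul : ∀ η ∈ Set.Ioo (0 : ℝ) 1, 0 ≤ multiplier a b (innerPoly j a b k) η := fun η hη => by
    rw [multiplier_innerPoly h j k hη]
    have := (loop_primitive_le hj hb hba ha hL (sq_nonneg η) (sq_mem_Ioo hη).2).1
    nlinarith
  refine isTheMinimizer_density h (p := innerPoly j a b k) ?_ ?_ hmul ?_ hψ
  · have := tendsto_innerPoly j h k
    rw [show 4 ^ (j + 1) * (2 * ((j + 1 : ℕ) : ℝ) + 1) * betaCoeff (j + 1) a b * t
      = k * betaCoeff (j + 1) a b by rw [hk]; ring]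
    exact this
  · intro η hη
    obtain ⟨d1, d2, d3⟩ := density_innerPoly hj hb hba ha hL hk0 hη
    rcases lt_trichotomy (η ^ 2) b with h1 | h1 | h1
    · exact (d1 h1).le
    · exact (by rw [density, bandDensity_branch h (Or.inr h1), mul_zero] : density a b _ η = 0).ge
    · rcases lt_trichotomy (η ^ 2) a with h2 | h2 | h2
      · exact (d2 h1 h2).ge
      · exact (by rw [density, bandDensity_branch h (Or.inl h2), mul_zero] : density a b _ η = 0).ge
      · exact (d3 h2).le
  · intro η hη hna hnb
    obtain ⟨-, d2, -⟩ := density_innerPoly hj hb hba ha hL hk0 hη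
    have hz : η ^ 2 ≤ b ∨ a ≤ η ^ 2 → multiplier a b (innerPoly j a b k) η = 0 := fun hy => by
      rw [multiplier_innerPoly h j k hη,
        (loop_primitive_le hj hb hba ha hL (sq_nonneg η) (sq_mem_Ioo hη).2).2 hy]
      ring
    rcases lt_or_gt_of_ne hnb with h1 | h1
    · rw [hz (Or.inl h1.le), zero_mul]
    · rcases lt_or_gt_of_ne hna with h2 | h2
      · rw [d2 h1 h2, mul_zero]
      · rw [hz (Or.inr h2.le), zero_mul]

end

end StepData

/-! ### Minimality for one upper band, the full band and the void. -/

namespace StepData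

open MeasureTheory Filter Asymptotics Topology

noncomputable section

variable {a b : ℝ}

/-! ### One upper band -/

lemma hFun_succ_zero (j : ℕ) (a ξ : ℝ) :
    hFun (j + 1) a 0 ξ = ξ * hFun j a 0 ξ + betaCoeff (j + 1) a 0 := by
  unfold betaCoeff
  rw [hFun_zero_right, hFun_zero_right, coeff_mul_geom_succ, bin_zero, mul_one]

lemma hFun_zero_zero (j : ℕ) (ξ : ℝ) : hFun j 0 0 ξ = bandFun j ξ := by
  rw [hFun_zero_right, ratioSeries_zero]; rfl

lemma integral_gapFun_sq (ha : 0 < a) :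
    ∫ s in (0 : ℝ)..√a, gapFun a 0 (s ^ 2) = a / 2 * outerMass a := by
  have hs := Real.sqrt_pos.2 ha
  have h1 := intervalIntegral.smul_integral_comp_mul_left (a := 0) (b := 1)
    (fun s : ℝ => gapFun a 0 (s ^ 2)) √a
  rw [mul_zero, mul_one, smul_eq_mul] at h1
  have h2 := integral_smul_comp_sq fun v : ℝ => √(1 - v) / √(v * (1 - a * v))
  rw [← h1, outerMass, ← h2, ← intervalIntegral.integral_const_mul,
    ← intervalIntegral.integral_const_mul]
  refine intervalIntegral_congr_Ioo zero_le_one fun μ hμ => ?_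
  have h0 := hμ.1
  have e1 : (√a * μ) ^ 2 = a * μ ^ 2 := by rw [mul_pow, Real.sq_sqrt ha.le]
  have e2 : 0 < a * μ ^ 2 := by positivity
  have e3 : a - a * μ ^ 2 = a * (1 - μ ^ 2) := by ring
  have e4 : 0 ≤ 1 - μ ^ 2 := by nlinarith [hμ.1, hμ.2]
  simp only [gapFun, e1, sub_zero, div_self e2.ne', Real.sqrt_one, one_mul, smul_eq_mul]
  rw [e3, Real.sqrt_div (mul_nonneg ha.le e4), Real.sqrt_mul ha.le, Real.sqrt_mul (sq_nonneg μ),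
    Real.sqrt_sq h0.le]
  rw [mul_div_assoc, ← mul_assoc, Real.mul_self_sqrt ha.le]
  field_simp

/-- The band polynomial vanishing at infinity at speed `outerSpeed`. -/
def outerBand (j : ℕ) (a v : ℝ) : ℝ := hFun (j + 1) a 0 v - outerSpeed j a

lemma outerBand_eq (j : ℕ) (a v : ℝ) :
    outerBand j a v = v * hFun j a 0 v - a * loopHat j a 0 / outerMass a := by
  unfold outerBand outerSpeed
  rw [hFun_succ_zero]; ring

/-- `outerBand` is v `hFun` minus a constant that is nonnegative because `loopHat` is. Divided by
v^{j+1}, both parts are monotone in the right direction. This is the role of the condition a ≥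
u^{**}. -/
lemma ratioMono_outerBand {j : ℕ} (hj : 1 ≤ j) (ha : 0 ≤ a) (ha1 : a < 1)
    (hL : 0 ≤ loopHat j a 0) : RatioMono (j + 1) (outerBand j a) := by
  intro r s hr hrs
  rw [outerBand_eq, outerBand_eq]
  have h1 := ratioMono_hFun_zero hj ha ha1 r s hr hrs
  have h2 : r ^ (j + 1) ≤ s ^ (j + 1) := pow_le_pow_left₀ hr.le hrs.le _
  have h3 : 0 ≤ a * loopHat j a 0 / outerMass a :=
    div_nonneg (mul_nonneg ha hL) (outerMass_pos ha1.le).le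
  have h4 := mul_lt_mul_of_pos_left h1 (mul_pos hr (hr.trans hrs))
  have h5 := mul_le_mul_of_nonneg_left h2 h3
  rw [pow_succ] at h5 ⊢
  rw [pow_succ] at h5 ⊢
  nlinarith

lemma bandEnds_outer (ha : 0 ≤ a) (ha1 : a < 1) : BandEnds a 0 := ⟨ha, ha1, Or.inl rfl⟩

lemma sqrt_lt_one_of_lt (ha1 : a < 1) : √a < 1 := by
  rw [Real.sqrt_lt' one_pos]; simpa using ha1

lemma intervalIntegrable_outerBand (j : ℕ) (ha : 0 ≤ a) (ha1 : a < 1) {c d : ℝ} (hc : 0 ≤ c)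
    (hcd : c ≤ d) (hd : d ≤ 1) :
    IntervalIntegrable (fun s => outerBand j a (s ^ 2) * gapFun a 0 (s ^ 2)) volume c d := by
  have h := intervalIntegrable_gap_polynomial (bandEnds_outer ha ha1)
    (outerPoly (j + 1) a 1 (outerSpeed j a))
  simp only [eval_outerPoly, one_mul] at h
  refine h.mono_set ?_
  rw [Set.uIcc_of_le hcd, Set.uIcc_of_le zero_le_one]
  exact Set.Icc_subset_Icc hc hd

/-- The equilibrium condition across the gap: half the loop integral equals the constant in
`outerBand_eq` times the mass `integral_gapFun_sq`. `outerSpeed` is normalized for this. -/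
lemma integral_outerBand (j : ℕ) (ha : 0 < a) (ha1 : a < 1) :
    ∫ s in (0 : ℝ)..√a, outerBand j a (s ^ 2) * gapFun a 0 (s ^ 2) = 0 := by
  have h := bandEnds_outer ha.le ha1
  have hs1 := sqrt_lt_one_of_lt ha1
  have h1 := intervalIntegrable_outerBand j ha.le ha1 le_rfl (Real.sqrt_nonneg a) hs1.le
  have h2 : IntervalIntegrable (fun s => gapFun a 0 (s ^ 2)) volume 0 √a := by
    have h3 := intervalIntegrable_gap_polynomial h 1
    simp only [Polynomial.eval_one, one_mul] at h3
    refine h3.mono_set ?_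
    rw [Set.uIcc_of_le (Real.sqrt_nonneg a), Set.uIcc_of_le zero_le_one]
    exact Set.Icc_subset_Icc le_rfl hs1.le
  set d := a * loopHat j a 0 / outerMass a with hd
  have h4 := intervalIntegral.integral_add h1 (h2.const_mul d)
  have h5 : ∫ s in (0 : ℝ)..√a, (outerBand j a (s ^ 2) * gapFun a 0 (s ^ 2)
      + d * gapFun a 0 (s ^ 2)) = 1 / 2 * loopInt j a 0 := by
    have h6 := integral_loop_comp_sq (a := a) (b := 0) j (Real.sqrt_nonneg a) hs1
    rw [Real.sq_sqrt ha.le] at h6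
    unfold loopInt
    rw [← h6]
    refine intervalIntegral_congr_Ioo (Real.sqrt_nonneg a) fun s hs => ?_
    have h7 := gapFun_sq_mul h (s := s) ⟨hs.1, hs.2.trans hs1⟩
    rw [outerBand_eq]
    linear_combination hFun j a 0 (s ^ 2) * h7
  rw [h5, intervalIntegral.integral_const_mul, integral_gapFun_sq ha, loopInt_eq j ha.le, hd] at h4
  have := (outerMass_pos ha1.le).ne'
  have e : a * loopHat j a 0 / outerMass a * (a / 2 * outerMass a) = 1 / 2 * (a ^ 2 * loopHat j a 0) := by
    field_simp
  rw [e, sub_zero] at h4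
  linarith

lemma gapFun_pos_outer (ha1 : a < 1) {s : ℝ} (hs : s ∈ Set.Ioo 0 √a) : 0 < gapFun a 0 (s ^ 2) := by
  have h1 : s ^ 2 < a := (Real.lt_sqrt hs.1.le).1 hs.2
  have h2 := hs.1
  unfold gapFun
  rw [sub_zero, div_self (by positivity), Real.sqrt_one, one_mul]
  exact Real.sqrt_pos.2 (div_pos (by linarith) (by linarith))

/-- A negative value at a would make `outerBand` negative in the whole gap, against the zero
integral. Beyond a the single sign change gives strict positivity. -/
lemma outerBand_pos {j : ℕ} (hj : 1 ≤ j) (ha : 0 < a) (ha1 : a < 1) (hL : 0 ≤ loopHat j a 0)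
    {v : ℝ} (hv : a < v) : 0 < outerBand j a v := by
  have hmono := ratioMono_outerBand hj ha.le ha1 hL
  refine hmono.pos_of_nonneg ha hv ?_
  by_contra hc
  have h := intervalIntegral_lt_of_lt (Real.sqrt_pos.2 ha)
    (intervalIntegrable_outerBand j ha.le ha1 le_rfl (Real.sqrt_nonneg a) (sqrt_lt_one_of_lt ha1).le)
    (intervalIntegrable_const (c := (0 : ℝ))) fun s hs => by
      have hs0 := hs.1
      exact mul_neg_of_neg_of_pos (hmono.neg_of_nonpos (by positivity)
        ((Real.lt_sqrt hs.1.le).1 hs.2) (not_le.1 hc).le) (gapFun_pos_outer ha1 hs)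
  rw [integral_outerBand j ha ha1] at h
  simp at h

lemma integral_outerBand_nonpos {j : ℕ} (hj : 1 ≤ j) (ha : 0 < a) (ha1 : a < 1)
    (hL : 0 ≤ loopHat j a 0) {η : ℝ} (hη : η ∈ Set.Ioo (0 : ℝ) 1) :
    (∫ s in (0 : ℝ)..η, outerBand j a (s ^ 2) * gapFun a 0 (s ^ 2)) ≤ 0 ∧
    (a ≤ η ^ 2 → ∫ s in (0 : ℝ)..η, outerBand j a (s ^ 2) * gapFun a 0 (s ^ 2) = 0) := by
  have hmono := ratioMono_outerBand hj ha.le ha1 hL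
  have hint {c d : ℝ} := intervalIntegrable_outerBand (c := c) (d := d) j ha.le ha1
  have hs := Real.sqrt_nonneg a
  have key : a ≤ η ^ 2 → ∫ s in (0 : ℝ)..η, outerBand j a (s ^ 2) * gapFun a 0 (s ^ 2) = 0 := by
    intro h
    have h' : √a ≤ η := Real.sqrt_le_left hη.1.le |>.2 h
    rw [← intervalIntegral.integral_add_adjacent_intervals (hint le_rfl hs (h'.trans hη.2.le))
      (hint hs h' hη.2.le), integral_outerBand j ha ha1, zero_add,
      intervalIntegral_congr_Ioo (g := fun _ => 0) h' fun s hs' => ?_]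
    · simp
    · have h1 : a ≤ s ^ 2 := ((Real.sqrt_lt' (hs.trans_lt hs'.1)).1 hs'.1).le
      rw [gapFun_upper ⟨h1, by nlinarith [hs.trans_lt hs'.1, hs'.2, hη.2]⟩, mul_zero]
  refine ⟨?_, key⟩
  rcases le_or_gt a (η ^ 2) with h | h
  · exact (key h).le
  have h' : η < √a := (Real.lt_sqrt hη.1.le).2 h
  have hη0 := hη.1
  rcases le_or_gt (outerBand j a (η ^ 2)) 0 with hP | hP
  · have := intervalIntegral.integral_mono_on_of_le_Ioo hη.1.le (hint le_rfl hη.1.le hη.2.le)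
      (intervalIntegrable_const (c := (0 : ℝ))) fun s hs => by
        have hs0 := hs.1
        exact mul_nonpos_of_nonpos_of_nonneg (hmono.neg_of_nonpos (by positivity)
          (pow_lt_pow_left₀ hs.2 hs0.le two_ne_zero) hP).le (gapFun_nonneg _ _ _)
    simpa using this
  · have h1 := intervalIntegral.integral_add_adjacent_intervals (hint le_rfl hη.1.le hη.2.le)
      (hint hη.1.le h'.le (sqrt_lt_one_of_lt ha1).le)
    rw [integral_outerBand j ha ha1] at h1
    have h2 : 0 ≤ ∫ s in η..√a, outerBand j a (s ^ 2) * gapFun a 0 (s ^ 2) := by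
      refine intervalIntegral.integral_nonneg h'.le fun s hs => ?_
      refine mul_nonneg ?_ (gapFun_nonneg _ _ _)
      rcases hs.1.eq_or_lt with rfl | hlt
      · exact hP.le
      · exact (hmono.pos_of_nonneg (by positivity)
          (pow_lt_pow_left₀ hlt hη0.le two_ne_zero) hP.le).le
    linarith

lemma density_outerPoly {j : ℕ} (hj : 1 ≤ j) (ha : 0 < a) (ha1 : a < 1) (hL : 0 ≤ loopHat j a 0)
    {k : ℝ} (hk : 0 < k) {η : ℝ} (hη : η ∈ Set.Ioo (0 : ℝ) 1) :
    (η ^ 2 < a → density a 0 (outerPoly (j + 1) a k (k * outerSpeed j a)) η = 0) ∧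
    (a < η ^ 2 → 0 < density a 0 (outerPoly (j + 1) a k (k * outerSpeed j a)) η) := by
  have h := bandEnds_outer ha.le ha1
  have hη2 := sq_mem_Ioo hη
  unfold density
  refine ⟨fun h1 => ?_, fun h1 => ?_⟩
  · rw [bandDensity_gap h ⟨hη2.1, h1⟩, mul_zero]
  · refine mul_pos ?_ (bandDensity_pos_upper h ⟨h1, hη2.2⟩)
    have := mul_pos hk (outerBand_pos hj ha ha1 hL h1)
    rw [eval_outerPoly]
    unfold outerBand at this
    linarith

lemma multiplier_outerPoly (j : ℕ) (a k η : ℝ) :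
    multiplier a 0 (outerPoly (j + 1) a k (k * outerSpeed j a)) η
      = -(k * ∫ s in (0 : ℝ)..η, outerBand j a (s ^ 2) * gapFun a 0 (s ^ 2)) := by
  unfold multiplier outerBand
  rw [← intervalIntegral.integral_const_mul]
  congr 1
  refine intervalIntegral.integral_congr fun s _ => ?_
  simp only [eval_outerPoly]
  ring

theorem isTheMinimizer_outer {j : ℕ} (hj : 1 ≤ j) (ha : 0 < a) (ha1 : a < 1)
    (hL : 0 ≤ loopHat j a 0) {t : ℝ} (ht : 0 < t) {ψ : ℝ → ℝ}
    (hψ : ψ =ᵐ[volume.restrict (Set.Icc (0 : ℝ) 1)] density a 0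
      (outerPoly (j + 1) a (4 ^ (j + 1) * (2 * ((j + 1 : ℕ) : ℝ) + 1) * t)
        (4 ^ (j + 1) * (2 * ((j + 1 : ℕ) : ℝ) + 1) * t * outerSpeed j a))) :
    KdVHierarchy.IsTheMinimizer (j + 1)
      (4 ^ (j + 1) * (2 * ((j + 1 : ℕ) : ℝ) + 1) * t * outerSpeed j a) t ψ := by
  have h := bandEnds_outer ha.le ha1
  set k := (4 : ℝ) ^ (j + 1) * (2 * ((j + 1 : ℕ) : ℝ) + 1) * t with hk
  have hk0 : 0 < k := by positivity
  refine isTheMinimizer_density h (p := outerPoly (j + 1) a k (k * outerSpeed j a))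
    (tendsto_outerPoly (j + 1) h k _) ?_ ?_ ?_ hψ
  · intro η hη
    obtain ⟨d1, d2⟩ := density_outerPoly hj ha ha1 hL hk0 hη
    rcases lt_trichotomy (η ^ 2) a with h1 | h1 | h1
    · exact (d1 h1).ge
    · exact (by rw [density, bandDensity_branch h (Or.inl h1), mul_zero] : density a 0 _ η = 0).ge
    · exact (d2 h1).le
  · intro η hη
    rw [multiplier_outerPoly]
    have := (integral_outerBand_nonpos hj ha ha1 hL hη).1
    nlinarith
  · intro η hη hna _
    rcases lt_or_gt_of_ne hna with h1 | h1
    · rw [(density_outerPoly hj ha ha1 hL hk0 hη).1 h1, mul_zero]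
    · rw [multiplier_outerPoly, (integral_outerBand_nonpos hj ha ha1 hL hη).2 h1.le]
      simp

/-! ### A single full band -/

/-- u^* is the strict minimum of `bandFun` on [0, ∞): the difference is (v - u) `hFun j u u v`, and
`hKer j u` changes sign at u because its value there is `trailFun j u` = 0. -/
lemma bandFun_lt {j : ℕ} (hj : 1 ≤ j) {u v : ℝ} (hu : 0 < u) (hu1 : u < 1) (h : trailFun j u = 0)
    (hv : 0 ≤ v) (hne : v ≠ u) : bandFun (j + 1) u < bandFun (j + 1) v := by
  rw [bandFun_eq j u v, betaCoeff_diag]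
  have hK : hKer j u u = 0 := by rw [hKer_diag_eq_trailFun, h]
  suffices 0 < (v - u) * hFun j u u v by linarith
  rcases lt_or_gt_of_ne hne with h1 | h1
  · refine mul_pos_of_neg_of_neg (by linarith) (hFun_neg fun s hs => ?_)
    exact hKer_neg_of_lt hj hu.le hu1 (by nlinarith [hs.1, hs.2])
      (by nlinarith [hs.1, hs.2]) hK.le
  · refine mul_pos (by linarith) (hFun_pos fun s hs => ?_)
    exact hKer_pos_of_lt hj hu.le hu1 hu.le (by nlinarith [hs.1, hs.2]) hK.ge

/-- For a = b = 0 there is no gap and the multiplier is zero. Only the sign of the density remains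
to be checked, and `bandFun_lt` reduces it to the point u. -/
theorem isTheMinimizer_full {j : ℕ} (hj : 1 ≤ j) {u : ℝ} (hu : 0 < u) (hu1 : u < 1)
    (hT : trailFun j u = 0) {x t : ℝ} (ht : 0 ≤ t)
    (hx : x ≤ 4 ^ (j + 1) * (2 * ((j + 1 : ℕ) : ℝ) + 1) * t * bandFun (j + 1) u) {ψ : ℝ → ℝ}
    (hψ : ψ =ᵐ[volume.restrict (Set.Icc (0 : ℝ) 1)] density 0 0
      (outerPoly (j + 1) 0 (4 ^ (j + 1) * (2 * ((j + 1 : ℕ) : ℝ) + 1) * t) x)) :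
    KdVHierarchy.IsTheMinimizer (j + 1) x t ψ := by
  have h := bandEnds_outer (a := 0) le_rfl one_pos
  set k := (4 : ℝ) ^ (j + 1) * (2 * ((j + 1 : ℕ) : ℝ) + 1) * t with hk
  have hk0 : 0 ≤ k := by positivity
  have hM : ∀ η ∈ Set.Ioo (0 : ℝ) 1, multiplier 0 0 (outerPoly (j + 1) 0 k x) η = 0 := fun η hη => by
    unfold multiplier
    rw [intervalIntegral_congr_Ioo (g := fun _ => 0) hη.1.le fun s hs => ?_]
    · simp
    · rw [gapFun_upper ⟨sq_nonneg s, by nlinarith [hs.1, hs.2, hη.2]⟩, mul_zero]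
  refine isTheMinimizer_density h (p := outerPoly (j + 1) 0 k x)
    (tendsto_outerPoly (j + 1) h k _) ?_ (fun η hη => (hM η hη).ge) ?_ hψ
  · intro η hη
    unfold density
    refine mul_nonneg ?_ ?_
    · rw [eval_outerPoly, hFun_zero_zero]
      rcases eq_or_ne (η ^ 2) u with e | hne
      · rw [e]; linarith
      · have := mul_le_mul_of_nonneg_left (bandFun_lt hj hu hu1 hT (sq_nonneg η) hne).le hk0
        linarith
    · exact (bandDensity_pos_upper h (sq_mem_Ioo hη)).le
  · intro η hη _ _
    rw [hM η hη, zero_mul]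

/-! ### The void region -/

/-- The zero density has zero potential, so the multiplier is `external` itself, nonnegative since
η^{2m} ≤ 1. -/
theorem isTheMinimizer_zero {m : ℕ} {x t : ℝ} (ht : 0 ≤ t) (hx : 4 ^ m * t ≤ x) :
    KdVHierarchy.IsTheMinimizer m x t fun _ => 0 := by
  refine isTheMinimizer_of_potential (N := external m x t)
    ⟨integrableOn_zero, ae_of_all _ fun _ => le_rfl⟩ (continuous_external m x t).continuousOn
    (fun η hη => ?_) (ae_of_all _ fun _ => mul_zero _) (fun _ _ => le_rfl) (fun η _ => by simp)
  unfold external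
  have h1 : η ^ (2 * m) ≤ 1 := pow_le_one₀ hη.1.le hη.2.le
  have h2 : 0 ≤ 4 ^ m * t := by positivity
  have h3 : 4 ^ m * t * η ^ (2 * m) ≤ x := (mul_le_of_le_one_right h2 h1).trans hx
  have h4 := mul_le_mul_of_nonneg_left h3 hη.1.le
  rw [pow_succ]
  linarith

end

end StepData

/-! ### Comparison of supports and the proof of the theorem. -/

namespace StepData

open MeasureTheory Filter Asymptotics Topology

noncomputable section

variable {a b : ℝ}

/-! ### Identification of the densities -/

lemma psi₁_eq_density (j : ℕ) {u : ℝ} (hu1 : u < 1) (x t : ℝ) :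
    KdVHierarchy.psi₁ (j + 1) x t u =ᵐ[volume.restrict (Set.Icc (0 : ℝ) 1)] density 0 0
      (outerPoly (j + 1) 0 (4 ^ (j + 1) * (2 * ((j + 1 : ℕ) : ℝ) + 1) * t) x) := by
  filter_upwards [ae_pos_Icc, ae_ne_Icc √u] with η hη hne
  have hη0 := hη.1
  have hη2 := sq_mem_Ioo hη
  have hne' : η ^ 2 - u ≠ 0 := fun h => hne (by
    rw [← sub_eq_zero.1 h, Real.sqrt_sq hη0.le])
  unfold KdVHierarchy.psi₁ density
  rw [eval_whithamPoly_diag j hu1, mul_div_cancel_left₀ _ hne', eval_outerPoly, hFun_zero_zero,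
    bandDensity_upper (bandEnds_outer le_rfl one_pos) hη2, sub_zero, div_self hη2.1.ne',
    Real.sqrt_one, one_mul, Real.sqrt_div hη2.1.le, Real.sqrt_sq hη0.le]
  ring

lemma psi₂_eq_density {j : ℕ} (hb : 0 < b) (hba : b < a) (ha : a < 1) (hL : loopInt j a b = 0)
    (t : ℝ) :
    KdVHierarchy.psi₂ (j + 1) (4 ^ (j + 1) * (2 * ((j + 1 : ℕ) : ℝ) + 1) * betaCoeff (j + 1) a b * t)
      t a b =ᵐ[volume.restrict (Set.Icc (0 : ℝ) 1)] density a b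
      (innerPoly j a b (4 ^ (j + 1) * (2 * ((j + 1 : ℕ) : ℝ) + 1) * t)) := by
  have h : BandEnds a b := ⟨(hb.trans hba).le, ha, Or.inr ⟨hb, hba⟩⟩
  filter_upwards [ae_pos_Icc, ae_ne_Icc √a, ae_ne_Icc √b] with η hη hna hnb
  have hη0 := hη.1
  have hη2 := sq_mem_Ioo hη
  have hnum := inner_density_numerator (t := t) hba ha hL (η ^ 2)
    (4 ^ (j + 1) * (2 * ((j + 1 : ℕ) : ℝ) + 1))
  unfold KdVHierarchy.psi₂ density
  generalize (4 : ℝ) ^ (j + 1) * (2 * ((j + 1 : ℕ) : ℝ) + 1) = c at hnum ⊢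
  have hnum' : -(c * betaCoeff (j + 1) a b * t) * η * (KdVHierarchy.whithamPoly 0 1 a b).eval (η ^ 2)
      + c * t * η * (KdVHierarchy.whithamPoly (j + 1) 1 a b).eval (η ^ 2)
      = η * ((η ^ 2 - a) * (η ^ 2 - b) * (c * t * hFun j a b (η ^ 2))) := by
    rw [← hnum]; ring
  rw [hnum', eval_innerPoly]
  have p1 : 0 < 1 - η ^ 2 := by linarith [hη2.2]
  have r1 := Real.sqrt_pos.2 p1
  split_ifs with h1 h2
  · rw [Real.lt_sqrt hη0.le] at h1
    have pb : 0 < b - η ^ 2 := by linarith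
    have pa : 0 < a - η ^ 2 := by linarith
    rw [bandDensity_lower ⟨hη2.1, h1⟩, Real.sqrt_div hη2.1.le, Real.sqrt_sq hη0.le,
      Real.sqrt_div pa.le, Real.sqrt_mul (mul_pos p1 pa).le, Real.sqrt_mul p1.le]
    have ra := Real.sqrt_pos.2 pa
    have rb := Real.sqrt_pos.2 pb
    have e := Real.sq_sqrt pa.le
    rw [show η ^ 2 - a = -√(a - η ^ 2) ^ 2 by rw [e]; ring]
    field_simp
  · have h3 : η < √a := lt_of_le_of_ne h2 hna
    have h4 : √b < η := lt_of_le_of_ne (not_lt.1 h1) hnb.symm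
    rw [Real.lt_sqrt hη0.le] at h3
    rw [Real.sqrt_lt' hη0] at h4
    rw [bandDensity_gap h ⟨h4, h3⟩, mul_zero]
  · have h3 : a < η ^ 2 := (Real.sqrt_lt' hη0).1 (not_le.1 h2)
    have pb : 0 < η ^ 2 - b := by linarith
    have pa : 0 < η ^ 2 - a := by linarith
    rw [bandDensity_upper h ⟨h3, hη2.2⟩, Real.sqrt_div hη2.1.le, Real.sqrt_sq hη0.le,
      Real.sqrt_div pa.le, Real.sqrt_mul (mul_pos p1 pa).le, Real.sqrt_mul p1.le]
    have ra := Real.sqrt_pos.2 pa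
    have rb := Real.sqrt_pos.2 pb
    have e := Real.sq_sqrt pa.le
    nth_rewrite 1 [← e]
    field_simp

lemma psi₃_eq_density (j : ℕ) (ha : 0 < a) (ha1 : a < 1) (t : ℝ) :
    KdVHierarchy.psi₃ (j + 1) (4 ^ (j + 1) * (2 * ((j + 1 : ℕ) : ℝ) + 1) * t * outerSpeed j a) t a
      =ᵐ[volume.restrict (Set.Icc (0 : ℝ) 1)] density a 0
      (outerPoly (j + 1) a (4 ^ (j + 1) * (2 * ((j + 1 : ℕ) : ℝ) + 1) * t)
        (4 ^ (j + 1) * (2 * ((j + 1 : ℕ) : ℝ) + 1) * t * outerSpeed j a)) := by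
  have h := bandEnds_outer ha.le ha1
  filter_upwards [ae_pos_Icc, ae_ne_Icc √a] with η hη hna
  have hη0 := hη.1
  have hη2 := sq_mem_Ioo hη
  have hnum := outer_density_numerator j (t := t) ha ha1 (η ^ 2)
    (4 ^ (j + 1) * (2 * ((j + 1 : ℕ) : ℝ) + 1))
  unfold KdVHierarchy.psi₃ density
  generalize (4 : ℝ) ^ (j + 1) * (2 * ((j + 1 : ℕ) : ℝ) + 1) = c at hnum ⊢
  rw [mul_right_comm] at hnum
  rw [hnum, eval_outerPoly]
  have p1 : 0 < 1 - η ^ 2 := by linarith [hη2.2]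
  have r1 := Real.sqrt_pos.2 p1
  split_ifs with h1
  · have h2 := (Real.lt_sqrt hη0.le).1 (lt_of_le_of_ne h1 hna)
    rw [bandDensity_gap h ⟨hη2.1, h2⟩, mul_zero]
  · have h3 : a < η ^ 2 := (Real.sqrt_lt' hη0).1 (not_le.1 h1)
    have pa : 0 < η ^ 2 - a := by linarith
    rw [bandDensity_upper h ⟨h3, hη2.2⟩, sub_zero, div_self hη2.1.ne', Real.sqrt_one, one_mul,
      Real.sqrt_div pa.le, Real.sqrt_mul p1.le]
    have ra := Real.sqrt_pos.2 pa
    have e := Real.sq_sqrt pa.le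
    nth_rewrite 1 [← e]
    field_simp

/-! ### Comparison of minimizers by their supports -/

lemma ae_eq_of_isTheMinimizer {m : ℕ} {x t : ℝ} {ψ φ : ℝ → ℝ}
    (h1 : KdVHierarchy.IsTheMinimizer m x t ψ) (h2 : KdVHierarchy.IsTheMinimizer m x t φ) :
    ψ =ᵐ[volume.restrict (Set.Icc (0 : ℝ) 1)] φ :=
  h2.2.2 ψ h1.1 (le_antisymm (h1.2.1 φ h2.1) (h2.2.1 ψ h1.1))

lemma exists_sq_mem_Ioo_of_ae {p : ℝ → Prop}
    (h : ∀ᵐ η ∂(volume.restrict (Set.Icc (0 : ℝ) 1)), p η) {c d : ℝ} (hc : 0 ≤ c) (hcd : c < d)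
    (hd : d ≤ 1) : ∃ η ∈ Set.Ioo (0 : ℝ) 1, η ^ 2 ∈ Set.Ioo c d ∧ p η := by
  have hlt : √c < √d := Real.sqrt_lt_sqrt hc hcd
  have hd1 : √d ≤ 1 := Real.sqrt_le_one.2 hd
  have hsub : Set.Ioo √c √d ⊆ Set.Icc (0 : ℝ) 1 := fun η hη =>
    ⟨(Real.sqrt_nonneg c).trans hη.1.le, hη.2.le.trans hd1⟩
  have : (ae (volume.restrict (Set.Ioo √c √d))).NeBot := by
    rw [ae_neBot, Ne, Measure.restrict_eq_zero, Real.volume_Ioo, ENNReal.ofReal_eq_zero, not_le]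
    linarith
  obtain ⟨η, h1, h2⟩ := ((ae_restrict_of_ae_restrict_of_subset hsub h).and
    (ae_restrict_mem measurableSet_Ioo)).exists
  have h0 : 0 < η := (Real.sqrt_nonneg c).trans_lt h2.1
  exact ⟨η, ⟨h0, h2.2.trans_le hd1⟩, ⟨(Real.sqrt_lt' h0).1 h2.1, (Real.lt_sqrt h0.le).1 h2.2⟩, h1⟩

/-- Otherwise, at t = 1 and the x given by `outerSpeed`, both the full-band and the one-band density
would be the minimizer. On (0, √a) the latter vanishes, while the former is positive except at √u.
-/
lemma bandFun_lt_outerSpeed {j : ℕ} (hj : 1 ≤ j) {u : ℝ} (hu : 0 < u) (hu1 : u < 1)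
    (hT : trailFun j u = 0) (ha : 0 < a) (ha1 : a < 1) (hL : 0 ≤ loopHat j a 0) :
    bandFun (j + 1) u < outerSpeed j a := by
  by_contra hc
  rw [not_lt] at hc
  have hc0 : 0 < (4 : ℝ) ^ (j + 1) * (2 * ((j + 1 : ℕ) : ℝ) + 1) * 1 := by positivity
  have e := (ae_eq_of_isTheMinimizer
    (isTheMinimizer_full hj hu hu1 hT zero_le_one (mul_le_mul_of_nonneg_left hc hc0.le)
      (ae_eq_refl _))
    (isTheMinimizer_outer hj ha ha1 hL one_pos (ae_eq_refl _))).and (ae_ne_Icc √u)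
  obtain ⟨η, hη, hη2, h1, h2⟩ := exists_sq_mem_Ioo_of_ae e le_rfl ha ha1.le
  have hne : η ^ 2 ≠ u := fun h => h2 (by rw [← h, Real.sqrt_sq hη.1.le])
  rw [(density_outerPoly hj ha ha1 hL hc0 hη).1 hη2.2] at h1
  refine h1.not_gt (mul_pos ?_ (bandDensity_pos_upper (bandEnds_outer le_rfl one_pos)
    (sq_mem_Ioo hη)))
  rw [eval_outerPoly, hFun_zero_zero, ← mul_sub]
  exact mul_pos hc0 (by linarith [bandFun_lt hj hu hu1 hT (sq_nonneg η) hne])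

/-- Otherwise the zero density would be a minimizer together with one that is positive on (√a, 1).
-/
lemma outerSpeed_lt_one {j : ℕ} (hj : 1 ≤ j) (ha : 0 < a) (ha1 : a < 1) (hL : 0 ≤ loopHat j a 0) :
    4 ^ (j + 1) * (2 * ((j + 1 : ℕ) : ℝ) + 1) * outerSpeed j a < 4 ^ (j + 1) := by
  by_contra hc
  rw [not_lt] at hc
  have hc0 : 0 < (4 : ℝ) ^ (j + 1) * (2 * ((j + 1 : ℕ) : ℝ) + 1) * 1 := by positivity
  have e := ae_eq_of_isTheMinimizer
    (isTheMinimizer_outer hj ha ha1 hL one_pos (ae_eq_refl _))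
    (isTheMinimizer_zero zero_le_one (by linarith))
  obtain ⟨η, hη, hη2, h1⟩ := exists_sq_mem_Ioo_of_ae e ha.le ha1 le_rfl
  exact ((density_outerPoly hj ha ha1 hL hc0 hη).2 hη2.1).ne' h1

/-- Equal speeds give the same minimization problem, and the support (√a, 1) of its minimizer
determines a. -/
lemma outerSpeed_injective {j : ℕ} (hj : 1 ≤ j) {a' : ℝ} (ha : 0 < a) (ha1 : a < 1)
    (hL : 0 ≤ loopHat j a 0) (ha' : 0 < a') (ha1' : a' < 1) (hL' : 0 ≤ loopHat j a' 0)
    (h : outerSpeed j a = outerSpeed j a') : a = a' := by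
  wlog hlt : a < a' generalizing a a'
  · rcases (not_lt.1 hlt).eq_or_lt with e | e
    · exact e.symm
    · exact (this ha' ha1' hL' ha ha1 hL h.symm e).symm
  have hc0 : 0 < (4 : ℝ) ^ (j + 1) * (2 * ((j + 1 : ℕ) : ℝ) + 1) * 1 := by positivity
  have h2 := isTheMinimizer_outer hj ha' ha1' hL' one_pos (ae_eq_refl _)
  rw [← h] at h2
  have e := ae_eq_of_isTheMinimizer
    (isTheMinimizer_outer hj ha ha1 hL one_pos (ae_eq_refl _)) h2
  obtain ⟨η, hη, hη2, h1⟩ := exists_sq_mem_Ioo_of_ae e ha.le hlt ha1'.le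
  rw [h, (density_outerPoly hj ha' ha1' hL' hc0 hη).1 hη2.2, ← h] at h1
  exact absurd h1 ((density_outerPoly hj ha ha1 hL hc0 hη).2 hη2.1).ne'

/-- Equal speeds give the same minimizer, and its gap (√b, √a) is recovered as the interval on which
it vanishes. -/
lemma inner_unique {j : ℕ} (hj : 1 ≤ j) {a' b' : ℝ} (hb : 0 < b) (hba : b < a) (ha : a < 1)
    (hL : loopInt j a b = 0) (hb' : 0 < b') (hba' : b' < a') (ha' : a' < 1)
    (hL' : loopInt j a' b' = 0) (h : betaCoeff (j + 1) a b = betaCoeff (j + 1) a' b') :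
    a = a' ∧ b = b' := by
  have hc0 : 0 < (4 : ℝ) ^ (j + 1) * (2 * ((j + 1 : ℕ) : ℝ) + 1) * 1 := by positivity
  have e : density a b (innerPoly j a b (4 ^ (j + 1) * (2 * ((j + 1 : ℕ) : ℝ) + 1) * 1))
      =ᵐ[volume.restrict (Set.Icc (0 : ℝ) 1)]
      density a' b' (innerPoly j a' b' (4 ^ (j + 1) * (2 * ((j + 1 : ℕ) : ℝ) + 1) * 1)) := by
    have h1 := isTheMinimizer_inner hj hb hba ha hL one_pos (ae_eq_refl _)
    rw [h] at h1
    exact ae_eq_of_isTheMinimizer h1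
      (isTheMinimizer_inner hj hb' hba' ha' hL' one_pos (ae_eq_refl _))
  have key : ∀ {a b a' b' : ℝ}, 0 < b → b < a → a < 1 → loopInt j a b = 0 → 0 < b' → b' < a' →
      a' < 1 → loopInt j a' b' = 0 →
      density a b (innerPoly j a b (4 ^ (j + 1) * (2 * ((j + 1 : ℕ) : ℝ) + 1) * 1))
        =ᵐ[volume.restrict (Set.Icc (0 : ℝ) 1)]
        density a' b' (innerPoly j a' b' (4 ^ (j + 1) * (2 * ((j + 1 : ℕ) : ℝ) + 1) * 1)) →
      b' ≤ b ∧ a' ≤ a := by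
    intro a b a' b' hb hba ha hL hb' hba' ha' hL' e
    have key1 : b' ≤ b := by
      by_contra hc
      rw [not_le] at hc
      obtain ⟨η, hη, hη2, h1⟩ := exists_sq_mem_Ioo_of_ae e hb.le (lt_min hc hba)
        ((min_le_right _ _).trans ha.le)
      have h2 := lt_min_iff.1 hη2.2
      rw [(density_innerPoly hj hb hba ha hL hc0 hη).2.1 hη2.1 h2.2] at h1
      exact h1.not_lt ((density_innerPoly hj hb' hba' ha' hL' hc0 hη).1 h2.1)
    refine ⟨key1, ?_⟩
    by_contra hc
    rw [not_le] at hc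
    obtain ⟨η, hη, hη2, h1⟩ := exists_sq_mem_Ioo_of_ae e (hb.trans hba).le hc ha'.le
    rw [(density_innerPoly hj hb' hba' ha' hL' hc0 hη).2.1 (key1.trans_lt (hba.trans hη2.1)) hη2.2]
      at h1
    exact ((density_innerPoly hj hb hba ha hL hc0 hη).2.2 hη2.1).ne' h1
  obtain ⟨k1, k2⟩ := key hb hba ha hL hb' hba' ha' hL' e
  obtain ⟨k3, k4⟩ := key hb' hba' ha' hL' hb hba ha hL e.symm
  exact ⟨le_antisymm k4 k2, le_antisymm k3 k1⟩

/-! ### The distinguished points -/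

lemma existsUnique_trailingPoint {j : ℕ} (hj : 1 ≤ j) :
    ∃! u : ℝ, KdVHierarchy.IsTrailingPoint (j + 1) u := by
  obtain ⟨u, hu, h⟩ := exists_trailFun_eq_zero hj
  refine ⟨u, (isTrailingPoint_iff j u).2 ⟨hu.1, hu.2, h⟩, fun v hv => ?_⟩
  obtain ⟨h1, -, h3⟩ := (isTrailingPoint_iff j v).1 hv
  exact trailFun_eq_zero_unique hj h1 hu.1 h3 h

lemma existsUnique_transitionPoint {j : ℕ} (hj : 1 ≤ j) :
    ∃! u : ℝ, KdVHierarchy.IsTransitionPoint (j + 1) u := by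
  obtain ⟨u, hu, h⟩ := exists_loopHat_zero hj
  refine ⟨u, (isTransitionPoint_iff j u).2 ⟨hu.1, hu.2, h⟩, fun v hv => ?_⟩
  obtain ⟨h1, h2, h3⟩ := (isTransitionPoint_iff j v).1 hv
  exact loopHat_zero_unique hj ⟨h1, h2⟩ hu h3 h

lemma exists_outerSpeed_eq {j : ℕ} {w y : ℝ} (hw : w ∈ Set.Ioo (0 : ℝ) 1)
    (h1 : outerSpeed j w < y) (h2 : y < outerSpeed j 1) : ∃ a ∈ Set.Ioo w 1, outerSpeed j a = y := by
  obtain ⟨a, ha, e⟩ := intermediate_value_Icc hw.2.le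
    ((continuousOn_outerSpeed j).mono (Set.Icc_subset_Icc hw.1.le le_rfl)) ⟨h1.le, h2.le⟩
  refine ⟨a, ⟨lt_of_le_of_ne ha.1 ?_, lt_of_le_of_ne ha.2 ?_⟩, e⟩
  · rintro rfl; exact h1.ne e
  · rintro rfl; exact h2.ne' e

end

end StepData

open StepData in
theorem theorem4p1 (m : ℕ) (hm : 2 ≤ m) :
    (∃! u : ℝ, KdVHierarchy.IsTrailingPoint m u) ∧
    (∃! u : ℝ, KdVHierarchy.IsTransitionPoint m u) ∧
    ∀ us uss α β : ℝ,
      KdVHierarchy.IsTrailingPoint m us → KdVHierarchy.IsTransitionPoint m uss →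
      α = KdVHierarchy.mu₂ m 1 us us → β = KdVHierarchy.mu₂ m 1 uss 0 →
      α < β ∧ β < 4 ^ m ∧
      ∀ x t : ℝ, 0 ≤ t →
        (x ≤ α * t →
          KdVHierarchy.IsTheMinimizer m x t (KdVHierarchy.psi₁ m x t us)) ∧
        (α * t < x → x < β * t →
          ∃ u₂ u₃ : ℝ, KdVHierarchy.SolvesInner m x t u₂ u₃ ∧
            (∀ v₂ v₃ : ℝ, KdVHierarchy.SolvesInner m x t v₂ v₃ → v₂ = u₂ ∧ v₃ = u₃) ∧
            KdVHierarchy.IsTheMinimizer m x t (KdVHierarchy.psi₂ m x t u₂ u₃)) ∧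
        (β * t < x → x < 4 ^ m * t →
          ∃ u₂ : ℝ, KdVHierarchy.SolvesOuter m uss x t u₂ ∧
            (∀ v₂ : ℝ, KdVHierarchy.SolvesOuter m uss x t v₂ → v₂ = u₂) ∧
            KdVHierarchy.IsTheMinimizer m x t (KdVHierarchy.psi₃ m x t u₂)) ∧
        (4 ^ m * t ≤ x →
          KdVHierarchy.IsTheMinimizer m x t (fun _ => 0)) := by
  -- m ≥ 2 becomes j ≥ 1, the degree needed for a genuine change of sign in `ratioMono_coeff`.
  obtain ⟨j, rfl⟩ : ∃ j, m = j + 1 := ⟨m - 1, by omega⟩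
  have hj : 1 ≤ j := by omega
  refine ⟨existsUnique_trailingPoint hj, existsUnique_transitionPoint hj, ?_⟩
  intro us uss α β hus huss hα hβ
  obtain ⟨us0, us1, hT⟩ := (isTrailingPoint_iff j us).1 hus
  obtain ⟨w0, w1, hL⟩ := (isTransitionPoint_iff j uss).1 huss
  rw [mu₂_diag j us1] at hα
  rw [mu₂_zero_eq j w0 w1] at hβ
  have hβ' : outerSpeed j uss = betaCoeff (j + 1) uss 0 := by rw [outerSpeed, hL]; simp
  have hc0 : 0 < (4 : ℝ) ^ (j + 1) * (2 * ((j + 1 : ℕ) : ℝ) + 1) := by positivity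
  refine ⟨?_, ?_, fun x t ht => ⟨fun hx => ?_, fun hx1 hx2 => ?_, fun hx1 hx2 => ?_,
    isTheMinimizer_zero ht⟩⟩
  · rw [hα, hβ]
    exact mul_lt_mul_of_pos_left (bandFun_lt_outerSpeed hj us0 us1 hT w0 w1 hL.ge) hc0
  · rw [hβ]
    exact outerSpeed_lt_one hj w0 w1 hL.ge
  · refine isTheMinimizer_full hj us0 us1 hT ht ?_ (psi₁_eq_density j us1 x t)
    rw [mul_right_comm, ← hα]; exact hx
  -- For t = 0 the two bounds would give 0 < x < 0.
  · have ht0 : 0 < t := lt_of_le_of_ne ht fun h => by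
      rw [← h, mul_zero] at hx1 hx2; exact lt_asymm hx1 hx2
    set c := (4 : ℝ) ^ (j + 1) * (2 * ((j + 1 : ℕ) : ℝ) + 1) with hc
    have hct : 0 < c * t := mul_pos hc0 ht0
    obtain ⟨a, b, hb, hba, ha, hI, hB⟩ := exists_loop_solution (x := x / (c * t)) hj
      ⟨us0, us1⟩ ⟨w0, w1⟩ hT hL
      (by rw [betaCoeff_diag, lt_div_iff₀ hct]; rw [hα] at hx1; linarith)
      (by rw [← hβ', div_lt_iff₀ hct]; rw [hβ] at hx2; linarith)
    have hx : x = c * betaCoeff (j + 1) a b * t := by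
      rw [hB]; field_simp
    refine ⟨a, b, (solvesInner_iff j ht0 a b).2 ⟨hb, hba, ha, hI, hx⟩, fun v w hv => ?_, ?_⟩
    · obtain ⟨g1, g2, g3, g4, g5⟩ := (solvesInner_iff j ht0 v w).1 hv
      refine inner_unique hj g1 g2 g3 g4 hb hba ha hI ?_
      rw [hx] at g5
      exact (mul_left_cancel₀ hc0.ne' (mul_right_cancel₀ ht0.ne' g5)).symm
    · rw [hx]
      exact isTheMinimizer_inner hj hb hba ha hI ht0 (psi₂_eq_density hb hba ha hI t)
  · have ht0 : 0 < t := lt_of_le_of_ne ht fun h => by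
      rw [← h, mul_zero] at hx1 hx2; exact lt_asymm hx1 hx2
    set c := (4 : ℝ) ^ (j + 1) * (2 * ((j + 1 : ℕ) : ℝ) + 1) with hc
    have hct : 0 < c * t := mul_pos hc0 ht0
    obtain ⟨a, ⟨ha, ha1⟩, hy⟩ := exists_outerSpeed_eq (j := j) (y := x / (c * t)) ⟨w0, w1⟩
      (by rw [lt_div_iff₀ hct]; rw [hβ] at hx1; linarith)
      -- The upper bound 4^m t corresponds to the value 1/(2m + 1) of the normalized speed at a = 1.
      (by
        rw [outerSpeed_one, div_lt_iff₀ hct, hc]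
        refine hx2.trans_eq ?_
        field_simp)
    have ha0 := w0.trans ha
    have hx : x = c * t * outerSpeed j a := by rw [hy]; field_simp
    have hLa := loopHat_zero_pos_of_nonneg hj w0 ha ha1 hL.ge
    refine ⟨a, ⟨ha, ha1, ?_⟩, fun v hv => ?_, ?_⟩
    · rw [mu₂_zero_eq j ha0 ha1, ← hc, hx]; ring
    · obtain ⟨g1, g2, g3⟩ := hv
      have hv0 := w0.trans g1
      refine outerSpeed_injective hj hv0 g2 (loopHat_zero_pos_of_nonneg hj w0 g1 g2 hL.ge).le
        ha0 ha1 hLa.le ?_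
      rw [mu₂_zero_eq j hv0 g2, ← hc, hx, mul_right_comm] at g3
      exact (mul_left_cancel₀ hc0.ne' (mul_right_cancel₀ ht0.ne' g3)).symm
    · rw [hx]
      exact isTheMinimizer_outer hj ha0 ha1 hLa.le ht0 (psi₃_eq_density j ha0 ha1 t)
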